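/- Let $M$ be a complex manifold of dimension $n$ with complex structure $I$. **Special period structure.** Let $\Gamma\subset TM$ be a bundle of lattices of rank $2n$ (so $\Gamma_p\otimes\mathbb R=T_pM$) with a fibrewise integral skew pairing $\langle-,-\rangle$ which admits, around every point, a local Darboux frame $(\gamma_i,\gamma^i)$, that is $\langle\gamma_i,\gamma^j\rangle=\delta_i^j$, $\langle\gamma_i,\gamma_j\rangle=\langle\gamma^i,\gamma^j\rangle=0$. Let $\omega$ be the induced 2-form on $M$ and $\nabla$ the connection on $TM$ for which local sections of $\Gamma$ are parallel. Let $Z$ be a holomorphic section of $\mathrm{Hom}(\Gamma,\mathbb C)$, $Z_\gamma:=Z(\gamma)$. Assume $\omega(I-,I-)=\omega(-,-)$ and that the complex vector field $\xi^{1,0}$ with $\frac12 Z=\omega(\xi^{1,0},-)$ satisfies $\nabla\xi^{1,0}=\pi^{1,0}$, the projection to $T^{1,0}M$. **Uncoupled BPS indices.** Let $\Omega:\Gamma\setminus\{0\}\to\mathbb Q$ satisfy: $\Omega(-\gamma)=\Omega(\gamma)$; $\Omega(\gamma),\Omega(\gamma')\neq0\Rightarrow\langle\gamma,\gamma'\rangle=0$;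 $\Omega$ is locally constant along flat local sections of $\Gamma$ (the wall-crossing formula in the uncoupled case); for every compact $K\subset M$ and every continuous family of norms on $TM|_K$ there is $C>0$ with $|Z_\gamma|>C|\gamma|$ for all $\gamma\in\Gamma|_K$ with $\Omega(\gamma)\ne0$; and for each $R>0$ the series $\sum_\gamma|\Omega(\gamma)|e^{-R|Z_\gamma|}$ converges normally on compact sets. **The function $J$ and its connections.** On $N=TM$ with projection $\pi:N\to M$, let $$J(V)=\frac1{2\pi i}\sum_{0\ne\gamma\in\Gamma_{\pi(V)}}\Omega(\gamma)\sum_{k>0}\frac{e^{ik\varphi_\gamma}}{k^2}K_0(2\pi k|Z_\gamma|),\qquad \varphi_\gamma(V)=\omega(V,\gamma).$$ Let $\mathcal H_X$ be the $\nabla$-horizontal lift and $\nu_X$ the vertical lift of $X$, both extended complex-linearly, let $\omega^\nu$ be the symplectic form on the vertical bundle induced by $\omega$, and let $\mathrm{Ham}_f$ be the vertical vector field with $Uf=\omega^\nu(U,\mathrm{Ham}_f)$ for vertical $U$. For $X\in T^{1,0}M$ put $h_X=\mathcal H_X+\mathrm{Ham}_{\mathcal H_XJ}$, $v_X=2\pi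 i(\nu_{\bar X}+\mathrm{Ham}_{\nu_{\bar X}J})$ and, for $\zeta\in\mathbb C^\times$, $$\mathcal A^\zeta_X=h_X-\zeta^{-1}\overline{v_X},\qquad \mathcal A^\zeta_{\bar X}=\overline{h_X}+\zeta v_X .$$ Assume (as can be attempted by shrinking $M$) the non-degeneracy condition $TN\otimes\mathbb C=\mathrm{Im}\,h\oplus\mathrm{Im}\,\bar h\oplus\mathrm{Im}\,v\oplus\mathrm{Im}\,\bar v$, where $v$ is injective, on all of $N$. **Conclusion.** The double series defining $J$ converges absolutely, and $J$ defines a special Joyce structure over the affine special Kähler manifold $(M,I,\omega,\nabla)$. That is, $(M,I,\omega)$ is pseudo-Kähler, $\nabla$ is flat and torsion-free, $\nabla\omega=0$ and $d_\nabla I=0$; $J$ is smooth; the $\mathcal A^\zeta$ are complexified Ehresmann connections with $d\pi\circ h_X=X$ and the non-degeneracy above; each $\mathcal A^\zeta$ ($\zeta\in\mathbb C^\times$) is flat, i.e. its image is an involutive distribution; and the almost complex structure $I_3$ whose $(-i)$-eigenspace is spanned by the $\overline{v_X}$ and $\overline{h_X}$ preserves the vertical bundle, and $\omega^\nu$ is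 of type $(1,1)$ for it. Moreover let $I_1,I_2,I_3$ be the almost complex structures on $N$ whose $(-i)$-eigenspaces are the image of $\mathcal A^{i}$, the image of $\mathcal A^{-1}$, and the span of the $\overline{v_X},\overline{h_X}$. Let $\omega_3$ be the real 2-form with $\omega_3(v_X,\overline{v_Y})=\omega_3(h_Y,\overline{h_X})=-\frac1{4\pi^2}\omega^\nu(v_X,\overline{v_Y})$ for $X,Y\in T^{1,0}M$ and all other pairings of $h,\bar h,v,\bar v$ zero. Put $g=\omega_3(-,I_3-)$ and $\omega_i=g(I_i-,-)$. Then $(N,g,I_1,I_2,I_3)$ is (pseudo-)hyperkähler, and under the identification $TM\cong T^*M$, $X\mapsto\omega(X,-)$, it is the Gaiotto–Moore–Neitzke / Cortés–Tulli instanton-corrected structure: for every local Darboux frame of $\Gamma$, with $Z^i=Z_{\gamma^i}$, $Z_i=Z_{\gamma_i}$, $\theta_\gamma(\alpha)=\alpha(\gamma)$, $\theta_i=\theta_{\gamma_i}$, $\theta^i=\theta_{\gamma^i}$, $$\omega_3=\pi^*\omega-\tfrac1{4\pi^2}d\theta_i\wedge d\theta^i+\sum_\gamma\Omega(\gamma)\Big(\tfrac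 i2V_\gamma\,dZ_\gamma\wedge d\bar Z_\gamma+\tfrac1{2\pi}d\theta_\gamma\wedge A_\gamma\Big),$$ $$\omega_1+i\omega_2=\tfrac1{2\pi}\big(dZ^i\wedge d\theta_i-dZ_i\wedge d\theta^i\big)+\sum_\gamma\Omega(\gamma)\Big(dZ_\gamma\wedge A_\gamma+\tfrac i{2\pi}V_\gamma\,d\theta_\gamma\wedge dZ_\gamma\Big),$$ where the sums over $\gamma$ run over the nonzero elements of $\Gamma$, $V_\gamma=\frac1{2\pi}\sum_{k>0}e^{ik\theta_\gamma}K_0(2\pi k|Z_\gamma|)$ and $A_\gamma=-\frac1{4\pi}\sum_{k>0}e^{ik\theta_\gamma}|Z_\gamma|K_1(2\pi k|Z_\gamma|)\big(\frac{dZ_\gamma}{Z_\gamma}-\frac{d\bar Z_\gamma}{\bar Z_\gamma}\big)$. -/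

import Mathlib

open scoped Manifold ContDiff TensorProduct Topology

noncomputable section

namespace SpecialJoyce

/-! ## Complexification of real vector spaces -/

section Complexification

variable {V W : Type*} [AddCommGroup V] [Module ℝ V] [AddCommGroup W] [Module ℝ W]

/-- The complexification `V ⊗ ℂ` of a real vector space. -/
abbrev Cx (V : Type*) [AddCommGroup V] [Module ℝ V] : Type _ := ℂ ⊗[ℝ] V

/-- Real part of a complexified vector. -/
def cre : Cx V →ₗ[ℝ] V := (TensorProduct.lid ℝ V).toLinearMap ∘ₗ LinearMap.rTensor V Complex.reLm

/-- Imaginary part of a complexified vector. -/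
def cim : Cx V →ₗ[ℝ] V := (TensorProduct.lid ℝ V).toLinearMap ∘ₗ LinearMap.rTensor V Complex.imLm

/-- The complexified vector `a + i b`. -/
def cmk (a b : V) : Cx V := (1 : ℂ) ⊗ₜ[ℝ] a + Complex.I ⊗ₜ[ℝ] b

/-- Complex conjugation on `V ⊗ ℂ`. -/
def cconj : Cx V →ₗ[ℝ] Cx V := LinearMap.rTensor V Complex.conjAe.toLinearMap

/-- Complex-linear extension of a real-linear map. -/
def cmap (f : V →ₗ[ℝ] W) : Cx V →ₗ[ℂ] Cx W := f.baseChange ℂ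

/-- Complex-linear extension of a complex-valued real-linear form. -/
def cform (f : V →ₗ[ℝ] ℂ) : Cx V →ₗ[ℂ] ℂ := f.liftBaseChange ℂ

/-- Complex-bilinear extension of a real bilinear form. -/
def cbil (b : LinearMap.BilinForm ℝ V) : LinearMap.BilinForm ℂ (Cx V) := b.baseChange ℂ

end Complexification

/-! ## Tensor calculus on a smooth manifold -/

section Calculus

variable {E : Type*} [NormedAddCommGroup E] [NormedSpace ℝ E] {H : Type*} [TopologicalSpace H]
  (I : ModelWithCorners ℝ E H) {X : Type*} [TopologicalSpace X] [ChartedSpace H X]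
  [IsManifold I ∞ X]

/-- The vector field `ξ` is smooth on `W`. -/
def SmoothVF (W : Set X) (ξ : ∀ x : X, TangentSpace I x) : Prop :=
  ContMDiffOn I I.tangent ∞ (fun x => (⟨x, ξ x⟩ : TangentBundle I X)) W

/-- The complexified vector field `ξ` is smooth on `W`. -/
def SmoothCVF (W : Set X) (ξ : ∀ x : X, Cx (TangentSpace I x)) : Prop :=
  SmoothVF I W (fun x => cre (ξ x)) ∧ SmoothVF I W (fun x => cim (ξ x))

/-- The field of bilinear forms `β` is smooth. -/
def SmoothBil (β : ∀ x : X, LinearMap.BilinForm ℝ (TangentSpace I x)) : Prop :=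
  ∀ (W : Set X) (ξ η : ∀ x : X, TangentSpace I x), IsOpen W → SmoothVF I W ξ → SmoothVF I W η →
    ContMDiffOn I 𝓘(ℝ, ℝ) ∞ (fun x => β x (ξ x) (η x)) W

/-- The field of endomorphisms `A` of the tangent bundle is smooth. -/
def SmoothEnd (A : ∀ x : X, TangentSpace I x →ₗ[ℝ] TangentSpace I x) : Prop :=
  ∀ (W : Set X) (ξ : ∀ x : X, TangentSpace I x), IsOpen W → SmoothVF I W ξ →
    SmoothVF I W (fun x => A x (ξ x))

/-- The derivative `v f` of a real function along a tangent vector. -/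
def dReal (f : X → ℝ) (x : X) (v : TangentSpace I x) : ℝ := mfderiv I 𝓘(ℝ, ℝ) f x v

/-- The differential at `x` of a complex-valued function, as a real-linear form. -/
def dCpx (f : X → ℂ) (x : X) : TangentSpace I x →ₗ[ℝ] ℂ :=
  (mfderiv I 𝓘(ℝ, ℂ) f x).toLinearMap

/-- The two-form `β` is closed: the invariant formula for `dβ(ξ,η,χ)` vanishes on all local smooth
vector fields. -/
def IsClosedForm (β : ∀ x : X, LinearMap.BilinForm ℝ (TangentSpace I x)) : Prop :=
  ∀ (W : Set X) (ξ η χ : ∀ x : X, TangentSpace I x), IsOpen W →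
    SmoothVF I W ξ → SmoothVF I W η → SmoothVF I W χ → ∀ x ∈ W,
    dReal I (fun y => β y (η y) (χ y)) x (ξ x) - dReal I (fun y => β y (ξ y) (χ y)) x (η x)
      + dReal I (fun y => β y (ξ y) (η y)) x (χ x)
      - β x (VectorField.mlieBracket I ξ η x) (χ x)
      + β x (VectorField.mlieBracket I ξ χ x) (η x)
      - β x (VectorField.mlieBracket I η χ x) (ξ x) = 0

/-- The complex-bilinear extension of the Lie bracket to complexified vector fields. -/
def cBracket (ξ η : ∀ x : X, Cx (TangentSpace I x)) (x : X) : Cx (TangentSpace I x) :=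
  cmk (VectorField.mlieBracket I (fun y => cre (ξ y)) (fun y => cre (η y)) x
        - VectorField.mlieBracket I (fun y => cim (ξ y)) (fun y => cim (η y)) x)
      (VectorField.mlieBracket I (fun y => cre (ξ y)) (fun y => cim (η y)) x
        + VectorField.mlieBracket I (fun y => cim (ξ y)) (fun y => cre (η y)) x)

/-- The distribution `D` in the complexified tangent bundle is involutive. -/
def Involutive (D : ∀ x : X, Set (Cx (TangentSpace I x))) : Prop :=
  ∀ (W : Set X) (ξ η : ∀ x : X, Cx (TangentSpace I x)), IsOpen W →
    SmoothCVF I W ξ → SmoothCVF I W η → (∀ x ∈ W, ξ x ∈ D x) → (∀ x ∈ W, η x ∈ D x) →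
    ∀ x ∈ W, cBracket I ξ η x ∈ D x

/-- Integrability of an almost complex structure: its `-i`-eigendistribution is involutive. -/
def IntegrableACS (A : ∀ x : X, TangentSpace I x →ₗ[ℝ] TangentSpace I x) : Prop :=
  Involutive I (fun x => {a | cmap (A x) a = -Complex.I • a})

end Calculus

/-! ## Complex manifolds and their real tangent bundle -/

/-- The model space of complex `n`-manifolds. -/
abbrev Model (n : ℕ) : Type := Fin n → ℂ

/-- A complex manifold is a real (analytic, hence smooth) manifold. -/
instance instRealManifold (n : ℕ) (M : Type*) [TopologicalSpace M] [ChartedSpace (Model n) M]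
    [IsManifold 𝓘(ℂ, Model n) ω M] : IsManifold 𝓘(ℝ, Model n) ω M := by
  refine isManifold_of_contDiffOn _ _ _ fun e e' he he' => ?_
  have h := (contDiffGroupoid ω 𝓘(ℂ, Model n)).compatible he he'
  rw [contDiffGroupoid, mem_groupoid_of_pregroupoid] at h
  have h3 := h.1
  simp only [contDiffPregroupoid] at h3
  exact ContDiffOn.restrict_scalars ℝ h3

section Base

variable (n : ℕ) {M : Type*} [TopologicalSpace M] [ChartedSpace (Model n) M]

/-- The real tangent space `T_p M`. -/
abbrev T (p : M) : Type := TangentSpace 𝓘(ℝ, Model n) p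

/-- The complex structure `I` of `M`: multiplication by `i` in holomorphic coordinates. -/
def cplxI (p : M) : T n p →ₗ[ℝ] T n p :=
  (LinearMap.lsmul ℂ (Model n) Complex.I).restrictScalars ℝ

/-- `T^{1,0}_p M`, the `i`-eigenspace of `I` in `T_p M ⊗ ℂ`. -/
def T10 (p : M) : Submodule ℂ (Cx (T n p)) :=
  Module.End.eigenspace (cmap (cplxI n p)) Complex.I

/-- The projection `π^{1,0}` onto `T^{1,0}`. -/
def pi10 (p : M) (Y : Cx (T n p)) : Cx (T n p) :=
  (1 / 2 : ℂ) • (Y - Complex.I • cmap (cplxI n p) Y)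

/-- The projection `π^{0,1}` onto `T^{0,1}`. -/
def pi01 (p : M) (Y : Cx (T n p)) : Cx (T n p) :=
  (1 / 2 : ℂ) • (Y + Complex.I • cmap (cplxI n p) Y)

variable (M)

/-- The total space `N = TM` of the real tangent bundle. -/
abbrev TM : Type _ := TangentBundle 𝓘(ℝ, Model n) M

/-- The model with corners of `N = TM` as a real manifold. -/
abbrev IN : ModelWithCorners ℝ (Model n × Model n) (ModelProd (Model n) (Model n)) :=
  𝓘(ℝ, Model n).tangent

end Base

section Main

variable {n : ℕ} {M : Type*} [TopologicalSpace M] [ChartedSpace (Model n) M]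
  [IsManifold 𝓘(ℂ, Model n) ω M]

/-- The real tangent space `T_V N` of `N = TM`. -/
abbrev TT (V : TM n M) : Type := TangentSpace (IN n) V

/-- The differential of the projection `π : TM → M`. -/
def dproj (V : TM n M) : TT V →ₗ[ℝ] T n V.proj :=
  (mfderiv (IN n) 𝓘(ℝ, Model n) (fun W : TM n M => W.proj) V).toLinearMap

/-- The vertical lift `ν_X` at `V`: the differential at `V` of the inclusion of the fibre. -/
def vert (V : TM n M) : T n V.proj →ₗ[ℝ] TT V :=
  let v₀ : Model n := V.2
  let dι : T n V.proj →L[ℝ] TT V :=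
    mfderiv 𝓘(ℝ, Model n) (IN n) (fun w : Model n => (⟨V.proj, w⟩ : TM n M)) v₀
  dι.toLinearMap

variable (n M) in
/-- The data `(ω, ∇)` of an affine special Kähler structure on the complex manifold `M`. -/
structure SKData where
  /-- the Kähler form -/
  form : ∀ p : M, LinearMap.BilinForm ℝ (T n p)
  /-- the connection; `conn s p X` is `∇_X s` at `p` -/
  conn : CovariantDerivative 𝓘(ℝ, Model n) (Model n)
    (fun p : M => TangentSpace 𝓘(ℝ, Model n) p)

namespace SKData

variable (S : SKData n M)

/-- `(M, I, ω, ∇)` is an affine special Kähler manifold: `(M, I, ω)` is pseudo-Kähler, `∇` is a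
flat torsion-free connection, `∇ω = 0` and `d_∇ I = 0`. -/
structure IsASK : Prop where
  form_smooth : SmoothBil 𝓘(ℝ, Model n) S.form
  form_skew : ∀ (p : M) (u v : T n p), S.form p u v = - S.form p v u
  form_nondeg : ∀ (p : M) (u : T n p), (∀ v, S.form p u v = 0) → u = 0
  form_compat : ∀ (p : M) (u v : T n p),
    S.form p (cplxI n p u) (cplxI n p v) = S.form p u v
  form_closed : IsClosedForm 𝓘(ℝ, Model n) S.form
  conn_smooth : ∀ (W : Set M) (ξ η : ∀ p : M, T n p), IsOpen W →
    SmoothVF 𝓘(ℝ, Model n) W ξ → SmoothVF 𝓘(ℝ, Model n) W η →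
    SmoothVF 𝓘(ℝ, Model n) W (fun p => S.conn η p (ξ p))
  conn_flat : ∀ (W : Set M) (ξ η χ : ∀ p : M, T n p), IsOpen W →
    SmoothVF 𝓘(ℝ, Model n) W ξ → SmoothVF 𝓘(ℝ, Model n) W η → SmoothVF 𝓘(ℝ, Model n) W χ →
    ∀ p ∈ W, S.conn (fun q => S.conn χ q (η q)) p (ξ p) - S.conn (fun q => S.conn χ q (ξ q)) p (η p)
      - S.conn χ p (VectorField.mlieBracket 𝓘(ℝ, Model n) ξ η p) = 0
  conn_torsion : ∀ (W : Set M) (ξ η : ∀ p : M, T n p), IsOpen W →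
    SmoothVF 𝓘(ℝ, Model n) W ξ → SmoothVF 𝓘(ℝ, Model n) W η →
    ∀ p ∈ W, S.conn η p (ξ p) - S.conn ξ p (η p) = VectorField.mlieBracket 𝓘(ℝ, Model n) ξ η p
  form_parallel : ∀ (W : Set M) (ξ η χ : ∀ p : M, T n p), IsOpen W →
    SmoothVF 𝓘(ℝ, Model n) W ξ → SmoothVF 𝓘(ℝ, Model n) W η → SmoothVF 𝓘(ℝ, Model n) W χ →
    ∀ p ∈ W, dReal 𝓘(ℝ, Model n) (fun q => S.form q (η q) (χ q)) p (ξ p)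
      = S.form p (S.conn η p (ξ p)) (χ p) + S.form p (η p) (S.conn χ p (ξ p))
  dI_zero : ∀ (W : Set M) (ξ η : ∀ p : M, T n p), IsOpen W →
    SmoothVF 𝓘(ℝ, Model n) W ξ → SmoothVF 𝓘(ℝ, Model n) W η →
    ∀ p ∈ W, S.conn (fun q => cplxI n q (η q)) p (ξ p) - S.conn (fun q => cplxI n q (ξ q)) p (η p)
      - cplxI n p (VectorField.mlieBracket 𝓘(ℝ, Model n) ξ η p) = 0

/-- The horizontal lift `ℋ_X` at `V` of the connection `∇`: with any smooth local section `s`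
through `V` it is `ds(X) - ν_{∇_X s}`, which is the velocity of the parallel transport of `V` along
a curve with velocity `X`. -/
def hor (V : TM n M) : T n V.proj →ₗ[ℝ] TT V :=
  let s : ∀ q : M, T n q := FiberBundle.extend (Model n) (E := fun q : M => T n q) V.2
  let ds : T n V.proj →L[ℝ] TT V :=
    mfderiv 𝓘(ℝ, Model n) (IN n) (fun q => (⟨q, s q⟩ : TM n M)) V.proj
  ds.toLinearMap - vert V ∘ₗ (S.conn s V.proj).toLinearMap

/-- For a function `f` on the fibre `T_p M`, the vector `w ∈ T_p M ⊗ ℂ` with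
`∂_u f (v) = ω(u, w)` for all `u`; its vertical lift is `Ham_f` at `v`. -/
def hamVec (p : M) (f : T n p → ℂ) (v : T n p) : Cx (T n p) :=
  Classical.epsilon fun w => ∀ u : T n p,
    cbil (S.form p) ((1 : ℂ) ⊗ₜ[ℝ] u) w = fderiv ℝ (fun x : Model n => f x) v u

/-- The function `ℋ_X f` on the fibre through `V`, for `X ∈ T_{π(V)} M ⊗ ℂ`. -/
def horDer (f : TM n M → ℂ) (p : M) (X : Cx (T n p)) : T n p → ℂ :=
  fun w => cform (dCpx (IN n) f ⟨p, w⟩) (cmap (S.hor ⟨p, w⟩) X)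

/-- The function `ν_X f` on the fibre through `V`, for `X ∈ T_{π(V)} M ⊗ ℂ`. -/
def vertDer (f : TM n M → ℂ) (p : M) (X : Cx (T n p)) : T n p → ℂ :=
  fun w => cform (dCpx (IN n) f ⟨p, w⟩) (cmap (vert ⟨p, w⟩) X)

/-- `h_X = ℋ_X + Ham_{ℋ_X J}`. -/
def h (J : TM n M → ℂ) (V : TM n M) (X : Cx (T n V.proj)) : Cx (TT V) :=
  cmap (S.hor V) X + cmap (vert V) (S.hamVec V.proj (S.horDer J V.proj X) V.2)

/-- The vector of `T_{π(V)} M ⊗ ℂ` whose vertical lift is `v_X`. -/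
def vBase (J : TM n M → ℂ) (V : TM n M) (X : Cx (T n V.proj)) : Cx (T n V.proj) :=
  (2 * Real.pi * Complex.I : ℂ) •
    (cconj X + S.hamVec V.proj (vertDer J V.proj (cconj X)) V.2)

/-- `v_X = 2πi (ν_{X̄} + Ham_{ν_{X̄} J})`. -/
def v (J : TM n M → ℂ) (V : TM n M) (X : Cx (T n V.proj)) : Cx (TT V) :=
  cmap (vert V) (S.vBase J V X)

/-- The family `𝒜^ζ` of complexified Ehresmann connections determined by `J`:
`𝒜^ζ_X = h_X - ζ⁻¹ conj(v_X)` and `𝒜^ζ_{X̄} = conj(h_X) + ζ v_X` for `X` of type `(1,0)`. -/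
def connFamily (J : TM n M → ℂ) (ζ : ℂ) (V : TM n M) (Y : Cx (T n V.proj)) : Cx (TT V) :=
  (S.h J V (pi10 n V.proj Y) - ζ⁻¹ • cconj (S.v J V (pi10 n V.proj Y)))
    + (cconj (S.h J V (cconj (pi01 n V.proj Y))) + ζ • S.v J V (cconj (pi01 n V.proj Y)))

/-- The rescaled limit at `ζ = 0`: `𝒜^0_X = - conj(v_X)`, `𝒜^0_{X̄} = conj(h_X)`. -/
def connZero (J : TM n M → ℂ) (V : TM n M) (Y : Cx (T n V.proj)) : Cx (TT V) :=
  - cconj (S.v J V (pi10 n V.proj Y)) + cconj (S.h J V (cconj (pi01 n V.proj Y)))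

/-- The non-degeneracy `TN ⊗ ℂ = Im h ⊕ Im h̄ ⊕ Im v ⊕ Im v̄` at `V`. Since `dim_ℂ (TN ⊗ ℂ) = 4n`
and `dim T^{1,0} = n`, it says that every vector is uniquely
`h_a + conj(h_b) + v_c + conj(v_d)`. -/
def NonDegAt (J : TM n M → ℂ) (V : TM n M) : Prop :=
  Function.Bijective (fun x : T10 n V.proj × T10 n V.proj × T10 n V.proj × T10 n V.proj =>
    S.h J V x.1 + cconj (S.h J V x.2.1) + S.v J V x.2.2.1 + cconj (S.v J V x.2.2.2))

/-- `A` is a complexified Ehresmann connection on `π : TM → M`. -/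
structure IsComplexEhresmann (A : ∀ V : TM n M, Cx (T n V.proj) → Cx (TT V)) : Prop where
  linear : ∀ V, IsLinearMap ℂ (A V)
  section_dproj : ∀ V Y, cmap (dproj V) (A V Y) = Y
  smooth : ∀ (W : Set M) (ξ : ∀ p : M, Cx (T n p)), IsOpen W → SmoothCVF 𝓘(ℝ, Model n) W ξ →
    SmoothCVF (IN n) ((fun V : TM n M => V.proj) ⁻¹' W) (fun V => A V (ξ V.proj))

/-- The function `J` determines, through the family `𝒜^ζ`, a special Joyce structure over the
affine special Kähler manifold `(M, I, ω, ∇)`. -/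
structure DefinesSpecialJoyce (J : TM n M → ℂ) : Prop where
  ask : S.IsASK
  smooth : ContMDiff (IN n) 𝓘(ℝ, ℂ) ∞ J
  nondeg : ∀ V, S.NonDegAt J V
  nondeg_proj : ∀ (V : TM n M), ∀ X ∈ T10 n V.proj, cmap (dproj V) (S.h J V X) = X
  ehresmann : ∀ ζ : ℂ, ζ ≠ 0 → IsComplexEhresmann (S.connFamily J ζ)
  /-- each `𝒜^ζ` is flat -/
  flat : ∀ ζ : ℂ, ζ ≠ 0 → Involutive (IN n) (fun V : TM n M => Set.range (S.connFamily J ζ V))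
  /-- the almost complex structure `I₃`, whose `-i`-eigenspace is `Im 𝒜^0`, preserves the vertical
  bundle, and the vertical symplectic form `ω^ν` is of type `(1,1)` for it -/
  type11 : ∀ V : TM n M, ∃ I₃ : TT V →ₗ[ℝ] TT V,
    (∀ Y, cmap I₃ (S.connZero J V Y) = -Complex.I • S.connZero J V Y) ∧
    ∃ j : T n V.proj →ₗ[ℝ] T n V.proj, (∀ u, I₃ (vert V u) = vert V (j u)) ∧
      ∀ a b, S.form V.proj (j a) (j b) = S.form V.proj a b

end SKData

/-! ## The associated hyperkähler structure on `N = TM` -/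

variable (n M) in
/-- A two-form `ω₃` and three endomorphism fields on `N = TM`. -/
structure HyperData where
  form₃ : ∀ V : TM n M, LinearMap.BilinForm ℝ (TT V)
  I₁ : ∀ V : TM n M, TT V →ₗ[ℝ] TT V
  I₂ : ∀ V : TM n M, TT V →ₗ[ℝ] TT V
  I₃ : ∀ V : TM n M, TT V →ₗ[ℝ] TT V

namespace HyperData

variable (Q : HyperData n M)

/-- The metric `g(a, b) = ω₃(a, I₃ b)`. -/
def g (V : TM n M) : LinearMap.BilinForm ℝ (TT V) := (Q.form₃ V).compRight (Q.I₃ V)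

/-- `ω₁(a, b) = g(I₁ a, b)`. -/
def form₁ (V : TM n M) : LinearMap.BilinForm ℝ (TT V) := (Q.g V).compLeft (Q.I₁ V)

/-- `ω₂(a, b) = g(I₂ a, b)`. -/
def form₂ (V : TM n M) : LinearMap.BilinForm ℝ (TT V) := (Q.g V).compLeft (Q.I₂ V)

/-- The holomorphic symplectic form `ω₁ + i ω₂` on real vectors. -/
def holForm (V : TM n M) (a b : TT V) : ℂ := (Q.form₁ V a b : ℂ) + Complex.I * (Q.form₂ V a b : ℂ)

/-- `(g, I₁, I₂, I₃)` is a (pseudo-)hyperkähler structure on `N` with third Kähler form `ω₃`. -/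
structure IsHyperkahler : Prop where
  g_smooth : SmoothBil (IN n) Q.g
  I₁_smooth : SmoothEnd (IN n) Q.I₁
  I₂_smooth : SmoothEnd (IN n) Q.I₂
  I₃_smooth : SmoothEnd (IN n) Q.I₃
  sq₁ : ∀ V a, Q.I₁ V (Q.I₁ V a) = -a
  sq₂ : ∀ V a, Q.I₂ V (Q.I₂ V a) = -a
  sq₃ : ∀ V a, Q.I₃ V (Q.I₃ V a) = -a
  mul₁₂ : ∀ V a, Q.I₁ V (Q.I₂ V a) = Q.I₃ V a
  anti₁₂ : ∀ V a, Q.I₁ V (Q.I₂ V a) = - Q.I₂ V (Q.I₁ V a)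
  anti₁₃ : ∀ V a, Q.I₁ V (Q.I₃ V a) = - Q.I₃ V (Q.I₁ V a)
  anti₂₃ : ∀ V a, Q.I₂ V (Q.I₃ V a) = - Q.I₃ V (Q.I₂ V a)
  integrable₁ : IntegrableACS (IN n) Q.I₁
  integrable₂ : IntegrableACS (IN n) Q.I₂
  integrable₃ : IntegrableACS (IN n) Q.I₃
  g_symm : ∀ V a b, Q.g V a b = Q.g V b a
  g_nondeg : ∀ V a, (∀ b, Q.g V a b = 0) → a = 0
  g_I₁ : ∀ V a b, Q.g V (Q.I₁ V a) (Q.I₁ V b) = Q.g V a b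
  g_I₂ : ∀ V a b, Q.g V (Q.I₂ V a) (Q.I₂ V b) = Q.g V a b
  g_I₃ : ∀ V a b, Q.g V (Q.I₃ V a) (Q.I₃ V b) = Q.g V a b
  form₃_eq : ∀ V a b, Q.form₃ V a b = Q.g V (Q.I₃ V a) b
  closed₁ : IsClosedForm (IN n) Q.form₁
  closed₂ : IsClosedForm (IN n) Q.form₂
  closed₃ : IsClosedForm (IN n) Q.form₃

/-- `Q` is the structure associated to the special Joyce structure determined by `J`: the
`-i`-eigenspaces of `I₁, I₂, I₃` are the images of `𝒜^ζ` for `ζ = i, -1, 0`, and `ω₃` is given by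
`ω₃(v_X, conj v_Y) = ω₃(h_Y, conj h_X) = -(1/4π²) ω^ν(v_X, conj v_Y)`, the other pairings of
`h_X, conj h_X, v_X, conj v_X` being zero. -/
structure IsAssociated (S : SKData n M) (J : TM n M → ℂ) : Prop where
  I₁_eq : ∀ (V : TM n M) Y,
    cmap (Q.I₁ V) (S.connFamily J Complex.I V Y) = -Complex.I • S.connFamily J Complex.I V Y
  I₂_eq : ∀ (V : TM n M) Y,
    cmap (Q.I₂ V) (S.connFamily J (-1) V Y) = -Complex.I • S.connFamily J (-1) V Y
  I₃_eq : ∀ (V : TM n M) Y,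
    cmap (Q.I₃ V) (S.connZero J V Y) = -Complex.I • S.connZero J V Y
  form₃_skew : ∀ (V : TM n M) a b, Q.form₃ V a b = - Q.form₃ V b a
  form₃_vv : ∀ (V : TM n M), ∀ X ∈ T10 n V.proj, ∀ Y ∈ T10 n V.proj,
    cbil (Q.form₃ V) (S.v J V X) (cconj (S.v J V Y))
      = -(1 / (4 * Real.pi ^ 2) : ℂ)
        * cbil (S.form V.proj) (S.vBase J V X) (cconj (S.vBase J V Y))
  form₃_hh : ∀ (V : TM n M), ∀ X ∈ T10 n V.proj, ∀ Y ∈ T10 n V.proj,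
    cbil (Q.form₃ V) (S.h J V Y) (cconj (S.h J V X))
      = -(1 / (4 * Real.pi ^ 2) : ℂ)
        * cbil (S.form V.proj) (S.vBase J V X) (cconj (S.vBase J V Y))
  form₃_zero : ∀ (V : TM n M), ∀ X ∈ T10 n V.proj, ∀ Y ∈ T10 n V.proj,
    cbil (Q.form₃ V) (S.h J V X) (S.h J V Y) = 0 ∧
    cbil (Q.form₃ V) (S.v J V X) (S.v J V Y) = 0 ∧
    cbil (Q.form₃ V) (S.h J V X) (S.v J V Y) = 0 ∧
    cbil (Q.form₃ V) (S.h J V X) (cconj (S.v J V Y)) = 0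

end HyperData

/-! ## Special period structures and uncoupled variations of BPS structures -/

/-- `e = (γ_i, γ^i)`, with `γ_i = e (inl i)` and `γ^i = e (inr i)`, is a local Darboux frame over the
open set `U` of the bundle of lattices `Γ ⊂ TM` with the skew pairing `ω`. -/
structure IsDarbouxFrame (Γ : ∀ p : M, AddSubgroup (T n p))
    (form : ∀ p : M, LinearMap.BilinForm ℝ (T n p)) (U : Set M)
    (e : Fin n ⊕ Fin n → ∀ p : M, T n p) : Prop where
  isOpen : IsOpen U
  smooth : ∀ a, SmoothVF 𝓘(ℝ, Model n) U (e a)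
  linInd : ∀ p ∈ U, LinearIndependent ℝ (fun a => e a p)
  span : ∀ p ∈ U, AddSubgroup.closure (Set.range fun a => e a p) = Γ p
  pair_lu : ∀ p ∈ U, ∀ i j, form p (e (Sum.inl i) p) (e (Sum.inr j) p) = if i = j then 1 else 0
  pair_ll : ∀ p ∈ U, ∀ i j, form p (e (Sum.inl i) p) (e (Sum.inl j) p) = 0
  pair_uu : ∀ p ∈ U, ∀ i j, form p (e (Sum.inr i) p) (e (Sum.inr j) p) = 0

/-- The flat local section `∑ m_a e_a` of `Γ` with integer coordinates `m`. -/
def comb (e : Fin n ⊕ Fin n → ∀ p : M, T n p) (m : Fin n ⊕ Fin n → ℤ) (p : M) : T n p :=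
  ∑ a, m a • e a p

variable (n M) in
/-- A special period structure `(M, Γ, Z)`. Since `Γ_p ⊗ ℝ = T_p M`, the skew pairing on `Γ_p` and
the homomorphism `Z_p : Γ_p → ℂ` are given through their real-linear extensions to `T_p M`; the
former is the two-form `ω`. The connection `∇` is the one for which the local sections of `Γ` are
parallel. -/
structure SpecialPeriodStructure extends SKData n M where
  Γ : ∀ p : M, AddSubgroup (T n p)
  Z : ∀ p : M, T n p →ₗ[ℝ] ℂ
  skew : ∀ (p : M) (u w : T n p), form p u w = - form p w u
  exists_frame : ∀ p : M, ∃ U e, p ∈ U ∧ IsDarbouxFrame Γ form U e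
  Z_holomorphic : ∀ U e, IsDarbouxFrame Γ form U e → ∀ a,
    MDifferentiableOn 𝓘(ℂ, Model n) 𝓘(ℂ, ℂ) (fun p => Z p (e a p)) U
  compat : ∀ (p : M) (u w : T n p), form p (cplxI n p u) (cplxI n p w) = form p u w
  conn_frame : ∀ U e, IsDarbouxFrame Γ form U e → ∀ a, ∀ p ∈ U, conn (e a) p = 0
  /-- the complex vector field `ξ^{1,0}` with `Z/2 = ω(ξ^{1,0}, -)` satisfies
  `∇ ξ^{1,0} = π^{1,0}` -/
  euler : ∃ ξ : ∀ p : M, Cx (T n p),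
    (∀ (p : M) (u : T n p), (1 / 2 : ℂ) * Z p u = cbil (form p) (ξ p) ((1 : ℂ) ⊗ₜ[ℝ] u)) ∧
    ∀ (p : M) (X : T n p),
      cmk (conn (fun q => cre (ξ q)) p X) (conn (fun q => cim (ξ q)) p X)
        = pi10 n p ((1 : ℂ) ⊗ₜ[ℝ] X)

/-- The BPS indices `Ω` of an uncoupled variation of BPS structures `(M, Γ, Z, Ω)` on a special
period structure. Only the values of `Ω` on nonzero elements of `Γ` matter. -/
structure UncoupledBPS (P : SpecialPeriodStructure n M) where
  index : ∀ p : M, T n p → ℚ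
  symm : ∀ (p : M), ∀ γ ∈ P.Γ p, γ ≠ 0 → index p (-γ) = index p γ
  uncoupled : ∀ (p : M), ∀ γ ∈ P.Γ p, ∀ γ' ∈ P.Γ p, γ ≠ 0 → γ' ≠ 0 →
    index p γ ≠ 0 → index p γ' ≠ 0 → P.form p γ γ' = 0
  /-- the wall-crossing formula, which in the uncoupled case says that `Ω` is locally constant along
  flat local sections of `Γ` (and thus monodromy invariant, being a function on `Γ`) -/
  wallCrossing : ∀ U e, IsDarbouxFrame P.Γ P.form U e → ∀ m : Fin n ⊕ Fin n → ℤ, m ≠ 0 →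
    ∀ p ∈ U, ∀ᶠ q in 𝓝 p, index q (comb e m q) = index p (comb e m p)
  support : ∀ (K : Set M) (nrm : ∀ p : M, Seminorm ℝ (T n p)), IsCompact K →
    (∀ p ∈ K, ∀ u : T n p, nrm p u = 0 → u = 0) →
    ContinuousOn (fun V : TM n M => nrm V.proj V.2) ((fun V : TM n M => V.proj) ⁻¹' K) →
    ∃ C : ℝ, 0 < C ∧ ∀ p ∈ K, ∀ γ ∈ P.Γ p, γ ≠ 0 → index p γ ≠ 0 → C * nrm p γ < ‖P.Z p γ‖
  /-- for every `R > 0`, `∑_γ |Ω(γ)| e^{-R |Z_γ|}` converges normally on compact sets -/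
  convergence : ∀ R : ℝ, 0 < R → ∀ U e, IsDarbouxFrame P.Γ P.form U e →
    ∀ K ⊆ U, IsCompact K → ∃ b : {m : Fin n ⊕ Fin n → ℤ // m ≠ 0} → ℝ, Summable b ∧
      ∀ m, ∀ p ∈ K,
        |(index p (comb e m.1 p) : ℝ)| * Real.exp (-R * ‖P.Z p (comb e m.1 p)‖) ≤ b m

/-! ## The function `J` and the instanton-corrected forms -/

/-- The modified Bessel function of the second kind `K_α(x)`, for `x > 0`. -/
def besselK (α x : ℝ) : ℝ :=
  ∫ t in Set.Ioi (0 : ℝ), Real.exp (-x * Real.cosh t) * Real.cosh (α * t)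

variable (P : SpecialPeriodStructure n M) (B : UncoupledBPS P)

/-- The summand of `J` at `V` for `γ ∈ Γ_{π(V)}` and `k > 0`. In the coordinates of a Darboux frame
with `γ = n_i γ^i`, the number `ω(V, γ)` is `φ_γ = n_i φ^i`. -/
def jTerm (V : TM n M) (γ : T n V.proj) (k : ℕ+) : ℂ :=
  Complex.exp (Complex.I * ((k : ℝ) * P.form V.proj V.2 γ : ℝ)) / ((k : ℕ) : ℂ) ^ 2
    * (besselK 0 (2 * Real.pi * (k : ℝ) * ‖P.Z V.proj γ‖) : ℂ)

/-- `J = (1 / 2πi) ∑_γ Ω(γ) ∑_{k > 0} k⁻² e^{i k φ_γ} K₀(2πk |Z_γ|)`, the first sum over the nonzero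
elements of `Γ`. -/
def joyceFunction (V : TM n M) : ℂ :=
  1 / (2 * Real.pi * Complex.I) *
    ∑' γ : {γ : T n V.proj // γ ∈ P.Γ V.proj ∧ γ ≠ 0},
      (B.index V.proj γ.1 : ℂ) * ∑' k : ℕ+, jTerm P V γ.1 k

variable (n M) in
/-- The set of points of the cotangent bundle `T^*M`. -/
abbrev CoT : Type _ := Σ p : M, (T n p →ₗ[ℝ] ℝ)

/-- The identification `TM ≅ T^*M`, `X ↦ ω(X, -)`. -/
def toCoT (S : SKData n M) (V : TM n M) : CoT n M := ⟨V.proj, S.form V.proj V.2⟩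

/-- For a local section `γ` of `TM`, the fibrewise linear function `θ_γ(α) = α(γ)` on `T^*M`. For
`γ = γ_i` and `γ = γ^i` these are the fibre coordinates `θ_i` and `θ^i`, that is, a point is
`θ_i dx^i + θ^i dy_i`. -/
def theta (γ : ∀ p : M, T n p) (α : CoT n M) : ℝ := α.2 (γ α.1)

/-- `a ∧ b` for complex-valued real-linear one-forms, evaluated on two vectors. -/
def wedge {V : Type*} [AddCommGroup V] [Module ℝ V] (a b : V →ₗ[ℝ] ℂ) (x y : V) : ℂ :=
  a x * b y - a y * b x

/-- The complex conjugate of a one-form. -/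
def conjForm {V : Type*} [AddCommGroup V] [Module ℝ V] (a : V →ₗ[ℝ] ℂ) : V →ₗ[ℝ] ℂ :=
  Complex.conjAe.toLinearMap ∘ₗ a

/-- The one-form `dZ_γ` at `V ∈ TM ≅ T^*M`, for a local section `γ` of `Γ`. -/
def dZ (γ : ∀ p : M, T n p) (V : TM n M) : TT V →ₗ[ℝ] ℂ :=
  dCpx (IN n) (fun W : TM n M => P.Z W.proj (γ W.proj)) V

/-- The one-form `dθ_γ`, pulled back by `TM ≅ T^*M`. -/
def dTheta (γ : ∀ p : M, T n p) (V : TM n M) : TT V →ₗ[ℝ] ℂ :=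
  dCpx (IN n) (fun W : TM n M => (theta γ (toCoT P.toSKData W) : ℂ)) V

/-- The function `V_γ = (1/2π) ∑_{k>0} e^{i k θ_γ} K₀(2πk |Z_γ|)`, pulled back by `TM ≅ T^*M`. -/
def instV (γ : ∀ p : M, T n p) (V : TM n M) : ℂ :=
  1 / (2 * Real.pi) * ∑' k : ℕ+,
    Complex.exp (Complex.I * ((k : ℝ) * theta γ (toCoT P.toSKData V) : ℝ))
      * (besselK 0 (2 * Real.pi * (k : ℝ) * ‖P.Z V.proj (γ V.proj)‖) : ℂ)

/-- The one-form
`A_γ = -(1/4π) ∑_{k>0} e^{i k θ_γ} |Z_γ| K₁(2πk |Z_γ|) (dZ_γ / Z_γ - dZ̄_γ / Z̄_γ)`, pulled back by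
`TM ≅ T^*M`. -/
def instA (γ : ∀ p : M, T n p) (V : TM n M) : TT V →ₗ[ℝ] ℂ :=
  let z : ℂ := P.Z V.proj (γ V.proj)
  (-(1 / (4 * Real.pi) : ℂ) * ∑' k : ℕ+,
    Complex.exp (Complex.I * ((k : ℝ) * theta γ (toCoT P.toSKData V) : ℝ)) * (‖z‖ : ℂ)
      * (besselK 1 (2 * Real.pi * (k : ℝ) * ‖z‖) : ℂ)) •
    (z⁻¹ • dZ P γ V - ((starRingEnd ℂ) z)⁻¹ • conjForm (dZ P γ V))

/-- Under the identification `TM ≅ T^*M`, `X ↦ ω(X, -)`, the Kähler form `ω₃` and the holomorphic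
symplectic form `ω₁ + i ω₂` of `Q` are the instanton-corrected forms on `T^*M`: in every local
Darboux frame `(γ_i, γ^i)` of `Γ`, with `Z^i = Z_{γ^i}`, `Z_i = Z_{γ_i}`,
`ω₃ = π^*ω - (1/4π²) dθ_i ∧ dθ^i + ∑_γ Ω(γ) ((i/2) V_γ dZ_γ ∧ dZ̄_γ + (1/2π) dθ_γ ∧ A_γ)` and
`ω₁ + i ω₂ = (1/2π) (dZ^i ∧ dθ_i - dZ_i ∧ dθ^i)
  + ∑_γ Ω(γ) (dZ_γ ∧ A_γ + (i/2π) V_γ dθ_γ ∧ dZ_γ)`. -/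
def MatchesInstantonMetric (Q : HyperData n M) : Prop :=
  ∀ U e, IsDarbouxFrame P.Γ P.form U e → ∀ V : TM n M, V.proj ∈ U → ∀ a b : TT V,
    HasSum (fun m : {m : Fin n ⊕ Fin n → ℤ // m ≠ 0} =>
        (B.index V.proj (comb e m.1 V.proj) : ℂ) *
          (Complex.I / 2 * instV P (comb e m.1) V
              * wedge (dZ P (comb e m.1) V) (conjForm (dZ P (comb e m.1) V)) a b
            + 1 / (2 * Real.pi) * wedge (dTheta P (comb e m.1) V) (instA P (comb e m.1) V) a b))
      ((Q.form₃ V a b : ℂ) - ((P.form V.proj (dproj V a) (dproj V b) : ℂ)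
        - 1 / (4 * Real.pi ^ 2) *
          ∑ i : Fin n, wedge (dTheta P (e (Sum.inl i)) V) (dTheta P (e (Sum.inr i)) V) a b)) ∧
    HasSum (fun m : {m : Fin n ⊕ Fin n → ℤ // m ≠ 0} =>
        (B.index V.proj (comb e m.1 V.proj) : ℂ) *
          (wedge (dZ P (comb e m.1) V) (instA P (comb e m.1) V) a b
            + Complex.I / (2 * Real.pi) * instV P (comb e m.1) V
              * wedge (dTheta P (comb e m.1) V) (dZ P (comb e m.1) V) a b))
      (Q.holForm V a b - 1 / (2 * Real.pi) *
          ∑ i : Fin n, (wedge (dZ P (e (Sum.inr i)) V) (dTheta P (e (Sum.inl i)) V) a b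
            - wedge (dZ P (e (Sum.inl i)) V) (dTheta P (e (Sum.inr i)) V) a b))

end Main

end SpecialJoyce

end

/-! Near a point of `M` a Darboux frame `e_a` gives coordinates on `N`: the periods `Z_a` and the
pairings `θ_a`. The condition on `ξ^{1,0}` says that `d Re Z_a = ω(-, e_a)` and `d Im Z_a = -ω(I-,
e_a)` (`dReal_period`). So the `Re Z_a` are flat coordinates in which `ω` is constant, and the
special Kähler axioms reduce to the commutator formula for brackets applied to `Re Z_a` and `Im Z_a`
(`isASK`).

In these coordinates `J = iF` with `F` real, because `Ω(-γ) = Ω(γ)`, and `F` is a sum over charges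
`m` of functions of `(Z_m, θ_m)` alone (`LocalModel.joyceFunction_eq`). The support property and the
exponential decay of the Bessel functions let the series be differentiated termwise to any order
(`FlatBPS.exists_summable_bound`). The geometry then depends only on the Hessian of `F`, encoded in
endomorphisms `q` (`vertHam`) and `ρ` (`horHam`) of `T_pM`: `ω(u, q a)` is the fibre-fibre Hessian
and `ω(u, ρ a)` the fibre-base Hessian. Three facts carry the proof. Uncoupledness makes the images
of `q` and `ρ` orthogonal to all active charges, hence isotropic and mutually orthogonal
(`form_vertHam_vertHam` and its companions). Each summand satisfies the Laplace-type equation `Δ_Z +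
4π² ∂_θ² = 0`, which is the Bessel equation (`LocalModel.potHess_zdiff_zdiff`). Finally `dZ(I-) = i
dZ` gives a symmetry of `ρ` (`LocalModel.form_horHam_symm`).

On `T^{1,0}` the operator `I` is multiplication by `i`, so `h` and `v` come from the real maps `a ↦
ℋ_a + ν_{ρ(Ia)}` and `c ↦ -2π ν_{Sc}` with `S = I + q`. Non-degeneracy turns their sum `twistMap`
into an isomorphism from pairs `(a, c)` to `T_V N`. There `I₁, I₂, I₃` are simple matrices in `I`,
and `ω₃ = η(a, a') - η(c, c')` with `η = ω(S-, S-)`. Isotropy makes `η` of type `(1,1)` for `I`, and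
the pointwise hyperkähler algebra follows.

Closedness comes from rewriting each `ω_i` through the Hessian of `F`, which exhibits it locally as
a finite sum of forms `df ∧ dg` (`LocalModel.wedgeSumOn_form₃` and its companions). Involutivity is
then a consequence: the kernel of a closed complex two-form is involutive (`involutive_kernel`). The
`-i`-eigenspaces of `I₁, I₂, I₃` are the kernels of `ω₂ + iω₃`, `ω₃ + iω₁`, `ω₁ + iω₂`
(`kernel_eq_eigenspace`), and the image of `𝒜^ζ` is the kernel of `ω₃ + σω₁ + τω₂` for a point of
the conic `1 + σ² + τ² = 0` (`range_connFamily`). Summed charge by charge, the same Hessian formulas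
are the instanton corrections (`LocalModel.hasSum_form₃`, `LocalModel.hasSum_holForm`). -/

noncomputable section

/-! ### Vector fields in a chart and the bracket as a commutator of derivations. -/

section

namespace SpecialJoyce
section Calc
variable {E : Type*} [NormedAddCommGroup E] [NormedSpace ℝ E] [CompleteSpace E] {H : Type*} [TopologicalSpace H]
  {I : ModelWithCorners ℝ E H} [I.Boundaryless] {X : Type*} [TopologicalSpace X] [ChartedSpace H X]
  [IsManifold I ∞ X]

open VectorField Set

/-- The field `V` read in the preferred chart at `x`. -/
def chartField (I : ModelWithCorners ℝ E H) {X : Type*} [TopologicalSpace X] [ChartedSpace H X] (x : X) (V : ∀ y : X, TangentSpace I y) : E → E :=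
  mpullbackWithin 𝓘(ℝ, E) I (extChartAt I x).symm V (range I)

theorem differentiableAt_chartField {x : X} {V : ∀ y : X, TangentSpace I y}
    (hV : MDifferentiableAt I I.tangent (fun y => (⟨y, V y⟩ : TangentBundle I X)) x) :
    DifferentiableAt ℝ (chartField I x V) (extChartAt I x x) := by
  have : IsManifold I 2 X := IsManifold.of_le (n := ∞) (WithTop.coe_le_coe.2 le_top)
  have h := MDifferentiableWithinAt.differentiableWithinAt_mpullbackWithin_vectorField
    (s := univ) (hV.mdifferentiableWithinAt)
  change DifferentiableWithinAt ℝ (chartField I x V) _ _ at h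
  rwa [preimage_univ, univ_inter, I.range_eq_univ, differentiableWithinAt_univ] at h

theorem chartField_extChartAt {x y : X} (hy : y ∈ (extChartAt I x).source)
    (V : ∀ y : X, TangentSpace I y) :
    chartField I x V (extChartAt I x y) = mfderiv I 𝓘(ℝ, E) (extChartAt I x) y (V y) := by
  have : IsManifold I 1 X := IsManifold.of_le (n := ∞) (WithTop.coe_le_coe.2 le_top)
  have A : (extChartAt I x).symm (extChartAt I x y) = y := (extChartAt I x).left_inv hy
  have B := isInvertible_mfderivWithin_extChartAt_symm (I := I) ((extChartAt I x).map_source hy)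
  have C := mfderivWithin_extChartAt_symm_comp_mfderiv_extChartAt' (I := I) hy
  let V' : X → E := V
  have hV' : V' ((extChartAt I x).symm (extChartAt I x y)) = V' y := congrArg V' A
  change (mfderivWithin 𝓘(ℝ, E) I (extChartAt I x).symm (range I) (extChartAt I x y)).inverse
    (V' ((extChartAt I x).symm (extChartAt I x y))) = _
  obtain ⟨e, he⟩ := B
  have C' : e (mfderiv I 𝓘(ℝ, E) (extChartAt I x) y (V y)) = V y := by
    have := DFunLike.congr_fun C (V y)
    rw [← he] at this
    exact this
  rw [← he, ContinuousLinearMap.inverse_equiv]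
  exact (e.symm_apply_eq).2 (hV'.trans C'.symm)

theorem dReal_eq_chart {x y : X} (hy : y ∈ (extChartAt I x).source) {f : X → ℝ}
    (hf : MDifferentiableAt I 𝓘(ℝ, ℝ) f y) (V : ∀ y : X, TangentSpace I y) :
    dReal I f y (V y) = fderiv ℝ (f ∘ (extChartAt I x).symm) (extChartAt I x y)
      (chartField I x V (extChartAt I x y)) := by
  have : IsManifold I 1 X := IsManifold.of_le (n := ∞) (WithTop.coe_le_coe.2 le_top)
  have A : (extChartAt I x).symm (extChartAt I x y) = y := (extChartAt I x).left_inv hy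
  rw [chartField_extChartAt hy]
  have hs : MDifferentiableAt 𝓘(ℝ, E) I (extChartAt I x).symm (extChartAt I x y) := by
    have := mdifferentiableWithinAt_extChartAt_symm (I := I) ((extChartAt I x).map_source hy)
    rwa [I.range_eq_univ, mdifferentiableWithinAt_univ] at this
  have hc : MDifferentiableAt I 𝓘(ℝ, E) (extChartAt I x) y :=
    mdifferentiableAt_extChartAt (by simpa using hy)
  have hfg : MDifferentiableAt 𝓘(ℝ, E) 𝓘(ℝ, ℝ) (f ∘ (extChartAt I x).symm) (extChartAt I x y) :=
    MDifferentiableAt.comp _ (by rw [A]; exact hf) hs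
  have key : f =ᶠ[𝓝 y] (f ∘ (extChartAt I x).symm) ∘ extChartAt I x := by
    filter_upwards [(isOpen_extChartAt_source (I := I) x).mem_nhds hy] with z hz
    simp only [Function.comp_apply]
    rw [(extChartAt I x).left_inv hz]
  unfold dReal
  rw [key.mfderiv_eq]
  rw [mfderiv_comp _ hfg hc, mfderiv_eq_fderiv]
  rfl

theorem contDiffAt_comp_extChartAt_symm {x : X} {f : X → ℝ} (hf : ContMDiffAt I 𝓘(ℝ, ℝ) ∞ f x) :
    ContDiffAt ℝ ∞ (f ∘ (extChartAt I x).symm) (extChartAt I x x) := by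
  rw [← contMDiffAt_iff_contDiffAt]
  refine ContMDiffAt.comp _ (by rw [extChartAt_to_inv]; exact hf) ?_
  exact (contMDiffOn_extChartAt_symm x).contMDiffAt (extChartAt_target_mem_nhds x)

/-- Read in a chart, both iterated derivatives contain the second derivative of `f` on the two
fields; its symmetry cancels these terms and leaves `df` on the bracket of the chart fields. -/
theorem dReal_mlieBracket {x : X} {f : X → ℝ} (hf : ContMDiffAt I 𝓘(ℝ, ℝ) ∞ f x)
    {V W : ∀ y : X, TangentSpace I y}
    (hV : MDifferentiableAt I I.tangent (fun y => (⟨y, V y⟩ : TangentBundle I X)) x)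
    (hW : MDifferentiableAt I I.tangent (fun y => (⟨y, W y⟩ : TangentBundle I X)) x) :
    dReal I f x (mlieBracket I V W x)
      = dReal I (fun y => dReal I f y (W y)) x (V x) - dReal I (fun y => dReal I f y (V y)) x (W x) := by
  have : IsManifold I 1 X := IsManifold.of_le (n := ∞) (WithTop.coe_le_coe.2 le_top)
  have hx := mem_extChartAt_source (I := I) x
  set c := extChartAt I x x with hc
  have hf' := contDiffAt_comp_extChartAt_symm hf
  have hV' := differentiableAt_chartField hV
  have hW' := differentiableAt_chartField hW
  have hd : DifferentiableAt ℝ (fderiv ℝ (f ∘ (extChartAt I x).symm)) c :=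
    (hf'.fderiv_right (m := 1) (WithTop.coe_le_coe.2 le_top)).differentiableAt one_ne_zero
  have hfm : ∀ᶠ y in 𝓝 x, MDifferentiableAt I 𝓘(ℝ, ℝ) f y := by
    have h1 : ContMDiffAt I 𝓘(ℝ, ℝ) 1 f x := hf.of_le (WithTop.coe_le_coe.2 le_top)
    filter_upwards [(contMDiffAt_iff_contMDiffAt_nhds (by simp)).1 h1] with y hy
    exact hy.mdifferentiableAt one_ne_zero
  have gen : ∀ V : (∀ y : X, TangentSpace I y), DifferentiableAt ℝ (chartField I x V) c →
      ∀ U : (∀ y : X, TangentSpace I y),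
      dReal I (fun y => dReal I f y (V y)) x (U x) =
      fderiv ℝ (fun z => fderiv ℝ (f ∘ (extChartAt I x).symm) z (chartField I x V z)) c
        (chartField I x U c) := by
    intro V hV U
    have e1 : (fun y => dReal I f y (V y)) =ᶠ[𝓝 x]
        (fun z => fderiv ℝ (f ∘ (extChartAt I x).symm) z (chartField I x V z)) ∘ extChartAt I x := by
      filter_upwards [hfm, (isOpen_extChartAt_source (I := I) x).mem_nhds hx] with y hy hy'
      exact dReal_eq_chart hy' hy V
    have e2 : DifferentiableAt ℝ
        (fun z => fderiv ℝ (f ∘ (extChartAt I x).symm) z (chartField I x V z)) c := hd.clm_apply hV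
    rw [chartField_extChartAt hx]
    unfold dReal at e1 ⊢
    rw [e1.mfderiv_eq, mfderiv_comp _ (by rw [mdifferentiableAt_iff_differentiableAt]; exact e2)
      (mdifferentiableAt_extChartAt (mem_chart_source H x)), mfderiv_eq_fderiv]
    rfl
  rw [gen W hW' V, gen V hV' W, dReal_eq_chart hx hfm.self_of_nhds (mlieBracket I V W),
    chartField_extChartAt hx]
  have hb : mfderiv I 𝓘(ℝ, E) (extChartAt I x) x (mlieBracket I V W x)
      = lieBracket ℝ (chartField I x V) (chartField I x W) c := by
    obtain ⟨e, he⟩ := isInvertible_mfderiv_extChartAt (I := I) (mem_extChartAt_source (I := I) x)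
    rw [← mlieBracketWithin_univ, mlieBracketWithin_apply, ← he, ContinuousLinearMap.inverse_equiv]
    refine (e.apply_symm_apply _).trans ?_
    change lieBracketWithin ℝ (chartField I x V) (chartField I x W) _ _ = _
    rw [preimage_univ, univ_inter, I.range_eq_univ, lieBracketWithin_univ]
  rw [hb]
  have hs : IsSymmSndFDerivAt ℝ (f ∘ (extChartAt I x).symm) c :=
    hf'.isSymmSndFDerivAt (by simpa using WithTop.coe_le_coe.2 (le_top : (2 : ℕ∞) ≤ ⊤))
  rw [fderiv_clm_apply hd hW', fderiv_clm_apply hd hV', lieBracket]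
  simp only [add_apply, ContinuousLinearMap.comp_apply,
    ContinuousLinearMap.flip_apply, map_sub]
  rw [hs.eq (chartField I x V c) (chartField I x W c)]
  abel
end Calc
end SpecialJoyce

end

/-! ### Differentials of functions, forms `df ∧ dg`, and kernels of closed two-forms. -/

section

namespace SpecialJoyce
section Calc2
variable {E : Type*} [NormedAddCommGroup E] [NormedSpace ℝ E] [CompleteSpace E] {H : Type*} [TopologicalSpace H]
  {I : ModelWithCorners ℝ E H} [I.Boundaryless] {X : Type*} [TopologicalSpace X] [ChartedSpace H X]
  [IsManifold I ∞ X]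

open VectorField Set

theorem SmoothVF.mdifferentiableAt {W : Set X} {ξ : ∀ x : X, TangentSpace I x} (h : SmoothVF I W ξ)
    (hW : IsOpen W) {x : X} (hx : x ∈ W) :
    MDifferentiableAt I I.tangent (fun y => (⟨y, ξ y⟩ : TangentBundle I X)) x :=
  (h.contMDiffAt (hW.mem_nhds hx)).mdifferentiableAt (by simp)

theorem SmoothVF.mono {W W' : Set X} {ξ : ∀ x : X, TangentSpace I x} (h : SmoothVF I W ξ)
    (hW : W' ⊆ W) : SmoothVF I W' ξ := ContMDiffOn.mono h hW

/-- The differential of a vector-valued function, with values in the target space. -/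
def dMap (I : ModelWithCorners ℝ E H) {X : Type*} [TopologicalSpace X] [ChartedSpace H X]
    {F : Type*} [NormedAddCommGroup F] [NormedSpace ℝ F] (f : X → F) (x : X) :
    TangentSpace I x →L[ℝ] F := mfderiv I 𝓘(ℝ, F) f x

theorem dReal_eq_dMap (f : X → ℝ) (x : X) (u : TangentSpace I x) : dReal I f x u = dMap I f x u :=
  rfl

theorem dCpx_eq_dMap (f : X → ℂ) (x : X) (u : TangentSpace I x) : dCpx I f x u = dMap I f x u :=
  rfl

section dMap
variable {F F' : Type*} [NormedAddCommGroup F] [NormedSpace ℝ F] [NormedAddCommGroup F']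
  [NormedSpace ℝ F']

theorem ContMDiffOn.dMap_vectorField {W : Set X} (hW : IsOpen W) {f : X → F}
    (hf : ContMDiffOn I 𝓘(ℝ, F) ∞ f W) {ξ : ∀ x : X, TangentSpace I x} (hξ : SmoothVF I W ξ) :
    ContMDiffOn I 𝓘(ℝ, F) ∞ (fun y => dMap I f y (ξ y)) W := by
  have h1 := hf.contMDiffOn_tangentMapWithin (m := ∞) (by simp) hW.uniqueMDiffOn
  have h2 := h1.comp hξ (fun x hx => hx)
  have h3 := (contMDiff_snd_tangentBundle_modelSpace F 𝓘(ℝ, F) (n := ∞)).comp_contMDiffOn h2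
  refine h3.congr fun y hy => ?_
  change _ = mfderivWithin I 𝓘(ℝ, F) f W y (ξ y)
  rw [mfderivWithin_of_isOpen hW hy]
  rfl

theorem ContMDiffOn.dReal_vectorField {W : Set X} (hW : IsOpen W) {f : X → ℝ}
    (hf : ContMDiffOn I 𝓘(ℝ, ℝ) ∞ f W) {ξ : ∀ x : X, TangentSpace I x} (hξ : SmoothVF I W ξ) :
    ContMDiffOn I 𝓘(ℝ, ℝ) ∞ (fun y => dReal I f y (ξ y)) W :=
  ContMDiffOn.dMap_vectorField hW hf hξ

theorem dMap_comp_apply {f : X → F} {x : X} {g : F → F'} (hg : DifferentiableAt ℝ g (f x))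
    (hf : MDifferentiableAt I 𝓘(ℝ, F) f x) (u : TangentSpace I x) :
    dMap I (fun y => g (f y)) x u = fderiv ℝ g (f x) (dMap I f x u) := by
  have := mfderiv_comp (I := I) (I' := 𝓘(ℝ, F)) (I'' := 𝓘(ℝ, F')) x
    (mdifferentiableAt_iff_differentiableAt.2 hg) hf
  rw [mfderiv_eq_fderiv] at this
  exact DFunLike.congr_fun this u

theorem dMap_clm_comp_apply {f : X → F} {x : X} (g : F →L[ℝ] F')
    (hf : MDifferentiableAt I 𝓘(ℝ, F) f x) (u : TangentSpace I x) :
    dMap I (fun y => g (f y)) x u = g (dMap I f x u) := by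
  rw [dMap_comp_apply g.differentiableAt hf, g.fderiv]

theorem dMap_congr {x : X} {f g : X → F} (h : f =ᶠ[𝓝 x] g) : dMap I f x = dMap I g x := by
  ext u
  exact DFunLike.congr_fun (h.mfderiv_eq (I := I) (I' := 𝓘(ℝ, F))) u

end dMap

/-- The constant fields of `F` pull back along `Λ` to a smooth frame, and the components of `dΛ(ξ)`
are the coefficients of `ξ` in it. This allows smoothness to be tested in the coordinates `Re Z` and
`θ` instead of charts. -/
theorem smoothVF_of_coordinates {F : Type*} [NormedAddCommGroup F] [NormedSpace ℝ F]
    [FiniteDimensional ℝ F] {W : Set X} (hW : IsOpen W) {Λ : X → F}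
    (hΛ : ContMDiffOn I 𝓘(ℝ, F) ∞ Λ W) (hinv : ∀ y ∈ W, (dMap I Λ y).IsInvertible)
    {ξ : ∀ x : X, TangentSpace I x}
    (hξ : ContMDiffOn I 𝓘(ℝ, F) ∞ (fun y => dMap I Λ y (ξ y)) W) :
    SmoothVF I W ξ := by
  have : CompleteSpace F := FiniteDimensional.complete ℝ F
  let b := Module.finBasis ℝ F
  let Ei : Fin (Module.finrank ℝ F) → ∀ x : X, TangentSpace I x := fun i =>
    mpullback I 𝓘(ℝ, F) Λ (fun _ => b i)
  have hE : ∀ i, ContMDiffOn I I.tangent ∞ (fun x => (⟨x, Ei i x⟩ : TangentBundle I X)) W := by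
    intro i x hx
    have hc : ContMDiff 𝓘(ℝ, F) 𝓘(ℝ, F).tangent ∞
        (fun y : F => (⟨y, b i⟩ : TangentBundle 𝓘(ℝ, F) F)) :=
      contMDiff_vectorSpace_iff_contDiff.2 (contDiff_const (c := b i))
    exact (ContMDiffAt.mpullback_vectorField_preimage (hc (Λ x))
      (hΛ.contMDiffAt (hW.mem_nhds hx)) (hinv x hx) (by simp)).contMDiffWithinAt
  have hco : ∀ i, ContMDiffOn I 𝓘(ℝ, ℝ) ∞ (fun y => b.repr (dMap I Λ y (ξ y)) i) W := by
    intro i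
    exact ((b.coord i).toContinuousLinearMap.contMDiff (n := ∞)).comp_contMDiffOn hξ
  have hs : ContMDiffOn I I.tangent ∞ (fun x => (⟨x, ∑ i, 
      b.repr (dMap I Λ x (ξ x)) i • Ei i x⟩ : TangentBundle I X)) W :=
    ContMDiffOn.sum_section (fun i _ => (hco i).smul_section (hE i))
  refine hs.congr fun x hx => ?_
  congr 1
  obtain ⟨e, he⟩ := hinv x hx
  have h1 : ∀ i, Ei i x = e.symm (b i) := by
    intro i
    change (dMap I Λ x).inverse (b i) = _
    rw [← he, ContinuousLinearMap.inverse_equiv]; rfl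
  simp only [h1, ← map_smul, ← map_sum]
  rw [b.sum_repr, ← he]
  exact (e.symm_apply_apply _).symm

theorem dReal_congr {x : X} {f g : X → ℝ} (h : f =ᶠ[𝓝 x] g) (u : TangentSpace I x) :
    dReal I f x u = dReal I g x u := by
  rw [dReal_eq_dMap, dMap_congr h]; rfl

theorem dReal_add {x : X} {f g : X → ℝ} (hf : MDifferentiableAt I 𝓘(ℝ, ℝ) f x)
    (hg : MDifferentiableAt I 𝓘(ℝ, ℝ) g x) (u : TangentSpace I x) :
    dReal I (fun y => f y + g y) x u = dReal I f x u + dReal I g x u :=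
  DFunLike.congr_fun (hf.hasMFDerivAt.add hg.hasMFDerivAt).mfderiv u

theorem dReal_mul {x : X} {f g : X → ℝ} (hf : MDifferentiableAt I 𝓘(ℝ, ℝ) f x)
    (hg : MDifferentiableAt I 𝓘(ℝ, ℝ) g x) (u : TangentSpace I x) :
    dReal I (fun y => f y * g y) x u = f x * dReal I g x u + g x * dReal I f x u :=
  DFunLike.congr_fun (hf.hasMFDerivAt.mul hg.hasMFDerivAt).mfderiv u

theorem dReal_const (x : X) (c : ℝ) (u : TangentSpace I x) :
    dReal I (fun _ => c) x u = 0 := by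
  exact DFunLike.congr_fun (mfderiv_const (I := I) (I' := 𝓘(ℝ, ℝ)) (x := x) (c := c)) u

theorem dReal_const_mul {x : X} {f : X → ℝ} (c : ℝ) (hf : MDifferentiableAt I 𝓘(ℝ, ℝ) f x)
    (u : TangentSpace I x) : dReal I (fun y => c * f y) x u = c * dReal I f x u := by
  rw [dReal_mul mdifferentiableAt_const hf, dReal_const]; ring

theorem dReal_sub {x : X} {f g : X → ℝ} (hf : MDifferentiableAt I 𝓘(ℝ, ℝ) f x)
    (hg : MDifferentiableAt I 𝓘(ℝ, ℝ) g x) (u : TangentSpace I x) :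
    dReal I (fun y => f y - g y) x u = dReal I f x u - dReal I g x u :=
  DFunLike.congr_fun (hf.hasMFDerivAt.sub hg.hasMFDerivAt).mfderiv u

theorem mdifferentiableAt_finsum {J : Type*} (s : Finset J) {x : X} {f : J → X → ℝ}
    (hf : ∀ j ∈ s, MDifferentiableAt I 𝓘(ℝ, ℝ) (f j) x) :
    MDifferentiableAt I 𝓘(ℝ, ℝ) (fun y => ∑ j ∈ s, f j y) x := by
  classical
  induction s using Finset.induction_on with
  | empty => simpa using mdifferentiableAt_const
  | insert a s ha ih =>
    simp only [Finset.sum_insert ha]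
    exact (hf a (by simp)).add (ih fun j hj => hf j (by simp [hj]))

theorem dReal_sum {J : Type*} (s : Finset J) {x : X} {f : J → X → ℝ}
    (hf : ∀ j ∈ s, MDifferentiableAt I 𝓘(ℝ, ℝ) (f j) x) (u : TangentSpace I x) :
    dReal I (fun y => ∑ j ∈ s, f j y) x u = ∑ j ∈ s, dReal I (f j) x u := by
  classical
  induction s using Finset.induction_on with
  | empty => simpa using dReal_const x 0 u
  | insert a s ha ih =>
    simp only [Finset.sum_insert ha]
    rw [dReal_add (hf a (by simp)) (mdifferentiableAt_finsum s fun j hj => hf j (by simp [hj])),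
      ih fun j hj => hf j (by simp [hj])]

/-- The two-form `df ∧ dg` evaluated at a pair of tangent vectors. -/
def dWedge (I : ModelWithCorners ℝ E H) {X : Type*} [TopologicalSpace X] [ChartedSpace H X]
    (f g : X → ℝ) (x : X) (u v : TangentSpace I x) : ℝ :=
  dReal I f x u * dReal I g x v - dReal I f x v * dReal I g x u

/-- The two-form `β` is locally a finite sum of forms `df ∧ dg`. -/
def LocallyWedgeSum (I : ModelWithCorners ℝ E H) {X : Type*} [TopologicalSpace X] [ChartedSpace H X]
    (β : ∀ x : X, LinearMap.BilinForm ℝ (TangentSpace I x)) : Prop :=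
  ∀ x : X, ∃ (J : Type) (_ : Fintype J) (f g : J → X → ℝ) (W : Set X), IsOpen W ∧ x ∈ W ∧
    (∀ j, ContMDiffOn I 𝓘(ℝ, ℝ) ∞ (f j) W) ∧ (∀ j, ContMDiffOn I 𝓘(ℝ, ℝ) ∞ (g j) W) ∧
    ∀ y ∈ W, ∀ u v, β y u v = ∑ j, dWedge I (f j) (g j) y u v

theorem LocallyWedgeSum.smoothBil {β : ∀ x : X, LinearMap.BilinForm ℝ (TangentSpace I x)}
    (hβ : LocallyWedgeSum I β) : SmoothBil I β := by
  intro W ξ η hW hξ hη x hx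
  obtain ⟨J, _, f, g, W₀, hW₀, hx₀, hf, hg, h⟩ := hβ x
  have hWW := hW.inter hW₀
  have hξ' := hξ.mono (inter_subset_left (t := W₀))
  have hη' := hη.mono (inter_subset_left (t := W₀))
  have : ContMDiffOn I 𝓘(ℝ, ℝ) ∞ (fun x => β x (ξ x) (η x)) (W ∩ W₀) := by
    have h2 : ContMDiffOn I 𝓘(ℝ, ℝ) ∞
        (fun y => ∑ j, dWedge I (f j) (g j) y (ξ y) (η y)) (W ∩ W₀) := by
      refine contMDiffOn_finsetSum fun j _ => ?_
      have f' := (hf j).mono (inter_subset_right (s := W))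
      have g' := (hg j).mono (inter_subset_right (s := W))
      exact ((ContMDiffOn.dReal_vectorField hWW f' hξ').mul (ContMDiffOn.dReal_vectorField hWW g' hη')).sub
        ((ContMDiffOn.dReal_vectorField hWW f' hη').mul (ContMDiffOn.dReal_vectorField hWW g' hξ'))
    exact h2.congr fun y hy => h y hy.2 _ _
  exact (this.contMDiffAt (hWW.mem_nhds ⟨hx, hx₀⟩)).contMDiffWithinAt

/-- This is `d(df ∧ dg) = 0`: once the brackets acting on `f` and `g` are replaced by commutators,
all terms of the invariant formula cancel. -/
theorem LocallyWedgeSum.isClosedForm {β : ∀ x : X, LinearMap.BilinForm ℝ (TangentSpace I x)}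
    (hβ : LocallyWedgeSum I β) : IsClosedForm I β := by
  intro W ξ η χ hW hξ hη hχ x hx
  obtain ⟨J, _, f, g, W₀, hW₀, hx₀, hf, hg, h⟩ := hβ x
  have hWW := hW.inter hW₀
  have hxx : x ∈ W ∩ W₀ := ⟨hx, hx₀⟩
  have vf : ∀ ζ : (∀ x : X, TangentSpace I x), SmoothVF I W ζ → SmoothVF I (W ∩ W₀) ζ :=
    fun ζ hζ => hζ.mono inter_subset_left
  have df : ∀ j, ∀ ζ : (∀ x : X, TangentSpace I x), SmoothVF I W ζ →
      MDifferentiableAt I 𝓘(ℝ, ℝ) (fun y => dReal I (f j) y (ζ y)) x := fun j ζ hζ =>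
    ((ContMDiffOn.dReal_vectorField hWW ((hf j).mono inter_subset_right) (vf ζ hζ)).contMDiffAt
      (hWW.mem_nhds hxx)).mdifferentiableAt (by simp)
  have dg : ∀ j, ∀ ζ : (∀ x : X, TangentSpace I x), SmoothVF I W ζ →
      MDifferentiableAt I 𝓘(ℝ, ℝ) (fun y => dReal I (g j) y (ζ y)) x := fun j ζ hζ =>
    ((ContMDiffOn.dReal_vectorField hWW ((hg j).mono inter_subset_right) (vf ζ hζ)).contMDiffAt
      (hWW.mem_nhds hxx)).mdifferentiableAt (by simp)
  have key : ∀ η χ : (∀ x : X, TangentSpace I x), SmoothVF I W η → SmoothVF I W χ →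
      ∀ u : TangentSpace I x, dReal I (fun y => β y (η y) (χ y)) x u =
      ∑ j, (dReal I (f j) x (η x) * dReal I (fun y => dReal I (g j) y (χ y)) x u
        + dReal I (g j) x (χ x) * dReal I (fun y => dReal I (f j) y (η y)) x u
        - (dReal I (f j) x (χ x) * dReal I (fun y => dReal I (g j) y (η y)) x u
        + dReal I (g j) x (η x) * dReal I (fun y => dReal I (f j) y (χ y)) x u)) := by
    intro η χ hη hχ u
    rw [dReal_congr (g := fun y => ∑ j, (dReal I (f j) y (η y) * dReal I (g j) y (χ y)
      - dReal I (f j) y (χ y) * dReal I (g j) y (η y)))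
      (by filter_upwards [hWW.mem_nhds hxx] with y hy using h y hy.2 _ _)]
    rw [dReal_sum]
    · refine Finset.sum_congr rfl fun j _ => ?_
      rw [dReal_sub (f := fun y => dReal I (f j) y (η y) * dReal I (g j) y (χ y))
        (g := fun y => dReal I (f j) y (χ y) * dReal I (g j) y (η y))
        ((df j η hη).mul (dg j χ hχ)) ((df j χ hχ).mul (dg j η hη)),
        dReal_mul (df j η hη) (dg j χ hχ), dReal_mul (df j χ hχ) (dg j η hη)]
    · exact fun j _ => ((df j η hη).mul (dg j χ hχ)).sub ((df j χ hχ).mul (dg j η hη))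
  have hfa : ∀ j, ContMDiffAt I 𝓘(ℝ, ℝ) ∞ (f j) x := fun j => (hf j).contMDiffAt (hW₀.mem_nhds hx₀)
  have hga : ∀ j, ContMDiffAt I 𝓘(ℝ, ℝ) ∞ (g j) x := fun j => (hg j).contMDiffAt (hW₀.mem_nhds hx₀)
  have mξ := hξ.mdifferentiableAt hW hx
  have mη := hη.mdifferentiableAt hW hx
  have mχ := hχ.mdifferentiableAt hW hx
  rw [key η χ hη hχ, key ξ χ hξ hχ, key ξ η hξ hη, h x hx₀, h x hx₀, h x hx₀]
  simp only [← Finset.sum_sub_distrib, ← Finset.sum_add_distrib]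
  refine Finset.sum_eq_zero fun j _ => ?_
  unfold dWedge
  rw [dReal_mlieBracket (hfa j) mξ mη, dReal_mlieBracket (hga j) mξ mη,
    dReal_mlieBracket (hfa j) mξ mχ, dReal_mlieBracket (hga j) mξ mχ,
    dReal_mlieBracket (hfa j) mη mχ, dReal_mlieBracket (hga j) mη mχ]
  ring

/-- Splitting into real and imaginary parts reduces this to differentiating a vanishing real
combination. It serves to differentiate the relation `β(ξ, χ) = 0` satisfied by a field `ξ` in the
kernel of a complex form. -/
theorem dReal_complex_sum_eq_zero {κ : Type*} [Fintype κ] (z : κ → ℂ) {x : X} {p q : κ → X → ℝ}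
    (hp : ∀ j, MDifferentiableAt I 𝓘(ℝ, ℝ) (p j) x) (hq : ∀ j, MDifferentiableAt I 𝓘(ℝ, ℝ) (q j) x)
    (h : ∀ᶠ y in 𝓝 x, ∑ j, z j * ((p j y : ℂ) + Complex.I * (q j y : ℂ)) = 0)
    (w : TangentSpace I x) :
    ∑ j, z j * ((dReal I (p j) x w : ℂ) + Complex.I * (dReal I (q j) x w : ℂ)) = 0 := by
  have gen : ∀ a b : κ → ℝ, (∀ᶠ y in 𝓝 x, ∑ j, (a j * p j y + b j * q j y) = 0) →
      ∑ j, (a j * dReal I (p j) x w + b j * dReal I (q j) x w) = 0 := by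
    intro a b hab
    have m1 : ∀ j, MDifferentiableAt I 𝓘(ℝ, ℝ) (fun y => a j * p j y) x := fun j =>
      mdifferentiableAt_const.mul (hp j)
    have m2 : ∀ j, MDifferentiableAt I 𝓘(ℝ, ℝ) (fun y => b j * q j y) x := fun j =>
      mdifferentiableAt_const.mul (hq j)
    have e : dReal I (fun y => ∑ j, (a j * p j y + b j * q j y)) x w = 0 := by
      rw [dReal_congr (g := fun _ => 0) hab, dReal_const]
    rw [dReal_sum (f := fun j y => a j * p j y + b j * q j y) _ (fun j _ => (m1 j).add (m2 j))] at e
    rw [← e]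
    refine Finset.sum_congr rfl fun j _ => ?_
    rw [dReal_add (m1 j) (m2 j), dReal_const_mul _ (hp j), dReal_const_mul _ (hq j)]
  have h1 := gen (fun j => (z j).re) (fun j => -(z j).im) (by
    filter_upwards [h] with y hy
    have := congrArg Complex.re hy
    simp only [Complex.re_sum, Complex.mul_re, Complex.add_re, Complex.add_im, Complex.ofReal_re,
      Complex.ofReal_im, Complex.mul_im, Complex.I_re, Complex.I_im, Complex.zero_re] at this
    exact (Finset.sum_congr rfl fun j _ => by ring).trans this)
  have h2 := gen (fun j => (z j).im) (fun j => (z j).re) (by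
    filter_upwards [h] with y hy
    have := congrArg Complex.im hy
    simp only [Complex.im_sum, Complex.mul_im, Complex.add_re, Complex.add_im, Complex.ofReal_re,
      Complex.ofReal_im, Complex.mul_re, Complex.I_re, Complex.I_im, Complex.zero_im] at this
    exact (Finset.sum_congr rfl fun j _ => by ring).trans this)
  apply Complex.ext
  · simp only [Complex.re_sum, Complex.mul_re, Complex.add_re, Complex.add_im, Complex.ofReal_re,
      Complex.ofReal_im, Complex.mul_im, Complex.I_re, Complex.I_im, Complex.zero_re]
    exact (Finset.sum_congr rfl fun j _ => by ring).trans h1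
  · simp only [Complex.im_sum, Complex.mul_im, Complex.add_re, Complex.add_im, Complex.ofReal_re,
      Complex.ofReal_im, Complex.mul_re, Complex.I_re, Complex.I_im, Complex.zero_im]
    exact (Finset.sum_congr rfl fun j _ => by ring).trans h2

@[simp] theorem cre_cmk {V : Type*} [AddCommGroup V] [Module ℝ V] (a b : V) : cre (cmk a b) = a := by
  simp [cre, cmk]

@[simp] theorem cim_cmk {V : Type*} [AddCommGroup V] [Module ℝ V] (a b : V) : cim (cmk a b) = b := by
  simp [cim, cmk]

theorem exists_smoothVF_extend (x : X) (u : TangentSpace I x) :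
    ∃ (W : Set X) (χ : ∀ y : X, TangentSpace I y), IsOpen W ∧ x ∈ W ∧ SmoothVF I W χ ∧ χ x = u := by
  obtain ⟨s, hs, h⟩ := FiberBundle.exists_contMDiffOn_extend (k := ∞) I E (V := fun y : X => TangentSpace I y) u
  obtain ⟨W, hWs, hW, hx⟩ := mem_nhds_iff.1 hs
  exact ⟨W, FiberBundle.extend E (E := fun y : X => TangentSpace I y) u, hW, hx, h.mono hWs, FiberBundle.extend_apply_self _ _⟩

/-- The kernel of a closed complex two-form is involutive. -/
theorem involutive_kernel {κ : Type*} [Fintype κ] (z : κ → ℂ)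
    {β : κ → ∀ x : X, LinearMap.BilinForm ℝ (TangentSpace I x)}
    (hskew : ∀ j x u v, β j x u v = - β j x v u)
    (hs : ∀ j, SmoothBil I (β j)) (hc : ∀ j, IsClosedForm I (β j)) :
    Involutive I (fun x => {a | ∀ b : TangentSpace I x,
      ∑ j, z j * ((β j x (cre a) b : ℂ) + Complex.I * (β j x (cim a) b : ℂ)) = 0}) := by
  intro W ξ η hW hξ hη kξ kη x hx u
  obtain ⟨W₀, χ, hW₀, hx₀, hχ, rfl⟩ := exists_smoothVF_extend x u
  have hWW := hW.inter hW₀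
  have hxx : x ∈ W ∩ W₀ := ⟨hx, hx₀⟩
  have s1 := hξ.1.mono (inter_subset_left (t := W₀))
  have s2 := hξ.2.mono (inter_subset_left (t := W₀))
  have t1 := hη.1.mono (inter_subset_left (t := W₀))
  have t2 := hη.2.mono (inter_subset_left (t := W₀))
  have r := hχ.mono (inter_subset_right (s := W))
  have md : ∀ j, ∀ a b : (∀ x : X, TangentSpace I x), SmoothVF I (W ∩ W₀) a →
      SmoothVF I (W ∩ W₀) b → MDifferentiableAt I 𝓘(ℝ, ℝ) (fun y => β j y (a y) (b y)) x :=
    fun j a b ha hb => ((hs j _ a b hWW ha hb).contMDiffAt (hWW.mem_nhds hxx)).mdifferentiableAt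
      (by simp)
  have nh := hWW.mem_nhds hxx
  set ξ1 : ∀ x : X, TangentSpace I x := fun y => cre (ξ y) with hξ1
  set ξ2 : ∀ x : X, TangentSpace I x := fun y => cim (ξ y) with hξ2
  set η1 : ∀ x : X, TangentSpace I x := fun y => cre (η y) with hη1
  set η2 : ∀ x : X, TangentSpace I x := fun y => cim (η y) with hη2
  have dξ : ∀ b, SmoothVF I (W ∩ W₀) b → ∀ w, _ := fun b hb w =>
    dReal_complex_sum_eq_zero z (fun j => md j ξ1 b s1 hb) (fun j => md j ξ2 b s2 hb)
      (by filter_upwards [nh] with y hy using kξ y hy.1 (b y)) w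
  have dη : ∀ b, SmoothVF I (W ∩ W₀) b → ∀ w, _ := fun b hb w =>
    dReal_complex_sum_eq_zero z (fun j => md j η1 b t1 hb) (fun j => md j η2 b t2 hb)
      (by filter_upwards [nh] with y hy using kη y hy.1 (b y)) w
  -- Closedness on the four real triples built from the real and imaginary parts of `ξ` and `η`;
  -- with weights `1, i, i, -1` they form `dβ(ξ, η, χ) = 0` for the complex fields.
  have c11 := fun j => hc j _ ξ1 η1 χ hWW s1 t1 r x hxx
  have c12 := fun j => hc j _ ξ1 η2 χ hWW s1 t2 r x hxx
  have c21 := fun j => hc j _ ξ2 η1 χ hWW s2 t1 r x hxx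
  have c22 := fun j => hc j _ ξ2 η2 χ hWW s2 t2 r x hxx
  have e1 := dη χ r (ξ1 x)
  have e2 := dη χ r (ξ2 x)
  have e3 := dξ χ r (η1 x)
  have e4 := dξ χ r (η2 x)
  have e5 := dξ η1 t1 (χ x)
  have e6 := dξ η2 t2 (χ x)
  have k1 : ∑ j, z j * ((β j x (η1 x) (mlieBracket I ξ1 χ x) : ℂ) + Complex.I * (β j x (η2 x) (mlieBracket I ξ1 χ x) : ℂ)) = 0 :=
    kη x hx _
  have k2 : ∑ j, z j * ((β j x (η1 x) (mlieBracket I ξ2 χ x) : ℂ) + Complex.I * (β j x (η2 x) (mlieBracket I ξ2 χ x) : ℂ)) = 0 :=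
    kη x hx _
  have k3 : ∑ j, z j * ((β j x (ξ1 x) (mlieBracket I η1 χ x) : ℂ) + Complex.I * (β j x (ξ2 x) (mlieBracket I η1 χ x) : ℂ)) = 0 :=
    kξ x hx _
  have k4 : ∑ j, z j * ((β j x (ξ1 x) (mlieBracket I η2 χ x) : ℂ) + Complex.I * (β j x (ξ2 x) (mlieBracket I η2 χ x) : ℂ)) = 0 :=
    kξ x hx _
  simp only [cBracket, cre_cmk, cim_cmk]
  -- In `dβ(ξ, η, χ)` every term except `β([ξ, η], χ)` vanishes: it is a derivative of a pairing
  -- with `ξ` or `η`, or a pairing of one of them with a bracket.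
  have split : ∀ (A B C D E F K L M N G : κ → ℂ), ∑ j, A j = 0 → ∑ j, B j = 0 → ∑ j, C j = 0 →
      ∑ j, D j = 0 → ∑ j, E j = 0 → ∑ j, F j = 0 → ∑ j, K j = 0 → ∑ j, L j = 0 → ∑ j, M j = 0 →
      ∑ j, N j = 0 → (∀ j, G j = A j + Complex.I * B j - (C j + Complex.I * D j)
        + (E j + Complex.I * F j) - (K j + Complex.I * L j) + (M j + Complex.I * N j)) →
      ∑ j, G j = 0 := by
    intro A B C D E F K L M N G a b c d e f k l m n g
    simp only [g, Finset.sum_add_distrib, Finset.sum_sub_distrib, ← Finset.mul_sum, a, b, c, d, e,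
      f, k, l, m, n]
    simp
  refine split _ _ _ _ _ _ _ _ _ _ _ e1 e2 e3 e4 e5 e6 k1 k2 k3 k4 fun j => ?_
  have C11 : ((_ : ℝ) : ℂ) = ((0 : ℝ) : ℂ) := congrArg _ (c11 j)
  have C12 : ((_ : ℝ) : ℂ) = ((0 : ℝ) : ℂ) := congrArg _ (c12 j)
  have C21 : ((_ : ℝ) : ℂ) = ((0 : ℝ) : ℂ) := congrArg _ (c21 j)
  have C22 : ((_ : ℝ) : ℂ) = ((0 : ℝ) : ℂ) := congrArg _ (c22 j)
  rw [hskew j x (mlieBracket I ξ1 χ x) (η1 x), hskew j x (mlieBracket I η1 χ x) (ξ1 x)] at C11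
  rw [hskew j x (mlieBracket I ξ1 χ x) (η2 x), hskew j x (mlieBracket I η2 χ x) (ξ1 x)] at C12
  rw [hskew j x (mlieBracket I ξ2 χ x) (η1 x), hskew j x (mlieBracket I η1 χ x) (ξ2 x)] at C21
  rw [hskew j x (mlieBracket I ξ2 χ x) (η2 x), hskew j x (mlieBracket I η2 χ x) (ξ2 x)] at C22
  push_cast at C11 C12 C21 C22
  simp only [map_sub, map_add, LinearMap.sub_apply, LinearMap.add_apply]
  push_cast
  linear_combination (norm := (ring_nf; simp only [Complex.I_sq]; ring))
    (-z j) * C11 - z j * Complex.I * C12 - z j * Complex.I * C21 + z j * C22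

end Calc2
end SpecialJoyce

end

/-! ### Darboux frames as linear coordinates on tangent spaces. -/

section

namespace SpecialJoyce
open VectorField Set

/-! ## The standard symplectic form -/

/-- The standard symplectic form on `ℝ^{2n}`. -/
def stdForm (n : ℕ) : LinearMap.BilinForm ℝ (Fin n ⊕ Fin n → ℝ) :=
  ∑ i : Fin n, (LinearMap.BilinForm.linMulLin (LinearMap.proj (Sum.inl i)) (LinearMap.proj (Sum.inr i))
    - LinearMap.BilinForm.linMulLin (LinearMap.proj (Sum.inr i)) (LinearMap.proj (Sum.inl i)))

theorem stdForm_apply {n : ℕ} (a b : Fin n ⊕ Fin n → ℝ) :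
    stdForm n a b = ∑ i : Fin n, (a (Sum.inl i) * b (Sum.inr i) - a (Sum.inr i) * b (Sum.inl i)) := by
  simp [stdForm, LinearMap.sum_apply]

/-- The vector of frame coefficients whose pairings with the frame are `a`. -/
def raise {n : ℕ} (a : Fin n ⊕ Fin n → ℝ) : Fin n ⊕ Fin n → ℝ :=
  Sum.elim (fun i => a (Sum.inr i)) (fun i => - a (Sum.inl i))

section Base
variable {n : ℕ} {M : Type*} [TopologicalSpace M] [ChartedSpace (Model n) M]
  [IsManifold 𝓘(ℂ, Model n) ω M]
variable {Γ : ∀ p : M, AddSubgroup (T n p)} {form : ∀ p : M, LinearMap.BilinForm ℝ (T n p)}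
  {U : Set M} {e : Fin n ⊕ Fin n → ∀ p : M, T n p}

/-- The pairings of a tangent vector with the elements of a frame. -/
def low (form : ∀ p : M, LinearMap.BilinForm ℝ (T n p)) (e : Fin n ⊕ Fin n → ∀ p : M, T n p) (p : M) :
    T n p →ₗ[ℝ] (Fin n ⊕ Fin n → ℝ) :=
  LinearMap.pi fun a => (form p).flip (e a p)

@[simp] theorem low_apply (p : M) (u : T n p) (a : Fin n ⊕ Fin n) :
    low form e p u a = form p u (e a p) := rfl

theorem finrank_model (n : ℕ) : Module.finrank ℝ (Model n) = n + n := by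
  rw [Module.finrank_pi_fintype]; simp [Complex.finrank_real_complex]; ring

instance (p : M) : FiniteDimensional ℝ (T n p) := inferInstanceAs (FiniteDimensional ℝ (Model n))

theorem finrank_T (p : M) : Module.finrank ℝ (T n p) = n + n := finrank_model n

namespace IsDarbouxFrame
variable (hF : IsDarbouxFrame Γ form U e)
include hF

theorem restrict {U' : Set M} (hU' : IsOpen U') (h : U' ⊆ U) : IsDarbouxFrame Γ form U' e where
  isOpen := hU'
  smooth a := (hF.smooth a).mono h
  linInd p hp := hF.linInd p (h hp)
  span p hp := hF.span p (h hp)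
  pair_lu p hp := hF.pair_lu p (h hp)
  pair_ll p hp := hF.pair_ll p (h hp)
  pair_uu p hp := hF.pair_uu p (h hp)

/-- The frame as a basis of the tangent space. -/
def basis {p : M} (hp : p ∈ U) : Module.Basis (Fin n ⊕ Fin n) ℝ (T n p) :=
  basisOfLinearIndependentOfCardEqFinrank' (fun a => e a p) (hF.linInd p hp)
    (by rw [finrank_T]; simp)

theorem basis_apply {p : M} (hp : p ∈ U) (a : Fin n ⊕ Fin n) : hF.basis hp a = e a p := by
  simp [basis]

variable (hskew : ∀ (p : M) (u w : T n p), form p u w = - form p w u)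
include hskew

theorem low_comb {p : M} (hp : p ∈ U) (c : Fin n ⊕ Fin n → ℝ) :
    low form e p (∑ a, c a • e a p) = Sum.elim (fun i => - c (Sum.inr i)) (fun i => c (Sum.inl i)) := by
  have h1 : ∀ i j, form p (e (Sum.inr i) p) (e (Sum.inl j) p) = if j = i then -1 else 0 := by
    intro i j
    rw [hskew, hF.pair_lu p hp]; split_ifs <;> simp
  funext a
  rcases a with j | j
  · simp [LinearMap.sum_apply, Fintype.sum_sum_type, hF.pair_ll p hp, h1]
  · simp [LinearMap.sum_apply, Fintype.sum_sum_type, hF.pair_uu p hp, hF.pair_lu p hp]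

/-- A Darboux frame is its own dual up to exchanging `γ_i` with `γ^i` and one sign, which is what
`raise` records. -/
theorem eq_sum_raise {p : M} (hp : p ∈ U) (u : T n p) : u = ∑ a, raise (low form e p u) a • e a p := by
  have h := (hF.basis hp).sum_repr u
  simp only [hF.basis_apply] at h
  have h2 := hF.low_comb hskew hp (fun a => (hF.basis hp).repr u a)
  rw [h] at h2
  rw [h2]
  conv_lhs => rw [← h]
  refine Finset.sum_congr rfl fun a _ => ?_
  rcases a with i | i <;> simp [raise]

theorem low_sum_raise {p : M} (hp : p ∈ U) (c : Fin n ⊕ Fin n → ℝ) :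
    low form e p (∑ a, raise c a • e a p) = c := by
  rw [hF.low_comb hskew hp]
  funext a; rcases a with i | i <;> simp [raise]

theorem low_bijective {p : M} (hp : p ∈ U) : Function.Bijective (low form e p) := by
  constructor
  · intro u w h
    rw [hF.eq_sum_raise hskew hp u, hF.eq_sum_raise hskew hp w, h]
  · intro c
    exact ⟨_, hF.low_sum_raise hskew hp c⟩

theorem form_eq_stdForm {p : M} (hp : p ∈ U) (u w : T n p) :
    form p u w = stdForm n (low form e p u) (low form e p w) := by
  have h : ∀ c : Fin n ⊕ Fin n → ℝ, form p u (∑ a, c a • e a p) = ∑ a, c a * low form e p u a := by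
    intro c
    rw [map_sum]
    exact Finset.sum_congr rfl fun a _ => map_smul _ _ _
  conv_lhs => rw [hF.eq_sum_raise hskew hp w]
  rw [stdForm_apply, h, Fintype.sum_sum_type, ← Finset.sum_add_distrib]
  refine Finset.sum_congr rfl fun i _ => ?_
  simp only [raise, Sum.elim_inl, Sum.elim_inr]; ring

theorem form_nondeg {p : M} (hp : p ∈ U) (u : T n p) (h : ∀ w, form p u w = 0) : u = 0 := by
  apply (hF.low_bijective hskew hp).1
  rw [map_zero]; funext a; exact h _

omit hskew in
/-- The pairings with a Darboux frame are smooth functions on the total space of the tangent bundle. -/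
theorem contMDiffOn_low (hskew : ∀ (p : M) (u w : T n p), form p u w = - form p w u) :
    ContMDiffOn (IN n) 𝓘(ℝ, Fin n ⊕ Fin n → ℝ) ∞
    (fun V : TM n M => low form e V.proj V.2) ((fun V : TM n M => V.proj) ⁻¹' U) := by
  intro V₀ hV₀
  set p₀ := V₀.proj
  set t := trivializationAt (Model n) (TangentSpace 𝓘(ℝ, Model n) : M → Type _) p₀ with ht
  have hp₀ : p₀ ∈ t.baseSet := FiberBundle.mem_baseSet_trivializationAt' p₀
  -- `A p` is the frame written in a trivialization. It is smooth in `p` with invertible values, so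
  -- its smooth inverse applied to the fibre coordinate gives the frame coefficients, and the
  -- pairings are these up to exchange and sign.
  let A : M → ((Fin n ⊕ Fin n → ℝ) →L[ℝ] Model n) := fun p =>
    ∑ a, (ContinuousLinearMap.proj (R := ℝ) (φ := fun _ : Fin n ⊕ Fin n => ℝ) a).smulRight
      (t ⟨p, e a p⟩).2
  have hA1 : ∀ p ∈ t.baseSet, ∀ c, A p c = (t ⟨p, ∑ a, c a • e a p⟩).2 := by
    intro p hp c
    have h1 : ∀ u : T n p, (t ⟨p, u⟩).2 = t.linearMapAt ℝ p u := fun u => by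
      rw [t.linearMapAt_apply, if_pos hp]
    calc A p c = ∑ a, c a • (t ⟨p, e a p⟩).2 := by
          simp only [A, sum_apply, ContinuousLinearMap.smulRight_apply, ContinuousLinearMap.proj_apply]
      _ = t.linearMapAt ℝ p (∑ a, c a • e a p) := by
          rw [map_sum]; exact Finset.sum_congr rfl fun a _ => by rw [map_smul, h1]
      _ = _ := (h1 _).symm
  have hinj : ∀ p ∈ t.baseSet ∩ U, Function.Injective (A p) := by
    intro p hp
    rw [injective_iff_map_eq_zero]
    intro c hc
    rw [hA1 p hp.1] at hc
    have h0 : (t.linearEquivAt ℝ p hp.1) (∑ a, c a • e a p) = 0 := hc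
    have h1 : ∑ a, c a • e a p = 0 := (LinearEquiv.map_eq_zero_iff _).1 h0
    funext a
    exact Fintype.linearIndependent_iff.1 (hF.linInd p hp.2) c h1 a
  have hequiv : ∀ p ∈ t.baseSet ∩ U, ∃ E : (Fin n ⊕ Fin n → ℝ) ≃L[ℝ] Model n, (E : _ →L[ℝ] _) = A p := by
    intro p hp
    let E := LinearEquiv.ofInjectiveOfFinrankEq (A p).toLinearMap (hinj p hp)
      (by rw [finrank_model]; simp)
    refine ⟨E.toContinuousLinearEquiv, ?_⟩
    ext c; rfl
  have hAs : ContMDiffAt 𝓘(ℝ, Model n) 𝓘(ℝ, (Fin n ⊕ Fin n → ℝ) →L[ℝ] Model n) ∞ A p₀ := by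
    refine contMDiffAt_finsetSum fun a _ => ?_
    have h1 := (Bundle.contMDiffAt_section p₀).1 ((hF.smooth a).contMDiffAt (hF.isOpen.mem_nhds hV₀))
    exact (ContinuousLinearMap.smulRightL ℝ (Fin n ⊕ Fin n → ℝ) (Model n)
      (ContinuousLinearMap.proj (R := ℝ) (φ := fun _ : Fin n ⊕ Fin n => ℝ) a)).contMDiff.contMDiffAt.comp p₀ h1
  have hEq : ∀ V : TM n M, V.proj ∈ t.baseSet ∩ U →
      low form e V.proj V.2 = Sum.elim (fun i => - ((A V.proj).inverse (t V).2) (Sum.inr i))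
        (fun i => ((A V.proj).inverse (t V).2) (Sum.inl i)) := by
    intro V hV
    obtain ⟨E, hE⟩ := hequiv _ hV
    rw [← hE, ContinuousLinearMap.inverse_equiv]
    have : E (raise (low form e V.proj V.2)) = (t V).2 := by
      have h1 := hA1 V.proj hV.1 (raise (low form e V.proj V.2))
      rw [← hF.eq_sum_raise hskew hV.2 V.2, ← hE] at h1
      exact h1
    rw [← this]
    funext a; rcases a with i | i <;> simp [raise]
  have hinv : ContMDiffAt 𝓘(ℝ, Model n) 𝓘(ℝ, Model n →L[ℝ] (Fin n ⊕ Fin n → ℝ)) ∞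
      (fun p => (A p).inverse) p₀ := by
    obtain ⟨E, hE⟩ := hequiv p₀ ⟨hp₀, hV₀⟩
    have := contDiffAt_map_inverse (n := ∞) E
    rw [hE] at this
    exact this.contMDiffAt.comp p₀ hAs
  have hproj : ContMDiffAt (IN n) 𝓘(ℝ, Model n) ∞ (fun V : TM n M => V.proj) V₀ :=
    (Bundle.contMDiff_proj (TangentSpace 𝓘(ℝ, Model n) : M → Type _)).contMDiffAt
  have hsnd : ContMDiffAt (IN n) 𝓘(ℝ, Model n) ∞ (fun V : TM n M => (t V).2) V₀ := by
    have := t.contMDiffOn (n := ∞) (IB := 𝓘(ℝ, Model n))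
    have h2 := this.contMDiffAt (t.open_source.mem_nhds (t.mem_source.2 hp₀))
    exact h2.snd
  have hcomp : ContMDiffAt (IN n) 𝓘(ℝ, Fin n ⊕ Fin n → ℝ) ∞
      (fun V : TM n M => (A V.proj).inverse (t V).2) V₀ := (hinv.comp V₀ hproj).clm_apply hsnd
  let R : (Fin n ⊕ Fin n → ℝ) →L[ℝ] (Fin n ⊕ Fin n → ℝ) := ContinuousLinearMap.pi
    (Sum.elim (fun i => - ContinuousLinearMap.proj (R := ℝ) (φ := fun _ : Fin n ⊕ Fin n => ℝ) (Sum.inr i))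
      (fun i => ContinuousLinearMap.proj (R := ℝ) (φ := fun _ : Fin n ⊕ Fin n => ℝ) (Sum.inl i)))
  have hfin := (R.contMDiff (n := ∞)).contMDiffAt.comp V₀ hcomp
  refine (hfin.congr_of_eventuallyEq ?_).contMDiffWithinAt
  have hopen : IsOpen ((fun V : TM n M => V.proj) ⁻¹' (t.baseSet ∩ U)) :=
    (t.open_baseSet.inter hF.isOpen).preimage (FiberBundle.continuous_proj _ _)
  filter_upwards [hopen.mem_nhds (show V₀ ∈ _ from ⟨hp₀, hV₀⟩)] with V hV
  rw [hEq V hV]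
  funext a; rcases a with i | i <;> simp [R]

end IsDarbouxFrame
end Base
end SpecialJoyce

end

/-! ### Complexified vectors, the flat connection in a frame, and derivatives of the periods. -/

section

namespace SpecialJoyce
open VectorField Set

@[simp] theorem cre_tmul {V : Type*} [AddCommGroup V] [Module ℝ V] (z : ℂ) (a : V) :
    cre (z ⊗ₜ[ℝ] a) = z.re • a := by simp [cre]

@[simp] theorem cim_tmul {V : Type*} [AddCommGroup V] [Module ℝ V] (z : ℂ) (a : V) :
    cim (z ⊗ₜ[ℝ] a) = z.im • a := by simp [cim]

theorem cx_ext {V : Type*} [AddCommGroup V] [Module ℝ V] {x y : Cx V} (h1 : cre x = cre y)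
    (h2 : cim x = cim y) : x = y := by
  have h : ∀ x : Cx V, x = cmk (cre x) (cim x) := by
    intro x
    induction x using TensorProduct.induction_on with
    | zero => simp [cmk]
    | tmul z a =>
      simp only [cmk, cre_tmul, cim_tmul, ← TensorProduct.smul_tmul, ← TensorProduct.add_tmul]
      congr 1
      apply Complex.ext <;> simp
    | add x y hx hy =>
      rw [map_add, map_add]
      nth_rewrite 1 [hx]; nth_rewrite 1 [hy]
      simp only [cmk, TensorProduct.tmul_add]; abel
  rw [h x, h y, h1, h2]

theorem cmk_cre_cim {V : Type*} [AddCommGroup V] [Module ℝ V] (x : Cx V) :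
    cmk (cre x) (cim x) = x := cx_ext (by simp) (by simp)

section Lemmas
variable {V W : Type*} [AddCommGroup V] [Module ℝ V] [AddCommGroup W] [Module ℝ W]

@[simp] theorem cre_smul (z : ℂ) (x : Cx V) : cre (z • x) = z.re • cre x - z.im • cim x := by
  rw [← cmk_cre_cim x]
  simp [cmk, smul_add, TensorProduct.smul_tmul', sub_eq_add_neg]

@[simp] theorem cim_smul (z : ℂ) (x : Cx V) : cim (z • x) = z.re • cim x + z.im • cre x := by
  rw [← cmk_cre_cim x]
  simp [cmk, smul_add, TensorProduct.smul_tmul', add_comm]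

@[simp] theorem cre_cconj (x : Cx V) : cre (cconj x) = cre x := by
  rw [← cmk_cre_cim x]; simp [cmk, cconj]

@[simp] theorem cim_cconj (x : Cx V) : cim (cconj x) = - cim x := by
  rw [← cmk_cre_cim x]; simp [cmk, cconj]

@[simp] theorem cre_cmap (f : V →ₗ[ℝ] W) (x : Cx V) : cre (cmap f x) = f (cre x) := by
  rw [← cmk_cre_cim x]; simp [cmk, cmap]

@[simp] theorem cim_cmap (f : V →ₗ[ℝ] W) (x : Cx V) : cim (cmap f x) = f (cim x) := by
  rw [← cmk_cre_cim x]; simp [cmk, cmap]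

theorem cform_apply (f : V →ₗ[ℝ] ℂ) (x : Cx V) :
    cform f x = f (cre x) + Complex.I * f (cim x) := by
  rw [← cmk_cre_cim x]; simp [cmk, cform]

theorem cbil_apply (b : LinearMap.BilinForm ℝ V) (x y : Cx V) :
    cbil b x y = ((b (cre x) (cre y) - b (cim x) (cim y) : ℝ) : ℂ)
      + Complex.I * ((b (cre x) (cim y) + b (cim x) (cre y) : ℝ) : ℂ) := by
  rw [← cmk_cre_cim x, ← cmk_cre_cim y]
  simp only [cmk, cbil, map_add, LinearMap.add_apply, LinearMap.BilinForm.baseChange_tmul, cre_tmul, cim_tmul]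
  simp
  ring

end Lemmas
theorem cre_pi10 {n : ℕ} {M : Type*} [TopologicalSpace M] [ChartedSpace (Model n) M] (p : M)
   (Y : Cx (T n p)) : cre (pi10 n p Y) = (1/2 : ℝ) • (cre Y + cplxI n p (cim Y)) := by
  simp [pi10]

theorem cim_pi10 {n : ℕ} {M : Type*} [TopologicalSpace M] [ChartedSpace (Model n) M] (p : M)
   (Y : Cx (T n p)) : cim (pi10 n p Y) = (1/2 : ℝ) • (cim Y - cplxI n p (cre Y)) := by
  simp [pi10]

theorem cre_pi01 {n : ℕ} {M : Type*} [TopologicalSpace M] [ChartedSpace (Model n) M] (p : M)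
   (Y : Cx (T n p)) : cre (pi01 n p Y) = (1/2 : ℝ) • (cre Y - cplxI n p (cim Y)) := by
  simp [pi01, sub_eq_add_neg]

theorem cim_pi01 {n : ℕ} {M : Type*} [TopologicalSpace M] [ChartedSpace (Model n) M] (p : M)
   (Y : Cx (T n p)) : cim (pi01 n p Y) = (1/2 : ℝ) • (cim Y + cplxI n p (cre Y)) := by
  simp [pi01]

theorem mdifferentiableAt_of_complex {E F : Type*} [NormedAddCommGroup E] [NormedSpace ℂ E]
   {X : Type*} [TopologicalSpace X] [ChartedSpace E X] [NormedAddCommGroup F] [NormedSpace ℂ F]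
   {f : X → F} {x : X} (h : MDifferentiableAt 𝓘(ℂ, E) 𝓘(ℂ, F) f x) :
   MDifferentiableAt 𝓘(ℝ, E) 𝓘(ℝ, F) f x := by
  rw [mdifferentiableAt_iff] at h ⊢
  exact ⟨h.1, h.2.restrictScalars ℝ⟩

section Base
variable {n : ℕ} {M : Type*} [TopologicalSpace M] [ChartedSpace (Model n) M]
  [IsManifold 𝓘(ℂ, Model n) ω M]

theorem cplxI_cplxI (p : M) (u : T n p) : cplxI n p (cplxI n p u) = -u := by
  have h : ∀ w : Model n, Complex.I • Complex.I • w = -w := fun w => by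
    rw [smul_smul, Complex.I_mul_I, neg_one_smul]
  exact h u

variable (P : SpecialPeriodStructure n M) {U : Set M} {e : Fin n ⊕ Fin n → ∀ p : M, T n p}

/-- The functions `Z_a` of a frame. -/
def periodFun (e : Fin n ⊕ Fin n → ∀ p : M, T n p) (p : M) : Fin n ⊕ Fin n → ℂ :=
  fun a => P.Z p (e a p)

variable (hF : IsDarbouxFrame P.Γ P.form U e)
include hF

theorem mdifferentiableAt_section_sum {c : Fin n ⊕ Fin n → M → ℝ} {p : M} (hp : p ∈ U)
    (hc : ∀ a, MDifferentiableAt 𝓘(ℝ, Model n) 𝓘(ℝ, ℝ) (c a) p) (s : Finset (Fin n ⊕ Fin n)) :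
    MDifferentiableAt 𝓘(ℝ, Model n) 𝓘(ℝ, Model n).tangent
      (fun q => (⟨q, ∑ a ∈ s, c a q • e a q⟩ : TM n M)) p :=
  MDifferentiableAt.sum_section fun a _ =>
    (hc a).smul_section ((hF.smooth a).mdifferentiableAt hF.isOpen hp)

/-- The frame is parallel, so the Leibniz rule leaves only the derivatives of the coefficients. -/
theorem conn_sum {c : Fin n ⊕ Fin n → M → ℝ} {p : M} (hp : p ∈ U)
    (hc : ∀ a, MDifferentiableAt 𝓘(ℝ, Model n) 𝓘(ℝ, ℝ) (c a) p) (X : T n p)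
    (s : Finset (Fin n ⊕ Fin n)) :
    P.conn (fun q => ∑ a ∈ s, c a q • e a q) p X
      = ∑ a ∈ s, dReal 𝓘(ℝ, Model n) (c a) p X • e a p := by
  classical
  have hcov := P.conn.isCovariantDerivativeOnUniv
  induction s using Finset.induction_on with
  | empty =>
    have : (fun q : M => ∑ a ∈ (∅ : Finset (Fin n ⊕ Fin n)), c a q • e a q)
        = (0 : ∀ q : M, T n q) := by funext q; simp
    rw [this, Finset.sum_empty]
    exact DFunLike.congr_fun (congrFun P.conn.zero p) X
  | insert a s ha ih =>
    have h1 : (fun q => ∑ a ∈ insert a s, c a q • e a q)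
        = (c a • e a : ∀ q : M, T n q) + fun q => ∑ a ∈ s, c a q • e a q := by
      funext q; rw [Finset.sum_insert ha]; rfl
    have he := (hF.smooth a).mdifferentiableAt hF.isOpen hp
    have h2 := hcov.add (σ := (c a • e a : ∀ q : M, T n q)) (σ' := fun q => ∑ a ∈ s, c a q • e a q)
      ((hc a).smul_section he) (mdifferentiableAt_section_sum P hF hp hc s)
    have h3 := hcov.leibniz (σ := e a) (g := c a) he (hc a)
    have h4 := P.conn_frame U e hF a p hp
    have h5 : P.conn (c a • e a : ∀ q : M, T n q) p X = dReal 𝓘(ℝ, Model n) (c a) p X • e a p := by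
      refine (DFunLike.congr_fun h3 X).trans ?_
      have h6 : P.conn.toFun (e a) p = 0 := h4
      rw [h6, smul_zero, zero_add]
      rfl
    rw [h1, Finset.sum_insert ha, ← ih, ← h5]
    exact DFunLike.congr_fun h2 X

/-- Pairings with the frame are frame coefficients up to exchange and sign, and the frame is
parallel; in terms of pairings `∇` is therefore plain differentiation. -/
theorem low_conn_of_eventuallyEq {η : ∀ q : M, T n q} {c : Fin n ⊕ Fin n → M → ℝ} {p : M} (hp : p ∈ U)
    (hc : ∀ a, MDifferentiableAt 𝓘(ℝ, Model n) 𝓘(ℝ, ℝ) (c a) p)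
    (h : ∀ q ∈ U, low P.form e q (η q) = fun a => c a q) (X : T n p) :
    low P.form e p (P.conn η p X) = fun a => dReal 𝓘(ℝ, Model n) (c a) p X := by
  let r : Fin n ⊕ Fin n → M → ℝ := fun a q => raise (fun b => c b q) a
  have hr : ∀ a, MDifferentiableAt 𝓘(ℝ, Model n) 𝓘(ℝ, ℝ) (r a) p := by
    rintro (i | i)
    · exact hc (Sum.inr i)
    · exact (hc (Sum.inl i)).neg
  have hη : ∀ q ∈ U, ∑ a, r a q • e a q = η q := by
    intro q hq
    conv_rhs => rw [hF.eq_sum_raise P.skew hq (η q), h q hq]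
  have hev : ∀ᶠ q in 𝓝 p, ∑ a, r a q • e a q = η q := by
    filter_upwards [hF.isOpen.mem_nhds hp] with q hq using hη q hq
  have m1 := mdifferentiableAt_section_sum P hF hp hr Finset.univ
  have m2 : MDifferentiableAt 𝓘(ℝ, Model n) 𝓘(ℝ, Model n).tangent
      (fun q => (⟨q, η q⟩ : TM n M)) p := by
    refine m1.congr_of_eventuallyEq ?_
    filter_upwards [hev] with q hq
    rw [hq]
  have h1 := (P.conn.isCovariantDerivativeOnUniv).congr_of_eventuallyEq m1 m2 Filter.univ_mem hev
  have h2 : P.conn η p X = ∑ a, dReal 𝓘(ℝ, Model n) (r a) p X • e a p := by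
    rw [← conn_sum P hF hp hr X]
    exact (DFunLike.congr_fun h1 X).symm
  have h3 : ∀ a, dReal 𝓘(ℝ, Model n) (r a) p X = raise (fun b => dReal 𝓘(ℝ, Model n) (c b) p X) a := by
    rintro (i | i)
    · rfl
    · have := dReal_const_mul (-1) (hc (Sum.inl i)) X
      simp only [neg_one_mul] at this
      exact this
  rw [h2]
  simp only [h3]
  rw [hF.low_sum_raise P.skew hp]

theorem mdifferentiableAt_period {p : M} (hp : p ∈ U) (a : Fin n ⊕ Fin n) :
    MDifferentiableAt 𝓘(ℝ, Model n) 𝓘(ℝ, ℂ) (fun q => P.Z q (e a q)) p :=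
  mdifferentiableAt_of_complex ((P.Z_holomorphic U e hF a).mdifferentiableAt (hF.isOpen.mem_nhds hp))

theorem mdifferentiableAt_period_re {p : M} (hp : p ∈ U) (a : Fin n ⊕ Fin n) :
    MDifferentiableAt 𝓘(ℝ, Model n) 𝓘(ℝ, ℝ) (fun q => (P.Z q (e a q)).re) p :=
  Complex.reCLM.differentiableAt.mdifferentiableAt.comp p (mdifferentiableAt_period P hF hp a)

theorem mdifferentiableAt_period_im {p : M} (hp : p ∈ U) (a : Fin n ⊕ Fin n) :
    MDifferentiableAt 𝓘(ℝ, Model n) 𝓘(ℝ, ℝ) (fun q => (P.Z q (e a q)).im) p :=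
  Complex.imCLM.differentiableAt.mdifferentiableAt.comp p (mdifferentiableAt_period P hF hp a)

/-- The pairings of `Re ξ` and `Im ξ` with the frame are half of `Re Z_a` and `Im Z_a`. Their
derivatives along `X` are thus the pairings of the real and imaginary parts of `π^{1,0} X`, namely
of `X/2` and `-IX/2`. -/
theorem dReal_period {p : M} (hp : p ∈ U) (X : T n p) (a : Fin n ⊕ Fin n) :
    dReal 𝓘(ℝ, Model n) (fun q => (P.Z q (e a q)).re) p X = P.form p X (e a p) ∧
    dReal 𝓘(ℝ, Model n) (fun q => (P.Z q (e a q)).im) p X = - P.form p (cplxI n p X) (e a p) := by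
  obtain ⟨ξ, h1, h2⟩ := P.euler
  have h3 : ∀ (q : M) (u : T n q), P.form q (cre (ξ q)) u = 1 / 2 * (P.Z q u).re ∧
      P.form q (cim (ξ q)) u = 1 / 2 * (P.Z q u).im := by
    intro q u
    have h := h1 q u
    rw [cbil_apply] at h
    simp only [cre_tmul, cim_tmul, Complex.one_re, Complex.one_im, one_smul, zero_smul, map_zero,
      sub_zero, zero_add] at h
    have hr := congrArg Complex.re h
    have hi := congrArg Complex.im h
    simp at hr hi
    constructor <;> linarith
  have hX := h2 p X
  have r1 := low_conn_of_eventuallyEq P hF (η := fun q => cre (ξ q)) hp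
    (c := fun a q => 1 / 2 * (P.Z q (e a q)).re)
    (fun a => mdifferentiableAt_const.mul (mdifferentiableAt_period_re P hF hp a))
    (fun q _ => by funext a; exact (h3 q _).1) X
  have r2 := low_conn_of_eventuallyEq P hF (η := fun q => cim (ξ q)) hp
    (c := fun a q => 1 / 2 * (P.Z q (e a q)).im)
    (fun a => mdifferentiableAt_const.mul (mdifferentiableAt_period_im P hF hp a))
    (fun q _ => by funext a; exact (h3 q _).2) X
  have c1 := congrArg cre hX
  have c2 := congrArg cim hX
  rw [cre_cmk, cre_pi10] at c1
  rw [cim_cmk, cim_pi10] at c2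
  simp only [cre_tmul, cim_tmul, Complex.one_re, Complex.one_im, one_smul, zero_smul, map_zero,
    add_zero, zero_sub] at c1 c2
  rw [c1] at r1
  rw [c2] at r2
  have r1 := congrFun r1 a
  have r2 := congrFun r2 a
  rw [dReal_const_mul _ (mdifferentiableAt_period_re P hF hp a)] at r1
  rw [dReal_const_mul _ (mdifferentiableAt_period_im P hF hp a)] at r2
  simp at r1 r2
  constructor <;> linarith

end Base
end SpecialJoyce

end

/-! ### Smoothness of the periods. -/

section

namespace SpecialJoyce
open VectorField Set
section Base
variable {n : ℕ} {M : Type*} [TopologicalSpace M] [ChartedSpace (Model n) M]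
  [IsManifold 𝓘(ℂ, Model n) ω M]

variable (P : SpecialPeriodStructure n M) {U : Set M} {e : Fin n ⊕ Fin n → ∀ p : M, T n p}
variable (hF : IsDarbouxFrame P.Γ P.form U e)
include hF

/-- The differential of `Re Z_a` is the pairing `ω(-, e_a)`, already known to be smooth, so `Re Z_a`
is smooth; the Cauchy–Riemann equations transfer this to `Im Z_a`. -/
theorem contMDiffAt_period {p₀ : M} (hp₀ : p₀ ∈ U) (a : Fin n ⊕ Fin n) :
    ContMDiffAt 𝓘(ℝ, Model n) 𝓘(ℝ, ℂ) ∞ (fun q => P.Z q (e a q)) p₀ := by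
  set φ := extChartAt 𝓘(ℝ, Model n) p₀ with hφ
  set Z : M → ℂ := fun q => P.Z q (e a q) with hZ
  set O : Set (Model n) := φ.target ∩ φ.symm ⁻¹' U with hO
  have hOo : IsOpen O := (continuousOn_extChartAt_symm p₀).isOpen_inter_preimage
    (isOpen_extChartAt_target p₀) hF.isOpen
  have hsrc : IsOpen φ.source := isOpen_extChartAt_source p₀
  have hφs : ContMDiffOn 𝓘(ℝ, Model n) 𝓘(ℝ, Model n) ∞ φ φ.source := by
    rw [hφ, extChartAt_source]; exact contMDiffOn_extChartAt
  -- complex differentiability in the chart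
  have hdC : ∀ z ∈ O, DifferentiableAt ℂ (Z ∘ φ.symm) z := by
    intro z hz
    have h1 : MDifferentiableAt 𝓘(ℂ, Model n) 𝓘(ℂ, ℂ) Z (φ.symm z) :=
      (P.Z_holomorphic U e hF a).mdifferentiableAt (hF.isOpen.mem_nhds hz.2)
    have h2 : MDifferentiableAt 𝓘(ℂ, Model n) 𝓘(ℂ, Model n)
        (extChartAt 𝓘(ℂ, Model n) p₀).symm z := by
      have h3 : IsManifold 𝓘(ℂ, Model n) 1 M := IsManifold.of_le (n := ω) le_top
      have := mdifferentiableWithinAt_extChartAt_symm (I := 𝓘(ℂ, Model n)) (x := p₀) (z := z) hz.1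
      rwa [ModelWithCorners.range_eq_univ, mdifferentiableWithinAt_univ] at this
    exact (MDifferentiableAt.comp z h1 h2).differentiableAt
  have hdR : ∀ z ∈ O, DifferentiableAt ℝ (Z ∘ φ.symm) z := fun z hz => (hdC z hz).restrictScalars ℝ
  have hre : ∀ z ∈ O, ∀ w, fderiv ℝ (fun z => ((Z ∘ φ.symm) z).re) z w
      = (fderiv ℂ (Z ∘ φ.symm) z w).re := by
    intro z hz w
    have h := Complex.reCLM.hasFDerivAt.comp z ((hdC z hz).hasFDerivAt.restrictScalars ℝ)
    exact DFunLike.congr_fun h.fderiv w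
  have him : ∀ z ∈ O, ∀ w, fderiv ℝ (fun z => ((Z ∘ φ.symm) z).im) z w
      = (fderiv ℂ (Z ∘ φ.symm) z w).im := by
    intro z hz w
    have h := Complex.imCLM.hasFDerivAt.comp z ((hdC z hz).hasFDerivAt.restrictScalars ℝ)
    exact DFunLike.congr_fun h.fderiv w
  have hfd : ∀ w, ContDiffOn ℝ ∞ (fun z => fderiv ℝ (fun z => ((Z ∘ φ.symm) z).re) z w) O := by
    intro w
    -- The field that is constantly `w` in the chart, so that pairing it with the frame yields the
    -- partial derivative of `Re Z_a` in the direction `w`.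
    let V : ∀ y : M, T n y := fun y => (dMap 𝓘(ℝ, Model n) φ y).inverse w
    have hinv : ∀ y ∈ φ.source, (dMap 𝓘(ℝ, Model n) φ y).IsInvertible := fun y hy =>
      isInvertible_mfderiv_extChartAt hy
    have hV : ∀ y ∈ φ.source, dMap 𝓘(ℝ, Model n) φ y (V y) = w := by
      intro y hy
      obtain ⟨E, hE⟩ := hinv y hy
      simp only [V]
      rw [← hE, ContinuousLinearMap.inverse_equiv]
      exact E.apply_symm_apply w
    have hVs : SmoothVF 𝓘(ℝ, Model n) φ.source V :=
      smoothVF_of_coordinates hsrc hφs hinv (contMDiffOn_const.congr hV)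
    have h1 : ContMDiffOn 𝓘(ℝ, Model n) 𝓘(ℝ, Fin n ⊕ Fin n → ℝ) ∞
        (fun y => low P.form e y (V y)) (φ.source ∩ U) :=
      (hF.contMDiffOn_low P.skew).comp (hVs.mono inter_subset_left) (fun y hy => hy.2)
    have h2 : ContMDiffOn 𝓘(ℝ, Model n) 𝓘(ℝ, Fin n ⊕ Fin n → ℝ) ∞
        (fun z => low P.form e (φ.symm z) (V (φ.symm z))) O :=
      h1.comp ((contMDiffOn_extChartAt_symm p₀).mono inter_subset_left)
        (fun z hz => ⟨φ.map_target hz.1, hz.2⟩)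
    have h3 := contDiffOn_pi.1 h2.contDiffOn a
    refine h3.congr fun z hz => ?_
    have hy : φ.symm z ∈ φ.source := φ.map_target hz.1
    have h4 := dReal_eq_chart hy (mdifferentiableAt_period_re P hF hz.2 a) V
    rw [(dReal_period P hF hz.2 _ a).1, chartField_extChartAt hy] at h4
    change fderiv ℝ _ z w = P.form (φ.symm z) (V (φ.symm z)) (e a (φ.symm z))
    rw [h4]
    have h5 : mfderiv 𝓘(ℝ, Model n) 𝓘(ℝ, Model n) φ (φ.symm z) (V (φ.symm z)) = w := hV _ hy
    rw [h5, φ.right_inv hz.1]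
    rfl
  have hreS : ContDiffOn ℝ ∞ (fun z => ((Z ∘ φ.symm) z).re) O := by
    rw [contDiffOn_infty_iff_fderiv_of_isOpen hOo]
    exact ⟨fun z hz => (Complex.reCLM.differentiableAt.comp z (hdR z hz)).differentiableWithinAt,
      contDiffOn_clm_apply.2 hfd⟩
  have himS : ContDiffOn ℝ ∞ (fun z => ((Z ∘ φ.symm) z).im) O := by
    rw [contDiffOn_infty_iff_fderiv_of_isOpen hOo]
    -- Cauchy–Riemann: the derivative of `Im Z` along `w` is minus the derivative of `Re Z` along `i
    -- w`.
    refine ⟨fun z hz => (Complex.imCLM.differentiableAt.comp z (hdR z hz)).differentiableWithinAt,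
      contDiffOn_clm_apply.2 fun w => (hfd (Complex.I • w)).neg.congr fun z hz => ?_⟩
    rw [him z hz, hre z hz, map_smul]
    simp
  have hS : ContDiffOn ℝ ∞ (Z ∘ φ.symm) O := by
    have := (Complex.ofRealCLM.contDiff.comp_contDiffOn hreS).add
      ((Complex.ofRealCLM.contDiff.comp_contDiffOn himS).mul (contDiffOn_const (c := Complex.I)))
    exact this.congr fun z _ => (Complex.re_add_im _).symm
  have hz₀ : φ p₀ ∈ O := ⟨mem_extChartAt_target p₀, by
    change φ.symm (φ p₀) ∈ U; rw [extChartAt_to_inv]; exact hp₀⟩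
  have hfin := (hS.contDiffAt (hOo.mem_nhds hz₀)).contMDiffAt.comp p₀
    (contMDiffAt_extChartAt (n := ∞))
  refine hfin.congr_of_eventuallyEq ?_
  filter_upwards [hsrc.mem_nhds (mem_extChartAt_source p₀)] with y hy
  simp only [Function.comp_apply]
  rw [φ.left_inv hy]

end Base
end SpecialJoyce

end

/-! ### The affine special Kähler structure. -/

section

namespace SpecialJoyce
open VectorField Set

section dMapPi
variable {E : Type*} [NormedAddCommGroup E] [NormedSpace ℝ E] [CompleteSpace E] {H : Type*} [TopologicalSpace H]
  {I : ModelWithCorners ℝ E H} [I.Boundaryless] {X : Type*} [TopologicalSpace X] [ChartedSpace H X]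
  [IsManifold I ∞ X]

theorem dMap_pi_apply {ι : Type*} [Fintype ι] {f : X → ι → ℝ} {x : X}
    (hf : MDifferentiableAt I 𝓘(ℝ, ι → ℝ) f x) (u : TangentSpace I x) (a : ι) :
    dMap I f x u a = dReal I (fun y => f y a) x u :=
  (dMap_clm_comp_apply (ContinuousLinearMap.proj (R := ℝ) (φ := fun _ : ι => ℝ) a) hf u).symm

theorem smoothVF_of_locally {W : Set X} {ξ : ∀ x : X, TangentSpace I x}
    (h : ∀ x ∈ W, ∃ W' : Set X, IsOpen W' ∧ x ∈ W' ∧ SmoothVF I (W ∩ W') ξ) : SmoothVF I W ξ := by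
  intro x hx
  obtain ⟨W', hW', hx', h⟩ := h x hx
  have := h x ⟨hx, hx'⟩
  exact (contMDiffWithinAt_inter (hW'.mem_nhds hx')).1 this

theorem contMDiffOn_of_pi {ι : Type*} [Fintype ι] {f : X → ι → ℝ} {W : Set X}
    (h : ∀ a, ContMDiffOn I 𝓘(ℝ, ℝ) ∞ (fun x => f x a) W) : ContMDiffOn I 𝓘(ℝ, ι → ℝ) ∞ f W :=
  contMDiffOn_pi_space.2 h

theorem isInvertible_of_bijective {F : Type*} [NormedAddCommGroup F] [NormedSpace ℝ F]
    {F' : Type*} [NormedAddCommGroup F'] [NormedSpace ℝ F'] [FiniteDimensional ℝ F]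
    (f : F →L[ℝ] F') (h : Function.Bijective f) : f.IsInvertible := by
  let L := LinearEquiv.ofBijective f.toLinearMap h
  have : FiniteDimensional ℝ F' := Module.Finite.equiv L
  exact ⟨L.toContinuousLinearEquiv, by ext; rfl⟩
end dMapPi

section Base
variable {n : ℕ} {M : Type*} [TopologicalSpace M] [ChartedSpace (Model n) M]
  [IsManifold 𝓘(ℂ, Model n) ω M]

variable (P : SpecialPeriodStructure n M) {U : Set M} {e : Fin n ⊕ Fin n → ∀ p : M, T n p}

/-- The flat coordinates `Re Z_a` of a frame. -/
def flatCoord (e : Fin n ⊕ Fin n → ∀ p : M, T n p) (p : M) : Fin n ⊕ Fin n → ℝ :=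
  fun a => (P.Z p (e a p)).re

variable (hF : IsDarbouxFrame P.Γ P.form U e)
include hF

theorem contMDiffOn_period_re (a : Fin n ⊕ Fin n) :
    ContMDiffOn 𝓘(ℝ, Model n) 𝓘(ℝ, ℝ) ∞ (fun q => (P.Z q (e a q)).re) U := fun p hp =>
  (Complex.reCLM.contMDiff.contMDiffAt.comp p (contMDiffAt_period P hF hp a)).contMDiffWithinAt

theorem contMDiffOn_period_im (a : Fin n ⊕ Fin n) :
    ContMDiffOn 𝓘(ℝ, Model n) 𝓘(ℝ, ℝ) ∞ (fun q => (P.Z q (e a q)).im) U := fun p hp =>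
  (Complex.imCLM.contMDiff.contMDiffAt.comp p (contMDiffAt_period P hF hp a)).contMDiffWithinAt

theorem contMDiffOn_flatCoord :
    ContMDiffOn 𝓘(ℝ, Model n) 𝓘(ℝ, Fin n ⊕ Fin n → ℝ) ∞ (flatCoord P e) U :=
  contMDiffOn_of_pi (contMDiffOn_period_re P hF)

theorem dMap_flatCoord {p : M} (hp : p ∈ U) (X : T n p) :
    dMap 𝓘(ℝ, Model n) (flatCoord P e) p X = low P.form e p X := by
  funext a
  rw [dMap_pi_apply (((contMDiffOn_flatCoord P hF).contMDiffAt
    (hF.isOpen.mem_nhds hp)).mdifferentiableAt (by simp))]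
  exact (dReal_period P hF hp X a).1

theorem smoothVF_low {W : Set M} (hWU : W ⊆ U) {ξ : ∀ p : M, T n p}
    (hξ : SmoothVF 𝓘(ℝ, Model n) W ξ) (a : Fin n ⊕ Fin n) :
    ContMDiffOn 𝓘(ℝ, Model n) 𝓘(ℝ, ℝ) ∞ (fun q => P.form q (ξ q) (e a q)) W :=
  contMDiffOn_pi_space.1 ((hF.contMDiffOn_low P.skew).comp hξ (fun _ hy => hWU hy)) a

/-- The functions `Re Z_a` are local coordinates whose differentials are the pairings with the
frame, so the pairings of `ξ` are its components. -/
theorem smoothVF_of_low {W : Set M} (hW : IsOpen W) (hWU : W ⊆ U) {ξ : ∀ p : M, T n p}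
    (h : ∀ a, ContMDiffOn 𝓘(ℝ, Model n) 𝓘(ℝ, ℝ) ∞ (fun q => P.form q (ξ q) (e a q)) W) :
    SmoothVF 𝓘(ℝ, Model n) W ξ := by
  refine smoothVF_of_coordinates hW ((contMDiffOn_flatCoord P hF).mono hWU) (fun y hy => ?_) ?_
  · refine isInvertible_of_bijective (F := Model n) _ ?_
    have : ⇑(dMap 𝓘(ℝ, Model n) (flatCoord P e) y) = low P.form e y := by
      funext X; exact dMap_flatCoord P hF (hWU hy) X
    exact this ▸ hF.low_bijective P.skew (hWU hy)
  · have h1 : ContMDiffOn 𝓘(ℝ, Model n) 𝓘(ℝ, Fin n ⊕ Fin n → ℝ) ∞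
        (fun y => low P.form e y (ξ y)) W := contMDiffOn_of_pi h
    exact h1.congr fun y hy => dMap_flatCoord P hF (hWU hy) _

theorem low_conn {W : Set M} (hW : IsOpen W) {η : ∀ q : M, T n q}
    (hη : SmoothVF 𝓘(ℝ, Model n) W η) {p : M} (hp : p ∈ U) (hpW : p ∈ W) (X : T n p)
    (a : Fin n ⊕ Fin n) :
    P.form p (P.conn η p X) (e a p)
      = dReal 𝓘(ℝ, Model n) (fun q => P.form q (η q) (e a q)) p X := by
  have hWU := hW.inter hF.isOpen
  have hF' := hF.restrict hWU inter_subset_right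
  have := low_conn_of_eventuallyEq P hF' (η := η) (c := fun a q => P.form q (η q) (e a q))
    ⟨hpW, hp⟩ (fun a => ((smoothVF_low P hF' subset_rfl (hη.mono inter_subset_left) a).contMDiffAt
      (hWU.mem_nhds ⟨hpW, hp⟩)).mdifferentiableAt (by simp)) (fun q _ => rfl) X
  exact congrFun this a

theorem low_cplxI {p : M} (hp : p ∈ U) (X : T n p) (a : Fin n ⊕ Fin n) :
    P.form p (cplxI n p X) (e a p)
      = - dReal 𝓘(ℝ, Model n) (fun q => (P.Z q (e a q)).im) p X := by
  rw [(dReal_period P hF hp X a).2, neg_neg]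

-- In the coordinates `x_a = Re Z_a` the form is the constant one, `∑ dx_i ∧ dx^i`; smoothness and
-- closedness of `ω` both follow.
omit hF in
theorem locallyWedgeSum_form : LocallyWedgeSum 𝓘(ℝ, Model n) P.form := by
  intro p
  obtain ⟨U, e, hp, hF⟩ := P.exists_frame p
  refine ⟨Fin n, inferInstance, fun i q => (P.Z q (e (Sum.inl i) q)).re,
    fun i q => (P.Z q (e (Sum.inr i) q)).re, U, hF.isOpen, hp,
    fun i => contMDiffOn_period_re P hF _, fun i => contMDiffOn_period_re P hF _, ?_⟩
  intro q hq u v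
  rw [hF.form_eq_stdForm P.skew hq, stdForm_apply]
  refine Finset.sum_congr rfl fun i _ => ?_
  unfold dWedge
  rw [(dReal_period P hF hq _ _).1, (dReal_period P hF hq _ _).1, (dReal_period P hF hq _ _).1,
    (dReal_period P hF hq _ _).1]
  simp only [low_apply]
  ring

omit hF in
theorem smoothEnd_cplxI (P : SpecialPeriodStructure n M) :
    SmoothEnd 𝓘(ℝ, Model n) (fun p : M => cplxI n p) := by
  intro W ξ hW hξ
  refine smoothVF_of_locally fun p hp => ?_
  obtain ⟨U, e, hpU, hF⟩ := P.exists_frame p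
  refine ⟨U, hF.isOpen, hpU, ?_⟩
  have hWU := hW.inter hF.isOpen
  refine smoothVF_of_low P hF hWU inter_subset_right fun a => ?_
  refine ((ContMDiffOn.dReal_vectorField hWU ((contMDiffOn_period_im P hF a).mono inter_subset_right)
    (hξ.mono inter_subset_left)).neg).congr fun q hq => low_cplxI P hF hq.2 _ a

omit hF in
theorem smoothVF_conn {W : Set M} {ξ η : ∀ p : M, T n p} (hW : IsOpen W)
    (hξ : SmoothVF 𝓘(ℝ, Model n) W ξ) (hη : SmoothVF 𝓘(ℝ, Model n) W η) :
    SmoothVF 𝓘(ℝ, Model n) W (fun p => P.conn η p (ξ p)) := by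
  refine smoothVF_of_locally fun p hp => ?_
  obtain ⟨U, e, hpU, hF⟩ := P.exists_frame p
  refine ⟨U, hF.isOpen, hpU, ?_⟩
  have hWU := hW.inter hF.isOpen
  refine smoothVF_of_low P hF hWU inter_subset_right fun a => ?_
  refine (ContMDiffOn.dReal_vectorField hWU (smoothVF_low P hF inter_subset_right
    (hη.mono inter_subset_left) a) (hξ.mono inter_subset_left)).congr fun q hq => ?_
  exact low_conn P hF hW hη hq.2 hq.1 _ a

theorem contMDiffAt_low {W : Set M} (hW : IsOpen W) {ξ : ∀ p : M, T n p}
    (hξ : SmoothVF 𝓘(ℝ, Model n) W ξ) {p : M} (hp : p ∈ U) (hpW : p ∈ W) (a : Fin n ⊕ Fin n) :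
    ContMDiffAt 𝓘(ℝ, Model n) 𝓘(ℝ, ℝ) ∞ (fun q => P.form q (ξ q) (e a q)) p :=
  (smoothVF_low P (hF.restrict (hW.inter hF.isOpen) inter_subset_right) subset_rfl
    (hξ.mono inter_subset_left) a).contMDiffAt ((hW.inter hF.isOpen).mem_nhds ⟨hpW, hp⟩)

-- Each identity between vectors is tested by pairing with a frame, which is injective and turns `∇`
-- into `d`. Flatness, torsion-freeness and `d_∇ I = 0` become the commutator formula for the
-- bracket acting on `ω(χ, e_a)`, on `Re Z_a` and on `Im Z_a` respectively.
omit hF in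
theorem isASK : P.toSKData.IsASK where
  form_smooth := (locallyWedgeSum_form P).smoothBil
  form_skew := P.skew
  form_nondeg p u h := by
    obtain ⟨U, e, hpU, hF⟩ := P.exists_frame p
    exact hF.form_nondeg P.skew hpU u h
  form_compat := P.compat
  form_closed := (locallyWedgeSum_form P).isClosedForm
  conn_smooth W ξ η hW hξ hη := smoothVF_conn P hW hξ hη
  conn_flat W ξ η χ hW hξ hη hχ p hp := by
    obtain ⟨U, e, hpU, hF⟩ := P.exists_frame p
    apply (hF.low_bijective P.skew hpU).1
    funext a
    rw [map_sub, map_sub, map_zero, Pi.sub_apply, Pi.sub_apply, Pi.zero_apply, low_apply, low_apply,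
      low_apply, low_conn P hF hW (smoothVF_conn P hW hη hχ) hpU hp,
      low_conn P hF hW (smoothVF_conn P hW hξ hχ) hpU hp, low_conn P hF hW hχ hpU hp,
      dReal_mlieBracket (contMDiffAt_low P hF hW hχ hpU hp a)
        (hξ.mdifferentiableAt hW hp) (hη.mdifferentiableAt hW hp)]
    have h : ∀ ζ : (∀ p : M, T n p), (fun q => P.form q (P.conn χ q (ζ q)) (e a q)) =ᶠ[𝓝 p]
        fun q => dReal 𝓘(ℝ, Model n) (fun q => P.form q (χ q) (e a q)) q (ζ q) := fun ζ => by
      filter_upwards [hF.isOpen.mem_nhds hpU, hW.mem_nhds hp] with q hq hqW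
      exact low_conn P hF hW hχ hq hqW _ a
    rw [dReal_congr (h η), dReal_congr (h ξ), sub_self]
  conn_torsion W ξ η hW hξ hη p hp := by
    obtain ⟨U, e, hpU, hF⟩ := P.exists_frame p
    apply (hF.low_bijective P.skew hpU).1
    funext a
    rw [map_sub, Pi.sub_apply, low_apply, low_apply, low_conn P hF hW hη hpU hp,
      low_conn P hF hW hξ hpU hp, low_apply, ← (dReal_period P hF hpU _ a).1,
      dReal_mlieBracket ((contMDiffOn_period_re P hF a).contMDiffAt (hF.isOpen.mem_nhds hpU))
        (hξ.mdifferentiableAt hW hp) (hη.mdifferentiableAt hW hp)]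
    congr 1 <;>
    · refine dReal_congr ?_ _
      filter_upwards [hF.isOpen.mem_nhds hpU] with q hq
      exact (dReal_period P hF hq _ a).1.symm
  form_parallel W ξ η χ hW hξ hη hχ p hp := by
    obtain ⟨U, e, hpU, hF⟩ := P.exists_frame p
    have hd : ∀ ζ : (∀ p : M, T n p), SmoothVF 𝓘(ℝ, Model n) W ζ → ∀ a,
        MDifferentiableAt 𝓘(ℝ, Model n) 𝓘(ℝ, ℝ) (fun q => P.form q (ζ q) (e a q)) p :=
      fun ζ hζ a => (contMDiffAt_low P hF hW hζ hpU hp a).mdifferentiableAt (by simp)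
    have h : (fun q => P.form q (η q) (χ q)) =ᶠ[𝓝 p] fun q => ∑ i : Fin n,
        (P.form q (η q) (e (Sum.inl i) q) * P.form q (χ q) (e (Sum.inr i) q)
          - P.form q (η q) (e (Sum.inr i) q) * P.form q (χ q) (e (Sum.inl i) q)) := by
      filter_upwards [hF.isOpen.mem_nhds hpU] with q hq
      rw [hF.form_eq_stdForm P.skew hq, stdForm_apply]; rfl
    have hm : ∀ a b, MDifferentiableAt 𝓘(ℝ, Model n) 𝓘(ℝ, ℝ) (fun q =>
        P.form q (η q) (e a q) * P.form q (χ q) (e b q)) p := fun a b =>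
      (hd η hη a).mul (hd χ hχ b)
    have hs : ∀ i : Fin n, MDifferentiableAt 𝓘(ℝ, Model n) 𝓘(ℝ, ℝ) (fun q =>
        P.form q (η q) (e (Sum.inl i) q) * P.form q (χ q) (e (Sum.inr i) q)
          - P.form q (η q) (e (Sum.inr i) q) * P.form q (χ q) (e (Sum.inl i) q)) p := fun i =>
      (hm _ _).sub (hm _ _)
    rw [dReal_congr h, dReal_sum _ (fun i _ => hs i), hF.form_eq_stdForm P.skew hpU,
      hF.form_eq_stdForm P.skew hpU (η p), stdForm_apply, stdForm_apply, ← Finset.sum_add_distrib]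
    refine Finset.sum_congr rfl fun i _ => ?_
    rw [dReal_sub (hm _ _) (hm _ _),
      dReal_mul (hd η hη _) (hd χ hχ _), dReal_mul (hd η hη _) (hd χ hχ _)]
    simp only [low_apply]
    rw [low_conn P hF hW hη hpU hp, low_conn P hF hW hη hpU hp, low_conn P hF hW hχ hpU hp,
      low_conn P hF hW hχ hpU hp]
    ring
  dI_zero W ξ η hW hξ hη p hp := by
    obtain ⟨U, e, hpU, hF⟩ := P.exists_frame p
    apply (hF.low_bijective P.skew hpU).1
    funext a
    have hd : ∀ ζ : (∀ p : M, T n p), SmoothVF 𝓘(ℝ, Model n) W ζ →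
        MDifferentiableAt 𝓘(ℝ, Model n) 𝓘(ℝ, ℝ)
          (fun q => dReal 𝓘(ℝ, Model n) (fun q => (P.Z q (e a q)).im) q (ζ q)) p := fun ζ hζ =>
      ((ContMDiffOn.dReal_vectorField (hW.inter hF.isOpen)
        ((contMDiffOn_period_im P hF a).mono inter_subset_right)
        (hζ.mono inter_subset_left)).contMDiffAt
        ((hW.inter hF.isOpen).mem_nhds ⟨hp, hpU⟩)).mdifferentiableAt (by simp)
    have h : ∀ ζ : (∀ p : M, T n p), (fun q => P.form q (cplxI n q (ζ q)) (e a q)) =ᶠ[𝓝 p]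
        fun q => -1 * dReal 𝓘(ℝ, Model n) (fun q => (P.Z q (e a q)).im) q (ζ q) := fun ζ => by
      filter_upwards [hF.isOpen.mem_nhds hpU] with q hq
      rw [low_cplxI P hF hq]; ring
    rw [map_sub, map_sub, map_zero, Pi.sub_apply, Pi.sub_apply, Pi.zero_apply, low_apply, low_apply,
      low_apply, low_conn P hF hW (smoothEnd_cplxI P W η hW hη) hpU hp,
      low_conn P hF hW (smoothEnd_cplxI P W ξ hW hξ) hpU hp, low_cplxI P hF hpU,
      dReal_mlieBracket ((contMDiffOn_period_im P hF a).contMDiffAt (hF.isOpen.mem_nhds hpU))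
        (hξ.mdifferentiableAt hW hp) (hη.mdifferentiableAt hW hp), dReal_congr (h η),
      dReal_congr (h ξ), dReal_const_mul _ (hd η hη), dReal_const_mul _ (hd ξ hξ)]
    ring

end Base
end SpecialJoyce

end

/-! ### Bessel functions as integrals over the line. -/

section

namespace SpecialJoyce
open MeasureTheory Set Filter

/-- Gaussian domination: `exp τ + exp (-τ) ≥ τ²`, and half of the resulting `cτ²` absorbs `sτ` by
completing the square. -/
theorem exp_mul_exp_neg_le {a b c : ℝ} (hc : 0 < c) (ha : c ≤ a) (hb : c ≤ b) (s τ : ℝ) :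
    Real.exp (s * τ) * Real.exp (-(a * Real.exp τ + b * Real.exp (-τ)))
      ≤ Real.exp (s ^ 2 / (2 * c)) * Real.exp (-(c / 2) * τ ^ 2) := by
  rw [← Real.exp_add, ← Real.exp_add, Real.exp_le_exp]
  have h1 : τ ^ 2 ≤ Real.exp τ + Real.exp (-τ) := by
    have h3 : (τ / 2) ^ 2 ≤ Real.sinh (τ / 2) ^ 2 := by
      rw [sq_le_sq, Real.abs_sinh]
      exact Real.self_le_sinh_iff.2 (abs_nonneg _)
    have h4 := Real.cosh_two_mul (τ / 2)
    rw [Real.cosh_sq, mul_div_cancel₀ τ two_ne_zero, Real.cosh_eq] at h4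
    nlinarith
  have h2 : c * τ ^ 2 ≤ a * Real.exp τ + b * Real.exp (-τ) := by
    have := mul_le_mul_of_nonneg_left h1 hc.le
    have := mul_le_mul_of_nonneg_right ha (Real.exp_pos τ).le
    have := mul_le_mul_of_nonneg_right hb (Real.exp_pos (-τ)).le
    linarith
  have h3 : s * τ ≤ s ^ 2 / (2 * c) + c / 2 * τ ^ 2 := by
    have : s ^ 2 / (2 * c) + c / 2 * τ ^ 2 - s * τ = (s - c * τ) ^ 2 / (2 * c) := by
      field_simp; ring
    have : 0 ≤ (s - c * τ) ^ 2 / (2 * c) := by positivity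
    linarith
  linarith

theorem integrable_exp_mul_exp_neg {a b : ℝ} (ha : 0 < a) (hb : 0 < b) (s : ℝ) :
    Integrable fun τ : ℝ => Real.exp (s * τ) * Real.exp (-(a * Real.exp τ + b * Real.exp (-τ))) := by
  have hc : 0 < min a b := lt_min ha hb
  refine ((integrable_exp_neg_mul_sq (half_pos hc)).const_mul
    (Real.exp (s ^ 2 / (2 * min a b)))).mono' (by fun_prop) (ae_of_all _ fun τ => ?_)
  rw [Real.norm_of_nonneg (by positivity)]
  exact exp_mul_exp_neg_le hc (min_le_left _ _) (min_le_right _ _) s τ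

/-- The integrals `½ ∫ exp (jτ - π (r exp τ + exp (-τ))) dτ`, which are `r^(-j/2) K_j(2π√r)`. -/
def besselL (j : ℕ) (r : ℝ) : ℝ :=
  1 / 2 * ∫ τ : ℝ, Real.exp (j * τ) *
    Real.exp (-(Real.pi * r * Real.exp τ + Real.pi * Real.exp (-τ)))

theorem integrable_besselL (j : ℕ) {r : ℝ} (hr : 0 < r) : Integrable fun τ : ℝ =>
    Real.exp (j * τ) * Real.exp (-(Real.pi * r * Real.exp τ + Real.pi * Real.exp (-τ))) :=
  integrable_exp_mul_exp_neg (mul_pos Real.pi_pos hr) Real.pi_pos _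

/-- Differentiating under the integral brings down `-π exp τ`, which raises the index by one. On the
neighbourhood `(r/2, ∞)` the integrand at `r/2` dominates. -/
theorem hasDerivAt_besselL (j : ℕ) {r : ℝ} (hr : 0 < r) :
    HasDerivAt (besselL j) (-Real.pi * besselL (j + 1) r) r := by
  have key := hasDerivAt_integral_of_dominated_loc_of_deriv_le (μ := volume) (𝕜 := ℝ)
    (F := fun r τ => Real.exp (j * τ) *
      Real.exp (-(Real.pi * r * Real.exp τ + Real.pi * Real.exp (-τ))))
    (F' := fun r τ => -Real.pi * (Real.exp ((j + 1 : ℕ) * τ) *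
      Real.exp (-(Real.pi * r * Real.exp τ + Real.pi * Real.exp (-τ)))))
    (x₀ := r) (s := Ioi (r / 2)) (bound := fun τ => Real.pi * (Real.exp ((j + 1 : ℕ) * τ) *
      Real.exp (-(Real.pi * (r / 2) * Real.exp τ + Real.pi * Real.exp (-τ)))))
    (Ioi_mem_nhds (by linarith)) (Eventually.of_forall fun x => by fun_prop)
    (integrable_besselL j hr) (by fun_prop) ?_
    ((integrable_besselL (j + 1) (half_pos hr)).const_mul _) ?_
  · have h2 := key.2.const_mul (1 / 2)
    rw [integral_const_mul] at h2
    refine h2.congr_deriv ?_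
    unfold besselL; ring
  · refine ae_of_all _ fun τ x hx => ?_
    rw [norm_mul, norm_neg, Real.norm_of_nonneg Real.pi_pos.le, Real.norm_of_nonneg (by positivity)]
    have : r / 2 ≤ x := (mem_Ioi.1 hx).le
    gcongr
  · refine ae_of_all _ fun τ x _ => ?_
    have h1 : HasDerivAt (fun x : ℝ => -(Real.pi * x * Real.exp τ + Real.pi * Real.exp (-τ)))
        (-(Real.pi * 1 * Real.exp τ)) x :=
      ((((hasDerivAt_id x).const_mul Real.pi).mul_const _).add_const _).neg
    have h2 := h1.exp.const_mul (Real.exp (j * τ))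
    refine h2.congr_deriv ?_
    push_cast
    rw [add_mul, Real.exp_add, one_mul]; ring

theorem besselL_nonneg (j : ℕ) (r : ℝ) : 0 ≤ besselL j r :=
  mul_nonneg (by norm_num) (integral_nonneg fun τ => by positivity)

/-- One unit is split off `π` in the exponent. By the arithmetic-geometric inequality `s² exp τ +
exp (-τ) ≥ 2s`, which gives the decay; the remaining weight `π - 1 > 0` keeps an integral that is
uniform for `s ≥ ε`. -/
theorem exists_besselL_le (j : ℕ) {ε : ℝ} (hε : 0 < ε) :
    ∃ C, 0 ≤ C ∧ ∀ s, ε ≤ s → besselL j (s ^ 2) ≤ C * Real.exp (-2 * s) := by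
  refine ⟨1 / 2 * ∫ τ : ℝ, Real.exp (j * τ) *
    Real.exp (-((Real.pi - 1) * ε ^ 2 * Real.exp τ + (Real.pi - 1) * Real.exp (-τ))),
    mul_nonneg (by norm_num) (integral_nonneg fun τ => by positivity), fun s hs => ?_⟩
  have hpi : 0 < Real.pi - 1 := by linarith [Real.pi_gt_three]
  unfold besselL
  rw [mul_assoc, ← integral_mul_const]
  refine mul_le_mul_of_nonneg_left (integral_mono (integrable_besselL j (pow_pos (hε.trans_le hs) 2))
    ((integrable_exp_mul_exp_neg (by positivity) hpi _).mul_const _) fun τ => ?_) (by norm_num)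
  dsimp only
  rw [mul_assoc (Real.exp _), ← Real.exp_add (-_)]
  refine mul_le_mul_of_nonneg_left (Real.exp_le_exp.2 ?_) (Real.exp_pos _).le
  have h1 : 2 * s ≤ s ^ 2 * Real.exp τ + Real.exp (-τ) := by
    have h2 := sq_nonneg (s * Real.exp τ - 1)
    have h3 : Real.exp τ * Real.exp (-τ) = 1 := by rw [← Real.exp_add]; simp
    have h4 := mul_nonneg h2 (Real.exp_pos (-τ)).le
    have : (s * Real.exp τ - 1) ^ 2 * Real.exp (-τ)
        = s ^ 2 * Real.exp τ * (Real.exp τ * Real.exp (-τ)) - 2 * s * (Real.exp τ * Real.exp (-τ))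
          + Real.exp (-τ) := by ring
    rw [this, h3] at h4
    linarith
  have h5 : ε ^ 2 ≤ s ^ 2 := by gcongr
  have h6 := mul_le_mul_of_nonneg_left (mul_le_mul_of_nonneg_right h5 (Real.exp_pos τ).le) hpi.le
  nlinarith

/-- The three terms are the integral of the derivative of `exp τ · exp (-(π r exp τ + π exp (-τ)))`,
which vanishes. In classical terms it is `K₂(x) = K₀(x) + (2/x) K₁(x)` at `x = 2π√r`. -/
theorem besselL_recurrence {r : ℝ} (hr : 0 < r) :
    Real.pi * r * besselL 2 r - besselL 1 r = Real.pi * besselL 0 r := by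
  have hd : ∀ τ : ℝ, HasDerivAt (fun τ : ℝ => Real.exp (1 * τ) *
      Real.exp (-(Real.pi * r * Real.exp τ + Real.pi * Real.exp (-τ))))
      (Real.exp ((1 : ℕ) * τ) * Real.exp (-(Real.pi * r * Real.exp τ + Real.pi * Real.exp (-τ)))
      - Real.pi * r * (Real.exp ((2 : ℕ) * τ) * Real.exp (-(Real.pi * r * Real.exp τ + Real.pi * Real.exp (-τ))))
      + Real.pi * (Real.exp ((0 : ℕ) * τ) * Real.exp (-(Real.pi * r * Real.exp τ + Real.pi * Real.exp (-τ))))) τ := by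
    intro τ
    have h0 : HasDerivAt (fun τ : ℝ => Real.exp (-τ)) (-Real.exp (-τ)) τ := by
      simpa using (hasDerivAt_neg τ).exp
    have h1 : HasDerivAt (fun τ : ℝ => -(Real.pi * r * Real.exp τ + Real.pi * Real.exp (-τ)))
        (-(Real.pi * r * Real.exp τ + Real.pi * (-Real.exp (-τ)))) τ :=
      (((Real.hasDerivAt_exp τ).const_mul _).add (h0.const_mul _)).neg
    have h2 := (((hasDerivAt_id τ).const_mul 1).exp).mul h1.exp
    refine h2.congr_deriv ?_
    have h3 : Real.exp τ * Real.exp (-τ) = 1 := by rw [← Real.exp_add]; simp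
    have h4 : Real.exp ((2 : ℕ) * τ) = Real.exp τ * Real.exp τ := by
      rw [← Real.exp_add]; congr 1; push_cast; ring
    rw [h4]
    simp only [id, one_mul, Nat.cast_one, Nat.cast_zero, zero_mul, Real.exp_zero, mul_one]
    linear_combination (Real.pi * Real.exp (-(Real.pi * r * Real.exp τ + Real.pi * Real.exp (-τ)))) * h3
  have hi := fun j => integrable_besselL j hr
  have h := integral_eq_zero_of_hasDerivAt_of_integrable hd
    (((hi 1).sub ((hi 2).const_mul _)).add ((hi 0).const_mul _))
    (by simpa using hi 1)
  rw [integral_add (by exact (hi 1).sub ((hi 2).const_mul _)) ((hi 0).const_mul _),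
    integral_sub (hi 1) ((hi 2).const_mul _), integral_const_mul, integral_const_mul] at h
  unfold besselL
  linear_combination -(1 / 2) * h

theorem integral_exp_cosh_eq {j : ℕ} {s : ℝ} (hs : 0 < s) :
    ∫ t : ℝ, Real.exp (j * t) * Real.exp (-(2 * Real.pi * s) * Real.cosh t)
      = 2 * (s ^ j * besselL j (s ^ 2)) := by
  -- The translation `t = τ + log s` makes the exponent `-π(s² exp τ + exp (-τ))` and produces the
  -- factor `s ^ j`.
  rw [← integral_add_right_eq_self _ (Real.log s)]
  unfold besselL
  rw [mul_left_comm, ← mul_assoc 2, mul_one_div_cancel two_ne_zero, one_mul, ← integral_const_mul]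
  refine integral_congr_ae (ae_of_all _ fun τ => ?_)
  have e1 : Real.exp (j * (τ + Real.log s)) = s ^ j * Real.exp (j * τ) := by
    rw [mul_add, Real.exp_add, mul_comm (j : ℝ) (Real.log s), Real.exp_mul (Real.log s), Real.exp_log hs,
      Real.rpow_natCast, mul_comm]
  dsimp only
  rw [e1, mul_assoc]
  congr 3
  rw [Real.cosh_eq, neg_add, Real.exp_add, Real.exp_add, Real.exp_log hs, Real.exp_neg (Real.log s),
    Real.exp_log hs]
  field_simp

/-- Folding the line at the origin: the integral of `exp (jt)` against an even weight over the line
is twice that of `cosh (jt)` over the half-line. -/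
theorem besselK_eq {j : ℕ} {s : ℝ} (hs : 0 < s) :
    besselK j (2 * Real.pi * s) = s ^ j * besselL j (s ^ 2) := by
  have hi : Integrable fun t : ℝ => Real.exp (j * t) * Real.exp (-(2 * Real.pi * s) * Real.cosh t) := by
    have := integrable_exp_mul_exp_neg (a := Real.pi * s) (b := Real.pi * s) (by positivity)
      (by positivity) j
    convert this using 4 with t
    rw [Real.cosh_eq]; ring
  set f : ℝ → ℝ := fun t => Real.exp (j * t) * Real.exp (-(2 * Real.pi * s) * Real.cosh t) with hf
  have h1 : ∫ t, f t = (∫ t in Iic 0, f t) + ∫ t in Ioi 0, f t :=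
    (intervalIntegral.integral_Iic_add_Ioi hi.integrableOn hi.integrableOn).symm
  have h2 : ∫ t in Iic 0, f t = ∫ t in Ioi 0, f (-t) := by
    rw [integral_comp_neg_Ioi, neg_zero]
  have h3 := integral_exp_cosh_eq (j := j) hs
  rw [h1, h2, ← integral_add hi.comp_neg.integrableOn hi.integrableOn] at h3
  have h4 : besselK j (2 * Real.pi * s) * 2 = ∫ t in Ioi 0, (f (-t) + f t) := by
    unfold besselK
    rw [← integral_mul_const]
    refine integral_congr_ae (ae_of_all _ fun t => ?_)
    simp only [hf]
    rw [Real.cosh_neg, Real.cosh_eq (j * t), mul_neg]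
    ring
  linarith

end SpecialJoyce

end

/-! ### Termwise differentiation of series and exponential bounds on all derivatives. -/

section

namespace SpecialJoyce
open Set Filter

section Series
universe u
variable {α : Type*} {E : Type u} [NormedAddCommGroup E] [NormedSpace ℝ E] {s : Set E}

theorem hasFDerivAt_tsum_of_bound {F : Type*} [NormedAddCommGroup F] [NormedSpace ℝ F] [CompleteSpace F]
    (hs : IsOpen s) (hc : IsPreconnected s) {u : α → E → F} {v : ℕ → α → ℝ}
    (hu : ∀ i, ContDiffOn ℝ ∞ (u i) s) (hv : ∀ k, Summable (v k))
    (hb : ∀ k i, ∀ x ∈ s, ‖iteratedFDeriv ℝ k (u i) x‖ ≤ v k i) {x : E} (hx : x ∈ s) :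
    HasFDerivAt (fun y => ∑' i, u i y) (∑' i, fderiv ℝ (u i) x) x := by
  refine hasFDerivAt_tsum_of_isPreconnected (hv 1) hs hc (fun i y hy =>
    (((hu i).contDiffAt (hs.mem_nhds hy)).differentiableAt (by simp)).hasFDerivAt)
    (fun i y hy => ?_) hx ?_ hx
  · rw [← norm_iteratedFDeriv_zero (𝕜 := ℝ), norm_iteratedFDeriv_fderiv]
    exact hb 1 i y hy
  · refine Summable.of_norm_bounded (hv 0) fun i => ?_
    rw [← norm_iteratedFDeriv_zero (𝕜 := ℝ)]
    exact hb 0 i x hx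

/-- The target varies in the induction on the order: the series of derivatives takes values in `E
→L[ℝ] F`, and its bounds are the given ones shifted by one. -/
theorem contDiffOn_tsum_nat (hs : IsOpen s) (hc : IsPreconnected s) (n : ℕ) :
    ∀ {F : Type u} [NormedAddCommGroup F] [NormedSpace ℝ F] [CompleteSpace F]
      {u : α → E → F} {v : ℕ → α → ℝ}, (∀ i, ContDiffOn ℝ ∞ (u i) s) → (∀ k, Summable (v k)) →
      (∀ k i, ∀ x ∈ s, ‖iteratedFDeriv ℝ k (u i) x‖ ≤ v k i) →
      ContDiffOn ℝ n (fun x => ∑' i, u i x) s := by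
  induction n with
  | zero =>
    intro F _ _ _ u v hu hv hb
    exact contDiffOn_zero.2 fun x hx =>
      (hasFDerivAt_tsum_of_bound hs hc hu hv hb hx).continuousAt.continuousWithinAt
  | succ n ih =>
    intro F _ _ _ u v hu hv hb
    push_cast
    rw [contDiffOn_succ_iff_fderiv_of_isOpen hs]
    refine ⟨fun x hx => (hasFDerivAt_tsum_of_bound hs hc hu hv hb
      hx).differentiableAt.differentiableWithinAt, by simp, ?_⟩
    refine (ih (u := fun i => fderiv ℝ (u i)) (v := fun k => v (k + 1)) (fun i => ?_)
      (fun k => hv (k + 1)) (fun k i x hx => ?_)).congr fun x hx =>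
        (hasFDerivAt_tsum_of_bound hs hc hu hv hb hx).fderiv
    · exact ((contDiffOn_infty_iff_fderiv_of_isOpen hs).1 (hu i)).2
    · rw [norm_iteratedFDeriv_fderiv]; exact hb (k + 1) i x hx

theorem contDiffOn_tsum_of_isOpen (hs : IsOpen s) (hc : IsPreconnected s)
    {F : Type u} [NormedAddCommGroup F] [NormedSpace ℝ F] [CompleteSpace F]
    {u : α → E → F} {v : ℕ → α → ℝ} (hu : ∀ i, ContDiffOn ℝ ∞ (u i) s) (hv : ∀ k, Summable (v k))
    (hb : ∀ k i, ∀ x ∈ s, ‖iteratedFDeriv ℝ k (u i) x‖ ≤ v k i) :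
    ContDiffOn ℝ ∞ (fun x => ∑' i, u i x) s :=
  contDiffOn_infty.2 fun n => contDiffOn_tsum_nat hs hc n hu hv hb

theorem hasSum_fderiv_fderiv_of_bound {F : Type*} [NormedAddCommGroup F] [NormedSpace ℝ F]
    [CompleteSpace F] (hs : IsOpen s) (hc : IsPreconnected s) {u : α → E → F} {v : ℕ → α → ℝ}
    (hu : ∀ i, ContDiffOn ℝ ∞ (u i) s) (hv : ∀ k, Summable (v k))
    (hb : ∀ k i, ∀ x ∈ s, ‖iteratedFDeriv ℝ k (u i) x‖ ≤ v k i) {x : E} (hx : x ∈ s) (a b : E) :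
    HasSum (fun i => fderiv ℝ (fderiv ℝ (u i)) x a b)
      (fderiv ℝ (fderiv ℝ (fun y => ∑' i, u i y)) x a b) := by
  have hb' : ∀ k i, ∀ x ∈ s, ‖iteratedFDeriv ℝ k (fderiv ℝ (u i)) x‖ ≤ v (k + 1) i :=
    fun k i x hx => by rw [norm_iteratedFDeriv_fderiv]; exact hb (k + 1) i x hx
  have h1 := hasFDerivAt_tsum_of_bound hs hc (u := fun i => fderiv ℝ (u i))
    (v := fun k => v (k + 1)) (fun i => ((contDiffOn_infty_iff_fderiv_of_isOpen hs).1 (hu i)).2)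
    (fun k => hv (k + 1)) hb' hx
  have h2 : (fderiv ℝ (fun y => ∑' i, u i y)) =ᶠ[𝓝 x] fun y => ∑' i, fderiv ℝ (u i) y := by
    filter_upwards [hs.mem_nhds hx] with y hy
    exact (hasFDerivAt_tsum_of_bound hs hc hu hv hb hy).fderiv
  rw [h2.fderiv_eq, h1.fderiv]
  have h3 : Summable fun i => (fderiv ℝ (fderiv ℝ (u i)) x : E →L[ℝ] E →L[ℝ] F) := by
    have h5 : ∀ i, ‖fderiv ℝ (fderiv ℝ (u i)) x‖ ≤ v 2 i := fun i => by
      have := hb' 1 i x hx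
      rwa [← norm_iteratedFDeriv_fderiv, norm_iteratedFDeriv_zero] at this
    exact Summable.of_norm_bounded (E := E →L[ℝ] E →L[ℝ] F) (g := v 2) (hv 2) h5
  have h4 := (ContinuousLinearMap.apply ℝ (E →L[ℝ] F) a).hasSum h3.hasSum
  exact (ContinuousLinearMap.apply ℝ F b).hasSum h4
end Series

section Bounds
variable {E F G : Type*} [NormedAddCommGroup E] [NormedSpace ℝ E] [NormedAddCommGroup F]
  [NormedSpace ℝ F] [NormedAddCommGroup G] [NormedSpace ℝ G]

theorem norm_iteratedFDeriv_comp_clm_le (ℓ : G →L[ℝ] E) {f : E → F} {s : Set E} (hs : IsOpen s)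
    (hf : ContDiffOn ℝ ∞ f s) (j : ℕ) {x : G} (hx : ℓ x ∈ s) :
    ‖iteratedFDeriv ℝ j (fun y => f (ℓ y)) x‖ ≤ ‖iteratedFDeriv ℝ j f (ℓ x)‖ * ‖ℓ‖ ^ j := by
  have hs' : IsOpen (ℓ ⁻¹' s) := hs.preimage ℓ.continuous
  have h := ℓ.iteratedFDerivWithin_comp_right (i := j) hf hs.uniqueDiffOn hs'.uniqueDiffOn hx
    (by exact_mod_cast le_top)
  rw [iteratedFDerivWithin_of_isOpen j hs' hx, iteratedFDerivWithin_of_isOpen j hs hx] at h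
  change ‖iteratedFDeriv ℝ j (f ∘ ℓ) x‖ ≤ _
  rw [h]
  refine (ContinuousMultilinearMap.norm_compContinuousLinearMap_le _ _).trans ?_
  simp

theorem contDiffOn_besselL (j : ℕ) : ContDiffOn ℝ ∞ (besselL j) (Ioi 0) := by
  refine contDiffOn_infty.2 fun n => ?_
  induction n generalizing j with
  | zero => exact contDiffOn_zero.2 fun x hx => (hasDerivAt_besselL j hx).continuousAt.continuousWithinAt
  | succ n ih =>
    push_cast
    rw [contDiffOn_succ_iff_deriv_of_isOpen isOpen_Ioi]
    refine ⟨fun x hx => (hasDerivAt_besselL j hx).differentiableAt.differentiableWithinAt, by simp, ?_⟩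
    exact ((ih (j + 1)).const_smul (-Real.pi)).congr fun x hx => (hasDerivAt_besselL j hx).deriv

theorem iteratedDerivWithin_besselL (j n : ℕ) {r : ℝ} (hr : 0 < r) :
    iteratedDerivWithin n (besselL j) (Ioi 0) r = (-Real.pi) ^ n * besselL (j + n) r := by
  induction n generalizing r with
  | zero => simp
  | succ n ih =>
    rw [iteratedDerivWithin_succ, derivWithin_congr (f := fun r => (-Real.pi) ^ n * besselL (j + n) r)
      (s := Ioi 0) (fun x hx => ih hx) (ih hr),
      derivWithin_of_isOpen isOpen_Ioi hr, ((hasDerivAt_besselL (j + n) hr).const_mul _).deriv]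
    rw [pow_succ, ← add_assoc]; ring

/-- The function `K₀(2π|z|)` of `z ≠ 0`. -/
def besselRadial (z : ℂ) : ℝ := besselL 0 (Complex.normSq z)

theorem hasFDerivAt_normSq (z : ℂ) :
    HasFDerivAt (fun z : ℂ => Complex.normSq z) ((2 • innerSL ℝ (E := ℂ)) z) z := by
  have := (hasStrictFDerivAt_norm_sq z).hasFDerivAt
  simpa [Complex.sq_norm] using this

/-- For a quadratic function only the orders one and two contribute. The bound has the shape `D ^ i`
needed in the estimate for iterated derivatives of a composition. -/
theorem norm_iteratedFDeriv_normSq_le (z : ℂ) (i : ℕ) (hi : 1 ≤ i) :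
    ‖iteratedFDeriv ℝ i (fun z : ℂ => Complex.normSq z) z‖ ≤ (2 * (1 + ‖z‖)) ^ i := by
  have hd : fderiv ℝ (fun z : ℂ => Complex.normSq z) = (2 • innerSL ℝ (E := ℂ) : ℂ →L[ℝ] ℂ →L[ℝ] ℝ) :=
    funext fun z => (hasFDerivAt_normSq z).fderiv
  have hn : ‖(2 • innerSL ℝ (E := ℂ) : ℂ →L[ℝ] ℂ →L[ℝ] ℝ)‖ ≤ 2 := by
    refine (norm_nsmul_le (E := ℂ →L[ℝ] ℂ →L[ℝ] ℝ)).trans ?_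
    have : ‖innerSL ℝ (E := ℂ)‖ ≤ 1 := ContinuousLinearMap.opNorm_le_bound _ zero_le_one fun x => by
      simp [innerSL_apply_norm]
    simpa using this
  have h0 := norm_nonneg z
  obtain ⟨i, rfl⟩ : ∃ k, i = k + 1 := ⟨i - 1, by omega⟩
  rw [← norm_iteratedFDeriv_fderiv, hd]
  rcases i with _ | i
  · rw [norm_iteratedFDeriv_zero]
    refine (ContinuousLinearMap.le_of_opNorm_le _ hn z).trans ?_
    simp
  · rw [← norm_iteratedFDeriv_fderiv]
    have hd2 : fderiv ℝ (⇑(2 • innerSL ℝ (E := ℂ) : ℂ →L[ℝ] ℂ →L[ℝ] ℝ)) = fun _ => 2 • innerSL ℝ (E := ℂ) :=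
      funext fun z => ContinuousLinearMap.fderiv _
    rw [hd2]
    rcases i with _ | i
    · rw [norm_iteratedFDeriv_zero]
      refine hn.trans ?_
      rw [zero_add, one_add_one_eq_two, mul_pow]
      nlinarith
    · rw [iteratedFDeriv_succ_const]
      simp only [Pi.zero_apply, norm_zero]
      positivity

theorem isOpen_ne_zero : IsOpen {z : ℂ | z ≠ 0} := isOpen_ne

theorem contDiffOn_besselRadial : ContDiffOn ℝ ∞ besselRadial {z : ℂ | z ≠ 0} :=
  (contDiffOn_besselL 0).comp (g := besselL 0) (f := fun z : ℂ => Complex.normSq z)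
    (by
      have : ContDiff ℝ ∞ (fun z : ℂ => ‖z‖ ^ 2) := contDiff_norm_sq ℝ
      simp only [Complex.sq_norm] at this
      exact this.contDiffOn)
    (fun z hz => Complex.normSq_pos.2 hz)

/-- The derivatives of `besselL 0` decay like `exp (-2|z|)`, while the inner function `|z|²` costs a
factor `(1 + |z|) ^ j`; half of the decay pays for this polynomial. -/
theorem exists_norm_iteratedFDeriv_besselRadial_le (j : ℕ) {ε : ℝ} (hε : 0 < ε) :
    ∃ C, 0 ≤ C ∧ ∀ z : ℂ, ε ≤ ‖z‖ → ‖iteratedFDeriv ℝ j besselRadial z‖ ≤ C * Real.exp (-‖z‖) := by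
  choose C hC0 hC using fun i => exists_besselL_le i hε
  set A := ∑ i ∈ Finset.range (j + 1), Real.pi ^ i * C i with hA
  have hA0 : 0 ≤ A := Finset.sum_nonneg fun i _ => mul_nonneg (by positivity) (hC0 i)
  refine ⟨j.factorial * A * (2 ^ j * (j.factorial * Real.exp 1)), by positivity, fun z hz => ?_⟩
  have hz0 : z ≠ 0 := by
    rintro rfl; simp at hz; linarith
  have h1 := norm_iteratedFDerivWithin_comp_le (N := ∞) (n := j) (contDiffOn_besselL 0)
    (f := fun z : ℂ => Complex.normSq z) (s := {z : ℂ | z ≠ 0}) (x := z)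
    (by
      have : ContDiff ℝ ∞ (fun z : ℂ => ‖z‖ ^ 2) := contDiff_norm_sq ℝ
      simp only [Complex.sq_norm] at this
      exact this.contDiffOn) (by exact_mod_cast le_top) isOpen_Ioi.uniqueDiffOn
    isOpen_ne_zero.uniqueDiffOn (fun z hz => Complex.normSq_pos.2 hz) hz0
    (C := A * Real.exp (-2 * ‖z‖)) (D := 2 * (1 + ‖z‖)) (fun i hi => ?_) (fun i hi _ => ?_)
  · rw [iteratedFDerivWithin_of_isOpen j isOpen_ne_zero hz0] at h1
    refine h1.trans ?_
    have h2 : (1 + ‖z‖) ^ j ≤ j.factorial * (Real.exp 1 * Real.exp ‖z‖) := by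
      have h3 := Real.pow_div_factorial_le_exp (1 + ‖z‖) (by positivity) j
      rw [div_le_iff₀ (by positivity), Real.exp_add] at h3
      linarith
    calc _ = j.factorial * A * (2 ^ j * (1 + ‖z‖) ^ j) * Real.exp (-2 * ‖z‖) := by
          rw [mul_pow]; ring
      _ ≤ j.factorial * A * (2 ^ j * (j.factorial * (Real.exp 1 * Real.exp ‖z‖))) * Real.exp (-2 * ‖z‖) := by
          gcongr
      _ = j.factorial * A * (2 ^ j * (j.factorial * Real.exp 1)) * (Real.exp ‖z‖ * Real.exp (-2 * ‖z‖)) := by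
          ring
      _ = _ := by rw [← Real.exp_add]; ring_nf
  · rw [norm_iteratedFDerivWithin_eq_norm_iteratedDerivWithin,
      iteratedDerivWithin_besselL 0 i (Complex.normSq_pos.2 hz0), norm_mul, norm_pow, norm_neg,
      Real.norm_of_nonneg Real.pi_pos.le, Real.norm_of_nonneg (besselL_nonneg _ _), zero_add,
      ← Complex.sq_norm]
    calc _ ≤ Real.pi ^ i * (C i * Real.exp (-2 * ‖z‖)) := by gcongr; exact hC i _ hz
      _ = Real.pi ^ i * C i * Real.exp (-2 * ‖z‖) := by ring
      _ ≤ _ := by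
        gcongr
        exact Finset.single_le_sum (f := fun i => Real.pi ^ i * C i)
          (fun i _ => mul_nonneg (by positivity) (hC0 i)) (Finset.mem_range.2 (by omega))
  · rw [iteratedFDerivWithin_of_isOpen i isOpen_ne_zero hz0]
    exact norm_iteratedFDeriv_normSq_le z i hi

/-- The function `exp(iφ) K₀(2π|z|)`. -/
def besselWave (x : ℂ × ℝ) : ℂ := Complex.exp (Complex.I * (x.2 : ℂ)) * (besselRadial x.1 : ℂ)

theorem norm_iteratedFDeriv_cexp_le (j : ℕ) (φ : ℝ) :
    ‖iteratedFDeriv ℝ j (fun φ : ℝ => Complex.exp (Complex.I * (φ : ℂ))) φ‖ ≤ 1 := by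
  have h : ∀ j : ℕ, iteratedDeriv j (fun φ : ℝ => Complex.exp (Complex.I * (φ : ℂ)))
      = fun φ : ℝ => Complex.I ^ j * Complex.exp (Complex.I * (φ : ℂ)) := by
    intro j
    induction j with
    | zero => simp
    | succ j ih =>
      rw [iteratedDeriv_succ, ih]
      funext φ
      have h1 : HasDerivAt (fun φ : ℝ => Complex.I * (φ : ℂ)) (Complex.I * 1) φ :=
        (Complex.ofRealCLM.hasDerivAt (x := φ)).const_mul _
      rw [(h1.cexp.const_mul _).deriv]
      ring
  rw [norm_iteratedFDeriv_eq_norm_iteratedDeriv, h, norm_mul, norm_pow, Complex.norm_I, one_pow,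
    one_mul, mul_comm, Complex.norm_exp_ofReal_mul_I]

theorem isOpen_fst_ne_zero : IsOpen {x : ℂ × ℝ | x.1 ≠ 0} := isOpen_ne_zero.preimage continuous_fst

theorem contDiff_cexp_snd : ContDiff ℝ ∞ (fun x : ℂ × ℝ => Complex.exp (Complex.I * (x.2 : ℂ))) :=
  (contDiff_const.mul (Complex.ofRealCLM.contDiff.comp contDiff_snd)).cexp

theorem contDiffOn_besselRadial_fst :
    ContDiffOn ℝ ∞ (fun x : ℂ × ℝ => (besselRadial x.1 : ℂ)) {x | x.1 ≠ 0} :=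
  (Complex.ofRealCLM.contDiff.comp_contDiffOn contDiffOn_besselRadial).comp contDiff_fst.contDiffOn
    (fun _ h => h)

theorem contDiffOn_besselWave : ContDiffOn ℝ ∞ besselWave {x | x.1 ≠ 0} :=
  contDiff_cexp_snd.contDiffOn.mul contDiffOn_besselRadial_fst

/-- Leibniz rule: all derivatives of the phase are bounded by one, so the decay of the radial factor
survives. -/
theorem exists_norm_iteratedFDeriv_besselWave_le (j : ℕ) {ε : ℝ} (hε : 0 < ε) :
    ∃ C, 0 ≤ C ∧ ∀ x : ℂ × ℝ, ε ≤ ‖x.1‖ →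
      ‖iteratedFDeriv ℝ j besselWave x‖ ≤ C * Real.exp (-‖x.1‖) := by
  choose C hC0 hC using fun i => exists_norm_iteratedFDeriv_besselRadial_le i hε
  refine ⟨∑ i ∈ Finset.range (j + 1), (j.choose i : ℝ) * 1 * C (j - i),
    Finset.sum_nonneg fun i _ => mul_nonneg (by positivity) (hC0 _), fun x hx => ?_⟩
  have hx0 : x ∈ {x : ℂ × ℝ | x.1 ≠ 0} := by
    rintro h0; rw [h0] at hx; simp at hx; linarith
  have h1 := norm_iteratedFDerivWithin_mul_le (n := j) contDiff_cexp_snd.contDiffOn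
    contDiffOn_besselRadial_fst isOpen_fst_ne_zero.uniqueDiffOn hx0 (by exact_mod_cast le_top)
  rw [iteratedFDerivWithin_of_isOpen j isOpen_fst_ne_zero hx0] at h1
  refine h1.trans ?_
  rw [Finset.sum_mul]
  refine Finset.sum_le_sum fun i _ => ?_
  rw [iteratedFDerivWithin_of_isOpen _ isOpen_fst_ne_zero hx0,
    iteratedFDerivWithin_of_isOpen _ isOpen_fst_ne_zero hx0, mul_assoc _ (C _)]
  have e1 := (norm_iteratedFDeriv_comp_clm_le (ContinuousLinearMap.snd ℝ ℂ ℝ) isOpen_univ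
    (f := fun φ : ℝ => Complex.exp (Complex.I * (φ : ℂ)))
    ((contDiff_const.mul Complex.ofRealCLM.contDiff).cexp).contDiffOn i (x := x) (mem_univ _)).trans
    (mul_le_mul (norm_iteratedFDeriv_cexp_le i _)
      (pow_le_one₀ (norm_nonneg _) (ContinuousLinearMap.norm_snd_le ℝ ℂ ℝ)) (by positivity) zero_le_one)
  have e2 := (norm_iteratedFDeriv_comp_clm_le (ContinuousLinearMap.fst ℝ ℂ ℝ) isOpen_ne_zero
    (Complex.ofRealCLM.contDiff.comp_contDiffOn contDiffOn_besselRadial) (j - i) hx0).trans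
    (mul_le_mul_of_nonneg_left (pow_le_one₀ (norm_nonneg _) (ContinuousLinearMap.norm_fst_le ℝ ℂ ℝ))
      (norm_nonneg _))
  have e3 : ‖iteratedFDeriv ℝ (j - i) (Complex.ofRealCLM ∘ besselRadial) x.1‖
      = ‖iteratedFDeriv ℝ (j - i) besselRadial x.1‖ :=
    Complex.ofRealLI.norm_iteratedFDeriv_comp_left
      (contDiffOn_besselRadial.contDiffAt (isOpen_ne_zero.mem_nhds hx0)) (by generalize j - i = l; exact_mod_cast le_top)
  have e4 := e2.trans ((mul_one _).trans_le (e3.trans_le (hC (j - i) x.1 hx)))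
  rw [mul_one] at e1
  exact mul_le_mul (mul_le_mul_of_nonneg_left e1 (by positivity)) e4 (norm_nonneg _) (by positivity)

end Bounds
end SpecialJoyce

end

/-! ### Second derivatives of a single wave and their sums over multiples of a charge. -/

section

namespace SpecialJoyce
open Set Filter

/-- The real inner product of two complex numbers. -/
def rdot (z w : ℂ) : ℝ := z.re * w.re + z.im * w.im

/-- The function `exp(iφ) |z|⁻ʲ K_j(2π|z|)`. -/
def waveL (j : ℕ) (x : ℂ × ℝ) : ℂ := Complex.exp (Complex.I * (x.2 : ℂ)) * (besselL j (Complex.normSq x.1) : ℂ)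

/-- The family is stable under differentiation: the phase direction multiplies by `i`, a direction
in `z` raises `j`. -/
theorem hasFDerivAt_waveL (j : ℕ) {x : ℂ × ℝ} (hx : x.1 ≠ 0) :
    ∃ D : ℂ × ℝ →L[ℝ] ℂ, HasFDerivAt (waveL j) D x ∧ ∀ a, D a = Complex.I * a.2 * waveL j x
      - 2 * Real.pi * rdot x.1 a.1 * waveL (j + 1) x := by
  have h1 : HasFDerivAt (fun x : ℂ × ℝ => Complex.I * (x.2 : ℂ))
      (Complex.I • (Complex.ofRealCLM ∘L ContinuousLinearMap.snd ℝ ℂ ℝ)) x :=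
    (Complex.ofRealCLM.hasFDerivAt.comp x hasFDerivAt_snd).const_mul _
  have h2 := ((hasDerivAt_besselL j (Complex.normSq_pos.2 hx)).comp_hasFDerivAt x.1
    (hasFDerivAt_normSq x.1)).comp x hasFDerivAt_fst
  have h3 := h1.cexp.mul (Complex.ofRealCLM.hasFDerivAt.comp x h2)
  refine ⟨_, h3, fun a => ?_⟩
  simp [waveL, rdot, Complex.inner]
  ring

theorem besselWave_eq : besselWave = waveL 0 := rfl

theorem fderiv_waveL (j : ℕ) {x : ℂ × ℝ} (hx : x.1 ≠ 0) (a : ℂ × ℝ) :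
    fderiv ℝ (waveL j) x a = Complex.I * a.2 * waveL j x
      - 2 * Real.pi * rdot x.1 a.1 * waveL (j + 1) x := by
  obtain ⟨D, hD, h⟩ := hasFDerivAt_waveL j hx
  rw [hD.fderiv, h]

theorem fderiv_fderiv_besselWave {x : ℂ × ℝ} (hx : x.1 ≠ 0) (a b : ℂ × ℝ) :
    fderiv ℝ (fderiv ℝ besselWave) x a b = -(a.2 * b.2 * waveL 0 x)
      - 2 * Real.pi * Complex.I * (a.2 * rdot x.1 b.1 + b.2 * rdot x.1 a.1) * waveL 1 x
      - 2 * Real.pi * rdot a.1 b.1 * waveL 1 x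
      + 4 * Real.pi ^ 2 * rdot x.1 a.1 * rdot x.1 b.1 * waveL 2 x := by
  have hd : DifferentiableAt ℝ (fderiv ℝ besselWave) x :=
    (((contDiffOn_infty_iff_fderiv_of_isOpen isOpen_fst_ne_zero).1
      contDiffOn_besselWave).2.contDiffAt (isOpen_fst_ne_zero.mem_nhds hx)).differentiableAt (by simp)
  have h1 : fderiv ℝ (fderiv ℝ besselWave) x a b = fderiv ℝ (fun y => fderiv ℝ besselWave y b) x a := by
    rw [fderiv_clm_apply hd (differentiableAt_const b)]; simp
  have h2 : (fun y => fderiv ℝ besselWave y b) =ᶠ[𝓝 x] fun y => Complex.I * b.2 * waveL 0 y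
      - 2 * Real.pi * rdot y.1 b.1 * waveL 1 y := by
    filter_upwards [isOpen_fst_ne_zero.mem_nhds hx] with y hy
    rw [besselWave_eq, fderiv_waveL 0 hy]
  obtain ⟨D0, hD0, e0⟩ := hasFDerivAt_waveL 0 hx
  obtain ⟨D1, hD1, e1⟩ := hasFDerivAt_waveL 1 hx
  have h3 : HasFDerivAt (fun y : ℂ × ℝ => (2 * Real.pi * rdot y.1 b.1 : ℂ))
      ((2 * Real.pi : ℂ) • (Complex.ofRealCLM ∘L (b.1.re • Complex.reCLM + b.1.im • Complex.imCLM)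
        ∘L ContinuousLinearMap.fst ℝ ℂ ℝ)) x := by
    have : (fun y : ℂ × ℝ => (2 * Real.pi * rdot y.1 b.1 : ℂ)) = fun y => (2 * Real.pi : ℂ) *
        (Complex.ofRealCLM ∘L (b.1.re • Complex.reCLM + b.1.im • Complex.imCLM)
        ∘L ContinuousLinearMap.fst ℝ ℂ ℝ) y := by
      funext y; simp [rdot]; ring
    rw [this]
    exact (ContinuousLinearMap.hasFDerivAt _).const_mul _
  have h4 : HasFDerivAt (fun y => Complex.I * b.2 * waveL 0 y
      - 2 * Real.pi * rdot y.1 b.1 * waveL 1 y) _ x := (hD0.const_mul _).sub (h3.mul hD1)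
  rw [h1, h2.fderiv_eq, h4.fderiv]
  simp [e0, e1, rdot]
  linear_combination (a.2 * b.2 * waveL 0 x : ℂ) * Complex.I_sq

/-- The sums `∑_k exp(ikφ) kⁱ (k|z|)⁻ʲ K_j(2πk|z|)`. -/
def waveSum (j i : ℕ) (x : ℂ × ℝ) : ℂ :=
  ∑' k : ℕ+, (k : ℂ) ^ i * waveL j ((k : ℝ) • x)

theorem normSq_smul (k : ℝ) (z : ℂ) : Complex.normSq (k • z) = (k * ‖z‖) ^ 2 := by
  rw [← Complex.sq_norm, norm_smul, mul_pow, mul_pow, Real.norm_eq_abs, sq_abs]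

theorem norm_waveL (j : ℕ) (x : ℂ × ℝ) : ‖waveL j x‖ = besselL j (Complex.normSq x.1) := by
  rw [waveL, norm_mul, mul_comm Complex.I, Complex.norm_exp_ofReal_mul_I, one_mul,
    Complex.norm_of_nonneg (besselL_nonneg _ _)]

theorem summable_waveL (j i : ℕ) {x : ℂ × ℝ} (hx : x.1 ≠ 0) :
    Summable fun k : ℕ+ => (k : ℂ) ^ i * waveL j ((k : ℝ) • x) := by
  have hr : 0 < ‖x.1‖ := norm_pos_iff.2 hx
  obtain ⟨C, hC0, hC⟩ := exists_besselL_le j hr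
  have hs := ((Real.summable_pow_mul_exp_neg_nat_mul i (r := 2 * ‖x.1‖) (by positivity)).comp_injective
    PNat.coe_injective).mul_left C
  refine Summable.of_norm_bounded hs fun k => ?_
  rw [norm_mul, norm_waveL, Prod.smul_fst, normSq_smul, norm_pow, Complex.norm_natCast]
  have hk : (1 : ℝ) ≤ k := by exact_mod_cast k.one_le
  calc _ ≤ ((k : ℕ) : ℝ) ^ i * (C * Real.exp (-2 * ((k : ℝ) * ‖x.1‖))) := by
        gcongr
        exact hC _ (by nlinarith)
    _ = _ := by
      simp only [Function.comp]
      rw [mul_left_comm]; congr 3; ring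

/-- The Bessel recurrence at `r = (k|z|)²`, summed over `k`. For `f = ∑ k⁻² exp(ikφ) K₀(2πk|z|)`
this says `Δ_z f + 4π² ∂_φ² f = 0`, the only form in which the Bessel equation enters the geometry.
-/
theorem waveSum_recurrence {x : ℂ × ℝ} (hx : x.1 ≠ 0) :
    Real.pi * ‖x.1‖ ^ 2 * waveSum 2 2 x - waveSum 1 0 x = Real.pi * waveSum 0 0 x := by
  unfold waveSum
  rw [← tsum_mul_left, ← tsum_mul_left, ← ((summable_waveL 2 2 hx).mul_left _).tsum_sub (summable_waveL 1 0 hx)]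
  refine tsum_congr fun k => ?_
  have hr : 0 < ‖x.1‖ := norm_pos_iff.2 hx
  have hk : (0 : ℝ) < k := by exact_mod_cast k.pos
  have h := besselL_recurrence (r := (k * ‖x.1‖) ^ 2) (by positivity)
  have h' := congrArg (Complex.ofReal) h
  push_cast at h'
  unfold waveL
  rw [Prod.smul_fst, normSq_smul]
  linear_combination (Complex.exp (Complex.I * (((k : ℝ) • x).2 : ℂ))) * h'

/-- The sum over `k > 0` of the second derivatives of `exp(iφ) K₀(2π|z|)` at `k (z, φ)`. -/
def hessSum (x a b : ℂ × ℝ) : ℂ :=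
  -(a.2 * b.2 * waveSum 0 0 x)
    - 2 * Real.pi * Complex.I * (a.2 * rdot x.1 b.1 + b.2 * rdot x.1 a.1) * waveSum 1 1 x
    - 2 * Real.pi * rdot a.1 b.1 * waveSum 1 0 x
    + 4 * Real.pi ^ 2 * rdot x.1 a.1 * rdot x.1 b.1 * waveSum 2 2 x

theorem hasSum_of_eq {α : Type*} {f g : α → ℂ} {a b : ℂ} (h : HasSum f a) (hf : ∀ k, g k = f k)
    (ha : b = a) : HasSum g b := by
  rw [show g = f from funext hf, ha]; exact h

theorem hasSum_hessSum {x : ℂ × ℝ} (hx : x.1 ≠ 0) (a b : ℂ × ℝ) :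
    HasSum (fun k : ℕ+ => fderiv ℝ (fderiv ℝ besselWave) ((k : ℝ) • x) a b) (hessSum x a b) := by
  have h := fun j i => (summable_waveL j i hx).hasSum
  have := ((((h 0 0).mul_left (-(a.2 * b.2 : ℂ))).add ((h 1 1).mul_left
    (-(2 * Real.pi * Complex.I * (a.2 * rdot x.1 b.1 + b.2 * rdot x.1 a.1))))).add
    ((h 1 0).mul_left (-(2 * Real.pi * rdot a.1 b.1 : ℂ)))).add ((h 2 2).mul_left
    (4 * Real.pi ^ 2 * rdot x.1 a.1 * rdot x.1 b.1 : ℂ))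
  refine hasSum_of_eq this (fun k => ?_) ?_
  -- The point is scaled by `k` but the directions are not, so each inner product with the base
  -- point contributes one power of `k`; this fixes the second index of `waveSum`.
  · have hk : (k : ℝ) • x ∈ {x : ℂ × ℝ | x.1 ≠ 0} := by
      simp [hx]
    rw [fderiv_fderiv_besselWave hk]
    have e : ∀ w, rdot ((k : ℝ) • x).1 w = k * rdot x.1 w := fun w => by simp [rdot]; ring
    rw [e, e]
    push_cast
    ring
  · unfold hessSum waveSum; ring

variable {ι : Type} [Fintype ι]

/-- The values of `Z` and `θ` on an integral combination of a frame. -/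
def evalComb (m : ι → ℤ) : (ι → ℂ) × (ι → ℝ) →L[ℝ] ℂ × ℝ :=
  LinearMap.toContinuousLinearMap
    { toFun := fun x => (∑ a, (m a : ℂ) * x.1 a, ∑ a, (m a : ℝ) * x.2 a)
      map_add' := fun x y => by simp [mul_add, Finset.sum_add_distrib]
      map_smul' := fun c x => by
        simp only [Prod.smul_fst, Prod.smul_snd, Pi.smul_apply, Prod.smul_mk, Finset.smul_sum,
          RingHom.id_apply]
        congr 1 <;> refine Finset.sum_congr rfl fun a _ => ?_
        · rw [mul_smul_comm]
        · rw [mul_smul_comm] }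

theorem evalComb_apply (m : ι → ℤ) (x : (ι → ℂ) × (ι → ℝ)) :
    evalComb m x = (∑ a, (m a : ℂ) * x.1 a, ∑ a, (m a : ℝ) * x.2 a) := rfl

/-- The `ℓ¹` norm of integral coordinates. -/
def combNorm (m : ι → ℤ) : ℝ := ∑ a, |(m a : ℝ)|

theorem one_le_combNorm {m : ι → ℤ} (hm : m ≠ 0) : 1 ≤ combNorm m := by
  obtain ⟨a, ha⟩ := Function.ne_iff.1 hm
  have h1 : (1 : ℝ) ≤ |(m a : ℝ)| := by exact_mod_cast Int.one_le_abs ha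
  exact h1.trans (Finset.single_le_sum (f := fun a => |(m a : ℝ)|) (fun _ _ => abs_nonneg _)
    (Finset.mem_univ a))

theorem combNorm_nonneg (m : ι → ℤ) : 0 ≤ combNorm m := Finset.sum_nonneg fun _ _ => abs_nonneg _

theorem norm_sum_mul_le (m : ι → ℤ) (ζ : ι → ℂ) : ‖∑ a, (m a : ℂ) * ζ a‖ ≤ combNorm m * ‖ζ‖ := by
  unfold combNorm
  rw [Finset.sum_mul]
  refine norm_sum_le_of_le _ fun a _ => ?_
  rw [norm_mul, Complex.norm_intCast]
  exact mul_le_mul_of_nonneg_left (norm_le_pi_norm ζ a) (abs_nonneg _)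

theorem norm_sum_mul_le' (m : ι → ℤ) (y : ι → ℝ) : ‖∑ a, (m a : ℝ) * y a‖ ≤ combNorm m * ‖y‖ := by
  unfold combNorm
  rw [Finset.sum_mul]
  refine norm_sum_le_of_le _ fun a _ => ?_
  rw [norm_mul, Real.norm_eq_abs]
  exact mul_le_mul_of_nonneg_left (norm_le_pi_norm y a) (abs_nonneg _)

theorem norm_evalComb_le (m : ι → ℤ) : ‖evalComb m‖ ≤ combNorm m := by
  refine ContinuousLinearMap.opNorm_le_bound _ (combNorm_nonneg m) fun x => ?_
  rw [evalComb_apply, Prod.norm_mk]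
  refine max_le ((norm_sum_mul_le m x.1).trans ?_) ((norm_sum_mul_le' m x.2).trans ?_)
  · exact mul_le_mul_of_nonneg_left (norm_fst_le x) (combNorm_nonneg m)
  · exact mul_le_mul_of_nonneg_left (norm_snd_le x) (combNorm_nonneg m)

/-- The terms of `2πi J` in flat coordinates. -/
def waveTerm (Ω : {m : ι → ℤ // m ≠ 0} → ℝ) (i : {m : ι → ℤ // m ≠ 0} × ℕ+)
    (x : (ι → ℂ) × (ι → ℝ)) : ℂ :=
  (Ω i.1 : ℂ) * (((i.2 : ℂ) ^ 2)⁻¹ * besselWave ((i.2 : ℝ) • evalComb i.1.1 x))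

end SpecialJoyce

end

/-! ### The potential in flat coordinates: convergence, reality and Hessian. -/

section

namespace SpecialJoyce
open Set Filter

section SecondDerivative
variable {E F G : Type*} [NormedAddCommGroup E] [NormedSpace ℝ E] [NormedAddCommGroup F]
  [NormedSpace ℝ F] [NormedAddCommGroup G] [NormedSpace ℝ G]

theorem fderiv_fderiv_apply {f : E → F} {s : Set E} (hs : IsOpen s) (hf : ContDiffOn ℝ ∞ f s) {x : E}
    (hx : x ∈ s) (a b : E) :
    fderiv ℝ (fderiv ℝ f) x a b = fderiv ℝ (fun y => fderiv ℝ f y b) x a := by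
  have hd : DifferentiableAt ℝ (fderiv ℝ f) x :=
    (((contDiffOn_infty_iff_fderiv_of_isOpen hs).1 hf).2.contDiffAt
      (hs.mem_nhds hx)).differentiableAt (by simp)
  rw [fderiv_clm_apply hd (differentiableAt_const b)]; simp

theorem fderiv_fderiv_comp_clm (ℓ : G →L[ℝ] E) {f : E → F} {s : Set E} (hs : IsOpen s)
    (hf : ContDiffOn ℝ ∞ f s) {x : G} (hx : ℓ x ∈ s) (a b : G) :
    fderiv ℝ (fderiv ℝ (fun y => f (ℓ y))) x a b = fderiv ℝ (fderiv ℝ f) (ℓ x) (ℓ a) (ℓ b) := by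
  have hs' : IsOpen (ℓ ⁻¹' s) := hs.preimage ℓ.continuous
  rw [fderiv_fderiv_apply (f := fun y => f (ℓ y)) hs' (hf.comp ℓ.contDiff.contDiffOn fun _ h => h) hx,
    fderiv_fderiv_apply hs hf hx]
  have h : (fun y => fderiv ℝ (fun y => f (ℓ y)) y b) =ᶠ[𝓝 x]
      fun y => (fun e => fderiv ℝ f e (ℓ b)) (ℓ y) := by
    filter_upwards [hs'.mem_nhds hx] with y hy
    have := ((hf.contDiffAt (hs.mem_nhds hy)).differentiableAt (by simp)).hasFDerivAt.comp y ℓ.hasFDerivAt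
    change fderiv ℝ (f ∘ ℓ) y b = _
    rw [this.fderiv]; rfl
  have hd : DifferentiableAt ℝ (fun e => fderiv ℝ f e (ℓ b)) (ℓ x) :=
    ((((contDiffOn_infty_iff_fderiv_of_isOpen hs).1 hf).2.contDiffAt
      (hs.mem_nhds hx)).differentiableAt (by simp)).clm_apply (differentiableAt_const _)
  have h2 := hd.hasFDerivAt.comp x ℓ.hasFDerivAt
  rw [h.fderiv_eq]
  change fderiv ℝ ((fun e => fderiv ℝ f e (ℓ b)) ∘ ℓ) x a = _
  rw [h2.fderiv]; rfl

theorem fderiv_fderiv_clm_comp (L : F →L[ℝ] G) {f : E → F} {s : Set E} (hs : IsOpen s)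
    (hf : ContDiffOn ℝ ∞ f s) {x : E} (hx : x ∈ s) (a b : E) :
    fderiv ℝ (fderiv ℝ (fun y => L (f y))) x a b = L (fderiv ℝ (fderiv ℝ f) x a b) := by
  rw [fderiv_fderiv_apply (f := fun y => L (f y)) hs (L.contDiff.comp_contDiffOn hf) hx, fderiv_fderiv_apply hs hf hx]
  have h : (fun y => fderiv ℝ (fun y => L (f y)) y b) =ᶠ[𝓝 x] fun y => L (fderiv ℝ f y b) := by
    filter_upwards [hs.mem_nhds hx] with y hy
    have := L.hasFDerivAt.comp y ((hf.contDiffAt (hs.mem_nhds hy)).differentiableAt (by simp)).hasFDerivAt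
    change fderiv ℝ (L ∘ f) y b = _
    rw [this.fderiv]; rfl
  have hd : DifferentiableAt ℝ (fun e => fderiv ℝ f e b) x :=
    ((((contDiffOn_infty_iff_fderiv_of_isOpen hs).1 hf).2.contDiffAt
      (hs.mem_nhds hx)).differentiableAt (by simp)).clm_apply (differentiableAt_const _)
  have h2 := L.hasFDerivAt.comp x hd.hasFDerivAt
  rw [h.fderiv_eq]
  change fderiv ℝ (L ∘ fun y => fderiv ℝ f y b) x a = _
  rw [h2.fderiv]; rfl

end SecondDerivative

variable {ι : Type} [Fintype ι]

/-- The domain of flat coordinates with values of `Z` near `ζ₀`. -/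
def flatDomain (ζ₀ : ι → ℂ) (c : ℝ) : Set ((ι → ℂ) × (ι → ℝ)) := {x | ‖x.1 - ζ₀‖ < c / 2}

theorem flatDomain_eq (ζ₀ : ι → ℂ) (c : ℝ) :
    flatDomain ζ₀ c = ContinuousLinearMap.fst ℝ (ι → ℂ) (ι → ℝ) ⁻¹' Metric.ball ζ₀ (c / 2) := by
  ext x; simp [flatDomain, dist_eq_norm]

theorem isOpen_flatDomain (ζ₀ : ι → ℂ) (c : ℝ) : IsOpen (flatDomain ζ₀ c) := by
  rw [flatDomain_eq]
  exact Metric.isOpen_ball.preimage (ContinuousLinearMap.continuous _)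

theorem isPreconnected_flatDomain (ζ₀ : ι → ℂ) (c : ℝ) : IsPreconnected (flatDomain ζ₀ c) := by
  rw [flatDomain_eq]
  exact ((convex_ball ζ₀ (c / 2)).linear_preimage
    (ContinuousLinearMap.fst ℝ (ι → ℂ) (ι → ℝ)).toLinearMap).isPreconnected

/-- Support and convergence of integral indices at the values `ζ₀` of `Z` on a frame. -/
structure FlatBPS (Ω : {m : ι → ℤ // m ≠ 0} → ℝ) (ζ₀ : ι → ℂ) (c : ℝ) : Prop where
  pos : 0 < c
  supp : ∀ m, Ω m ≠ 0 → c * combNorm m.1 ≤ ‖∑ a, (m.1 a : ℂ) * ζ₀ a‖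
  conv : ∀ R : ℝ, 0 < R → Summable fun m => |Ω m| * Real.exp (-R * ‖∑ a, (m.1 a : ℂ) * ζ₀ a‖)
  symm : ∀ m, Ω ⟨-m.1, neg_ne_zero.2 m.2⟩ = Ω m

/-- The real potential `-iJ` in flat coordinates. -/
def flatPotential (Ω : {m : ι → ℤ // m ≠ 0} → ℝ) (x : (ι → ℂ) × (ι → ℝ)) : ℝ :=
  -(1 / (2 * Real.pi)) * (∑' i, waveTerm Ω i x).re

namespace FlatBPS
variable {Ω : {m : ι → ℤ // m ≠ 0} → ℝ} {ζ₀ : ι → ℂ} {c : ℝ} (hB : FlatBPS Ω ζ₀ c)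
include hB

theorem le_norm {m : {m : ι → ℤ // m ≠ 0}} (hm : Ω m ≠ 0) : c ≤ ‖∑ a, (m.1 a : ℂ) * ζ₀ a‖ := by
  have h1 := hB.supp m hm
  have h2 := one_le_combNorm m.2
  have := hB.pos
  nlinarith

/-- Moving the periods by less than `c/2` changes `Z_m` by at most `(c/2)` times the `ℓ¹` norm of
`m`, which the support property bounds by half of `|Z_m|` at `ζ₀`. -/
theorem half_norm_le {m : {m : ι → ℤ // m ≠ 0}} (hm : Ω m ≠ 0) {x : (ι → ℂ) × (ι → ℝ)}
    (hx : x ∈ flatDomain ζ₀ c) :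
    1 / 2 * ‖∑ a, (m.1 a : ℂ) * ζ₀ a‖ ≤ ‖(evalComb m.1 x).1‖ := by
  have h1 := hB.supp m hm
  have h2 := norm_sum_mul_le m.1 (x.1 - ζ₀)
  have h3 : combNorm m.1 * ‖x.1 - ζ₀‖ ≤ combNorm m.1 * (c / 2) :=
    mul_le_mul_of_nonneg_left (le_of_lt hx) (combNorm_nonneg _)
  have h4 : (evalComb m.1 x).1 - ∑ a, (m.1 a : ℂ) * (x.1 - ζ₀) a = ∑ a, (m.1 a : ℂ) * ζ₀ a := by
    rw [evalComb_apply, ← Finset.sum_sub_distrib]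
    exact Finset.sum_congr rfl fun a _ => by simp; ring
  have h5 := norm_sub_le (evalComb m.1 x).1 (∑ a, (m.1 a : ℂ) * (x.1 - ζ₀) a)
  rw [h4] at h5
  linarith

theorem evalComb_ne_zero {m : {m : ι → ℤ // m ≠ 0}} (hm : Ω m ≠ 0) {x : (ι → ℂ) × (ι → ℝ)}
    (hx : x ∈ flatDomain ζ₀ c) : (evalComb m.1 x).1 ≠ 0 := by
  have h1 := hB.half_norm_le hm hx
  have h2 := hB.le_norm hm
  have := hB.pos
  exact norm_pos_iff.1 (by linarith)

theorem contDiffOn_waveTerm (i : {m : ι → ℤ // m ≠ 0} × ℕ+) :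
    ContDiffOn ℝ ∞ (waveTerm Ω i) (flatDomain ζ₀ c) := by
  by_cases hm : Ω i.1 = 0
  · have : waveTerm Ω i = fun _ => 0 := by funext x; simp [waveTerm, hm]
    rw [this]; exact contDiffOn_const
  · refine contDiffOn_const.mul (contDiffOn_const.mul (contDiffOn_besselWave.comp
      ((evalComb i.1.1).contDiff.const_smul (i.2 : ℝ)).contDiffOn fun x hx => ?_))
    have hk : ((i.2 : ℕ) : ℝ) ≠ 0 := by exact_mod_cast i.2.ne_zero
    simpa using hB.evalComb_ne_zero hm hx

/-- With `y = |Z_m|` at `ζ₀`, the chain rule costs `j` factors of at most `k y / c` by the support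
property, whereas the wave decays like `exp(-k y / 2)`. A quarter of the exponent absorbs the
polynomial, and the other `exp(-k y / 4)` splits, using `k ≥ 1` and `y ≥ c`, into a factor in the
charge and a geometric factor in `k`. -/
theorem exists_norm_iteratedFDeriv_waveTerm_le (j : ℕ) :
    ∃ C, 0 ≤ C ∧ ∀ i, ∀ x ∈ flatDomain ζ₀ c, ‖iteratedFDeriv ℝ j (waveTerm Ω i) x‖
      ≤ C * ((|Ω i.1| * Real.exp (-(1 / 8) * ‖∑ a, (i.1.1 a : ℂ) * ζ₀ a‖))
        * Real.exp (-(c / 8)) ^ (i.2 : ℕ)) := by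
  have hc := hB.pos
  obtain ⟨C, hC0, hC⟩ := exists_norm_iteratedFDeriv_besselWave_le j (half_pos hc)
  refine ⟨C * ((4 / c) ^ j * j.factorial), by positivity, fun i x hx => ?_⟩
  -- Charges of index zero carry no support bound, so `Z_m` may vanish there; their terms are
  -- identically zero and are treated apart.
  by_cases hm : Ω i.1 = 0
  · have : waveTerm Ω i = fun _ => 0 := by funext x; simp [waveTerm, hm]
    rw [this]
    have h0 : iteratedFDeriv ℝ j (fun _ : (ι → ℂ) × (ι → ℝ) => (0 : ℂ)) x = 0 :=
      congrFun (iteratedFDeriv_fun_zero (𝕜 := ℝ)) x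
    rw [h0, norm_zero]
    positivity
  set y := ‖∑ a, (i.1.1 a : ℂ) * ζ₀ a‖ with hy
  have hk : (1 : ℝ) ≤ (i.2 : ℕ) := by exact_mod_cast i.2.one_le
  set k : ℝ := ((i.2 : ℕ) : ℝ) with hkdef
  have hcy : c ≤ y := hB.le_norm hm
  have hz : 1 / 2 * y ≤ ‖(evalComb i.1.1 x).1‖ := hB.half_norm_le hm hx
  set ℓ : (ι → ℂ) × (ι → ℝ) →L[ℝ] ℂ × ℝ := k • evalComb i.1.1 with hℓ
  have hnz : ‖(ℓ x).1‖ = k * ‖(evalComb i.1.1 x).1‖ := by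
    rw [hℓ]; simp [abs_of_nonneg (zero_le_one.trans hk)]
  have hge : k * (1 / 2 * y) ≤ ‖(ℓ x).1‖ := by rw [hnz]; gcongr
  have hge2 : c / 2 ≤ ‖(ℓ x).1‖ := by nlinarith
  have hmem : ℓ x ∈ {x : ℂ × ℝ | x.1 ≠ 0} := by
    intro h0; rw [h0, norm_zero] at hge2; linarith
  have h1 := norm_iteratedFDeriv_comp_clm_le ℓ isOpen_fst_ne_zero contDiffOn_besselWave j hmem
  have h2 : ‖ℓ‖ ≤ k * y / c := by
    rw [hℓ, norm_smul, Real.norm_of_nonneg (zero_le_one.trans hk), mul_div_assoc]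
    gcongr
    rw [le_div_iff₀ hc, mul_comm]
    exact (mul_le_mul_of_nonneg_left (norm_evalComb_le _) hc.le).trans (hB.supp _ hm)
  have hcd : ContDiffAt ℝ j (fun x => besselWave (ℓ x)) x :=
    ((contDiffOn_besselWave.contDiffAt (isOpen_fst_ne_zero.mem_nhds hmem)).comp x
      ℓ.contDiff.contDiffAt).of_le (by exact_mod_cast le_top)
  have h3 : waveTerm Ω i = ((Ω i.1 : ℂ) * ((i.2 : ℂ) ^ 2)⁻¹) • fun x => besselWave (ℓ x) := by
    funext x
    simp only [waveTerm, Pi.smul_apply, smul_eq_mul, mul_assoc]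
    rfl
  rw [h3, iteratedFDeriv_const_smul_apply hcd, norm_smul, norm_mul, norm_inv, norm_pow,
    Complex.norm_natCast, Complex.norm_real, Real.norm_eq_abs]
  have h4 : (k ^ 2)⁻¹ ≤ 1 := inv_le_one_of_one_le₀ (one_le_pow₀ hk)
  have h5 : (k * y / c) ^ j ≤ (4 / c) ^ j * (j.factorial * Real.exp (k * y / 4)) := by
    have h6 := Real.pow_div_factorial_le_exp (k * y / 4) (by positivity) j
    rw [div_le_iff₀ (by positivity)] at h6
    calc _ = (4 / c) ^ j * (k * y / 4) ^ j := by rw [← mul_pow]; congr 1; field_simp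
      _ ≤ _ := by gcongr; linarith
  have h7 : Real.exp (k * y / 4) * Real.exp (-(k * (1 / 2 * y)))
      ≤ Real.exp (-(1 / 8) * y) * Real.exp (-(c / 8)) ^ (i.2 : ℕ) := by
    rw [← Real.exp_add, ← Real.exp_nat_mul, ← Real.exp_add, Real.exp_le_exp, ← hkdef]
    nlinarith
  calc |Ω i.1| * (k ^ 2)⁻¹ * ‖iteratedFDeriv ℝ j (fun x => besselWave (ℓ x)) x‖
      ≤ |Ω i.1| * 1 * (C * Real.exp (-(k * (1 / 2 * y))) * ((4 / c) ^ j * (j.factorial * Real.exp (k * y / 4)))) := by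
        refine mul_le_mul (mul_le_mul_of_nonneg_left h4 (abs_nonneg _)) (h1.trans ?_) (norm_nonneg _)
          (by positivity)
        refine mul_le_mul ((hC _ hge2).trans ?_) ((pow_le_pow_left₀ (norm_nonneg _) h2 j).trans h5)
          (by positivity) (by positivity)
        gcongr
    _ = C * ((4 / c) ^ j * j.factorial) * |Ω i.1| * (Real.exp (k * y / 4) * Real.exp (-(k * (1 / 2 * y)))) := by ring
    _ ≤ C * ((4 / c) ^ j * j.factorial) * |Ω i.1| * (Real.exp (-(1 / 8) * y) * Real.exp (-(c / 8)) ^ (i.2 : ℕ)) := by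
        gcongr
    _ = _ := by ring

theorem exists_summable_bound : ∃ v : ℕ → {m : ι → ℤ // m ≠ 0} × ℕ+ → ℝ, (∀ k, Summable (v k)) ∧
    ∀ k i, ∀ x ∈ flatDomain ζ₀ c, ‖iteratedFDeriv ℝ k (waveTerm Ω i) x‖ ≤ v k i := by
  choose C hC0 hC using hB.exists_norm_iteratedFDeriv_waveTerm_le
  have hg : Summable fun k : ℕ+ => Real.exp (-(c / 8)) ^ (k : ℕ) := by
    have h1 : Real.exp (-(c / 8)) < 1 := by
      rw [Real.exp_lt_one_iff]; linarith [hB.pos]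
    exact (summable_geometric_of_lt_one (Real.exp_pos _).le h1).comp_injective PNat.coe_injective
  have hf := hB.conv (1 / 8) (by norm_num)
  set f : {m : ι → ℤ // m ≠ 0} → ℝ := fun m =>
    |Ω m| * Real.exp (-(1 / 8) * ‖∑ a, (m.1 a : ℂ) * ζ₀ a‖)
  set g : ℕ+ → ℝ := fun k => Real.exp (-(c / 8)) ^ (k : ℕ)
  have hf0 : 0 ≤ f := fun m => mul_nonneg (abs_nonneg _) (Real.exp_pos _).le
  have hg0 : 0 ≤ g := fun k => (pow_pos (Real.exp_pos _) _).le
  have h := Summable.mul_of_nonneg hf hg hf0 hg0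
  exact ⟨fun k i => C k * (f i.1 * g i.2), fun k => h.mul_left (C k), hC⟩

theorem summable_waveTerm {x : (ι → ℂ) × (ι → ℝ)} (hx : x ∈ flatDomain ζ₀ c) :
    Summable fun i => waveTerm Ω i x := by
  obtain ⟨v, hv, hb⟩ := hB.exists_summable_bound
  refine Summable.of_norm_bounded (hv 0) fun i => ?_
  rw [← norm_iteratedFDeriv_zero (𝕜 := ℝ) (f := waveTerm Ω i)]
  exact hb 0 i x hx

theorem contDiffOn_tsum_waveTerm :
    ContDiffOn ℝ ∞ (fun x => ∑' i, waveTerm Ω i x) (flatDomain ζ₀ c) := by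
  obtain ⟨v, hv, hb⟩ := hB.exists_summable_bound
  exact contDiffOn_tsum_of_isOpen (isOpen_flatDomain _ _) (isPreconnected_flatDomain _ _)
    hB.contDiffOn_waveTerm hv hb

theorem contDiffOn_flatPotential : ContDiffOn ℝ ∞ (flatPotential Ω) (flatDomain ζ₀ c) :=
  contDiffOn_const.mul (Complex.reCLM.contDiff.comp_contDiffOn hB.contDiffOn_tsum_waveTerm)

/-- Replacing `m` by `-m` conjugates each term and preserves `Ω`, so the sum is real and taking the
real part in `flatPotential` loses nothing. -/
theorem tsum_waveTerm (x : (ι → ℂ) × (ι → ℝ)) :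
    ∑' i, waveTerm Ω i x = ((-(2 * Real.pi) * flatPotential Ω x : ℝ) : ℂ) := by
  have h1 : (starRingEnd ℂ) (∑' i, waveTerm Ω i x) = ∑' i, waveTerm Ω i x := by
    rw [Complex.conj_tsum]
    let σ : {m : ι → ℤ // m ≠ 0} ≃ {m : ι → ℤ // m ≠ 0} :=
      (Equiv.neg (ι → ℤ)).subtypeEquiv fun m => by simp
    rw [← (σ.prodCongr (Equiv.refl ℕ+)).tsum_eq]
    refine tsum_congr fun i => ?_
    have e1 : Ω (σ i.1) = Ω i.1 := hB.symm i.1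
    have e2 : evalComb (σ i.1).1 x = - evalComb i.1.1 x := by
      change evalComb (-i.1.1) x = _
      rw [evalComb_apply, evalComb_apply]
      simp
    simp only [waveTerm, Equiv.prodCongr_apply, Prod.map_fst, Prod.map_snd, Equiv.refl_apply, e1, e2,
      map_mul, Complex.conj_ofReal, map_inv₀, map_pow, Complex.conj_natCast]
    congr 2
    unfold besselWave besselRadial
    simp [← Complex.exp_conj]
  have h2 := Complex.conj_eq_iff_re.1 h1
  rw [← h2, flatPotential]
  push_cast
  have : (Real.pi : ℂ) ≠ 0 := by exact_mod_cast Real.pi_ne_zero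
  field_simp

theorem hasSum_fderiv_fderiv_flatPotential {x : (ι → ℂ) × (ι → ℝ)} (hx : x ∈ flatDomain ζ₀ c)
    (a b : (ι → ℂ) × (ι → ℝ)) :
    HasSum (fun m => (Ω m : ℂ) * hessSum (evalComb m.1 x) (evalComb m.1 a) (evalComb m.1 b))
      (-(2 * Real.pi) * fderiv ℝ (fderiv ℝ (flatPotential Ω)) x a b) := by
  obtain ⟨v, hv, hb⟩ := hB.exists_summable_bound
  have h1 := hasSum_fderiv_fderiv_of_bound (isOpen_flatDomain _ _) (isPreconnected_flatDomain _ _)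
    hB.contDiffOn_waveTerm hv hb hx a b
  have h2 : ∀ i, fderiv ℝ (fderiv ℝ (waveTerm Ω i)) x a b = (Ω i.1 : ℂ) * fderiv ℝ (fderiv ℝ besselWave)
      ((i.2 : ℝ) • evalComb i.1.1 x) (evalComb i.1.1 a) (evalComb i.1.1 b) := fun i => by
    by_cases hm : Ω i.1 = 0
    · have : waveTerm Ω i = fun _ => 0 := by funext x; simp [waveTerm, hm]
      rw [this, hm]
      simp
    have hk : ((i.2 : ℕ) : ℝ) ≠ 0 := by exact_mod_cast i.2.ne_zero
    have hk' : ((i.2 : ℕ) : ℂ) ≠ 0 := by exact_mod_cast i.2.ne_zero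
    set ℓ : (ι → ℂ) × (ι → ℝ) →L[ℝ] ℂ × ℝ := ((i.2 : ℕ) : ℝ) • evalComb i.1.1 with hℓ
    have hmem : ℓ x ∈ {x : ℂ × ℝ | x.1 ≠ 0} := by
      simpa [hℓ] using hB.evalComb_ne_zero hm hx
    let L : ℂ →L[ℝ] ℂ := ((Ω i.1 : ℂ) * ((i.2 : ℂ) ^ 2)⁻¹) • ContinuousLinearMap.id ℝ ℂ
    have h3 : waveTerm Ω i = fun x => L (besselWave (ℓ x)) := by
      funext x
      simp only [waveTerm, L, ContinuousLinearMap.smul_apply, smul_eq_mul, mul_assoc]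
      rfl
    have hs' : IsOpen (ℓ ⁻¹' {x : ℂ × ℝ | x.1 ≠ 0}) := isOpen_fst_ne_zero.preimage ℓ.continuous
    rw [h3, fderiv_fderiv_clm_comp L (f := fun x => besselWave (ℓ x)) hs'
      (contDiffOn_besselWave.comp ℓ.contDiff.contDiffOn fun _ h => h) hmem,
      fderiv_fderiv_comp_clm ℓ isOpen_fst_ne_zero contDiffOn_besselWave hmem]
    have e : ∀ y, ℓ y = ((i.2 : ℕ) : ℝ) • evalComb i.1.1 y := fun _ => rfl
    rw [e, e, e]
    simp only [L, map_smul, ContinuousLinearMap.smul_apply, smul_eq_mul, Complex.real_smul,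
      ContinuousLinearMap.id_apply]
    push_cast
    -- The two factors `k` from the chain rule cancel the `k⁻²` of the term.
    field_simp
  simp only [h2] at h1
  have h4 : HasSum (fun m => (Ω m : ℂ) * hessSum (evalComb m.1 x) (evalComb m.1 a) (evalComb m.1 b))
      (fderiv ℝ (fderiv ℝ fun y => ∑' i, waveTerm Ω i y) x a b) := by
    -- Summing over `k` first collapses each charge to `hessSum`.
    refine h1.prod_fiberwise fun m => ?_
    by_cases hm : Ω m = 0
    · simp only [hm, Complex.ofReal_zero, zero_mul]; exact hasSum_zero
    · exact (hasSum_hessSum (hB.evalComb_ne_zero hm hx) _ _).mul_left _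
  have h5 : (fun y => ∑' i, waveTerm Ω i y) =
      fun y => ((-(2 * Real.pi)) • Complex.ofRealCLM) (flatPotential Ω y) := by
    funext y
    rw [hB.tsum_waveTerm]
    simp
  rw [h5, fderiv_fderiv_clm_comp _ (isOpen_flatDomain _ _) hB.contDiffOn_flatPotential hx] at h4
  simpa using h4

end FlatBPS
end SpecialJoyce

end

/-! ### Lattice coordinates, local models and smoothness of `J`. -/

section

namespace SpecialJoyce
open Set Filter

section Base
variable {n : ℕ} {M : Type*} [TopologicalSpace M] [ChartedSpace (Model n) M]
  [IsManifold 𝓘(ℂ, Model n) ω M]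

section Lattice
variable {Γ : ∀ p : M, AddSubgroup (T n p)} {form : ∀ p : M, LinearMap.BilinForm ℝ (T n p)}
  {U : Set M} {e : Fin n ⊕ Fin n → ∀ p : M, T n p}

theorem comb_eq_real (m : Fin n ⊕ Fin n → ℤ) (p : M) :
    comb e m p = ∑ a, (m a : ℝ) • e a p :=
  Finset.sum_congr rfl fun a _ => (Int.cast_smul_eq_zsmul ℝ _ _).symm

variable (hF : IsDarbouxFrame Γ form U e)
include hF

theorem IsDarbouxFrame.comb_mem {p : M} (hp : p ∈ U) (m : Fin n ⊕ Fin n → ℤ) : comb e m p ∈ Γ p := by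
  rw [← hF.span p hp]
  exact sum_mem fun a _ => zsmul_mem (AddSubgroup.subset_closure (mem_range_self a)) _

theorem IsDarbouxFrame.comb_injective {p : M} (hp : p ∈ U) :
    Function.Injective fun m : Fin n ⊕ Fin n → ℤ => comb e m p := by
  intro m m' h
  simp only [comb_eq_real] at h
  have h1 := Fintype.linearIndependent_iff.1 (hF.linInd p hp) (fun a => (m a : ℝ) - m' a)
    (by simp only [sub_smul, Finset.sum_sub_distrib, h, sub_self])
  funext a
  have := h1 a
  exact_mod_cast sub_eq_zero.1 this

omit hF in
theorem comb_zero (p : M) : comb e 0 p = 0 := by simp [comb]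

omit hF in
theorem comb_neg (m : Fin n ⊕ Fin n → ℤ) (p : M) : comb e (-m) p = - comb e m p := by
  simp [comb]

omit hF in
theorem comb_add (m m' : Fin n ⊕ Fin n → ℤ) (p : M) : comb e (m + m') p = comb e m p + comb e m' p := by
  simp [comb, add_smul, Finset.sum_add_distrib]

theorem IsDarbouxFrame.comb_ne_zero {p : M} (hp : p ∈ U) {m : Fin n ⊕ Fin n → ℤ} (hm : m ≠ 0) :
    comb e m p ≠ 0 := fun h => hm (hF.comb_injective hp (h.trans (comb_zero p).symm))

theorem IsDarbouxFrame.exists_comb {p : M} (hp : p ∈ U) {γ : T n p} (hγ : γ ∈ Γ p) :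
    ∃ m, comb e m p = γ := by
  classical
  rw [← hF.span p hp] at hγ
  induction hγ using AddSubgroup.closure_induction with
  | mem x hx =>
    obtain ⟨a, rfl⟩ := hx
    exact ⟨Pi.single a 1, by simp [comb, Pi.single_apply, ite_smul]⟩
  | zero => exact ⟨0, comb_zero p⟩
  | add x y _ _ hx hy =>
    obtain ⟨m, rfl⟩ := hx
    obtain ⟨m', rfl⟩ := hy
    exact ⟨m + m', comb_add m m' p⟩
  | neg x _ hx =>
    obtain ⟨m, rfl⟩ := hx
    exact ⟨-m, comb_neg m p⟩

/-- The nonzero elements of the lattice in terms of the coordinates of a frame. -/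
def IsDarbouxFrame.latticeEquiv {p : M} (hp : p ∈ U) :
    {m : Fin n ⊕ Fin n → ℤ // m ≠ 0} ≃ {γ : T n p // γ ∈ Γ p ∧ γ ≠ 0} :=
  Equiv.ofBijective (fun m => ⟨comb e m.1 p, hF.comb_mem hp _, hF.comb_ne_zero hp m.2⟩) (by
    constructor
    · intro m m' h
      exact Subtype.ext (hF.comb_injective hp (congrArg Subtype.val h))
    · rintro ⟨γ, hγ, h0⟩
      obtain ⟨m, rfl⟩ := hF.exists_comb hp hγ
      exact ⟨⟨m, fun h => h0 (by rw [h, comb_zero])⟩, rfl⟩)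

end Lattice

variable {P : SpecialPeriodStructure n M} (B : UncoupledBPS P)

/-- A Darboux frame near `p₀` along which the indices are constant and `Z` varies little. -/
structure LocalModel (p₀ : M) (U : Set M) (e : Fin n ⊕ Fin n → ∀ p : M, T n p)
    (Ω : {m : Fin n ⊕ Fin n → ℤ // m ≠ 0} → ℝ) (c : ℝ) : Prop where
  frame : IsDarbouxFrame P.Γ P.form U e
  mem : p₀ ∈ U
  bps : FlatBPS Ω (periodFun P e p₀) c
  index : ∀ q ∈ U, ∀ m, (B.index q (comb e m.1 q) : ℝ) = Ω m
  near : ∀ q ∈ U, ‖periodFun P e q - periodFun P e p₀‖ < c / 2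

theorem Z_comb (e : Fin n ⊕ Fin n → ∀ p : M, T n p) (m : Fin n ⊕ Fin n → ℤ) (p : M) :
    P.Z p (comb e m p) = ∑ a, (m a : ℂ) * periodFun P e p a := by
  rw [comb_eq_real, map_sum]
  exact Finset.sum_congr rfl fun a _ => by rw [map_smul]; simp [periodFun]

theorem form_comb (e : Fin n ⊕ Fin n → ∀ p : M, T n p) (m : Fin n ⊕ Fin n → ℤ) (p : M) (u : T n p) :
    P.form p u (comb e m p) = ∑ a, (m a : ℝ) * low P.form e p u a := by
  rw [comb_eq_real, map_sum]
  exact Finset.sum_congr rfl fun a _ => by rw [map_smul]; rfl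

theorem exists_seminorm (e : Fin n ⊕ Fin n → ∀ p : M, T n p) :
    ∃ nrm : ∀ p : M, Seminorm ℝ (T n p), ∀ p u, nrm p u = ‖low P.form e p u‖ :=
  ⟨fun p => (normSeminorm ℝ (Fin n ⊕ Fin n → ℝ)).comp (low P.form e p), fun _ _ => rfl⟩

theorem norm_low_comb {U : Set M} {e : Fin n ⊕ Fin n → ∀ p : M, T n p}
    (hF : IsDarbouxFrame P.Γ P.form U e) {p : M} (hp : p ∈ U) (m : Fin n ⊕ Fin n → ℤ) :
    combNorm m ≤ (n + n) * ‖low P.form e p (comb e m p)‖ := by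
  have h : ∀ a, |(m a : ℝ)| ≤ ‖low P.form e p (comb e m p)‖ := by
    intro a
    rw [comb_eq_real, hF.low_comb P.skew hp]
    rcases a with i | i
    · have := norm_le_pi_norm (Sum.elim (fun i => -(m (Sum.inr i) : ℝ)) (fun i => (m (Sum.inl i) : ℝ))) (Sum.inr i)
      simpa using this
    · have := norm_le_pi_norm (Sum.elim (fun i => -(m (Sum.inr i) : ℝ)) (fun i => (m (Sum.inl i) : ℝ))) (Sum.inl i)
      simpa using this
  unfold combNorm
  refine (Finset.sum_le_sum fun a _ => h a).trans ?_
  simp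

theorem exists_flatBPS {U : Set M} {e : Fin n ⊕ Fin n → ∀ p : M, T n p}
    (hF : IsDarbouxFrame P.Γ P.form U e) {p : M} (hp : p ∈ U) :
    ∃ c, FlatBPS (fun m => (B.index p (comb e m.1 p) : ℝ)) (periodFun P e p) c := by
  -- The support property is used over a single point, with the norm of the vector of pairings with
  -- the frame; on lattice vectors this is the sup norm of the integral coordinates.
  obtain ⟨nrm, hnrm⟩ := exists_seminorm (P := P) e
  obtain ⟨C, hC, hsupp⟩ := B.support {p} nrm isCompact_singleton
    (by
      rintro q rfl u hu
      rw [hnrm, norm_eq_zero] at hu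
      exact (hF.low_bijective P.skew hp).1 (hu.trans (map_zero _).symm))
    (by
      have h1 := (hF.contMDiffOn_low P.skew).continuousOn.norm
      refine (h1.mono ?_).congr fun V _ => hnrm V.proj V.2
      rintro V rfl
      exact hp)
  have hn : (0 : ℝ) < n + n + 1 := by positivity
  -- The factor `2n` compares the `ℓ¹` norm with the sup norm; the extra `1` keeps the denominator
  -- positive when `n = 0`.
  refine ⟨C / (n + n + 1), by positivity, fun m hm => ?_, fun R hR => ?_, fun m => ?_⟩
  · have h1 := hsupp p rfl _ (hF.comb_mem hp m.1) (hF.comb_ne_zero hp m.2) (by exact_mod_cast hm)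
    rw [hnrm, Z_comb] at h1
    refine le_trans ?_ h1.le
    have h2 := norm_low_comb hF hp m.1
    rw [div_mul_eq_mul_div, div_le_iff₀ hn, mul_assoc]
    refine mul_le_mul_of_nonneg_left (h2.trans ?_) hC.le
    rw [mul_comm]
    refine mul_le_mul_of_nonneg_left (by linarith) (norm_nonneg _)
  · obtain ⟨b, hb, h⟩ := B.convergence R hR U e hF {p} (by simpa using hp) isCompact_singleton
    refine Summable.of_nonneg_of_le (fun m => by positivity) (fun m => ?_) hb
    have := h m p rfl
    rwa [Z_comb] at this
  · have := B.symm p _ (hF.comb_mem hp m.1) (hF.comb_ne_zero hp m.2)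
    dsimp only
    rw [comb_neg, this]

theorem index_locally_constant {U : Set M} {e : Fin n ⊕ Fin n → ∀ p : M, T n p}
    (hF : IsDarbouxFrame P.Γ P.form U e) (hU : IsPreconnected U) {p q : M} (hp : p ∈ U) (hq : q ∈ U)
    {m : Fin n ⊕ Fin n → ℤ} (hm : m ≠ 0) :
    B.index q (comb e m q) = B.index p (comb e m p) := by
  have h1 : IsLocallyConstant fun x : U => B.index x.1 (comb e m x.1) := by
    rw [IsLocallyConstant.iff_eventually_eq]
    intro x
    have := B.wallCrossing U e hF m hm x.1 x.2
    exact continuous_subtype_val.continuousAt.eventually this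
  have := isPreconnected_iff_preconnectedSpace.1 hU
  exact h1.apply_eq_of_preconnectedSpace ⟨q, hq⟩ ⟨p, hp⟩

theorem contMDiffOn_periodFun {U : Set M} {e : Fin n ⊕ Fin n → ∀ p : M, T n p}
    (hF : IsDarbouxFrame P.Γ P.form U e) :
    ContMDiffOn 𝓘(ℝ, Model n) 𝓘(ℝ, Fin n ⊕ Fin n → ℂ) ∞ (periodFun P e) U :=
  contMDiffOn_pi_space.2 fun a _ hp => (contMDiffAt_period P hF hp a).contMDiffWithinAt

/-- The neighbourhood is shrunk to be connected, so that the locally constant indices are constant,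
and small enough that the periods stay within `c/2` of their values at `p`. The frame itself is
kept. -/
theorem exists_localModel {U : Set M} {e : Fin n ⊕ Fin n → ∀ p : M, T n p}
    (hF : IsDarbouxFrame P.Γ P.form U e) {p : M} (hp : p ∈ U) :
    ∃ U' ⊆ U, ∃ Ω c, LocalModel B p U' e Ω c := by
  obtain ⟨c, hc⟩ := exists_flatBPS B hF hp
  have : LocallyConnectedSpace M := ChartedSpace.locallyConnectedSpace (Model n) M
  have h1 : {q | ‖periodFun P e q - periodFun P e p‖ < c / 2} ∈ 𝓝 p := by
    have hcont := (contMDiffOn_periodFun hF).continuousOn.continuousAt (hF.isOpen.mem_nhds hp)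
    have := hcont.eventually (Metric.ball_mem_nhds (periodFun P e p) (half_pos hc.pos))
    filter_upwards [this] with q hq
    exact (dist_eq_norm _ _).symm.trans_lt hq
  obtain ⟨U', hU', ho, hpU', hcon⟩ := locallyConnectedSpace_iff_subsets_isOpen_isConnected.1 this p _
    (Filter.inter_mem h1 (hF.isOpen.mem_nhds hp))
  have hF' := hF.restrict ho (hU'.trans inter_subset_right)
  refine ⟨U', hU'.trans inter_subset_right, _, c, hF', hpU', hc, fun q hq m => ?_,
    fun q hq => (hU' hq).1⟩
  exact_mod_cast index_locally_constant B hF' hcon.isPreconnected hpU' hq m.2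

/-- The values of `Z` and `θ` on a frame. -/
def flatMap (P : SpecialPeriodStructure n M) (e : Fin n ⊕ Fin n → ∀ p : M, T n p) (V : TM n M) :
    (Fin n ⊕ Fin n → ℂ) × (Fin n ⊕ Fin n → ℝ) :=
  (periodFun P e V.proj, low P.form e V.proj V.2)

theorem evalComb_flatMap (e : Fin n ⊕ Fin n → ∀ p : M, T n p) (m : Fin n ⊕ Fin n → ℤ) (V : TM n M) :
    evalComb m (flatMap P e V)
      = (P.Z V.proj (comb e m V.proj), P.form V.proj V.2 (comb e m V.proj)) := by
  rw [evalComb_apply, Z_comb, form_comb]; rfl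

theorem jTerm_eq (V : TM n M) (γ : T n V.proj) (hγ : P.Z V.proj γ ≠ 0) (k : ℕ+) :
    jTerm P V γ k = ((k : ℂ) ^ 2)⁻¹ *
      besselWave ((k : ℝ) • (P.Z V.proj γ, P.form V.proj V.2 γ)) := by
  have hk : (0 : ℝ) < k := by exact_mod_cast k.pos
  have h := besselK_eq (j := 0) (s := (k : ℝ) * ‖P.Z V.proj γ‖) (mul_pos hk (norm_pos_iff.2 hγ))
  rw [pow_zero, one_mul, ← normSq_smul, ← mul_assoc, Nat.cast_zero] at h
  rw [jTerm, h, besselWave, besselRadial, div_eq_mul_inv]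
  simp only [Prod.smul_mk, smul_eq_mul]
  ring

namespace LocalModel
variable {B} {p₀ : M} {U : Set M} {e : Fin n ⊕ Fin n → ∀ p : M, T n p}
  {Ω : {m : Fin n ⊕ Fin n → ℤ // m ≠ 0} → ℝ} {c : ℝ} (hL : LocalModel B p₀ U e Ω c)
include hL

theorem flatMap_mem {V : TM n M} (hV : V.proj ∈ U) :
    flatMap P e V ∈ flatDomain (periodFun P e p₀) c := hL.near _ hV

theorem term_eq {V : TM n M} (hV : V.proj ∈ U) (m : {m : Fin n ⊕ Fin n → ℤ // m ≠ 0}) (k : ℕ+) :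
    (B.index V.proj (comb e m.1 V.proj) : ℂ) * jTerm P V (comb e m.1 V.proj) k
      = waveTerm Ω (m, k) (flatMap P e V) := by
  have h1 : (B.index V.proj (comb e m.1 V.proj) : ℂ) = (Ω m : ℂ) := by
    rw [← hL.index _ hV m]; push_cast; rfl
  rw [h1]
  -- The comparison of `besselK` with `besselL` needs `Z_γ ≠ 0`, which is known only for charges of
  -- nonzero index.
  by_cases hm : Ω m = 0
  · simp [hm, waveTerm]
  have h2 := hL.bps.evalComb_ne_zero hm (hL.flatMap_mem hV)
  rw [evalComb_flatMap] at h2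
  rw [jTerm_eq V _ h2, waveTerm, evalComb_flatMap]

theorem summable_jTerm {V : TM n M} (hV : V.proj ∈ U) : Summable
    fun x : {γ : T n V.proj // γ ∈ P.Γ V.proj ∧ γ ≠ 0} × ℕ+ =>
        (B.index V.proj x.1.1 : ℂ) * jTerm P V x.1.1 x.2 := by
  have h := hL.bps.summable_waveTerm (hL.flatMap_mem hV)
  rw [← ((hL.frame.latticeEquiv hV).prodCongr (Equiv.refl ℕ+)).summable_iff]
  refine h.congr fun i => ?_
  exact (hL.term_eq hV i.1 i.2).symm

theorem joyceFunction_eq {V : TM n M} (hV : V.proj ∈ U) :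
    joyceFunction P B V = Complex.I * (flatPotential Ω (flatMap P e V) : ℂ) := by
  have h1 : (∑' γ : {γ : T n V.proj // γ ∈ P.Γ V.proj ∧ γ ≠ 0},
      (B.index V.proj γ.1 : ℂ) * ∑' k : ℕ+, jTerm P V γ.1 k)
      = ∑' i, waveTerm Ω i (flatMap P e V) := by
    rw [(hL.bps.summable_waveTerm (hL.flatMap_mem hV)).tsum_prod, ← (hL.frame.latticeEquiv hV).tsum_eq]
    refine tsum_congr fun m => ?_
    rw [← tsum_mul_left]
    exact tsum_congr fun k => hL.term_eq hV m k
  rw [joyceFunction, h1, hL.bps.tsum_waveTerm]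
  push_cast
  have : (Real.pi : ℂ) ≠ 0 := by exact_mod_cast Real.pi_ne_zero
  field_simp
  linear_combination (-(flatPotential Ω (flatMap P e V)) : ℂ) * Complex.I_sq

theorem contMDiffOn_flatMap : ContMDiffOn (IN n) 𝓘(ℝ, (Fin n ⊕ Fin n → ℂ) × (Fin n ⊕ Fin n → ℝ)) ∞
    (flatMap P e) ((fun V : TM n M => V.proj) ⁻¹' U) :=
  ((contMDiffOn_periodFun hL.frame).comp (Bundle.contMDiff_proj _).contMDiffOn
    (fun _ h => h)).prodMk_space (hL.frame.contMDiffOn_low P.skew)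

theorem contMDiffOn_comp_flatMap {F : Type*} [NormedAddCommGroup F] [NormedSpace ℝ F]
    {f : (Fin n ⊕ Fin n → ℂ) × (Fin n ⊕ Fin n → ℝ) → F}
    (hf : ContDiffOn ℝ ∞ f (flatDomain (periodFun P e p₀) c)) :
    ContMDiffOn (IN n) 𝓘(ℝ, F) ∞ (fun V => f (flatMap P e V)) ((fun V : TM n M => V.proj) ⁻¹' U) :=
  hf.contMDiffOn.comp hL.contMDiffOn_flatMap fun _ hV => hL.flatMap_mem hV

end LocalModel

theorem exists_localModel_at (p : M) : ∃ (U : Set M) (e : Fin n ⊕ Fin n → ∀ p : M, T n p)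
    (Ω : {m : Fin n ⊕ Fin n → ℤ // m ≠ 0} → ℝ) (c : ℝ), LocalModel B p U e Ω c := by
  obtain ⟨U, e, hp, hF⟩ := P.exists_frame p
  obtain ⟨U', -, Ω, c, h⟩ := exists_localModel B hF hp
  exact ⟨U', e, Ω, c, h⟩

theorem isOpen_preimage_proj {U : Set M} (hU : IsOpen U) :
    IsOpen ((fun V : TM n M => V.proj) ⁻¹' U) :=
  hU.preimage (FiberBundle.continuous_proj (Model n) (TangentSpace 𝓘(ℝ, Model n) : M → Type _))

theorem contMDiff_joyceFunction : ContMDiff (IN n) 𝓘(ℝ, ℂ) ∞ (joyceFunction P B) := by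
  intro V
  obtain ⟨U, e, Ω, c, hL⟩ := exists_localModel_at B V.proj
  have h1 := hL.contMDiffOn_comp_flatMap hL.bps.contDiffOn_flatPotential
  have hU := isOpen_preimage_proj (n := n) hL.frame.isOpen
  have h2 : ContDiff ℝ ∞ (fun x : ℝ => Complex.I * (x : ℂ)) :=
    contDiff_const.mul Complex.ofRealCLM.contDiff
  refine ((h2.contMDiff.comp_contMDiffOn h1).congr fun W hW => ?_).contMDiffAt (hU.mem_nhds hL.mem)
  exact hL.joyceFunction_eq hW

end Base
end SpecialJoyce

end

/-! ### Vertical and horizontal lifts in the coordinates `(Z, θ)` of `N`. -/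

section

namespace SpecialJoyce
open Set Filter

section Base
variable {n : ℕ} {M : Type*} [TopologicalSpace M] [ChartedSpace (Model n) M]
  [IsManifold 𝓘(ℂ, Model n) ω M]

theorem mdifferentiableAt_fibre (p : M) (w₀ : Model n) :
    MDifferentiableAt 𝓘(ℝ, Model n) (IN n) (fun w : Model n => (⟨p, w⟩ : TM n M)) w₀ := by
  rw [mdifferentiableAt_totalSpace]
  refine ⟨mdifferentiableAt_const, ?_⟩
  set t := trivializationAt (Model n) (TangentSpace 𝓘(ℝ, Model n) : M → Type _) p with ht
  have hp : p ∈ t.baseSet := FiberBundle.mem_baseSet_trivializationAt' p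
  let L : Model n →ₗ[ℝ] Model n := t.linearMapAt ℝ p
  have h : (fun w : Model n => (t ⟨p, w⟩).2) = L.toContinuousLinearMap := by
    funext w
    exact (congrFun (t.coe_linearMapAt_of_mem hp) w).symm
  change MDifferentiableAt _ _ (fun w : Model n => (t ⟨p, w⟩).2) w₀
  rw [h]
  exact (ContinuousLinearMap.differentiableAt _).mdifferentiableAt

theorem mdifferentiableAt_proj_TM (V : TM n M) :
    MDifferentiableAt (IN n) 𝓘(ℝ, Model n) (fun W : TM n M => W.proj) V :=
  Bundle.mdifferentiableAt_proj _

variable {F : Type*} [NormedAddCommGroup F] [NormedSpace ℝ F]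

theorem dMap_proj {f : M → F} {V : TM n M} (hf : MDifferentiableAt 𝓘(ℝ, Model n) 𝓘(ℝ, F) f V.proj)
    (A : TT V) :
    dMap (IN n) (fun W : TM n M => f W.proj) V A = dMap 𝓘(ℝ, Model n) f V.proj (dproj V A) :=
  DFunLike.congr_fun (mfderiv_comp V hf (mdifferentiableAt_proj_TM V)) A

theorem dMap_vert {f : TM n M → F} {V : TM n M} (hf : MDifferentiableAt (IN n) 𝓘(ℝ, F) f V)
    (u : T n V.proj) :
    dMap (IN n) f V (vert V u) = fderiv ℝ (fun w : Model n => f ⟨V.proj, w⟩) V.2 u := by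
  have h := mfderiv_comp (I := 𝓘(ℝ, Model n)) (I' := IN n) (I'' := 𝓘(ℝ, F))
    (f := fun w : Model n => (⟨V.proj, w⟩ : TM n M)) (g := f) (V.2 : Model n) hf (mdifferentiableAt_fibre V.proj V.2)
  exact (DFunLike.congr_fun h u).symm.trans (DFunLike.congr_fun (mfderiv_eq_fderiv
    (f := fun w : Model n => f ⟨V.proj, w⟩)) u)

theorem dproj_vert (V : TM n M) (u : T n V.proj) : dproj V (vert V u) = 0 := by
  have h := mfderiv_comp (I := 𝓘(ℝ, Model n)) (I' := IN n) (I'' := 𝓘(ℝ, Model n))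
    (f := fun w : Model n => (⟨V.proj, w⟩ : TM n M)) (g := fun W : TM n M => W.proj) (V.2 : Model n)
    (mdifferentiableAt_proj_TM V) (mdifferentiableAt_fibre V.proj V.2)
  have h2 : mfderiv 𝓘(ℝ, Model n) 𝓘(ℝ, Model n)
    ((fun W : TM n M => W.proj) ∘ fun w : Model n => (⟨V.proj, w⟩ : TM n M)) V.2 = 0 := mfderiv_const
  exact (DFunLike.congr_fun (h.symm.trans h2) u)

/-- A local section through a point of the total space. -/
def extSection (V : TM n M) (q : M) : T n q :=
  FiberBundle.extend (Model n) (E := fun q : M => T n q) V.2 q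

theorem extSection_self (V : TM n M) : extSection V V.proj = V.2 := FiberBundle.extend_apply_self _ _

theorem exists_smooth_extSection (V : TM n M) :
    ∃ W : Set M, IsOpen W ∧ V.proj ∈ W ∧ SmoothVF 𝓘(ℝ, Model n) W (extSection V) := by
  obtain ⟨s, hs, h⟩ := FiberBundle.exists_contMDiffOn_extend (k := ∞) 𝓘(ℝ, Model n) (Model n)
    (V := fun y : M => T n y) V.2
  obtain ⟨W, hWs, hW, hx⟩ := mem_nhds_iff.1 hs
  exact ⟨W, hW, hx, h.mono hWs⟩

theorem mdifferentiableAt_extSection (V : TM n M) :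
    MDifferentiableAt 𝓘(ℝ, Model n) (IN n) (fun q => (⟨q, extSection V q⟩ : TM n M)) V.proj := by
  obtain ⟨W, hW, hV, h⟩ := exists_smooth_extSection V
  exact h.mdifferentiableAt hW hV

theorem extSection_eq (V : TM n M) : (⟨V.proj, extSection V V.proj⟩ : TM n M) = V := by
  rw [extSection_self]

theorem dMap_hor (S : SKData n M) {f : TM n M → F} {V : TM n M}
    (hf : MDifferentiableAt (IN n) 𝓘(ℝ, F) f V) (X : T n V.proj) :
    dMap (IN n) f V (S.hor V X) = dMap 𝓘(ℝ, Model n) (fun q => f ⟨q, extSection V q⟩) V.proj X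
      - dMap (IN n) f V (vert V (S.conn (extSection V) V.proj X)) := by
  have hf' : MDifferentiableAt (IN n) 𝓘(ℝ, F) f ⟨V.proj, extSection V V.proj⟩ := by
    rw [extSection_eq]; exact hf
  have h := DFunLike.congr_fun (mfderiv_comp V.proj hf' (mdifferentiableAt_extSection V)) X
  -- The extended section passes through `V` only up to a proved equality of points, so the two
  -- differentials are compared on the common model space.
  have key : ∀ W : TM n M, W = V → ∀ A : Model n × Model n,
      (mfderiv (IN n) 𝓘(ℝ, F) f W : Model n × Model n →L[ℝ] F) A
        = (mfderiv (IN n) 𝓘(ℝ, F) f V : Model n × Model n →L[ℝ] F) A := by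
    rintro W rfl A; rfl
  have h2 := key _ (extSection_eq V)
    (mfderiv 𝓘(ℝ, Model n) (IN n) (fun q => (⟨q, extSection V q⟩ : TM n M)) V.proj X)
  refine (map_sub (dMap (IN n) f V) _ _).trans ?_
  congr 1
  exact h2.symm.trans h.symm

theorem dproj_hor (S : SKData n M) (V : TM n M) (X : T n V.proj) : dproj V (S.hor V X) = X := by
  have hf' : MDifferentiableAt (IN n) 𝓘(ℝ, Model n) (fun W : TM n M => W.proj)
      ⟨V.proj, extSection V V.proj⟩ := mdifferentiableAt_proj_TM _
  have h := DFunLike.congr_fun (mfderiv_comp V.proj hf' (mdifferentiableAt_extSection V)) X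
  have key : ∀ W : TM n M, W = V → ∀ A : Model n × Model n,
      (mfderiv (IN n) 𝓘(ℝ, Model n) (fun W : TM n M => W.proj) W : Model n × Model n →L[ℝ] Model n) A
        = (mfderiv (IN n) 𝓘(ℝ, Model n) (fun W : TM n M => W.proj) V :
          Model n × Model n →L[ℝ] Model n) A := by
    rintro W rfl A; rfl
  have h2 := key _ (extSection_eq V)
    (mfderiv 𝓘(ℝ, Model n) (IN n) (fun q => (⟨q, extSection V q⟩ : TM n M)) V.proj X)
  have h3 : mfderiv 𝓘(ℝ, Model n) 𝓘(ℝ, Model n)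
      ((fun W : TM n M => W.proj) ∘ fun q => (⟨q, extSection V q⟩ : TM n M)) V.proj X = X :=
    DFunLike.congr_fun (mfderiv_id (I := 𝓘(ℝ, Model n)) (x := V.proj)) X
  refine (map_sub (dproj V) _ _).trans ?_
  exact (congrArg₂ (· - ·) (h2.symm.trans (h.symm.trans h3))
    (dproj_vert V (S.conn (extSection V) V.proj X))).trans (sub_zero X)

variable {P : SpecialPeriodStructure n M} {U : Set M} {e : Fin n ⊕ Fin n → ∀ p : M, T n p}

/-- The differentials of the functions `Z` on a frame. -/
def zdiff (P : SpecialPeriodStructure n M) (e : Fin n ⊕ Fin n → ∀ p : M, T n p) (p : M) :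
    T n p →ₗ[ℝ] (Fin n ⊕ Fin n → ℂ) where
  toFun X a := (P.form p X (e a p) : ℂ) - Complex.I * (P.form p (cplxI n p X) (e a p) : ℂ)
  map_add' X Y := by
    funext a
    simp only [map_add, LinearMap.add_apply, Complex.ofReal_add, Pi.add_apply]
    ring
  map_smul' c X := by
    funext a
    simp only [map_smul, LinearMap.smul_apply, smul_eq_mul, Complex.ofReal_mul, Pi.smul_apply,
      RingHom.id_apply, Complex.real_smul]
    ring

theorem zdiff_apply (p : M) (X : T n p) (a : Fin n ⊕ Fin n) :
    zdiff P e p X a = (P.form p X (e a p) : ℂ) - Complex.I * (P.form p (cplxI n p X) (e a p) : ℂ) := rfl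

variable (hF : IsDarbouxFrame P.Γ P.form U e)
include hF

theorem dMap_periodFun {p : M} (hp : p ∈ U) (X : T n p) :
    dMap 𝓘(ℝ, Model n) (periodFun P e) p X = zdiff P e p X := by
  have h : MDifferentiableAt 𝓘(ℝ, Model n) 𝓘(ℝ, Fin n ⊕ Fin n → ℂ) (periodFun P e) p :=
    ((contMDiffOn_periodFun hF).contMDiffAt (hF.isOpen.mem_nhds hp)).mdifferentiableAt (by simp)
  funext a
  have h1 := dMap_clm_comp_apply
    (Complex.reCLM ∘L ContinuousLinearMap.proj (R := ℝ) (φ := fun _ : Fin n ⊕ Fin n => ℂ) a) h X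
  have h2 := dMap_clm_comp_apply
    (Complex.imCLM ∘L ContinuousLinearMap.proj (R := ℝ) (φ := fun _ : Fin n ⊕ Fin n => ℂ) a) h X
  have h3 := dReal_period P hF hp X a
  refine Complex.ext (h1.symm.trans (h3.1.trans ?_)) (h2.symm.trans (h3.2.trans ?_))
  · rw [zdiff_apply]; simp
  · rw [zdiff_apply]; simp

theorem mdifferentiableAt_low {V : TM n M} (hV : V.proj ∈ U) :
    MDifferentiableAt (IN n) 𝓘(ℝ, Fin n ⊕ Fin n → ℝ) (fun V : TM n M => low P.form e V.proj V.2) V :=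
  ((hF.contMDiffOn_low P.skew).contMDiffAt
    ((isOpen_preimage_proj (n := n) hF.isOpen).mem_nhds hV)).mdifferentiableAt (by simp)

theorem dMap_low_vert {V : TM n M} (hV : V.proj ∈ U) (u : T n V.proj) :
    dMap (IN n) (fun V : TM n M => low P.form e V.proj V.2) V (vert V u) = low P.form e V.proj u := by
  rw [dMap_vert (mdifferentiableAt_low hF hV)]
  let L : Model n →ₗ[ℝ] (Fin n ⊕ Fin n → ℝ) := low P.form e V.proj
  exact DFunLike.congr_fun (L.toContinuousLinearMap.fderiv (x := V.2)) u

/-- The pairings `θ_a` are constant along parallel transport. For the auxiliary section `s` used to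
define the lift, the derivative of `ω(s, e_a)` is the pairing of `∇s`, which is exactly what the
vertical correction removes. -/
theorem dMap_low_hor {V : TM n M} (hV : V.proj ∈ U) (X : T n V.proj) :
    dMap (IN n) (fun V : TM n M => low P.form e V.proj V.2) V (P.hor V X) = 0 := by
  refine (dMap_hor P.toSKData (mdifferentiableAt_low hF hV) X).trans (sub_eq_zero.2 ?_)
  rw [dMap_low_vert hF hV]
  obtain ⟨W, hW, hVW, h⟩ := exists_smooth_extSection V
  have hWU := hW.inter hF.isOpen
  have hs : ContMDiffAt 𝓘(ℝ, Model n) 𝓘(ℝ, Fin n ⊕ Fin n → ℝ) ∞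
      (fun q => low P.form e q (extSection V q)) V.proj :=
    (contMDiffOn_of_pi fun a => smoothVF_low P hF (W := W ∩ U) inter_subset_right
      (h.mono inter_subset_left) a).contMDiffAt (hWU.mem_nhds ⟨hVW, hV⟩)
  funext a
  refine (dMap_pi_apply (hs.mdifferentiableAt (by simp)) X a).trans ?_
  exact (low_conn P hF hW h hV hVW X a).symm

/-- The coordinates `(Re Z, θ)` on the total space. -/
def totalCoord (P : SpecialPeriodStructure n M) (e : Fin n ⊕ Fin n → ∀ p : M, T n p) (V : TM n M) :
    (Fin n ⊕ Fin n → ℝ) × (Fin n ⊕ Fin n → ℝ) :=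
  (flatCoord P e V.proj, low P.form e V.proj V.2)

theorem contMDiffOn_totalCoord : ContMDiffOn (IN n) 𝓘(ℝ, (Fin n ⊕ Fin n → ℝ) × (Fin n ⊕ Fin n → ℝ)) ∞
    (totalCoord P e) ((fun V : TM n M => V.proj) ⁻¹' U) :=
  ((contMDiffOn_flatCoord P hF).comp (Bundle.contMDiff_proj _).contMDiffOn
    (fun _ h => h)).prodMk_space (hF.contMDiffOn_low P.skew)

omit hF in
theorem dMap_prod_apply {F F' : Type*} [NormedAddCommGroup F] [NormedSpace ℝ F]
    [NormedAddCommGroup F'] [NormedSpace ℝ F'] {f : TM n M → F × F'} {V : TM n M}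
    (hf : MDifferentiableAt (IN n) 𝓘(ℝ, F × F') f V) (A : TT V) :
    dMap (IN n) f V A = (dMap (IN n) (fun W => (f W).1) V A, dMap (IN n) (fun W => (f W).2) V A) :=
  Prod.ext (dMap_clm_comp_apply (ContinuousLinearMap.fst ℝ F F') hf A).symm
    (dMap_clm_comp_apply (ContinuousLinearMap.snd ℝ F F') hf A).symm

theorem dMap_totalCoord {V : TM n M} (hV : V.proj ∈ U) (A : TT V) :
    dMap (IN n) (totalCoord P e) V A = (low P.form e V.proj (dproj V A),
      dMap (IN n) (fun V : TM n M => low P.form e V.proj V.2) V A) := by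
  rw [dMap_prod_apply (((contMDiffOn_totalCoord hF).contMDiffAt
    ((isOpen_preimage_proj (n := n) hF.isOpen).mem_nhds hV)).mdifferentiableAt (by simp))]
  refine Prod.ext ?_ rfl
  exact (dMap_proj (((contMDiffOn_flatCoord P hF).contMDiffAt
    (hF.isOpen.mem_nhds hV)).mdifferentiableAt (by simp)) A).trans (dMap_flatCoord P hF hV _)

omit hF in
theorem finrank_TT (V : TM n M) : Module.finrank ℝ (TT V) = (n + n) + (n + n) := by
  change Module.finrank ℝ (Model n × Model n) = _
  rw [Module.finrank_prod, finrank_model]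

omit hF in
instance (V : TM n M) : FiniteDimensional ℝ (TT V) :=
  inferInstanceAs (FiniteDimensional ℝ (Model n × Model n))

/-- Horizontal lifts fill the first component, vertical lifts the second, and the dimensions agree.
-/
theorem bijective_dMap_totalCoord {V : TM n M} (hV : V.proj ∈ U) :
    Function.Bijective (dMap (IN n) (totalCoord P e) V) := by
  have hs : Function.Surjective (dMap (IN n) (totalCoord P e) V) := by
    rintro ⟨x, y⟩
    obtain ⟨X, rfl⟩ := (hF.low_bijective P.skew hV).2 x
    obtain ⟨u, rfl⟩ := (hF.low_bijective P.skew hV).2 y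
    refine ⟨P.hor V X + vert V u, ?_⟩
    rw [map_add, dMap_totalCoord hF hV, dMap_totalCoord hF hV, dproj_hor, dproj_vert,
      dMap_low_hor hF hV, dMap_low_vert hF hV, map_zero]
    simp
  refine ⟨?_, hs⟩
  refine (LinearMap.injective_iff_surjective_of_finrank_eq_finrank
    (f := (dMap (IN n) (totalCoord P e) V).toLinearMap) ?_).2 hs
  rw [finrank_TT]
  simp

theorem mdifferentiableAt_flatMap {V : TM n M} (hV : V.proj ∈ U) :
    MDifferentiableAt (IN n) 𝓘(ℝ, (Fin n ⊕ Fin n → ℂ) × (Fin n ⊕ Fin n → ℝ)) (flatMap P e) V :=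
  ((((contMDiffOn_periodFun hF).comp (Bundle.contMDiff_proj _).contMDiffOn
    (fun _ h => h)).prodMk_space (hF.contMDiffOn_low P.skew)).contMDiffAt
    ((isOpen_preimage_proj (n := n) hF.isOpen).mem_nhds hV)).mdifferentiableAt (by simp)

theorem dMap_flatMap {V : TM n M} (hV : V.proj ∈ U) (A : TT V) :
    dMap (IN n) (flatMap P e) V A = (zdiff P e V.proj (dproj V A),
      dMap (IN n) (fun V : TM n M => low P.form e V.proj V.2) V A) := by
  rw [dMap_prod_apply (mdifferentiableAt_flatMap hF hV)]
  refine Prod.ext ?_ rfl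
  exact (dMap_proj (((contMDiffOn_periodFun hF).contMDiffAt
    (hF.isOpen.mem_nhds hV)).mdifferentiableAt (by simp)) A).trans (dMap_periodFun hF hV _)

theorem dMap_flatMap_vert {V : TM n M} (hV : V.proj ∈ U) (u : T n V.proj) :
    dMap (IN n) (flatMap P e) V (vert V u) = (0, low P.form e V.proj u) := by
  rw [dMap_flatMap hF hV, dproj_vert, dMap_low_vert hF hV, map_zero]

theorem dMap_flatMap_hor {V : TM n M} (hV : V.proj ∈ U) (X : T n V.proj) :
    dMap (IN n) (flatMap P e) V (P.hor V X) = (zdiff P e V.proj X, 0) := by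
  rw [dMap_flatMap hF hV, dproj_hor, dMap_low_hor hF hV]

end Base
end SpecialJoyce

end

/-! ### Hamiltonian vectors from the Hessian of the potential. -/

section

namespace SpecialJoyce
open Set Filter

/-- The second derivative of the flat potential. -/
def potHess {ι : Type} [Fintype ι] (Ω : {m : ι → ℤ // m ≠ 0} → ℝ) (x : (ι → ℂ) × (ι → ℝ)) :
    (ι → ℂ) × (ι → ℝ) →L[ℝ] (ι → ℂ) × (ι → ℝ) →L[ℝ] ℝ :=
  fderiv ℝ (fderiv ℝ (flatPotential Ω)) x

section Flat
variable {ι : Type} [Fintype ι] {Ω : {m : ι → ℤ // m ≠ 0} → ℝ} {ζ₀ : ι → ℂ} {c : ℝ}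
  (hB : FlatBPS Ω ζ₀ c) {x : (ι → ℂ) × (ι → ℝ)} (hx : x ∈ flatDomain ζ₀ c)
include hB

theorem FlatBPS.contDiffOn_fderiv_flatPotential :
    ContDiffOn ℝ ∞ (fderiv ℝ (flatPotential Ω)) (flatDomain ζ₀ c) :=
  ((contDiffOn_infty_iff_fderiv_of_isOpen (isOpen_flatDomain _ _)).1 hB.contDiffOn_flatPotential).2

theorem FlatBPS.contDiffOn_potHess : ContDiffOn ℝ ∞ (potHess Ω) (flatDomain ζ₀ c) :=
  ((contDiffOn_infty_iff_fderiv_of_isOpen (isOpen_flatDomain _ _)).1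
    hB.contDiffOn_fderiv_flatPotential).2

include hx

theorem FlatBPS.hasFDerivAt_fderiv_flatPotential :
    HasFDerivAt (fderiv ℝ (flatPotential Ω)) (potHess Ω x) x :=
  ((hB.contDiffOn_fderiv_flatPotential.contDiffAt
    ((isOpen_flatDomain _ _).mem_nhds hx)).differentiableAt (by simp)).hasFDerivAt

theorem FlatBPS.potHess_symm (a b : (ι → ℂ) × (ι → ℝ)) : potHess Ω x a b = potHess Ω x b a :=
  ((hB.contDiffOn_flatPotential.contDiffAt ((isOpen_flatDomain _ _).mem_nhds hx)).isSymmSndFDerivAt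
    (by
      simp only [minSmoothness_of_isRCLikeNormedField]
      exact WithTop.coe_le_coe.2 (le_top (a := (2 : ℕ∞))))).eq a b

end Flat

section Base
variable {n : ℕ} {M : Type*} [TopologicalSpace M] [ChartedSpace (Model n) M]
  [IsManifold 𝓘(ℂ, Model n) ω M] {P : SpecialPeriodStructure n M}

theorem SpecialPeriodStructure.form_nondeg (P : SpecialPeriodStructure n M) {p : M} {u : T n p}
    (h : ∀ w, P.form p u w = 0) : u = 0 := by
  obtain ⟨U, e, hp, hF⟩ := P.exists_frame p
  exact hF.form_nondeg P.skew hp u h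

theorem SpecialPeriodStructure.ext_form (P : SpecialPeriodStructure n M) {p : M} {w w' : T n p}
    (h : ∀ u, P.form p u w = P.form p u w') : w = w' := by
  refine sub_eq_zero.1 (P.form_nondeg fun u => ?_)
  rw [map_sub, LinearMap.sub_apply, P.skew, P.skew p w', h]
  ring

theorem SpecialPeriodStructure.exists_form_eq (P : SpecialPeriodStructure n M) {p : M}
    (ℓ : T n p →ₗ[ℝ] ℝ) : ∃ w, ∀ u, P.form p u w = ℓ u := by
  have hinj : Function.Injective (P.form p) := (injective_iff_map_eq_zero (P.form p)).2
    fun u hu => P.form_nondeg fun w => by rw [hu]; rfl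
  have hs := (LinearMap.injective_iff_surjective_of_finrank_eq_finrank
    (f := (P.form p : T n p →ₗ[ℝ] Module.Dual ℝ (T n p)))
    Subspace.dual_finrank_eq.symm).1 hinj
  obtain ⟨w, hw⟩ := hs (-ℓ)
  refine ⟨w, fun u => ?_⟩
  rw [P.skew]
  have := DFunLike.congr_fun hw u
  rw [this]; simp

/-- Nondegeneracy of `ω` leaves at most one candidate, so exhibiting one identifies the chosen
vector. -/
theorem hamVec_eq (P : SpecialPeriodStructure n M) {p : M} {f : T n p → ℂ} {v : T n p}
    {w : Cx (T n p)} (h : ∀ u : T n p, (P.form p u (cre w) : ℂ) + Complex.I * P.form p u (cim w)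
      = fderiv ℝ (fun x : Model n => f x) v u) :
    P.hamVec p f v = w := by
  have key : ∀ (u : T n p) (w : Cx (T n p)), cbil (P.form p) ((1 : ℂ) ⊗ₜ[ℝ] u) w
      = (P.form p u (cre w) : ℂ) + Complex.I * P.form p u (cim w) := by
    intro u w
    rw [cbil_apply]; simp
  have h1 : ∀ u : T n p, cbil (P.form p) ((1 : ℂ) ⊗ₜ[ℝ] u) (P.hamVec p f v)
      = fderiv ℝ (fun x : Model n => f x) v u :=
    Classical.epsilon_spec (p := fun w => ∀ u : T n p,
      cbil (P.form p) ((1 : ℂ) ⊗ₜ[ℝ] u) w = fderiv ℝ (fun x : Model n => f x) v u)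
      ⟨w, fun u => (key u w).trans (h u)⟩
  have h2 : ∀ u : T n p, (P.form p u (cre (P.hamVec p f v)) : ℂ)
      + Complex.I * P.form p u (cim (P.hamVec p f v))
      = (P.form p u (cre w) : ℂ) + Complex.I * P.form p u (cim w) := fun u =>
    (key u _).symm.trans ((h1 u).trans (h u).symm)
  refine cx_ext (P.ext_form fun u => ?_) (P.ext_form fun u => ?_)
  · simpa using congrArg Complex.re (h2 u)
  · simpa using congrArg Complex.im (h2 u)

variable {B : UncoupledBPS P} {p₀ : M} {U : Set M} {e : Fin n ⊕ Fin n → ∀ p : M, T n p}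
  {Ω : {m : Fin n ⊕ Fin n → ℤ // m ≠ 0} → ℝ} {c : ℝ}

namespace LocalModel
variable (hL : LocalModel B p₀ U e Ω c)
include hL

theorem dCpx_joyceFunction {V : TM n M} (hV : V.proj ∈ U) (A : TT V) :
    dCpx (IN n) (joyceFunction P B) V A
      = Complex.I * (fderiv ℝ (flatPotential Ω) (flatMap P e V) (dMap (IN n) (flatMap P e) V A) : ℝ) := by
  have h1 : joyceFunction P B =ᶠ[𝓝 V] fun W =>
      (fun x => Complex.I * (flatPotential Ω x : ℂ)) (flatMap P e W) := by
    filter_upwards [(isOpen_preimage_proj (n := n) hL.frame.isOpen).mem_nhds hV] with W hW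
    exact hL.joyceFunction_eq hW
  have hd : HasFDerivAt (flatPotential Ω) (fderiv ℝ (flatPotential Ω) (flatMap P e V)) (flatMap P e V) :=
    ((hL.bps.contDiffOn_flatPotential.contDiffAt
      ((isOpen_flatDomain _ _).mem_nhds (hL.flatMap_mem hV))).differentiableAt (by simp)).hasFDerivAt
  have hd2 : HasFDerivAt (fun x => Complex.I * (flatPotential Ω x : ℂ))
      (Complex.I • (Complex.ofRealCLM ∘L fderiv ℝ (flatPotential Ω) (flatMap P e V))) (flatMap P e V) :=
    (Complex.ofRealCLM.hasFDerivAt.comp (flatMap P e V) hd).const_mul Complex.I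
  rw [dCpx_eq_dMap, dMap_congr h1]
  refine (dMap_comp_apply hd2.differentiableAt (mdifferentiableAt_flatMap hL.frame hV) A).trans ?_
  rw [hd2.fderiv]
  rfl

theorem hasFDerivAt_fibre {V : TM n M} (hV : V.proj ∈ U) (b : (Fin n ⊕ Fin n → ℂ) × (Fin n ⊕ Fin n → ℝ)) :
    ∃ D : Model n →L[ℝ] ℝ,
      HasFDerivAt (fun w : Model n => fderiv ℝ (flatPotential Ω) (flatMap P e ⟨V.proj, w⟩) b) D V.2 ∧
      ∀ u : T n V.proj, D u = potHess Ω (flatMap P e V) (0, low P.form e V.proj u) b := by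
  let Lw : Model n →ₗ[ℝ] (Fin n ⊕ Fin n → ℝ) := low P.form e V.proj
  have h1 : HasFDerivAt (fun w : Model n => flatMap P e ⟨V.proj, w⟩)
      ((0 : Model n →L[ℝ] (Fin n ⊕ Fin n → ℂ)).prod Lw.toContinuousLinearMap) V.2 :=
    (hasFDerivAt_const (periodFun P e V.proj) (V.2 : Model n)).prodMk
      Lw.toContinuousLinearMap.hasFDerivAt
  have h2 := hL.bps.hasFDerivAt_fderiv_flatPotential (hL.flatMap_mem hV)
  let v₀ : Model n := V.2
  have h3 := ((ContinuousLinearMap.apply ℝ ℝ b).hasFDerivAt (x := _)).comp v₀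
    (HasFDerivAt.comp (f := fun w : Model n => flatMap P e ⟨V.proj, w⟩) v₀ h2 h1)
  exact ⟨_, h3, fun u => rfl⟩

/-- The function is `i` times the derivative of the real potential along `a + ib`, so its
Hamiltonian vector is `i(x + iy)`. -/
theorem hamVec_eq_cmk {V : TM n M} (hV : V.proj ∈ U) {f : T n V.proj → ℂ}
    {a b : (Fin n ⊕ Fin n → ℂ) × (Fin n ⊕ Fin n → ℝ)}
    (hf : ∀ w : T n V.proj, f w
      = Complex.I * ((fderiv ℝ (flatPotential Ω) (flatMap P e ⟨V.proj, w⟩) a : ℝ)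
        + Complex.I * (fderiv ℝ (flatPotential Ω) (flatMap P e ⟨V.proj, w⟩) b : ℝ)))
    {x y : T n V.proj}
    (hx : ∀ u, P.form V.proj u x = potHess Ω (flatMap P e V) (0, low P.form e V.proj u) a)
    (hy : ∀ u, P.form V.proj u y = potHess Ω (flatMap P e V) (0, low P.form e V.proj u) b) :
    P.hamVec V.proj f V.2 = cmk (-y) x := by
  refine hamVec_eq P fun u => ?_
  obtain ⟨Da, ha, ha'⟩ := hL.hasFDerivAt_fibre hV a
  obtain ⟨Db, hb, hb'⟩ := hL.hasFDerivAt_fibre hV b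
  let v₀ : Model n := V.2
  have h1 := (((Complex.ofRealCLM.hasFDerivAt (x := _)).comp v₀ ha).add
    (((Complex.ofRealCLM.hasFDerivAt (x := _)).comp v₀ hb).const_mul Complex.I)).const_mul Complex.I
  have h2 : HasFDerivAt (fun x : Model n => f x) _ v₀ :=
    h1.congr_of_eventuallyEq (Eventually.of_forall hf)
  have h3 : fderiv ℝ (fun x : Model n => f x) V.2 u = Complex.I * ((Da u : ℂ) + Complex.I * (Db u : ℂ)) := by
    rw [h2.fderiv]; rfl
  refine Eq.trans ?_ h3.symm
  rw [cre_cmk, cim_cmk, map_neg, hx, hy, ha', hb']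
  push_cast
  linear_combination (-(potHess Ω (flatMap P e V) (0, low P.form e V.proj u) b) : ℂ) * Complex.I_sq

theorem hamVec_vertDer {V : TM n M} (hV : V.proj ∈ U) (X : Cx (T n V.proj)) {x y : T n V.proj}
    (hx : ∀ u, P.form V.proj u x
      = potHess Ω (flatMap P e V) (0, low P.form e V.proj u) (0, low P.form e V.proj (cre X)))
    (hy : ∀ u, P.form V.proj u y
      = potHess Ω (flatMap P e V) (0, low P.form e V.proj u) (0, low P.form e V.proj (cim X))) :
    P.hamVec V.proj (SKData.vertDer (joyceFunction P B) V.proj X) V.2 = cmk (-y) x := by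
  refine hL.hamVec_eq_cmk hV (fun w => ?_) hx hy
  have h : ∀ a, dCpx (IN n) (joyceFunction P B) ⟨V.proj, w⟩ (vert ⟨V.proj, w⟩ a)
      = Complex.I * (fderiv ℝ (flatPotential Ω) (flatMap P e ⟨V.proj, w⟩)
        (0, low P.form e V.proj a) : ℝ) := fun a => by
    rw [hL.dCpx_joyceFunction (V := ⟨V.proj, w⟩) hV, dMap_flatMap_vert hL.frame (V := ⟨V.proj, w⟩) hV]
  rw [SKData.vertDer, cform_apply, cre_cmap, cim_cmap, h, h]
  ring

theorem hamVec_horDer {V : TM n M} (hV : V.proj ∈ U) (X : Cx (T n V.proj)) {x y : T n V.proj}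
    (hx : ∀ u, P.form V.proj u x
      = potHess Ω (flatMap P e V) (0, low P.form e V.proj u) (zdiff P e V.proj (cre X), 0))
    (hy : ∀ u, P.form V.proj u y
      = potHess Ω (flatMap P e V) (0, low P.form e V.proj u) (zdiff P e V.proj (cim X), 0)) :
    P.hamVec V.proj (P.horDer (joyceFunction P B) V.proj X) V.2 = cmk (-y) x := by
  refine hL.hamVec_eq_cmk hV (fun w => ?_) hx hy
  have h : ∀ a, dCpx (IN n) (joyceFunction P B) ⟨V.proj, w⟩ (P.hor ⟨V.proj, w⟩ a)
      = Complex.I * (fderiv ℝ (flatPotential Ω) (flatMap P e ⟨V.proj, w⟩)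
        (zdiff P e V.proj a, 0) : ℝ) := fun a => by
    rw [hL.dCpx_joyceFunction (V := ⟨V.proj, w⟩) hV, dMap_flatMap_hor hL.frame (V := ⟨V.proj, w⟩) hV]
  rw [SKData.horDer, cform_apply, cre_cmap, cim_cmap, h, h]
  ring

theorem exists_vertHam (V : TM n M) (a : (Fin n ⊕ Fin n → ℂ) × (Fin n ⊕ Fin n → ℝ)) :
    ∃ x, ∀ u, P.form V.proj u x = potHess Ω (flatMap P e V) (0, low P.form e V.proj u) a :=
  P.exists_form_eq (((ContinuousLinearMap.apply ℝ ℝ a).toLinearMap ∘ₗ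
    (potHess Ω (flatMap P e V)).toLinearMap) ∘ₗ (LinearMap.inr ℝ _ _ ∘ₗ low P.form e V.proj))

end LocalModel

/-- The real endomorphism `q` with `ω(u, q a) = -i u a J` for vertical lifts. -/
def vertHamFun (B : UncoupledBPS P) (V : TM n M) (a : T n V.proj) : T n V.proj :=
  cim (P.hamVec V.proj (SKData.vertDer (joyceFunction P B) V.proj (cmk a 0)) V.2)

/-- `J` is `i` times a real function, so for a real direction the Hamiltonian vector is purely
imaginary and its imaginary part carries everything. -/
def horHamFun (B : UncoupledBPS P) (V : TM n M) (a : T n V.proj) : T n V.proj :=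
  cim (P.hamVec V.proj (P.horDer (joyceFunction P B) V.proj (cmk a 0)) V.2)

namespace LocalModel

theorem form_vertHamFun (hL : LocalModel B p₀ U e Ω c) {V : TM n M} (hV : V.proj ∈ U)
    (a u : T n V.proj) : P.form V.proj u (vertHamFun B V a)
      = potHess Ω (flatMap P e V) (0, low P.form e V.proj u) (0, low P.form e V.proj a) := by
  obtain ⟨x, hx⟩ := hL.exists_vertHam V (0, low P.form e V.proj a)
  have h := hL.hamVec_vertDer hV (cmk a 0) (x := x) (y := 0) (by simpa using hx)
    (fun u => by rw [cim_cmk, map_zero, map_zero, Prod.mk_zero_zero, map_zero])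
  rw [vertHamFun, h, cim_cmk, hx]

theorem form_horHamFun (hL : LocalModel B p₀ U e Ω c) {V : TM n M} (hV : V.proj ∈ U)
    (a u : T n V.proj) : P.form V.proj u (horHamFun B V a)
      = potHess Ω (flatMap P e V) (0, low P.form e V.proj u) (zdiff P e V.proj a, 0) := by
  obtain ⟨x, hx⟩ := hL.exists_vertHam V (zdiff P e V.proj a, 0)
  have h := hL.hamVec_horDer hV (cmk a 0) (x := x) (y := 0) (by simpa using hx)
    (fun u => by rw [cim_cmk, map_zero, map_zero, Prod.mk_zero_zero, map_zero])
  rw [horHamFun, h, cim_cmk, hx]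

end LocalModel

/-- The real endomorphism `q` of `T_{π(V)} M` with `ω(u, q a) = -i ν_u ν_a J`. -/
def vertHam (B : UncoupledBPS P) (V : TM n M) : T n V.proj →ₗ[ℝ] T n V.proj where
  toFun := vertHamFun B V
  map_add' a b := P.ext_form fun u => by
    obtain ⟨U, e, Ω, c, hL⟩ := exists_localModel_at B V.proj
    rw [map_add, hL.form_vertHamFun hL.mem, hL.form_vertHamFun hL.mem, hL.form_vertHamFun hL.mem,
      ← map_add]
    exact congrArg _ (show ((0, low P.form e V.proj (a + b)) : ((Fin n ⊕ Fin n → ℂ) × (Fin n ⊕ Fin n → ℝ)))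
      = (0, low P.form e V.proj a) + (0, low P.form e V.proj b) by simp)
  map_smul' r a := P.ext_form fun u => by
    obtain ⟨U, e, Ω, c, hL⟩ := exists_localModel_at B V.proj
    rw [map_smul, hL.form_vertHamFun hL.mem, hL.form_vertHamFun hL.mem, RingHom.id_apply, ← map_smul]
    exact congrArg _ (show ((0, low P.form e V.proj (r • a)) : ((Fin n ⊕ Fin n → ℂ) × (Fin n ⊕ Fin n → ℝ)))
      = r • (0, low P.form e V.proj a) by simp)

/-- The real endomorphism `ρ` of `T_{π(V)} M` with `ω(u, ρ a) = -i ν_u ℋ_a J`. -/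
def horHam (B : UncoupledBPS P) (V : TM n M) : T n V.proj →ₗ[ℝ] T n V.proj where
  toFun := horHamFun B V
  map_add' a b := P.ext_form fun u => by
    obtain ⟨U, e, Ω, c, hL⟩ := exists_localModel_at B V.proj
    rw [map_add, hL.form_horHamFun hL.mem, hL.form_horHamFun hL.mem, hL.form_horHamFun hL.mem,
      ← map_add]
    exact congrArg _ (show ((zdiff P e V.proj (a + b), 0) : ((Fin n ⊕ Fin n → ℂ) × (Fin n ⊕ Fin n → ℝ)))
      = (zdiff P e V.proj a, 0) + (zdiff P e V.proj b, 0) by simp)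
  map_smul' r a := P.ext_form fun u => by
    obtain ⟨U, e, Ω, c, hL⟩ := exists_localModel_at B V.proj
    rw [map_smul, hL.form_horHamFun hL.mem, hL.form_horHamFun hL.mem, RingHom.id_apply, ← map_smul]
    exact congrArg _ (show ((zdiff P e V.proj (r • a), 0) : ((Fin n ⊕ Fin n → ℂ) × (Fin n ⊕ Fin n → ℝ)))
      = r • (zdiff P e V.proj a, 0) by simp)

theorem LocalModel.form_vertHam (hL : LocalModel B p₀ U e Ω c) {V : TM n M} (hV : V.proj ∈ U)
    (a u : T n V.proj) : P.form V.proj u (vertHam B V a)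
      = potHess Ω (flatMap P e V) (0, low P.form e V.proj u) (0, low P.form e V.proj a) :=
  hL.form_vertHamFun hV a u

theorem LocalModel.form_horHam (hL : LocalModel B p₀ U e Ω c) {V : TM n M} (hV : V.proj ∈ U)
    (a u : T n V.proj) : P.form V.proj u (horHam B V a)
      = potHess Ω (flatMap P e V) (0, low P.form e V.proj u) (zdiff P e V.proj a, 0) :=
  hL.form_horHamFun hV a u

theorem hamVec_vertDer (B : UncoupledBPS P) (V : TM n M) (X : Cx (T n V.proj)) :
    P.hamVec V.proj (SKData.vertDer (joyceFunction P B) V.proj X) V.2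
      = cmk (-vertHam B V (cim X)) (vertHam B V (cre X)) := by
  obtain ⟨U, e, Ω, c, hL⟩ := exists_localModel_at B V.proj
  exact hL.hamVec_vertDer hL.mem X (hL.form_vertHam hL.mem _) (hL.form_vertHam hL.mem _)

theorem hamVec_horDer (B : UncoupledBPS P) (V : TM n M) (X : Cx (T n V.proj)) :
    P.hamVec V.proj (P.horDer (joyceFunction P B) V.proj X) V.2
      = cmk (-horHam B V (cim X)) (horHam B V (cre X)) := by
  obtain ⟨U, e, Ω, c, hL⟩ := exists_localModel_at B V.proj
  exact hL.hamVec_horDer hL.mem X (hL.form_horHam hL.mem _) (hL.form_horHam hL.mem _)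

end Base
end SpecialJoyce

end

/-! ### Isotropy from uncoupledness, the Laplace equation, and the twisted form. -/

section

namespace SpecialJoyce
open Set Filter

section Flat
variable {ι : Type} [Fintype ι] {Ω : {m : ι → ℤ // m ≠ 0} → ℝ} {ζ₀ : ι → ℂ} {c : ℝ}

namespace FlatBPS
variable (hB : FlatBPS Ω ζ₀ c) {x : (ι → ℂ) × (ι → ℝ)} (hx : x ∈ flatDomain ζ₀ c)
include hB hx

/-- Since the Hessian is a sum over charges, a linear relation between its values need only be
checked for one active charge at a time. -/
theorem sum_potHess_eq_zero {κ : Type*} [Fintype κ] (r : κ → ℝ) (a b : κ → (ι → ℂ) × (ι → ℝ))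
    (h : ∀ m, Ω m ≠ 0 → ∑ j, (r j : ℂ) * hessSum (evalComb m.1 x) (evalComb m.1 (a j)) (evalComb m.1 (b j)) = 0) :
    ∑ j, r j * potHess Ω x (a j) (b j) = 0 := by
  have h1 := hasSum_sum (s := Finset.univ) fun j _ =>
    (hB.hasSum_fderiv_fderiv_flatPotential hx (a j) (b j)).mul_left (r j : ℂ)
  have h2 : (fun m => ∑ j, (r j : ℂ) * ((Ω m : ℂ) * hessSum (evalComb m.1 x) (evalComb m.1 (a j))
      (evalComb m.1 (b j)))) = fun _ => 0 := by
    funext m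
    by_cases hm : Ω m = 0
    · simp [hm]
    · rw [← mul_zero (Ω m : ℂ), ← h m hm, Finset.mul_sum]
      exact Finset.sum_congr rfl fun j _ => by ring
  rw [h2] at h1
  have h3 := h1.unique hasSum_zero
  have h4 : ((-(2 * Real.pi) * ∑ j, r j * potHess Ω x (a j) (b j) : ℝ) : ℂ) = 0 := by
    rw [← h3, Finset.mul_sum]
    push_cast
    refine Finset.sum_congr rfl fun j _ => ?_
    rw [potHess]; ring
  have h5 : -(2 * Real.pi) ≠ 0 := by simp [Real.pi_ne_zero]
  exact (mul_eq_zero.1 (Complex.ofReal_eq_zero.1 h4)).resolve_left h5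

omit hB hx in
theorem _root_.SpecialJoyce.hessSum_zero_left (y b : ℂ × ℝ) : hessSum y 0 b = 0 := by
  simp [hessSum, rdot]

/-- The potential depends only on `(Z_m, θ_m)` for active charges `m`, and the direction `a` moves
none of them. -/
theorem potHess_eq_zero {a : (ι → ℂ) × (ι → ℝ)} (h : ∀ m, Ω m ≠ 0 → evalComb m.1 a = 0)
    (b : (ι → ℂ) × (ι → ℝ)) : potHess Ω x a b = 0 := by
  have := hB.sum_potHess_eq_zero hx (fun _ : Fin 1 => 1) (fun _ => a) (fun _ => b)
    fun m hm => by simp [h m hm, hessSum_zero_left]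
  simpa using this

end FlatBPS
end Flat

section Base
variable {n : ℕ} {M : Type*} [TopologicalSpace M] [ChartedSpace (Model n) M]
  [IsManifold 𝓘(ℂ, Model n) ω M] {P : SpecialPeriodStructure n M}

variable {B : UncoupledBPS P} {p₀ : M} {U : Set M} {e : Fin n ⊕ Fin n → ∀ p : M, T n p}
  {Ω : {m : Fin n ⊕ Fin n → ℤ // m ≠ 0} → ℝ} {c : ℝ}

theorem evalComb_low (m : Fin n ⊕ Fin n → ℤ) (p : M) (u : T n p) :
    evalComb m (0, low P.form e p u) = (0, P.form p u (comb e m p)) := by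
  rw [evalComb_apply, form_comb]; simp

theorem evalComb_zdiff (m : Fin n ⊕ Fin n → ℤ) (p : M) (u : T n p) :
    evalComb m (zdiff P e p u, 0) = ((P.form p u (comb e m p) : ℂ)
      - Complex.I * (P.form p (cplxI n p u) (comb e m p) : ℂ), 0) := by
  rw [evalComb_apply, form_comb, form_comb]
  simp only [zdiff_apply, low_apply, Complex.ofReal_sum, Finset.mul_sum, ← Finset.sum_sub_distrib]
  refine Prod.ext ?_ (by simp)
  dsimp only
  refine Finset.sum_congr rfl fun a _ => ?_
  push_cast
  ring

namespace LocalModel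
variable (hL : LocalModel B p₀ U e Ω c)
include hL

theorem potHess_low_eq_zero {V : TM n M} (hV : V.proj ∈ U) {u : T n V.proj}
    (h : ∀ m, Ω m ≠ 0 → P.form V.proj u (comb e m.1 V.proj) = 0)
    (b : (Fin n ⊕ Fin n → ℂ) × (Fin n ⊕ Fin n → ℝ)) :
    potHess Ω (flatMap P e V) (0, low P.form e V.proj u) b = 0 :=
  hL.bps.potHess_eq_zero (hL.flatMap_mem hV) (fun m hm => by rw [evalComb_low, h m hm]; rfl) b

theorem form_comb_comb {q : M} (hq : q ∈ U) {m m' : {m : Fin n ⊕ Fin n → ℤ // m ≠ 0}} (hm : Ω m ≠ 0)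
    (hm' : Ω m' ≠ 0) : P.form q (comb e m.1 q) (comb e m'.1 q) = 0 := by
  refine B.uncoupled q _ (hL.frame.comb_mem hq _) _ (hL.frame.comb_mem hq _)
    (hL.frame.comb_ne_zero hq m.2) (hL.frame.comb_ne_zero hq m'.2) ?_ ?_
  · rw [← hL.index q hq m] at hm; exact_mod_cast hm
  · rw [← hL.index q hq m'] at hm'; exact_mod_cast hm'

/-- Uncoupledness enters here: the pairing is a Hessian in the fibre direction `γ`, and moving along
an active `γ` changes no active `θ_γ'`, because active charges pair to zero. -/
theorem form_vertHam_comb {V : TM n M} (hV : V.proj ∈ U) (a : T n V.proj)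
    {m : {m : Fin n ⊕ Fin n → ℤ // m ≠ 0}} (hm : Ω m ≠ 0) :
    P.form V.proj (vertHam B V a) (comb e m.1 V.proj) = 0 := by
  rw [P.skew, hL.form_vertHam hV, hL.potHess_low_eq_zero hV fun m' hm' => hL.form_comb_comb hV hm hm',
    neg_zero]

theorem form_horHam_comb {V : TM n M} (hV : V.proj ∈ U) (a : T n V.proj)
    {m : {m : Fin n ⊕ Fin n → ℤ // m ≠ 0}} (hm : Ω m ≠ 0) :
    P.form V.proj (horHam B V a) (comb e m.1 V.proj) = 0 := by
  rw [P.skew, hL.form_horHam hV, hL.potHess_low_eq_zero hV fun m' hm' => hL.form_comb_comb hV hm hm',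
    neg_zero]

/-- As `dZ(Ib) = i dZ(b)`, only the trace of the Hessian in `Z` survives this antisymmetrization for
each charge. The equation `Δ_Z = -4π² ∂_θ²` of `waveSum_recurrence` then replaces that trace by
fibre derivatives, which define `vertHam`. -/
theorem potHess_zdiff_zdiff {V : TM n M} (hV : V.proj ∈ U) (a b : T n V.proj) :
    potHess Ω (flatMap P e V) (zdiff P e V.proj a, 0) (zdiff P e V.proj (cplxI n V.proj b), 0)
      - potHess Ω (flatMap P e V) (zdiff P e V.proj b, 0) (zdiff P e V.proj (cplxI n V.proj a), 0)
      = 4 * Real.pi ^ 2 * (P.form V.proj (cplxI n V.proj a) (vertHam B V b)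
        - P.form V.proj a (vertHam B V (cplxI n V.proj b))) := by
  rw [hL.form_vertHam hV, hL.form_vertHam hV]
  have := hL.bps.sum_potHess_eq_zero (hL.flatMap_mem hV)
    ![1, -1, -(4 * Real.pi ^ 2), 4 * Real.pi ^ 2]
    ![(zdiff P e V.proj a, 0), (zdiff P e V.proj b, 0), (0, low P.form e V.proj (cplxI n V.proj a)),
      (0, low P.form e V.proj a)]
    ![(zdiff P e V.proj (cplxI n V.proj b), 0), (zdiff P e V.proj (cplxI n V.proj a), 0),
      (0, low P.form e V.proj b), (0, low P.form e V.proj (cplxI n V.proj b))] fun m hm => by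
    have h1 := waveSum_recurrence (hL.bps.evalComb_ne_zero hm (hL.flatMap_mem hV))
    simp only [Fin.sum_univ_four, Matrix.cons_val, evalComb_zdiff, evalComb_low, hessSum,
      cplxI_cplxI, map_neg, LinearMap.neg_apply]
    set x := evalComb m.1 (flatMap P e V)
    set α := P.form V.proj a (comb e m.1 V.proj)
    set α' := P.form V.proj (cplxI n V.proj a) (comb e m.1 V.proj)
    set β := P.form V.proj b (comb e m.1 V.proj)
    set β' := P.form V.proj (cplxI n V.proj b) (comb e m.1 V.proj)
    rw [← Complex.ofReal_pow, ← Complex.normSq_eq_norm_sq, Complex.normSq_apply] at h1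
    simp only [rdot]
    simp
    push_cast at h1
    linear_combination (4 * Real.pi * (α * β' - α' * β) : ℂ) * h1
  simp only [Fin.sum_univ_four, Matrix.cons_val] at this
  linarith

/-- For one charge the mixed Hessian is `ω(-, γ)` times a fixed real functional of `dZ_γ`; given
`dZ_γ(I-) = i dZ_γ` the four terms cancel algebraically, without the Bessel recurrence. -/
theorem form_horHam_symm {V : TM n M} (hV : V.proj ∈ U) (a b : T n V.proj) :
    P.form V.proj a (horHam B V (cplxI n V.proj b)) - P.form V.proj b (horHam B V (cplxI n V.proj a))
      - P.form V.proj (cplxI n V.proj b) (horHam B V a)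
      + P.form V.proj (cplxI n V.proj a) (horHam B V b) = 0 := by
  rw [hL.form_horHam hV, hL.form_horHam hV, hL.form_horHam hV, hL.form_horHam hV]
  have := hL.bps.sum_potHess_eq_zero (hL.flatMap_mem hV) ![1, -1, -1, 1]
    ![(0, low P.form e V.proj a), (0, low P.form e V.proj b),
      (0, low P.form e V.proj (cplxI n V.proj b)), (0, low P.form e V.proj (cplxI n V.proj a))]
    ![(zdiff P e V.proj (cplxI n V.proj b), 0), (zdiff P e V.proj (cplxI n V.proj a), 0),
      (zdiff P e V.proj a, 0), (zdiff P e V.proj b, 0)] fun m hm => by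
    simp only [Fin.sum_univ_four, Matrix.cons_val, evalComb_zdiff, evalComb_low, hessSum,
      cplxI_cplxI, map_neg, LinearMap.neg_apply]
    simp only [rdot]
    simp
    ring
  simp only [Fin.sum_univ_four, Matrix.cons_val] at this
  linarith

end LocalModel

section Global
variable (B) (V : TM n M) (a b : T n V.proj)

theorem form_vertHam_symm :
    P.form V.proj a (vertHam B V b) = P.form V.proj b (vertHam B V a) := by
  obtain ⟨U, e, Ω, c, hL⟩ := exists_localModel_at B V.proj
  rw [hL.form_vertHam hL.mem, hL.form_vertHam hL.mem, hL.bps.potHess_symm (hL.flatMap_mem hL.mem)]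

/-- The left vector pairs to zero with every active charge, so as a fibre direction it annihilates
the Hessian. The same argument covers the pairings involving `horHam`. -/
theorem form_vertHam_vertHam : P.form V.proj (vertHam B V a) (vertHam B V b) = 0 := by
  obtain ⟨U, e, Ω, c, hL⟩ := exists_localModel_at B V.proj
  rw [hL.form_vertHam hL.mem,
    hL.potHess_low_eq_zero hL.mem fun m hm => hL.form_vertHam_comb hL.mem a hm]

theorem form_horHam_vertHam : P.form V.proj (horHam B V a) (vertHam B V b) = 0 := by
  obtain ⟨U, e, Ω, c, hL⟩ := exists_localModel_at B V.proj
  rw [hL.form_vertHam hL.mem,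
    hL.potHess_low_eq_zero hL.mem fun m hm => hL.form_horHam_comb hL.mem a hm]

theorem form_vertHam_horHam : P.form V.proj (vertHam B V a) (horHam B V b) = 0 := by
  rw [P.skew, form_horHam_vertHam, neg_zero]

theorem form_horHam_horHam : P.form V.proj (horHam B V a) (horHam B V b) = 0 := by
  obtain ⟨U, e, Ω, c, hL⟩ := exists_localModel_at B V.proj
  rw [hL.form_horHam hL.mem,
    hL.potHess_low_eq_zero hL.mem fun m hm => hL.form_horHam_comb hL.mem a hm]

/-- The endomorphism `I + q` of `T_{π(V)} M`. -/
def twistI : T n V.proj →ₗ[ℝ] T n V.proj := cplxI n V.proj + vertHam B V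

theorem twistI_apply : twistI B V a = cplxI n V.proj a + vertHam B V a := rfl

/-- The form `ω(S -, S -)` with `S = I + q`. -/
def twistForm : LinearMap.BilinForm ℝ (T n V.proj) :=
  (P.form V.proj).comp (twistI B V) (twistI B V)

theorem twistForm_apply : twistForm B V a b = P.form V.proj (twistI B V a) (twistI B V b) := rfl

/-- The term quadratic in `q` drops out by isotropy, so the form is affine in `q`. -/
theorem twistForm_eq : twistForm B V a b = P.form V.proj a b
    + P.form V.proj (cplxI n V.proj a) (vertHam B V b)
    - P.form V.proj (cplxI n V.proj b) (vertHam B V a) := by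
  rw [twistForm_apply, twistI_apply, twistI_apply]
  simp only [map_add, LinearMap.add_apply]
  rw [P.compat, form_vertHam_vertHam, P.skew _ (vertHam B V a) (cplxI n V.proj b)]
  ring

theorem twistForm_skew : twistForm B V a b = - twistForm B V b a := by
  rw [twistForm_apply, twistForm_apply, P.skew]

/-- The cross terms `ω(Ia, qb)` and `ω(Ib, qa)` are exchanged by `I` through the symmetry of `q`;
without the quadratic term nothing obstructs type `(1,1)`. -/
theorem twistForm_cplxI :
    twistForm B V (cplxI n V.proj a) (cplxI n V.proj b) = twistForm B V a b := by
  rw [twistForm_eq, twistForm_eq, P.compat, cplxI_cplxI, cplxI_cplxI, map_neg, map_neg,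
    LinearMap.neg_apply, LinearMap.neg_apply, form_vertHam_symm B V a, form_vertHam_symm B V b]
  ring

theorem twistForm_cplxI_left : twistForm B V (cplxI n V.proj a) b = - twistForm B V a (cplxI n V.proj b) := by
  rw [← twistForm_cplxI, cplxI_cplxI, map_neg, LinearMap.neg_apply]

end Global

end Base
end SpecialJoyce

end

/-! ### The lifts `h` and `v` as complexifications of real maps. -/

section

namespace SpecialJoyce
open Set Filter

section Base
variable {n : ℕ} {M : Type*} [TopologicalSpace M] [ChartedSpace (Model n) M]
  [IsManifold 𝓘(ℂ, Model n) ω M]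

theorem cplxI_cre_of_mem_T10 {p : M} {X : Cx (T n p)} (hX : X ∈ T10 n p) :
    cplxI n p (cre X) = - cim X := by
  have h := congrArg cre (Module.End.mem_eigenspace_iff.1 hX)
  simpa using h

theorem cplxI_cim_of_mem_T10 {p : M} {X : Cx (T n p)} (hX : X ∈ T10 n p) :
    cplxI n p (cim X) = cre X := by
  have h := congrArg cim (Module.End.mem_eigenspace_iff.1 hX)
  simpa using h

theorem pi10_mem_T10 (p : M) (Y : Cx (T n p)) : pi10 n p Y ∈ T10 n p := by
  refine Module.End.mem_eigenspace_iff.2 (cx_ext ?_ ?_)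
  · simp [cre_pi10, cim_pi10, cplxI_cplxI]; module
  · simp [cre_pi10, cim_pi10, cplxI_cplxI]; module

theorem cconj_pi01_mem_T10 (p : M) (Y : Cx (T n p)) : cconj (pi01 n p Y) ∈ T10 n p := by
  refine Module.End.mem_eigenspace_iff.2 (cx_ext ?_ ?_)
  · simp [cre_pi01, cim_pi01, cplxI_cplxI]; module
  · simp [cre_pi01, cim_pi01, cplxI_cplxI]; module

theorem pi10_add_pi01 (p : M) (Y : Cx (T n p)) : pi10 n p Y + pi01 n p Y = Y := by
  rw [pi10, pi01]; module

variable {P : SpecialPeriodStructure n M} (B : UncoupledBPS P)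
  (V : TM n M)

/-- The real horizontal lift `a ↦ ℋ_a + ν_{ρ(Ia)}` whose complexification restricts to `h`. -/
def horTwist : T n V.proj →ₗ[ℝ] TT V :=
  P.hor V + vert V ∘ₗ horHam B V ∘ₗ cplxI n V.proj

theorem horTwist_apply (a : T n V.proj) :
    horTwist B V a = P.hor V a + vert V (horHam B V (cplxI n V.proj a)) := rfl

/-- The real vertical map `c ↦ -2π S c` whose complexification is `v` on conjugate vectors. -/
def vertTwistBase : T n V.proj →ₗ[ℝ] T n V.proj := (-(2 * Real.pi)) • twistI B V

theorem vertTwistBase_apply (c : T n V.proj) :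
    vertTwistBase B V c = (-(2 * Real.pi)) • twistI B V c := rfl

def vertTwist : T n V.proj →ₗ[ℝ] TT V := vert V ∘ₗ vertTwistBase B V

theorem vertTwist_apply (c : T n V.proj) :
    vertTwist B V c = vert V (vertTwistBase B V c) := rfl

variable {V}

/-- The Hamiltonian part is `iρ(X)`, and `iX = IX` for `X` of type `(1,0)`, so it equals the
complexification of `ρI`. -/
theorem h_eq_cmap {X : Cx (T n V.proj)} (hX : X ∈ T10 n V.proj) :
    P.h (joyceFunction P B) V X = cmap (horTwist B V) X := by
  rw [SKData.h, hamVec_horDer]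
  refine cx_ext ?_ ?_
  · simp only [map_add, cre_cmap, cre_cmk, horTwist_apply, cplxI_cre_of_mem_T10 hX, map_neg]
  · simp only [map_add, cim_cmap, cim_cmk, horTwist_apply, cplxI_cim_of_mem_T10 hX]

/-- On conjugates `iX̄ = -IX̄`, hence `2πi(X̄ + i q X̄) = -2π(I + q)X̄`. -/
theorem vBase_eq_cmap {X : Cx (T n V.proj)} (hX : X ∈ T10 n V.proj) :
    P.vBase (joyceFunction P B) V X = cmap (vertTwistBase B V) (cconj X) := by
  rw [SKData.vBase, hamVec_vertDer]
  refine cx_ext ?_ ?_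
  · simp [vertTwistBase_apply, twistI_apply, cplxI_cre_of_mem_T10 hX]
  · simp [vertTwistBase_apply, twistI_apply, cplxI_cim_of_mem_T10 hX]

theorem v_eq_cmap {X : Cx (T n V.proj)} (hX : X ∈ T10 n V.proj) :
    P.v (joyceFunction P B) V X = cmap (vertTwist B V) (cconj X) := by
  rw [SKData.v, vBase_eq_cmap B hX]
  exact cx_ext (by simp [vertTwist_apply]) (by simp [vertTwist_apply])

theorem cconj_cmap {V W : Type*} [AddCommGroup V] [Module ℝ V] [AddCommGroup W] [Module ℝ W]
    (f : V →ₗ[ℝ] W) (x : Cx V) : cconj (cmap f x) = cmap f (cconj x) := cx_ext (by simp) (by simp)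

theorem cconj_cconj {V : Type*} [AddCommGroup V] [Module ℝ V] (x : Cx V) : cconj (cconj x) = x :=
  cx_ext (by simp) (by simp)

theorem connFamily_eq (ζ : ℂ) (Y : Cx (T n V.proj)) :
    P.connFamily (joyceFunction P B) ζ V Y = cmap (horTwist B V) Y
      + cmap (vertTwist B V) (ζ • pi01 n V.proj Y - ζ⁻¹ • pi10 n V.proj Y) := by
  have h10 := pi10_mem_T10 V.proj Y
  have h01 := cconj_pi01_mem_T10 V.proj Y
  rw [SKData.connFamily, h_eq_cmap B h10, h_eq_cmap B h01, v_eq_cmap B h10, v_eq_cmap B h01,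
    cconj_cmap, cconj_cmap, cconj_cconj, cconj_cconj]
  conv_rhs => rw [← pi10_add_pi01 V.proj Y]
  rw [map_add, map_sub, map_smul, map_smul, pi10_add_pi01]
  abel

theorem connZero_eq (Y : Cx (T n V.proj)) :
    P.connZero (joyceFunction P B) V Y = cmap (horTwist B V) (pi01 n V.proj Y)
      - cmap (vertTwist B V) (pi10 n V.proj Y) := by
  have h10 := pi10_mem_T10 V.proj Y
  have h01 := cconj_pi01_mem_T10 V.proj Y
  rw [SKData.connZero, h_eq_cmap B h01, v_eq_cmap B h10, cconj_cmap, cconj_cmap, cconj_cconj, cconj_cconj]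
  abel

variable (V) in
/-- The real parametrization `(a, c) ↦ ℋ_a + ν_{ρ(Ia)} - 2π ν_{Sc}` of `T_V N`. -/
def twistMap : T n V.proj × T n V.proj →ₗ[ℝ] TT V := (horTwist B V).coprod (vertTwist B V)

theorem twistMap_apply (x : T n V.proj × T n V.proj) :
    twistMap B V x = horTwist B V x.1 + vertTwist B V x.2 := rfl

/-- Taking real parts of a decomposition of a real vector into `h`, `h̄`, `v`, `v̄` writes it with
the two real maps, which gives surjectivity; injectivity is a dimension count. -/
theorem bijective_twistMap (hnd : P.NonDegAt (joyceFunction P B) V) :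
    Function.Bijective (twistMap B V) := by
  have hs : Function.Surjective (twistMap B V) := by
    intro A
    obtain ⟨x, hx⟩ := hnd.2 (cmk A 0)
    have h := congrArg cre hx
    simp only [h_eq_cmap B (SetLike.coe_mem _), v_eq_cmap B (SetLike.coe_mem _), map_add, cre_cconj,
      cre_cmap, cre_cmk] at h
    refine ⟨(cre (x.1 : Cx (T n V.proj)) + cre (x.2.1 : Cx (T n V.proj)),
      cre (x.2.2.1 : Cx (T n V.proj)) + cre (x.2.2.2 : Cx (T n V.proj))), ?_⟩
    rw [twistMap_apply, ← h, map_add, map_add]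
    abel
  refine ⟨?_, hs⟩
  refine (LinearMap.injective_iff_surjective_of_finrank_eq_finrank ?_).2 hs
  rw [finrank_TT, Module.finrank_prod, finrank_T]

theorem twistI_injective (hnd : P.NonDegAt (joyceFunction P B) V) :
    Function.Injective (twistI B V) := by
  intro a b h
  have h1 : twistMap B V (0, a) = twistMap B V (0, b) := by
    simp only [twistMap_apply, vertTwist_apply, vertTwistBase_apply, h]
  exact congrArg Prod.snd ((bijective_twistMap B hnd).1 h1)

theorem twistForm_nondeg (hnd : P.NonDegAt (joyceFunction P B) V) {a : T n V.proj}
    (h : ∀ b, twistForm B V a b = 0) : a = 0 := by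
  have hs : Function.Surjective (twistI B V) :=
    LinearMap.injective_iff_surjective.1 (twistI_injective B hnd)
  refine twistI_injective B hnd ((P.form_nondeg fun w => ?_).trans (map_zero _).symm)
  obtain ⟨b, rfl⟩ := hs w
  exact h b

theorem dproj_horTwist (a : T n V.proj) : dproj V (horTwist B V a) = a := by
  rw [horTwist_apply, map_add, dproj_hor, dproj_vert, add_zero]

end Base
end SpecialJoyce

end

/-! ### The hyperkähler data in the parametrization by pairs `(a, c)`. -/

section

namespace SpecialJoyce
open Set Filter

section Base
variable {n : ℕ} {M : Type*} [TopologicalSpace M] [ChartedSpace (Model n) M]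
  [IsManifold 𝓘(ℂ, Model n) ω M] {P : SpecialPeriodStructure n M} (B : UncoupledBPS P)
  (hnd : ∀ V, P.NonDegAt (joyceFunction P B) V)

/-- The parametrization `twistMap` as an isomorphism. -/
def twistEquiv (V : TM n M) : (T n V.proj × T n V.proj) ≃ₗ[ℝ] TT V :=
  LinearEquiv.ofBijective (twistMap B V) (bijective_twistMap B (hnd V))

/-- The hyperkähler data in terms of the parametrization `(a, c) ↦ ℋ_a + ν_{ρ(Ia)} - 2π ν_{Sc}`. -/
def joyceHyperData : HyperData n M where
  form₃ V := ((twistForm B V).comp (LinearMap.fst ℝ _ _) (LinearMap.fst ℝ _ _)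
      - (twistForm B V).comp (LinearMap.snd ℝ _ _) (LinearMap.snd ℝ _ _)).comp
      (twistEquiv B hnd V).symm (twistEquiv B hnd V).symm
  I₁ V := (twistEquiv B hnd V).conj ((-LinearMap.snd ℝ _ _).prod (LinearMap.fst ℝ _ _))
  I₂ V := (twistEquiv B hnd V).conj ((-(cplxI n V.proj ∘ₗ LinearMap.snd ℝ _ _)).prod
      (-(cplxI n V.proj ∘ₗ LinearMap.fst ℝ _ _)))
  I₃ V := (twistEquiv B hnd V).conj ((cplxI n V.proj ∘ₗ LinearMap.fst ℝ _ _).prod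
      (-(cplxI n V.proj ∘ₗ LinearMap.snd ℝ _ _)))

variable (V : TM n M) (x y : T n V.proj × T n V.proj)

theorem twistEquiv_symm_twistMap : (twistEquiv B hnd V).symm (twistMap B V x) = x :=
  (twistEquiv B hnd V).symm_apply_apply x

theorem joyceHyperData_form₃ : (joyceHyperData B hnd).form₃ V (twistMap B V x) (twistMap B V y)
    = twistForm B V x.1 y.1 - twistForm B V x.2 y.2 := by
  simp [joyceHyperData, twistEquiv_symm_twistMap]

theorem joyceHyperData_I₁ : (joyceHyperData B hnd).I₁ V (twistMap B V x) = twistMap B V (-x.2, x.1) := by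
  simp only [joyceHyperData, LinearEquiv.conj_apply_apply, twistEquiv_symm_twistMap]
  rfl

theorem joyceHyperData_I₂ : (joyceHyperData B hnd).I₂ V (twistMap B V x)
    = twistMap B V (-cplxI n V.proj x.2, -cplxI n V.proj x.1) := by
  simp only [joyceHyperData, LinearEquiv.conj_apply_apply, twistEquiv_symm_twistMap]
  rfl

theorem joyceHyperData_I₃ : (joyceHyperData B hnd).I₃ V (twistMap B V x)
    = twistMap B V (cplxI n V.proj x.1, -cplxI n V.proj x.2) := by
  simp only [joyceHyperData, LinearEquiv.conj_apply_apply, twistEquiv_symm_twistMap]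
  rfl

theorem joyceHyperData_g : (joyceHyperData B hnd).g V (twistMap B V x) (twistMap B V y)
    = twistForm B V x.1 (cplxI n V.proj y.1) + twistForm B V x.2 (cplxI n V.proj y.2) := by
  rw [HyperData.g, LinearMap.BilinForm.compRight_apply, joyceHyperData_I₃, joyceHyperData_form₃]
  simp

theorem joyceHyperData_form₁ : (joyceHyperData B hnd).form₁ V (twistMap B V x) (twistMap B V y)
    = twistForm B V x.1 (cplxI n V.proj y.2) - twistForm B V x.2 (cplxI n V.proj y.1) := by
  rw [HyperData.form₁, LinearMap.BilinForm.compLeft_apply, joyceHyperData_I₁, joyceHyperData_g]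
  simp
  ring

theorem joyceHyperData_form₂ : (joyceHyperData B hnd).form₂ V (twistMap B V x) (twistMap B V y)
    = -twistForm B V x.1 y.2 - twistForm B V x.2 y.1 := by
  rw [HyperData.form₂, LinearMap.BilinForm.compLeft_apply, joyceHyperData_I₂, joyceHyperData_g]
  simp [twistForm_cplxI]
  ring

include hnd in
theorem exists_twistMap (A : TT V) : ∃ x, twistMap B V x = A := (bijective_twistMap B (hnd V)).2 A

theorem cmap_horTwist (Y : Cx (T n V.proj)) :
    cmap (horTwist B V) Y = cmk (twistMap B V (cre Y, 0)) (twistMap B V (cim Y, 0)) :=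
  cx_ext (by simp [twistMap_apply]) (by simp [twistMap_apply])

theorem cmap_vertTwist (Y : Cx (T n V.proj)) :
    cmap (vertTwist B V) Y = cmk (twistMap B V (0, cre Y)) (twistMap B V (0, cim Y)) :=
  cx_ext (by simp [twistMap_apply]) (by simp [twistMap_apply])

theorem cmk_twistMap_add (Y W : Cx (T n V.proj)) :
    cmap (horTwist B V) Y + cmap (vertTwist B V) W
      = cmk (twistMap B V (cre Y, cre W)) (twistMap B V (cim Y, cim W)) :=
  cx_ext (by simp [twistMap_apply]) (by simp [twistMap_apply])

theorem cmk_twistMap_congr {x y x' y' : T n V.proj × T n V.proj} (h : x = x') (h' : y = y') :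
    cmk (twistMap B V x) (twistMap B V y) = cmk (twistMap B V x') (twistMap B V y') := by
  rw [h, h']

theorem cmap_cmk {V W : Type*} [AddCommGroup V] [Module ℝ V] [AddCommGroup W] [Module ℝ W]
    (f : V →ₗ[ℝ] W) (a b : V) : cmap f (cmk a b) = cmk (f a) (f b) := cx_ext (by simp) (by simp)

theorem neg_I_smul_cmk_twistMap : -Complex.I • cmk (twistMap B V x) (twistMap B V y)
    = cmk (twistMap B V y) (twistMap B V (-x)) := cx_ext (by simp) (by simp)

theorem connZero_eq_cmk (Y : Cx (T n V.proj)) : P.connZero (joyceFunction P B) V Y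
    = cmk (twistMap B V (cre (pi01 n V.proj Y), -cre (pi10 n V.proj Y)))
      (twistMap B V (cim (pi01 n V.proj Y), -cim (pi10 n V.proj Y))) := by
  rw [connZero_eq, sub_eq_add_neg, ← map_neg, cmk_twistMap_add, map_neg, map_neg]

theorem cmap_joyceHyperData_I₁ (Y : Cx (T n V.proj)) :
    cmap ((joyceHyperData B hnd).I₁ V) (P.connFamily (joyceFunction P B) Complex.I V Y)
      = -Complex.I • P.connFamily (joyceFunction P B) Complex.I V Y := by
  rw [connFamily_eq, cmk_twistMap_add, cmap_cmk, joyceHyperData_I₁, joyceHyperData_I₁,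
    neg_I_smul_cmk_twistMap]
  refine cmk_twistMap_congr B V (Prod.ext ?_ ?_) (Prod.ext ?_ ?_) <;>
    simp [cre_pi10, cim_pi10, cre_pi01, cim_pi01] <;> module

theorem cmap_joyceHyperData_I₂ (Y : Cx (T n V.proj)) :
    cmap ((joyceHyperData B hnd).I₂ V) (P.connFamily (joyceFunction P B) (-1) V Y)
      = -Complex.I • P.connFamily (joyceFunction P B) (-1) V Y := by
  rw [connFamily_eq, cmk_twistMap_add, cmap_cmk, joyceHyperData_I₂, joyceHyperData_I₂,
    neg_I_smul_cmk_twistMap]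
  refine cmk_twistMap_congr B V (Prod.ext ?_ ?_) (Prod.ext ?_ ?_) <;>
    simp [cre_pi10, cim_pi10, cre_pi01, cim_pi01, cplxI_cplxI] <;> module

theorem cmap_joyceHyperData_I₃ (Y : Cx (T n V.proj)) :
    cmap ((joyceHyperData B hnd).I₃ V) (P.connZero (joyceFunction P B) V Y)
      = -Complex.I • P.connZero (joyceFunction P B) V Y := by
  rw [connZero_eq_cmk, cmap_cmk, joyceHyperData_I₃, joyceHyperData_I₃, neg_I_smul_cmk_twistMap]
  refine cmk_twistMap_congr B V (Prod.ext ?_ ?_) (Prod.ext ?_ ?_) <;>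
    simp [cre_pi10, cim_pi10, cre_pi01, cim_pi01, cplxI_cplxI] <;> module

theorem joyceHyperData_isAssociated :
    (joyceHyperData B hnd).IsAssociated P.toSKData (joyceFunction P B) where
  I₁_eq := cmap_joyceHyperData_I₁ B hnd
  I₂_eq := cmap_joyceHyperData_I₂ B hnd
  I₃_eq := cmap_joyceHyperData_I₃ B hnd
  form₃_skew V A A' := by
    obtain ⟨x, rfl⟩ := exists_twistMap B hnd V A
    obtain ⟨y, rfl⟩ := exists_twistMap B hnd V A'
    rw [joyceHyperData_form₃, joyceHyperData_form₃, twistForm_skew B V x.1, twistForm_skew B V x.2]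
    ring
  form₃_vv V X hX Y hY := by
    rw [v_eq_cmap B hX, v_eq_cmap B hY, vBase_eq_cmap B hX, vBase_eq_cmap B hY, cconj_cmap, cconj_cmap,
      cconj_cconj, cmap_vertTwist, cmap_vertTwist, cbil_apply, cbil_apply]
    simp only [cre_cmk, cim_cmk, joyceHyperData_form₃, cre_cmap, cim_cmap, vertTwistBase_apply, map_smul,
      LinearMap.smul_apply, ← twistForm_apply, map_zero, smul_eq_mul]
    have : (Real.pi : ℂ) ≠ 0 := by exact_mod_cast Real.pi_ne_zero
    push_cast
    field_simp
    ring
  form₃_hh V X hX Y hY := by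
    rw [h_eq_cmap B hX, h_eq_cmap B hY, vBase_eq_cmap B hX, vBase_eq_cmap B hY, cconj_cmap, cconj_cmap,
      cconj_cconj, cmap_horTwist, cmap_horTwist, cbil_apply, cbil_apply]
    simp only [cre_cmk, cim_cmk, joyceHyperData_form₃, cre_cmap, cim_cmap, vertTwistBase_apply, map_smul,
      LinearMap.smul_apply, ← twistForm_apply, map_zero, smul_eq_mul]
    -- The order `h_Y, h̄_X` is reversed compared with `v_X, v̄_Y`, and skewness supplies the sign
    -- with which the two blocks enter `ω₃`.
    rw [twistForm_skew B V (cre Y), twistForm_skew B V (cre Y), twistForm_skew B V (cim Y),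
      twistForm_skew B V (cim Y)]
    have : (Real.pi : ℂ) ≠ 0 := by exact_mod_cast Real.pi_ne_zero
    push_cast
    field_simp
    ring
  form₃_zero V X hX Y hY := by
    -- `k1` and `k2` say that a form of type `(1,1)` vanishes on two vectors of type `(1,0)`.
    have k1 : twistForm B V (cre X) (cre Y) = twistForm B V (cim X) (cim Y) := by
      rw [← cplxI_cim_of_mem_T10 hX, ← cplxI_cim_of_mem_T10 hY, twistForm_cplxI]
    have k2 : twistForm B V (cre X) (cim Y) = - twistForm B V (cim X) (cre Y) := by
      rw [← cplxI_cim_of_mem_T10 hX, ← cplxI_cim_of_mem_T10 hY, twistForm_cplxI_left]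
    rw [v_eq_cmap B hX, v_eq_cmap B hY, h_eq_cmap B hX, h_eq_cmap B hY, cconj_cmap, cmap_vertTwist,
      cmap_vertTwist, cmap_vertTwist, cmap_horTwist, cmap_horTwist, cbil_apply, cbil_apply, cbil_apply,
      cbil_apply]
    simp [joyceHyperData_form₃, k1, k2]

include hnd in
theorem exists_type11 : ∃ I₃ : TT V →ₗ[ℝ] TT V,
    (∀ Y, cmap I₃ (P.connZero (joyceFunction P B) V Y)
      = -Complex.I • P.connZero (joyceFunction P B) V Y) ∧
    ∃ j : T n V.proj →ₗ[ℝ] T n V.proj, (∀ u, I₃ (vert V u) = vert V (j u)) ∧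
      ∀ a b, P.form V.proj (j a) (j b) = P.form V.proj a b := by
  refine ⟨(joyceHyperData B hnd).I₃ V, (joyceHyperData_isAssociated B hnd).I₃_eq V, ?_⟩
  let s : T n V.proj ≃ₗ[ℝ] T n V.proj := LinearEquiv.ofInjectiveEndo (twistI B V) (twistI_injective B (hnd V))
  have hs : ∀ a, s a = twistI B V a := fun a => rfl
  -- In the `c` component `I₃` is `-I`, so on vertical vectors it is `-S I S⁻¹`; `ω` is of type
  -- `(1,1)` for this exactly because `ω(S-, S-)` is so for `I`.
  refine ⟨-(s.conj (cplxI n V.proj)), fun u => ?_, fun a b => ?_⟩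
  · obtain ⟨c, rfl⟩ := s.surjective u
    have h1 : ∀ c, vert V (s c) = twistMap B V (0, (-(2 * Real.pi))⁻¹ • c) := fun c => by
      rw [twistMap_apply, map_zero, zero_add, map_smul, vertTwist_apply, vertTwistBase_apply, map_smul,
        smul_smul, inv_mul_cancel₀ (by simp [Real.pi_ne_zero]), one_smul, hs]
    rw [h1, joyceHyperData_I₃, LinearMap.neg_apply, LinearEquiv.conj_apply_apply, s.symm_apply_apply,
      map_neg, h1, map_smul, ← map_neg]
    simp
  · obtain ⟨a, rfl⟩ := s.surjective a
    obtain ⟨b, rfl⟩ := s.surjective b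
    simp only [LinearMap.neg_apply, LinearEquiv.conj_apply_apply, s.symm_apply_apply, map_neg, neg_neg]
    exact twistForm_cplxI B V a b

end Base
end SpecialJoyce

end

/-! ### The three Kähler forms expressed through the Hessian of the potential. -/

section

namespace SpecialJoyce
open Set Filter

section Wedge
variable {E : Type*} [NormedAddCommGroup E] [NormedSpace ℝ E] [CompleteSpace E] {H : Type*} [TopologicalSpace H]
  (I : ModelWithCorners ℝ E H) {X : Type*} [TopologicalSpace X] [ChartedSpace H X]
  [IsManifold I ∞ X] [I.Boundaryless]

/-- The field of two-tensors `φ` is on `W` a finite sum of forms `df ∧ dg`. -/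
def WedgeSumOn (W : Set X) (φ : ∀ x : X, TangentSpace I x → TangentSpace I x → ℝ) : Prop :=
  ∃ (J : Type) (_ : Fintype J) (f g : J → X → ℝ),
    (∀ j, ContMDiffOn I 𝓘(ℝ, ℝ) ∞ (f j) W) ∧ (∀ j, ContMDiffOn I 𝓘(ℝ, ℝ) ∞ (g j) W) ∧
    ∀ y ∈ W, ∀ u v, φ y u v = ∑ j, dWedge I (f j) (g j) y u v

variable {I} {W : Set X}

theorem wedgeSumOn_dWedge {f g : X → ℝ} (hf : ContMDiffOn I 𝓘(ℝ, ℝ) ∞ f W)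
    (hg : ContMDiffOn I 𝓘(ℝ, ℝ) ∞ g W) : WedgeSumOn I W (dWedge I f g) :=
  ⟨Unit, inferInstance, fun _ => f, fun _ => g, fun _ => hf, fun _ => hg, fun y _ u v => by simp⟩

theorem WedgeSumOn.sum {κ : Type} [Fintype κ] {φ : κ → ∀ x : X, TangentSpace I x → TangentSpace I x → ℝ}
    (h : ∀ k, WedgeSumOn I W (φ k)) : WedgeSumOn I W fun x u v => ∑ k, φ k x u v := by
  choose J hJ f g hf hg hfg using h
  refine ⟨Σ k, J k, inferInstance, fun j => f j.1 j.2, fun j => g j.1 j.2, fun j => hf _ _,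
    fun j => hg _ _, fun y hy u v => ?_⟩
  rw [Fintype.sum_sigma]
  exact Finset.sum_congr rfl fun k _ => hfg k y hy u v

theorem WedgeSumOn.add {φ ψ : ∀ x : X, TangentSpace I x → TangentSpace I x → ℝ}
    (h : WedgeSumOn I W φ) (h' : WedgeSumOn I W ψ) :
    WedgeSumOn I W fun x u v => φ x u v + ψ x u v := by
  have := WedgeSumOn.sum (φ := fun b : Bool => cond b φ ψ) (W := W) (by rintro (_ | _); exacts [h', h])
  simpa using this

theorem WedgeSumOn.const_mul (hW : IsOpen W) {φ : ∀ x : X, TangentSpace I x → TangentSpace I x → ℝ}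
    (h : WedgeSumOn I W φ) (c : ℝ) : WedgeSumOn I W fun x u v => c * φ x u v := by
  obtain ⟨J, hJ, f, g, hf, hg, hfg⟩ := h
  refine ⟨J, hJ, fun j y => c * f j y, g, fun j => contMDiffOn_const.mul (hf j), hg, fun y hy u v => ?_⟩
  dsimp only
  rw [hfg y hy, Finset.mul_sum]
  refine Finset.sum_congr rfl fun j _ => ?_
  have hd := ((hf j).contMDiffAt (hW.mem_nhds hy)).mdifferentiableAt (by simp)
  rw [dWedge, dWedge, dReal_const_mul c hd, dReal_const_mul c hd]
  ring

theorem WedgeSumOn.congr {φ ψ : ∀ x : X, TangentSpace I x → TangentSpace I x → ℝ}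
    (h : WedgeSumOn I W φ) (h' : ∀ y ∈ W, ∀ u v, ψ y u v = φ y u v) : WedgeSumOn I W ψ := by
  obtain ⟨J, hJ, f, g, hf, hg, hfg⟩ := h
  exact ⟨J, hJ, f, g, hf, hg, fun y hy u v => (h' y hy u v).trans (hfg y hy u v)⟩

theorem locallyWedgeSum_of_wedgeSumOn {β : ∀ x : X, LinearMap.BilinForm ℝ (TangentSpace I x)}
    (h : ∀ x, ∃ W, IsOpen W ∧ x ∈ W ∧ WedgeSumOn I W fun y u v => β y u v) : LocallyWedgeSum I β := by
  intro x
  obtain ⟨W, hW, hx, J, hJ, f, g, hf, hg, hfg⟩ := h x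
  exact ⟨J, hJ, f, g, W, hW, hx, hf, hg, hfg⟩

end Wedge

section Base
variable {n : ℕ} {M : Type*} [TopologicalSpace M] [ChartedSpace (Model n) M]
  [IsManifold 𝓘(ℂ, Model n) ω M] {P : SpecialPeriodStructure n M} {B : UncoupledBPS P}
  (hnd : ∀ V, P.NonDegAt (joyceFunction P B) V)

variable (B) in
/-- The vertical part of `twistMap`. -/
def fibrePart (V : TM n M) (x : T n V.proj × T n V.proj) : T n V.proj :=
  horHam B V (cplxI n V.proj x.1) + vertTwistBase B V x.2

theorem twistMap_eq (V : TM n M) (x : T n V.proj × T n V.proj) :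
    twistMap B V x = P.hor V x.1 + vert V (fibrePart B V x) := by
  rw [twistMap_apply, horTwist_apply, vertTwist_apply, fibrePart, map_add]
  abel

theorem dproj_twistMap (V : TM n M) (x : T n V.proj × T n V.proj) : dproj V (twistMap B V x) = x.1 := by
  rw [twistMap_eq, map_add, dproj_hor, dproj_vert, add_zero]

/-- By isotropy only the summand `-2π I c` of the vertical part pairs nontrivially with an image of
`ρ`. -/
theorem form_fibrePart_horHam (V : TM n M) (x : T n V.proj × T n V.proj) (b : T n V.proj) :
    P.form V.proj (fibrePart B V x) (horHam B V b)
      = -(2 * Real.pi) * P.form V.proj (cplxI n V.proj x.2) (horHam B V b) := by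
  simp only [fibrePart, vertTwistBase_apply, twistI_apply, map_add, map_smul, LinearMap.add_apply,
    LinearMap.smul_apply, smul_eq_mul]
  rw [form_horHam_horHam, form_vertHam_horHam]
  ring

theorem form_fibrePart_vertHam (V : TM n M) (x : T n V.proj × T n V.proj) (b : T n V.proj) :
    P.form V.proj (fibrePart B V x) (vertHam B V b)
      = -(2 * Real.pi) * P.form V.proj (cplxI n V.proj x.2) (vertHam B V b) := by
  simp only [fibrePart, vertTwistBase_apply, twistI_apply, map_add, map_smul, LinearMap.add_apply,
    LinearMap.smul_apply, smul_eq_mul]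
  rw [form_horHam_vertHam, form_vertHam_vertHam]
  ring

theorem form_fibrePart (V : TM n M) (x : T n V.proj × T n V.proj) (b : T n V.proj) :
    P.form V.proj b (fibrePart B V x)
      = P.form V.proj b (horHam B V (cplxI n V.proj x.1))
        - 2 * Real.pi * (P.form V.proj b (cplxI n V.proj x.2) + P.form V.proj b (vertHam B V x.2)) := by
  simp only [fibrePart, vertTwistBase_apply, twistI_apply, map_add, map_smul, smul_eq_mul]
  ring

theorem form_fibrePart_fibrePart (V : TM n M) (x y : T n V.proj × T n V.proj) :
    P.form V.proj (fibrePart B V x) (fibrePart B V y)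
      = 2 * Real.pi * P.form V.proj (cplxI n V.proj y.2) (horHam B V (cplxI n V.proj x.1))
        - 2 * Real.pi * P.form V.proj (cplxI n V.proj x.2) (horHam B V (cplxI n V.proj y.1))
        + 4 * Real.pi ^ 2 * twistForm B V x.2 y.2 := by
  rw [form_fibrePart, form_fibrePart_horHam, form_fibrePart_vertHam, P.skew _ (fibrePart B V x),
    form_fibrePart, twistForm_eq, P.compat, P.skew _ y.2 x.2]
  ring

variable {p₀ : M} {U : Set M} {e : Fin n ⊕ Fin n → ∀ p : M, T n p}
  {Ω : {m : Fin n ⊕ Fin n → ℤ // m ≠ 0} → ℝ} {c : ℝ}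

namespace LocalModel
variable (hL : LocalModel B p₀ U e Ω c) {V : TM n M} (hV : V.proj ∈ U)
include hL hV

theorem dMap_low_twistMap (x : T n V.proj × T n V.proj) :
    dMap (IN n) (fun V : TM n M => low P.form e V.proj V.2) V (twistMap B V x)
      = low P.form e V.proj (fibrePart B V x) := by
  rw [twistMap_eq, map_add, dMap_low_hor hL.frame hV, dMap_low_vert hL.frame hV, zero_add]

theorem dMap_flatMap_twistMap (x : T n V.proj × T n V.proj) :
    dMap (IN n) (flatMap P e) V (twistMap B V x)
      = (zdiff P e V.proj x.1, low P.form e V.proj (fibrePart B V x)) := by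
  rw [dMap_flatMap hL.frame hV, dproj_twistMap, hL.dMap_low_twistMap hV]

theorem potHess_twistMap (x : T n V.proj × T n V.proj) (b : (Fin n ⊕ Fin n → ℂ) × (Fin n ⊕ Fin n → ℝ)) :
    potHess Ω (flatMap P e V) (dMap (IN n) (flatMap P e) V (twistMap B V x)) b
      = potHess Ω (flatMap P e V) (zdiff P e V.proj x.1, 0) b
        + potHess Ω (flatMap P e V) (0, low P.form e V.proj (fibrePart B V x)) b := by
  rw [hL.dMap_flatMap_twistMap hV, ← ContinuousLinearMap.add_apply, ← map_add]
  simp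

theorem potHess_twistMap_zdiff (x : T n V.proj × T n V.proj) (b : T n V.proj) :
    potHess Ω (flatMap P e V) (dMap (IN n) (flatMap P e) V (twistMap B V x)) (zdiff P e V.proj b, 0)
      = potHess Ω (flatMap P e V) (zdiff P e V.proj x.1, 0) (zdiff P e V.proj b, 0)
        - 2 * Real.pi * P.form V.proj (cplxI n V.proj x.2) (horHam B V b) := by
  rw [hL.potHess_twistMap hV, ← hL.form_horHam hV, form_fibrePart_horHam]
  ring

theorem potHess_twistMap_low (x : T n V.proj × T n V.proj) (b : T n V.proj) :
    potHess Ω (flatMap P e V) (dMap (IN n) (flatMap P e) V (twistMap B V x)) (0, low P.form e V.proj b)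
      = P.form V.proj b (horHam B V x.1)
        - 2 * Real.pi * P.form V.proj (cplxI n V.proj x.2) (vertHam B V b) := by
  rw [hL.potHess_twistMap hV, ← hL.form_vertHam hV, form_fibrePart_vertHam,
    hL.bps.potHess_symm (hL.flatMap_mem hV), ← hL.form_horHam hV]
  ring

/-- The right side contains only differentials: the Hessian along `A` is the derivative of the
gradient of `F`, and `dZ(I-)` is the differential of the functions `iZ_a`. The two sides differ by a
multiple of `potHess_zdiff_zdiff`, so this is where the Laplace equation makes `ω₃` closed. -/
theorem joyceHyperData_form₃_eq (A A' : TT V) : (joyceHyperData B hnd).form₃ V A A'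
    = stdForm n (low P.form e V.proj (dproj V A)) (low P.form e V.proj (dproj V A'))
      - 1 / (4 * Real.pi ^ 2) * stdForm n (dMap (IN n) (fun V : TM n M => low P.form e V.proj V.2) V A)
          (dMap (IN n) (fun V : TM n M => low P.form e V.proj V.2) V A')
      + 1 / (4 * Real.pi ^ 2) *
        (potHess Ω (flatMap P e V) (dMap (IN n) (flatMap P e) V A)
            (zdiff P e V.proj (cplxI n V.proj (dproj V A')), 0)
          - potHess Ω (flatMap P e V) (dMap (IN n) (flatMap P e) V A')
            (zdiff P e V.proj (cplxI n V.proj (dproj V A)), 0)) := by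
  obtain ⟨x, rfl⟩ := exists_twistMap B hnd V A
  obtain ⟨y, rfl⟩ := exists_twistMap B hnd V A'
  have h := hL.potHess_zdiff_zdiff hV x.1 y.1
  rw [joyceHyperData_form₃, dproj_twistMap, dproj_twistMap, hL.dMap_low_twistMap hV,
    hL.dMap_low_twistMap hV, ← hL.frame.form_eq_stdForm P.skew hV, ← hL.frame.form_eq_stdForm P.skew hV,
    hL.potHess_twistMap_zdiff hV, hL.potHess_twistMap_zdiff hV, form_fibrePart_fibrePart,
    twistForm_eq B V x.1]
  rw [form_vertHam_symm B V x.1] at h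
  have := Real.pi_ne_zero
  field_simp
  linear_combination -h

/-- Here, and likewise for `ω₂`, the discrepancy between the twisted form and the Hessian expression
is the symmetry `form_horHam_symm` of the mixed derivatives. -/
theorem joyceHyperData_form₁_eq (A A' : TT V) : (joyceHyperData B hnd).form₁ V A A'
    = -(1 / (2 * Real.pi)) * (stdForm n (low P.form e V.proj (dproj V A))
          (dMap (IN n) (fun V : TM n M => low P.form e V.proj V.2) V A')
        - stdForm n (low P.form e V.proj (dproj V A'))
          (dMap (IN n) (fun V : TM n M => low P.form e V.proj V.2) V A))
      + 1 / (2 * Real.pi) *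
        (potHess Ω (flatMap P e V) (dMap (IN n) (flatMap P e) V A)
            (0, low P.form e V.proj (cplxI n V.proj (dproj V A')))
          - potHess Ω (flatMap P e V) (dMap (IN n) (flatMap P e) V A')
            (0, low P.form e V.proj (cplxI n V.proj (dproj V A)))) := by
  obtain ⟨x, rfl⟩ := exists_twistMap B hnd V A
  obtain ⟨y, rfl⟩ := exists_twistMap B hnd V A'
  have h := hL.form_horHam_symm hV x.1 y.1
  rw [joyceHyperData_form₁, dproj_twistMap, dproj_twistMap, hL.dMap_low_twistMap hV,
    hL.dMap_low_twistMap hV, ← hL.frame.form_eq_stdForm P.skew hV, ← hL.frame.form_eq_stdForm P.skew hV,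
    hL.potHess_twistMap_low hV, hL.potHess_twistMap_low hV, form_fibrePart, form_fibrePart,
    twistForm_eq, twistForm_eq, form_vertHam_symm B V (cplxI n V.proj x.1) (cplxI n V.proj y.2)]
  have h1 := form_vertHam_symm B V y.2 x.1
  have h3 := P.compat V.proj y.1 (cplxI n V.proj x.2)
  rw [P.skew V.proj (cplxI n V.proj y.1)] at h3
  simp only [cplxI_cplxI, map_neg, LinearMap.neg_apply, neg_neg] at h1 h3 ⊢
  have := Real.pi_ne_zero
  field_simp
  linear_combination h + 2 * Real.pi * h1 - 2 * Real.pi * h3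

theorem joyceHyperData_form₂_eq (A A' : TT V) : (joyceHyperData B hnd).form₂ V A A'
    = 1 / (2 * Real.pi) * (stdForm n (low P.form e V.proj (cplxI n V.proj (dproj V A)))
          (dMap (IN n) (fun V : TM n M => low P.form e V.proj V.2) V A')
        - stdForm n (low P.form e V.proj (cplxI n V.proj (dproj V A')))
          (dMap (IN n) (fun V : TM n M => low P.form e V.proj V.2) V A))
      + 1 / (2 * Real.pi) *
        (potHess Ω (flatMap P e V) (dMap (IN n) (flatMap P e) V A)
            (0, low P.form e V.proj (dproj V A'))
          - potHess Ω (flatMap P e V) (dMap (IN n) (flatMap P e) V A')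
            (0, low P.form e V.proj (dproj V A))) := by
  obtain ⟨x, rfl⟩ := exists_twistMap B hnd V A
  obtain ⟨y, rfl⟩ := exists_twistMap B hnd V A'
  have h := hL.form_horHam_symm hV x.1 (cplxI n V.proj y.1)
  rw [joyceHyperData_form₂, dproj_twistMap, dproj_twistMap, hL.dMap_low_twistMap hV,
    hL.dMap_low_twistMap hV, ← hL.frame.form_eq_stdForm P.skew hV, ← hL.frame.form_eq_stdForm P.skew hV,
    hL.potHess_twistMap_low hV, hL.potHess_twistMap_low hV, form_fibrePart, form_fibrePart,
    twistForm_eq, twistForm_eq, P.compat, P.compat]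
  have h3 := P.skew V.proj y.1 x.2
  simp only [cplxI_cplxI, map_neg, LinearMap.neg_apply, neg_neg] at h h3 ⊢
  have := Real.pi_ne_zero
  field_simp
  linear_combination -h - 2 * Real.pi * h3

end LocalModel
end Base
end SpecialJoyce

end

/-! ### The Kähler forms as finite sums of `df ∧ dg`. -/

section

namespace SpecialJoyce
open Set Filter

section Base
variable {n : ℕ} {M : Type*} [TopologicalSpace M] [ChartedSpace (Model n) M]
  [IsManifold 𝓘(ℂ, Model n) ω M] {P : SpecialPeriodStructure n M} {B : UncoupledBPS P}

theorem wedgeSumOn_stdForm {W : Set (TM n M)} (hW : IsOpen W) {f g : Fin n ⊕ Fin n → TM n M → ℝ}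
    (hf : ∀ a, ContMDiffOn (IN n) 𝓘(ℝ, ℝ) ∞ (f a) W) (hg : ∀ a, ContMDiffOn (IN n) 𝓘(ℝ, ℝ) ∞ (g a) W) :
    WedgeSumOn (IN n) W fun V A A' =>
      stdForm n (fun a => dReal (IN n) (f a) V A) (fun a => dReal (IN n) (g a) V A')
        - stdForm n (fun a => dReal (IN n) (f a) V A') (fun a => dReal (IN n) (g a) V A) := by
  refine (WedgeSumOn.sum fun i : Fin n =>
    (wedgeSumOn_dWedge (hf (Sum.inl i)) (hg (Sum.inr i))).add
      ((wedgeSumOn_dWedge (hf (Sum.inr i)) (hg (Sum.inl i))).const_mul hW (-1))).congr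
    fun V _ A A' => ?_
  rw [stdForm_apply, stdForm_apply, ← Finset.sum_sub_distrib]
  exact Finset.sum_congr rfl fun i _ => by simp only [dWedge]; ring

variable {p₀ : M} {U : Set M} {e : Fin n ⊕ Fin n → ∀ p : M, T n p}
  {Ω : {m : Fin n ⊕ Fin n → ℤ // m ≠ 0} → ℝ} {c : ℝ}

section Frame
variable (hF : IsDarbouxFrame P.Γ P.form U e)
include hF

theorem contMDiffOn_flatCoord_proj (a : Fin n ⊕ Fin n) :
    ContMDiffOn (IN n) 𝓘(ℝ, ℝ) ∞ (fun V : TM n M => flatCoord P e V.proj a)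
      ((fun V : TM n M => V.proj) ⁻¹' U) :=
  (contMDiffOn_period_re P hF a).comp (Bundle.contMDiff_proj _).contMDiffOn fun _ h => h

theorem contMDiffOn_period_im_proj (a : Fin n ⊕ Fin n) :
    ContMDiffOn (IN n) 𝓘(ℝ, ℝ) ∞ (fun V : TM n M => (P.Z V.proj (e a V.proj)).im)
      ((fun V : TM n M => V.proj) ⁻¹' U) :=
  (contMDiffOn_period_im P hF a).comp (Bundle.contMDiff_proj _).contMDiffOn fun _ h => h

theorem contMDiffOn_low_apply (a : Fin n ⊕ Fin n) :
    ContMDiffOn (IN n) 𝓘(ℝ, ℝ) ∞ (fun V : TM n M => low P.form e V.proj V.2 a)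
      ((fun V : TM n M => V.proj) ⁻¹' U) :=
  (ContinuousLinearMap.proj (R := ℝ) (φ := fun _ : Fin n ⊕ Fin n => ℝ) a).contMDiff.comp_contMDiffOn
    (hF.contMDiffOn_low P.skew)

variable {V : TM n M} (hV : V.proj ∈ U) (A : TT V)
include hV

theorem dReal_flatCoord_proj (a : Fin n ⊕ Fin n) :
    dReal (IN n) (fun V : TM n M => flatCoord P e V.proj a) V A = low P.form e V.proj (dproj V A) a := by
  have h1 := ((contMDiffOn_period_re P hF a).contMDiffAt (hF.isOpen.mem_nhds hV)).mdifferentiableAt (by simp)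
  exact (dMap_proj h1 A).trans (dReal_period P hF hV _ a).1

theorem dReal_period_im_proj (a : Fin n ⊕ Fin n) :
    dReal (IN n) (fun V : TM n M => (P.Z V.proj (e a V.proj)).im) V A
      = - low P.form e V.proj (cplxI n V.proj (dproj V A)) a := by
  have h1 := ((contMDiffOn_period_im P hF a).contMDiffAt (hF.isOpen.mem_nhds hV)).mdifferentiableAt (by simp)
  exact (dMap_proj h1 A).trans (dReal_period P hF hV _ a).2

theorem dReal_low_apply (a : Fin n ⊕ Fin n) :
    dReal (IN n) (fun V : TM n M => low P.form e V.proj V.2 a) V A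
      = dMap (IN n) (fun V : TM n M => low P.form e V.proj V.2) V A a :=
  dMap_clm_comp_apply (ContinuousLinearMap.proj (R := ℝ) (φ := fun _ : Fin n ⊕ Fin n => ℝ) a)
    (mdifferentiableAt_low hF hV) A

end Frame

namespace LocalModel
variable (hL : LocalModel B p₀ U e Ω c)
include hL

theorem isOpen_preimage : IsOpen ((fun V : TM n M => V.proj) ⁻¹' U) :=
  isOpen_preimage_proj (n := n) hL.frame.isOpen

theorem contMDiffOn_fderiv_flatMap (b : (Fin n ⊕ Fin n → ℂ) × (Fin n ⊕ Fin n → ℝ)) :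
    ContMDiffOn (IN n) 𝓘(ℝ, ℝ) ∞ (fun V => fderiv ℝ (flatPotential Ω) (flatMap P e V) b)
      ((fun V : TM n M => V.proj) ⁻¹' U) :=
  hL.contMDiffOn_comp_flatMap (hL.bps.contDiffOn_fderiv_flatPotential.clm_apply contDiffOn_const)

theorem dReal_fderiv_flatMap {V : TM n M} (hV : V.proj ∈ U)
    (b : (Fin n ⊕ Fin n → ℂ) × (Fin n ⊕ Fin n → ℝ)) (A : TT V) :
    dReal (IN n) (fun V => fderiv ℝ (flatPotential Ω) (flatMap P e V) b) V A
      = potHess Ω (flatMap P e V) (dMap (IN n) (flatMap P e) V A) b := by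
  have h := ((ContinuousLinearMap.apply ℝ ℝ b).hasFDerivAt (x := _)).comp (flatMap P e V)
    (hL.bps.hasFDerivAt_fderiv_flatPotential (hL.flatMap_mem hV))
  have h2 : HasFDerivAt (fun x => fderiv ℝ (flatPotential Ω) x b) _ (flatMap P e V) := h
  refine (dMap_comp_apply h2.differentiableAt (mdifferentiableAt_flatMap hL.frame hV) A).trans ?_
  rw [h2.fderiv]
  rfl

/-- The form is `∑ d(∂_b F) ∧ dy`, where `∂_b F` is the derivative of the potential in the constant
direction `b`, pulled back to `N`. -/
theorem wedgeSumOn_potHess {κ : Type} [Fintype κ] (b : κ → (Fin n ⊕ Fin n → ℂ) × (Fin n ⊕ Fin n → ℝ))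
    {y : κ → TM n M → ℝ}
    (hy : ∀ k, ContMDiffOn (IN n) 𝓘(ℝ, ℝ) ∞ (y k) ((fun V : TM n M => V.proj) ⁻¹' U)) :
    WedgeSumOn (IN n) ((fun V : TM n M => V.proj) ⁻¹' U) fun V A A' =>
      potHess Ω (flatMap P e V) (dMap (IN n) (flatMap P e) V A) (∑ k, dReal (IN n) (y k) V A' • b k)
        - potHess Ω (flatMap P e V) (dMap (IN n) (flatMap P e) V A')
          (∑ k, dReal (IN n) (y k) V A • b k) := by
  refine (WedgeSumOn.sum fun k => wedgeSumOn_dWedge (hL.contMDiffOn_fderiv_flatMap (b k)) (hy k)).congr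
    fun V hV A A' => ?_
  rw [map_sum, map_sum, ← Finset.sum_sub_distrib]
  refine Finset.sum_congr rfl fun k _ => ?_
  rw [dWedge, hL.dReal_fderiv_flatMap hV, hL.dReal_fderiv_flatMap hV, map_smul, map_smul, smul_eq_mul,
    smul_eq_mul]
  ring

variable (hnd : ∀ V, P.NonDegAt (joyceFunction P B) V)

theorem wedgeSumOn_form₃ : WedgeSumOn (IN n) ((fun V : TM n M => V.proj) ⁻¹' U)
    fun V A A' => (joyceHyperData B hnd).form₃ V A A' := by
  have hx := contMDiffOn_flatCoord_proj hL.frame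
  have hs := contMDiffOn_period_im_proj hL.frame
  have hθ := contMDiffOn_low_apply hL.frame
  -- With equal families the antisymmetrized sum counts the standard form twice, whence `1/2` and
  -- `1/(8π²)`. The directions `-1` and `i` come from `dZ(I-) = -d Im Z + i d Re Z`.
  refine ((((wedgeSumOn_stdForm hL.isOpen_preimage hx hx).const_mul hL.isOpen_preimage (1 / 2)).add
    ((wedgeSumOn_stdForm hL.isOpen_preimage hθ hθ).const_mul hL.isOpen_preimage
      (-(1 / (8 * Real.pi ^ 2))))).add
    ((hL.wedgeSumOn_potHess (Sum.elim (fun a => (Pi.single a (-1), 0))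
      (fun a => (Pi.single a Complex.I, 0))) (y := Sum.elim
        (fun a (V : TM n M) => (P.Z V.proj (e a V.proj)).im)
        (fun a (V : TM n M) => flatCoord P e V.proj a))
      (by rintro (a | a); exacts [hs a, hx a])).const_mul
      hL.isOpen_preimage (1 / (4 * Real.pi ^ 2)))).congr fun V hV A A' => ?_
  have key : ∀ A : TT V, (zdiff P e V.proj (cplxI n V.proj (dproj V A)), (0 : Fin n ⊕ Fin n → ℝ))
      = ∑ k, dReal (IN n) (Sum.elim (fun a (V : TM n M) => (P.Z V.proj (e a V.proj)).im)
        (fun a (V : TM n M) => flatCoord P e V.proj a) k) V A •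
        (Sum.elim (fun a => (Pi.single a (-1), 0)) (fun a => (Pi.single a Complex.I, 0)) k :
          (Fin n ⊕ Fin n → ℂ) × (Fin n ⊕ Fin n → ℝ)) := by
    intro A
    simp only [Fintype.sum_sum_type, Sum.elim_inl, Sum.elim_inr, dReal_flatCoord_proj hL.frame hV,
      dReal_period_im_proj hL.frame hV]
    refine Prod.ext ?_ ?_
    · funext b
      rcases b with b | b <;>
        simp [Prod.fst_sum, Pi.single_apply, zdiff_apply, cplxI_cplxI] <;> ring
    · funext b
      simp [Prod.snd_sum]
  rw [hL.joyceHyperData_form₃_eq hnd hV, key, key]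
  simp only [dReal_flatCoord_proj hL.frame hV, dReal_low_apply hL.frame hV]
  have h1 : ∀ u w, stdForm n w u = - stdForm n u w := fun u w => by
    rw [stdForm_apply, stdForm_apply, ← Finset.sum_neg_distrib]
    exact Finset.sum_congr rfl fun i _ => by ring
  rw [h1 (fun a => low P.form e V.proj (dproj V A) a), h1 (fun a =>
    dMap (IN n) (fun W : TM n M => low P.form e W.proj W.2) V A a)]
  ring

theorem wedgeSumOn_form₁ : WedgeSumOn (IN n) ((fun V : TM n M => V.proj) ⁻¹' U)
    fun V A A' => (joyceHyperData B hnd).form₁ V A A' := by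
  have hx := contMDiffOn_flatCoord_proj hL.frame
  have hs := contMDiffOn_period_im_proj hL.frame
  have hθ := contMDiffOn_low_apply hL.frame
  refine (((wedgeSumOn_stdForm hL.isOpen_preimage hx hθ).const_mul hL.isOpen_preimage
      (-(1 / (2 * Real.pi)))).add
    ((hL.wedgeSumOn_potHess (fun a => (0, Pi.single a (-1))) hs).const_mul
      hL.isOpen_preimage (1 / (2 * Real.pi)))).congr fun V hV A A' => ?_
  have key : ∀ A : TT V, ((0 : Fin n ⊕ Fin n → ℂ), low P.form e V.proj (cplxI n V.proj (dproj V A)))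
      = ∑ a, dReal (IN n) (fun V : TM n M => (P.Z V.proj (e a V.proj)).im) V A •
        ((0, Pi.single a (-1)) : (Fin n ⊕ Fin n → ℂ) × (Fin n ⊕ Fin n → ℝ)) := by
    intro A
    simp only [dReal_period_im_proj hL.frame hV]
    refine Prod.ext ?_ ?_
    · funext b
      simp [Prod.fst_sum]
    · funext b
      rcases b with b | b <;> simp [Prod.snd_sum, Pi.single_apply]
  rw [hL.joyceHyperData_form₁_eq hnd hV, key, key]
  simp only [dReal_flatCoord_proj hL.frame hV, dReal_low_apply hL.frame hV]

theorem wedgeSumOn_form₂ : WedgeSumOn (IN n) ((fun V : TM n M => V.proj) ⁻¹' U)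
    fun V A A' => (joyceHyperData B hnd).form₂ V A A' := by
  have hx := contMDiffOn_flatCoord_proj hL.frame
  have hs := contMDiffOn_period_im_proj hL.frame
  have hθ := contMDiffOn_low_apply hL.frame
  refine (((wedgeSumOn_stdForm hL.isOpen_preimage hs hθ).const_mul hL.isOpen_preimage
      (-(1 / (2 * Real.pi)))).add
    ((hL.wedgeSumOn_potHess (fun a => (0, Pi.single a 1)) hx).const_mul
      hL.isOpen_preimage (1 / (2 * Real.pi)))).congr fun V hV A A' => ?_
  have key : ∀ A : TT V, ((0 : Fin n ⊕ Fin n → ℂ), low P.form e V.proj (dproj V A))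
      = ∑ a, dReal (IN n) (fun V : TM n M => flatCoord P e V.proj a) V A •
        ((0, Pi.single a 1) : (Fin n ⊕ Fin n → ℂ) × (Fin n ⊕ Fin n → ℝ)) := by
    intro A
    simp only [dReal_flatCoord_proj hL.frame hV]
    refine Prod.ext ?_ ?_
    · funext b
      simp [Prod.fst_sum]
    · funext b
      rcases b with b | b <;> simp [Prod.snd_sum, Pi.single_apply]
  have h1 : ∀ u w, stdForm n (fun a => - u a) w = - stdForm n u w := fun u w => by
    rw [stdForm_apply, stdForm_apply, ← Finset.sum_neg_distrib]
    exact Finset.sum_congr rfl fun i _ => by ring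
  rw [hL.joyceHyperData_form₂_eq hnd hV, key, key]
  simp only [dReal_period_im_proj hL.frame hV, dReal_low_apply hL.frame hV, h1]
  ring

end LocalModel

variable (hnd : ∀ V, P.NonDegAt (joyceFunction P B) V)

theorem locallyWedgeSum_form₁ : LocallyWedgeSum (IN n) (joyceHyperData B hnd).form₁ :=
  locallyWedgeSum_of_wedgeSumOn fun V => by
    obtain ⟨U, e, Ω, c, hL⟩ := exists_localModel_at B V.proj
    exact ⟨_, hL.isOpen_preimage, hL.mem, hL.wedgeSumOn_form₁ hnd⟩

theorem locallyWedgeSum_form₂ : LocallyWedgeSum (IN n) (joyceHyperData B hnd).form₂ :=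
  locallyWedgeSum_of_wedgeSumOn fun V => by
    obtain ⟨U, e, Ω, c, hL⟩ := exists_localModel_at B V.proj
    exact ⟨_, hL.isOpen_preimage, hL.mem, hL.wedgeSumOn_form₂ hnd⟩

theorem locallyWedgeSum_form₃ : LocallyWedgeSum (IN n) (joyceHyperData B hnd).form₃ :=
  locallyWedgeSum_of_wedgeSumOn fun V => by
    obtain ⟨U, e, Ω, c, hL⟩ := exists_localModel_at B V.proj
    exact ⟨_, hL.isOpen_preimage, hL.mem, hL.wedgeSumOn_form₃ hnd⟩

end Base
end SpecialJoyce

end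

/-! ### Smoothness, integrability and the hyperkähler property. -/

section

namespace SpecialJoyce
open Set Filter

section Smooth
variable {E : Type*} [NormedAddCommGroup E] [NormedSpace ℝ E] [CompleteSpace E] {H : Type*}
  [TopologicalSpace H] {I : ModelWithCorners ℝ E H} {X : Type*} [TopologicalSpace X] [ChartedSpace H X]
  [IsManifold I ∞ X] [I.Boundaryless]
  {F : Type*} [NormedAddCommGroup F] [NormedSpace ℝ F] [FiniteDimensional ℝ F]

omit [CompleteSpace E] [IsManifold I ∞ X] [I.Boundaryless] in
theorem contMDiffOn_clm_of_apply {G : Type*} [NormedAddCommGroup G] [NormedSpace ℝ G] {W : Set X}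
    {f : X → F →L[ℝ] G} (h : ∀ x, ContMDiffOn I 𝓘(ℝ, G) ∞ (fun y => f y x) W) :
    ContMDiffOn I 𝓘(ℝ, F →L[ℝ] G) ∞ f W := by
  let b := Module.finBasis ℝ F
  have h1 : f = fun y => ∑ j, ContinuousLinearMap.smulRightL ℝ F G
      (b.coord j).toContinuousLinearMap (f y (b j)) := by
    funext y
    ext x
    conv_lhs => rw [← b.sum_repr x, map_sum]
    simp [ContinuousLinearMap.sum_apply]
  rw [h1]
  exact contMDiffOn_finsetSum fun j _ =>
    (ContinuousLinearMap.smulRightL ℝ F G (b.coord j).toContinuousLinearMap).contMDiff.comp_contMDiffOn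
      (h (b j))

/-- In the coordinates `Λ` the field solves a linear system with smooth invertible matrix `β` and
smooth right-hand side, and matrix inversion is smooth. -/
theorem smoothVF_of_form {W : Set X} (hW : IsOpen W) {Λ : X → F}
    (hΛ : ContMDiffOn I 𝓘(ℝ, F) ∞ Λ W) (hinv : ∀ y ∈ W, (dMap I Λ y).IsInvertible)
    {β : ∀ x : X, LinearMap.BilinForm ℝ (TangentSpace I x)} (hβ : SmoothBil I β)
    (hnd : ∀ x u, (∀ v, β x u v = 0) → u = 0) {η : ∀ x : X, TangentSpace I x}
    (hη : ∀ χ : ∀ x : X, TangentSpace I x, SmoothVF I W χ →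
      ContMDiffOn I 𝓘(ℝ, ℝ) ∞ (fun x => β x (η x) (χ x)) W) :
    SmoothVF I W η := by
  let D : ∀ y, F →ₗ[ℝ] TangentSpace I y := fun y => (dMap I Λ y).inverse.toLinearMap
  have hD : ∀ y ∈ W, ∀ x, dMap I Λ y (D y x) = x := fun y hy x => by
    obtain ⟨L, hL⟩ := hinv y hy
    change dMap I Λ y ((dMap I Λ y).inverse x) = x
    rw [← hL]; simp
  have hD' : ∀ y ∈ W, ∀ u, D y (dMap I Λ y u) = u := fun y hy x => by
    obtain ⟨L, hL⟩ := hinv y hy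
    change (dMap I Λ y).inverse (dMap I Λ y x) = x
    rw [← hL]; simp
  have hDs : ∀ x, SmoothVF I W fun y => D y x := fun x =>
    smoothVF_of_coordinates hW hΛ hinv (contMDiffOn_const.congr fun y hy => hD y hy x)
  let L : X → F →L[ℝ] F →L[ℝ] ℝ := fun y => LinearMap.toContinuousLinearMap
    (LinearMap.toContinuousLinearMap.toLinearMap ∘ₗ (β y).compl₁₂ (D y) (D y))
  let b : X → F →L[ℝ] ℝ := fun y => LinearMap.toContinuousLinearMap (β y (η y) ∘ₗ D y)
  have hL : ContMDiffOn I 𝓘(ℝ, F →L[ℝ] F →L[ℝ] ℝ) ∞ L W :=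
    contMDiffOn_clm_of_apply fun x => contMDiffOn_clm_of_apply fun x' =>
      hβ W _ _ hW (hDs x) (hDs x')
  have hb : ContMDiffOn I 𝓘(ℝ, F →L[ℝ] ℝ) ∞ b W :=
    contMDiffOn_clm_of_apply fun x => hη _ (hDs x)
  have hLb : ∀ y ∈ W, L y (dMap I Λ y (η y)) = b y := fun y hy => by
    ext x
    change β y (D y (dMap I Λ y (η y))) (D y x) = β y (η y) (D y x)
    rw [hD' y hy]
  have hLi : ∀ y ∈ W, (L y).IsInvertible := fun y hy => by
    have hinj : Function.Injective (L y) := (injective_iff_map_eq_zero (L y)).2 fun x hx => by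
      have h1 : D y x = 0 := hnd y _ fun v => by
        have := DFunLike.congr_fun hx (dMap I Λ y v)
        change β y (D y x) (D y (dMap I Λ y v)) = 0 at this
        rwa [hD' y hy] at this
      rw [← hD y hy x, h1, map_zero]
    refine isInvertible_of_bijective _ ⟨hinj, ?_⟩
    refine (LinearMap.injective_iff_surjective_of_finrank_eq_finrank (f := (L y).toLinearMap) ?_).1 hinj
    rw [← (LinearMap.toContinuousLinearMap (𝕜 := ℝ) (E := F) (F' := ℝ)).finrank_eq]
    exact Subspace.dual_finrank_eq.symm
  refine smoothVF_of_coordinates hW hΛ hinv ?_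
  have hs : ContMDiffOn I 𝓘(ℝ, F) ∞ (fun y => ContinuousLinearMap.inverse (L y) (b y)) W := by
    intro y hy
    obtain ⟨e, he⟩ := hLi y hy
    have h1 : ContDiffAt ℝ ∞ ContinuousLinearMap.inverse (L y) := by
      rw [← he]; exact contDiffAt_map_inverse e
    exact (h1.contMDiffAt.comp_contMDiffWithinAt y (hL y hy)).clm_apply (hb y hy)
  refine hs.congr fun y hy => ?_
  obtain ⟨e, he⟩ := hLi y hy
  rw [← hLb y hy, ← he]
  simp

end Smooth

section Kernel
variable {V : Type*} [AddCommGroup V] [Module ℝ V]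

/-- With `B = -AC` the complex form is `g(A(a - iCa), b)`. As `g` is nondegenerate and `A`
invertible, its kernel is `a = iCa`, that is, `Ca = -ia`. -/
theorem kernel_eq_eigenspace {g : LinearMap.BilinForm ℝ V} (hg : ∀ a, (∀ b, g a b = 0) → a = 0)
    {A B C : V →ₗ[ℝ] V} (hA : ∀ a, A (A a) = -a) (hC : ∀ a, C (C a) = -a) (hB : ∀ a, B a = -A (C a)) :
    {a : Cx V | ∀ b : V, ∑ j : Fin 2, ![(1 : ℂ), Complex.I] j *
      ((![g.compLeft A, g.compLeft B] j (cre a) b : ℂ)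
        + Complex.I * (![g.compLeft A, g.compLeft B] j (cim a) b : ℂ)) = 0}
      = {a | cmap C a = -Complex.I • a} := by
  ext a
  have h1 : (∀ b : V, ∑ j : Fin 2, ![(1 : ℂ), Complex.I] j *
      ((![g.compLeft A, g.compLeft B] j (cre a) b : ℂ)
        + Complex.I * (![g.compLeft A, g.compLeft B] j (cim a) b : ℂ)) = 0)
      ↔ A (cre a + C (cim a)) = 0 ∧ A (cim a - C (cre a)) = 0 := by
    have h2 : ∀ b : V, ∑ j : Fin 2, ![(1 : ℂ), Complex.I] j *
      ((![g.compLeft A, g.compLeft B] j (cre a) b : ℂ)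
        + Complex.I * (![g.compLeft A, g.compLeft B] j (cim a) b : ℂ))
        = (g (A (cre a + C (cim a))) b : ℂ) + Complex.I * (g (A (cim a - C (cre a))) b : ℂ) := fun b => by
      simp only [Fin.sum_univ_two, Matrix.cons_val, LinearMap.BilinForm.compLeft_apply, hB, map_add, map_sub,
        map_neg, LinearMap.add_apply, LinearMap.sub_apply, LinearMap.neg_apply]
      push_cast
      linear_combination (-(g (A (C (cim a))) b) : ℂ) * Complex.I_sq
    constructor
    · intro h
      refine ⟨hg _ fun b => ?_, hg _ fun b => ?_⟩
      · simpa using congrArg Complex.re ((h2 b).symm.trans (h b))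
      · simpa using congrArg Complex.im ((h2 b).symm.trans (h b))
    · rintro ⟨h, h'⟩ b
      rw [h2, h, h']; simp
  have hA0 : ∀ x, A x = 0 ↔ x = 0 := fun x => ⟨fun h => by
    have := hA x; rw [h, map_zero] at this; exact neg_eq_zero.1 this.symm, fun h => by rw [h, map_zero]⟩
  rw [mem_setOf_eq, mem_setOf_eq, h1, hA0, hA0]
  constructor
  · rintro ⟨h, h'⟩
    refine cx_ext ?_ ?_
    · simp only [cre_cmap, cre_smul, Complex.neg_re, Complex.neg_im, Complex.I_re, Complex.I_im]
      rw [← sub_eq_zero.1 h']; simp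
    · simp only [cim_cmap, cim_smul, Complex.neg_re, Complex.neg_im, Complex.I_re, Complex.I_im]
      rw [eq_neg_of_add_eq_zero_right h]; simp
  · intro h
    have e1 : C (cre a) = cim a := by simpa using congrArg cre h
    have e2 : C (cim a) = -cre a := by simpa using congrArg cim h
    rw [e1, e2]; simp

end Kernel

section Base
variable {n : ℕ} {M : Type*} [TopologicalSpace M] [ChartedSpace (Model n) M]
  [IsManifold 𝓘(ℂ, Model n) ω M] {P : SpecialPeriodStructure n M} {B : UncoupledBPS P}
  (hnd : ∀ V, P.NonDegAt (joyceFunction P B) V)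

theorem joyceHyperData_g_nondeg (V : TM n M) (A : TT V)
    (h : ∀ A', (joyceHyperData B hnd).g V A A' = 0) : A = 0 := by
  obtain ⟨x, rfl⟩ := exists_twistMap B hnd V A
  have h1 : ∀ b, twistForm B V x.1 b = 0 := fun b => by
    have := h (twistMap B V (-cplxI n V.proj b, 0))
    rw [joyceHyperData_g] at this
    simpa [cplxI_cplxI] using this
  have h2 : ∀ b, twistForm B V x.2 b = 0 := fun b => by
    have := h (twistMap B V (0, -cplxI n V.proj b))
    rw [joyceHyperData_g] at this
    simpa [cplxI_cplxI] using this
  rw [show x = 0 from Prod.ext (twistForm_nondeg B (hnd V) h1) (twistForm_nondeg B (hnd V) h2), map_zero]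

theorem joyceHyperData_sq₁ (V : TM n M) (A : TT V) :
    (joyceHyperData B hnd).I₁ V ((joyceHyperData B hnd).I₁ V A) = -A := by
  obtain ⟨x, rfl⟩ := exists_twistMap B hnd V A
  rw [joyceHyperData_I₁, joyceHyperData_I₁, ← map_neg]; rfl

theorem joyceHyperData_sq₂ (V : TM n M) (A : TT V) :
    (joyceHyperData B hnd).I₂ V ((joyceHyperData B hnd).I₂ V A) = -A := by
  obtain ⟨x, rfl⟩ := exists_twistMap B hnd V A
  rw [joyceHyperData_I₂, joyceHyperData_I₂]
  refine (congrArg (twistMap B V) (Prod.ext ?_ ?_)).trans (map_neg (twistMap B V) _) <;> simp [cplxI_cplxI]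

theorem joyceHyperData_sq₃ (V : TM n M) (A : TT V) :
    (joyceHyperData B hnd).I₃ V ((joyceHyperData B hnd).I₃ V A) = -A := by
  obtain ⟨x, rfl⟩ := exists_twistMap B hnd V A
  rw [joyceHyperData_I₃, joyceHyperData_I₃]
  refine (congrArg (twistMap B V) (Prod.ext ?_ ?_)).trans (map_neg (twistMap B V) _) <;> simp [cplxI_cplxI]

theorem joyceHyperData_mul₁₂ (V : TM n M) (A : TT V) :
    (joyceHyperData B hnd).I₁ V ((joyceHyperData B hnd).I₂ V A) = (joyceHyperData B hnd).I₃ V A := by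
  obtain ⟨x, rfl⟩ := exists_twistMap B hnd V A
  rw [joyceHyperData_I₂, joyceHyperData_I₁, joyceHyperData_I₃, neg_neg]

theorem joyceHyperData_mul₂₁ (V : TM n M) (A : TT V) :
    (joyceHyperData B hnd).I₂ V ((joyceHyperData B hnd).I₁ V A) = -(joyceHyperData B hnd).I₃ V A := by
  obtain ⟨x, rfl⟩ := exists_twistMap B hnd V A
  rw [joyceHyperData_I₁, joyceHyperData_I₂, joyceHyperData_I₃]
  refine (congrArg (twistMap B V) (Prod.ext ?_ ?_)).trans (map_neg (twistMap B V) _) <;> simp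

theorem joyceHyperData_mul₁₃ (V : TM n M) (A : TT V) :
    (joyceHyperData B hnd).I₁ V ((joyceHyperData B hnd).I₃ V A) = -(joyceHyperData B hnd).I₂ V A := by
  rw [← joyceHyperData_mul₁₂, joyceHyperData_sq₁]

theorem joyceHyperData_mul₃₂ (V : TM n M) (A : TT V) :
    (joyceHyperData B hnd).I₃ V ((joyceHyperData B hnd).I₂ V A) = -(joyceHyperData B hnd).I₁ V A := by
  rw [← joyceHyperData_mul₁₂, joyceHyperData_sq₂, map_neg]

theorem joyceHyperData_mul₃₁ (V : TM n M) (A : TT V) :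
    (joyceHyperData B hnd).I₃ V ((joyceHyperData B hnd).I₁ V A) = (joyceHyperData B hnd).I₂ V A := by
  rw [← neg_neg ((joyceHyperData B hnd).I₃ V _), ← joyceHyperData_mul₂₁, joyceHyperData_sq₁, map_neg, neg_neg]

theorem joyceHyperData_mul₂₃ (V : TM n M) (A : TT V) :
    (joyceHyperData B hnd).I₂ V ((joyceHyperData B hnd).I₃ V A) = (joyceHyperData B hnd).I₁ V A := by
  rw [← neg_neg ((joyceHyperData B hnd).I₃ V A), ← joyceHyperData_mul₂₁, map_neg, joyceHyperData_sq₂, neg_neg]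

theorem joyceHyperData_g_symm (V : TM n M) (A A' : TT V) :
    (joyceHyperData B hnd).g V A A' = (joyceHyperData B hnd).g V A' A := by
  obtain ⟨x, rfl⟩ := exists_twistMap B hnd V A
  obtain ⟨y, rfl⟩ := exists_twistMap B hnd V A'
  rw [joyceHyperData_g, joyceHyperData_g, twistForm_skew B V x.1, twistForm_skew B V x.2,
    twistForm_cplxI_left, twistForm_cplxI_left, neg_neg, neg_neg]

theorem joyceHyperData_form₃_eq_g (V : TM n M) (A A' : TT V) :
    (joyceHyperData B hnd).form₃ V A A' = (joyceHyperData B hnd).g V ((joyceHyperData B hnd).I₃ V A) A' := by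
  obtain ⟨x, rfl⟩ := exists_twistMap B hnd V A
  obtain ⟨y, rfl⟩ := exists_twistMap B hnd V A'
  rw [joyceHyperData_I₃, joyceHyperData_g, joyceHyperData_form₃]
  simp only [map_neg, LinearMap.neg_apply, twistForm_cplxI]
  ring

theorem joyceHyperData_form₃_skew (V : TM n M) (A A' : TT V) :
    (joyceHyperData B hnd).form₃ V A A' = - (joyceHyperData B hnd).form₃ V A' A :=
  (joyceHyperData_isAssociated B hnd).form₃_skew V A A'

theorem joyceHyperData_form₁_skew (V : TM n M) (A A' : TT V) :
    (joyceHyperData B hnd).form₁ V A A' = - (joyceHyperData B hnd).form₁ V A' A := by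
  obtain ⟨x, rfl⟩ := exists_twistMap B hnd V A
  obtain ⟨y, rfl⟩ := exists_twistMap B hnd V A'
  rw [joyceHyperData_form₁, joyceHyperData_form₁, twistForm_skew B V x.1, twistForm_skew B V x.2,
    twistForm_cplxI_left, twistForm_cplxI_left]
  ring

theorem joyceHyperData_form₂_skew (V : TM n M) (A A' : TT V) :
    (joyceHyperData B hnd).form₂ V A A' = - (joyceHyperData B hnd).form₂ V A' A := by
  obtain ⟨x, rfl⟩ := exists_twistMap B hnd V A
  obtain ⟨y, rfl⟩ := exists_twistMap B hnd V A'
  rw [joyceHyperData_form₂, joyceHyperData_form₂, twistForm_skew B V x.1, twistForm_skew B V x.2]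
  ring

theorem joyceHyperData_form₁_nondeg (V : TM n M) (A : TT V)
    (h : ∀ A', (joyceHyperData B hnd).form₁ V A A' = 0) : A = 0 := by
  have h1 := joyceHyperData_g_nondeg hnd V ((joyceHyperData B hnd).I₁ V A) h
  have h2 := joyceHyperData_sq₁ hnd V A
  rw [h1, map_zero] at h2
  exact neg_eq_zero.1 h2.symm

theorem joyceHyperData_form₂_nondeg (V : TM n M) (A : TT V)
    (h : ∀ A', (joyceHyperData B hnd).form₂ V A A' = 0) : A = 0 := by
  have h1 := joyceHyperData_g_nondeg hnd V ((joyceHyperData B hnd).I₂ V A) h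
  have h2 := joyceHyperData_sq₂ hnd V A
  rw [h1, map_zero] at h2
  exact neg_eq_zero.1 h2.symm

theorem isInvertible_dMap_totalCoord {U : Set M} {e : Fin n ⊕ Fin n → ∀ p : M, T n p}
    (hF : IsDarbouxFrame P.Γ P.form U e) {V : TM n M} (hV : V.proj ∈ U) :
    (dMap (IN n) (totalCoord P e) V).IsInvertible :=
  isInvertible_of_bijective (F := Model n × Model n) _ (bijective_dMap_totalCoord hF hV)

/-- Each of `I₁, I₂, I₃` is, up to sign, the quotient of two of the Kähler forms; this turns
smoothness of the forms into smoothness of the complex structures. -/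
theorem smoothEnd_of_forms {β β' : ∀ V : TM n M, LinearMap.BilinForm ℝ (TT V)} (hβ : SmoothBil (IN n) β)
    (hβ' : SmoothBil (IN n) β') (hn : ∀ V A, (∀ A', β V A A' = 0) → A = 0) {A : ∀ V : TM n M, TT V →ₗ[ℝ] TT V}
    (h : ∀ V X Y, β V (A V X) Y = β' V X Y) (P : SpecialPeriodStructure n M) : SmoothEnd (IN n) A := by
  intro W ξ hW hξ
  refine smoothVF_of_locally fun V _ => ?_
  obtain ⟨U, e, hpU, hF⟩ := P.exists_frame V.proj
  refine ⟨_, isOpen_preimage_proj (n := n) hF.isOpen, hpU, ?_⟩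
  have hWU := hW.inter (isOpen_preimage_proj (n := n) hF.isOpen)
  refine smoothVF_of_form hWU ((contMDiffOn_totalCoord hF).mono inter_subset_right)
    (fun V hV => isInvertible_dMap_totalCoord hF hV.2) hβ hn fun χ hχ => ?_
  simp only [h]
  exact hβ' _ _ _ hWU (hξ.mono inter_subset_left) hχ

theorem smoothEnd_joyceHyperData_I₁ : SmoothEnd (IN n) (joyceHyperData B hnd).I₁ :=
  smoothEnd_of_forms (locallyWedgeSum_form₂ hnd).smoothBil
    (β' := fun V => -(joyceHyperData B hnd).form₃ V)
    (fun W ξ η hW hξ hη => ((locallyWedgeSum_form₃ hnd).smoothBil W ξ η hW hξ hη).neg)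
    (joyceHyperData_form₂_nondeg hnd)
    (fun V X Y => by
      rw [HyperData.form₂, LinearMap.BilinForm.compLeft_apply, joyceHyperData_mul₂₁, LinearMap.neg_apply,
        LinearMap.neg_apply, joyceHyperData_form₃_eq_g, map_neg, LinearMap.neg_apply]) P

theorem smoothEnd_joyceHyperData_I₂ : SmoothEnd (IN n) (joyceHyperData B hnd).I₂ :=
  smoothEnd_of_forms (locallyWedgeSum_form₁ hnd).smoothBil (locallyWedgeSum_form₃ hnd).smoothBil
    (joyceHyperData_form₁_nondeg hnd)
    (fun V X Y => by
      rw [HyperData.form₁, LinearMap.BilinForm.compLeft_apply, joyceHyperData_mul₁₂,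
        joyceHyperData_form₃_eq_g]) P

theorem smoothEnd_joyceHyperData_I₃ : SmoothEnd (IN n) (joyceHyperData B hnd).I₃ :=
  smoothEnd_of_forms (locallyWedgeSum_form₁ hnd).smoothBil
    (β' := fun V => -(joyceHyperData B hnd).form₂ V)
    (fun W ξ η hW hξ hη => ((locallyWedgeSum_form₂ hnd).smoothBil W ξ η hW hξ hη).neg)
    (joyceHyperData_form₁_nondeg hnd)
    (fun V X Y => by
      rw [HyperData.form₁, LinearMap.BilinForm.compLeft_apply, joyceHyperData_mul₁₃, LinearMap.neg_apply,
        LinearMap.neg_apply, HyperData.form₂, LinearMap.BilinForm.compLeft_apply, map_neg,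
        LinearMap.neg_apply]) P

theorem smoothBil_joyceHyperData_g : SmoothBil (IN n) (joyceHyperData B hnd).g :=
  fun W ξ η hW hξ hη => (locallyWedgeSum_form₃ hnd).smoothBil W ξ _ hW hξ
    (smoothEnd_joyceHyperData_I₃ hnd W η hW hη)

theorem integrable_of_forms {g : ∀ V : TM n M, LinearMap.BilinForm ℝ (TT V)}
    (hg : ∀ V A, (∀ A', g V A A' = 0) → A = 0) {A B C : ∀ V : TM n M, TT V →ₗ[ℝ] TT V}
    (hA : ∀ V X, A V (A V X) = -X) (hC : ∀ V X, C V (C V X) = -X) (hB : ∀ V X, B V X = -A V (C V X))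
    (hAl : LocallyWedgeSum (IN n) fun V => (g V).compLeft (A V))
    (hBl : LocallyWedgeSum (IN n) fun V => (g V).compLeft (B V))
    (hAs : ∀ V X Y, (g V).compLeft (A V) X Y = - (g V).compLeft (A V) Y X)
    (hBs : ∀ V X Y, (g V).compLeft (B V) X Y = - (g V).compLeft (B V) Y X) :
    IntegrableACS (IN n) C := by
  have h := involutive_kernel (I := IN n) (X := TM n M) ![(1 : ℂ), Complex.I]
    (β := fun j V => ![(g V).compLeft (A V), (g V).compLeft (B V)] j)
    (fun j => by fin_cases j; exacts [hAs, hBs])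
    (fun j => by fin_cases j; exacts [hAl.smoothBil, hBl.smoothBil])
    (fun j => by fin_cases j; exacts [hAl.isClosedForm, hBl.isClosedForm])
  have h2 := fun V => kernel_eq_eigenspace (hg V) (hA V) (hC V) (hB V)
  simp only [h2] at h
  exact h

theorem joyceHyperData_form₃_eq_compLeft (hnd : ∀ V, P.NonDegAt (joyceFunction P B) V) :
    (joyceHyperData B hnd).form₃
      = fun V => ((joyceHyperData B hnd).g V).compLeft ((joyceHyperData B hnd).I₃ V) := by
  funext V
  ext A A'
  exact joyceHyperData_form₃_eq_g hnd V A A'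

theorem joyceHyperData_isHyperkahler : (joyceHyperData B hnd).IsHyperkahler where
  g_smooth := smoothBil_joyceHyperData_g hnd
  I₁_smooth := smoothEnd_joyceHyperData_I₁ hnd
  I₂_smooth := smoothEnd_joyceHyperData_I₂ hnd
  I₃_smooth := smoothEnd_joyceHyperData_I₃ hnd
  sq₁ := joyceHyperData_sq₁ hnd
  sq₂ := joyceHyperData_sq₂ hnd
  sq₃ := joyceHyperData_sq₃ hnd
  mul₁₂ := joyceHyperData_mul₁₂ hnd
  anti₁₂ V A := by rw [joyceHyperData_mul₁₂, joyceHyperData_mul₂₁, neg_neg]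
  anti₁₃ V A := by rw [joyceHyperData_mul₁₃, joyceHyperData_mul₃₁]
  anti₂₃ V A := by rw [joyceHyperData_mul₂₃, joyceHyperData_mul₃₂, neg_neg]
  -- The `-i`-eigenspaces of `I₁`, `I₂`, `I₃` are the kernels of `ω₂ + iω₃`, `ω₃ + iω₁`, `ω₁ + iω₂`,
  -- in cyclic order.
  integrable₁ := by
    have h3 := locallyWedgeSum_form₃ hnd
    have h3s := joyceHyperData_form₃_skew hnd
    rw [joyceHyperData_form₃_eq_compLeft] at h3 h3s
    exact integrable_of_forms (joyceHyperData_g_nondeg hnd) (joyceHyperData_sq₂ hnd)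
      (joyceHyperData_sq₁ hnd) (fun V X => by rw [joyceHyperData_mul₂₁, neg_neg])
      (locallyWedgeSum_form₂ hnd) h3 (joyceHyperData_form₂_skew hnd) h3s
  integrable₂ := by
    have h3 := locallyWedgeSum_form₃ hnd
    have h3s := joyceHyperData_form₃_skew hnd
    rw [joyceHyperData_form₃_eq_compLeft] at h3 h3s
    exact integrable_of_forms (joyceHyperData_g_nondeg hnd) (joyceHyperData_sq₃ hnd)
      (joyceHyperData_sq₂ hnd) (fun V X => by rw [joyceHyperData_mul₃₂, neg_neg])
      h3 (locallyWedgeSum_form₁ hnd) h3s (joyceHyperData_form₁_skew hnd)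
  integrable₃ := integrable_of_forms (joyceHyperData_g_nondeg hnd) (joyceHyperData_sq₁ hnd)
      (joyceHyperData_sq₃ hnd) (fun V X => by rw [joyceHyperData_mul₁₃, neg_neg])
      (locallyWedgeSum_form₁ hnd) (locallyWedgeSum_form₂ hnd) (joyceHyperData_form₁_skew hnd)
      (joyceHyperData_form₂_skew hnd)
  g_symm := joyceHyperData_g_symm hnd
  g_nondeg := joyceHyperData_g_nondeg hnd
  g_I₁ V A A' := by
    obtain ⟨x, rfl⟩ := exists_twistMap B hnd V A
    obtain ⟨y, rfl⟩ := exists_twistMap B hnd V A'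
    rw [joyceHyperData_I₁, joyceHyperData_I₁, joyceHyperData_g, joyceHyperData_g]
    simp [add_comm]
  g_I₂ V A A' := by
    obtain ⟨x, rfl⟩ := exists_twistMap B hnd V A
    obtain ⟨y, rfl⟩ := exists_twistMap B hnd V A'
    rw [joyceHyperData_I₂, joyceHyperData_I₂, joyceHyperData_g, joyceHyperData_g]
    simp [twistForm_cplxI, add_comm]
  g_I₃ V A A' := by
    obtain ⟨x, rfl⟩ := exists_twistMap B hnd V A
    obtain ⟨y, rfl⟩ := exists_twistMap B hnd V A'
    rw [joyceHyperData_I₃, joyceHyperData_I₃, joyceHyperData_g, joyceHyperData_g]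
    simp [twistForm_cplxI]
  form₃_eq := joyceHyperData_form₃_eq_g hnd
  closed₁ := (locallyWedgeSum_form₁ hnd).isClosedForm
  closed₂ := (locallyWedgeSum_form₂ hnd).isClosedForm
  closed₃ := (locallyWedgeSum_form₃ hnd).isClosedForm

end Base
end SpecialJoyce

end

/-! ### The connections `𝒜^ζ`: smoothness, flatness and the special Joyce structure. -/

section

namespace SpecialJoyce
open Set Filter

section Base
variable {n : ℕ} {M : Type*} [TopologicalSpace M] [ChartedSpace (Model n) M]
  [IsManifold 𝓘(ℂ, Model n) ω M] {P : SpecialPeriodStructure n M} {B : UncoupledBPS P}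

section Smooth

theorem contMDiffOn_comp_proj {F : Type*} [NormedAddCommGroup F] [NormedSpace ℝ F] {W : Set M}
    {f : M → F} (hf : ContMDiffOn 𝓘(ℝ, Model n) 𝓘(ℝ, F) ∞ f W) :
    ContMDiffOn (IN n) 𝓘(ℝ, F) ∞ (fun V : TM n M => f V.proj) ((fun V : TM n M => V.proj) ⁻¹' W) :=
  hf.comp (Bundle.contMDiff_proj _).contMDiffOn fun _ h => h

variable {U : Set M} {e : Fin n ⊕ Fin n → ∀ p : M, T n p} (hF : IsDarbouxFrame P.Γ P.form U e)
include hF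

theorem contMDiffOn_low_section {W : Set M} (hWU : W ⊆ U) {ξ : ∀ p : M, T n p}
    (hξ : SmoothVF 𝓘(ℝ, Model n) W ξ) :
    ContMDiffOn 𝓘(ℝ, Model n) 𝓘(ℝ, Fin n ⊕ Fin n → ℝ) ∞ (fun q => low P.form e q (ξ q)) W :=
  contMDiffOn_of_pi fun a => smoothVF_low P hF hWU hξ a

theorem contMDiffOn_zdiff_section {W : Set M} (hW : IsOpen W) (hWU : W ⊆ U) {ξ : ∀ p : M, T n p}
    (hξ : SmoothVF 𝓘(ℝ, Model n) W ξ) :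
    ContMDiffOn 𝓘(ℝ, Model n) 𝓘(ℝ, Fin n ⊕ Fin n → ℂ) ∞ (fun q => zdiff P e q (ξ q)) W :=
  (ContMDiffOn.dMap_vectorField hW ((contMDiffOn_periodFun hF).mono hWU) hξ).congr fun _ hq =>
    (dMap_periodFun hF (hWU hq) _).symm

end Smooth

/-- In the coordinates `(Re Z, θ)` the components of this field are pairings of `ξ`, `η` and `I`
with the frame and contractions of the Hessian with smooth data. -/
theorem smoothVF_twistMap {W : Set M} (hW : IsOpen W) {ξ η : ∀ p : M, T n p}
    (hξ : SmoothVF 𝓘(ℝ, Model n) W ξ) (hη : SmoothVF 𝓘(ℝ, Model n) W η) :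
    SmoothVF (IN n) ((fun V : TM n M => V.proj) ⁻¹' W)
      (fun V => twistMap B V (ξ V.proj, η V.proj)) := by
  refine smoothVF_of_locally fun V _ => ?_
  obtain ⟨U, e, Ω, c, hL⟩ := exists_localModel_at B V.proj
  refine ⟨_, hL.isOpen_preimage, hL.mem, ?_⟩
  have hWU : IsOpen (W ∩ U) := hW.inter hL.frame.isOpen
  have hξ' := hξ.mono (inter_subset_left (t := U))
  have hη' := hη.mono (inter_subset_left (t := U))
  have hIξ := smoothEnd_cplxI P _ _ hWU hξ'
  have hIη := smoothEnd_cplxI P _ _ hWU hη'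
  have hκ := hL.contMDiffOn_flatMap.mono (preimage_mono (inter_subset_right (s := W)))
  have hH : ContMDiffOn (IN n) 𝓘(ℝ, _) ∞ (fun V => potHess Ω (flatMap P e V))
      ((fun V : TM n M => V.proj) ⁻¹' (W ∩ U)) :=
    (hL.contMDiffOn_comp_flatMap hL.bps.contDiffOn_potHess).mono
      (preimage_mono (inter_subset_right (s := W)))
  refine smoothVF_of_coordinates (Λ := totalCoord P e) (isOpen_preimage_proj (n := n) hWU)
    ((contMDiffOn_totalCoord hL.frame).mono (preimage_mono inter_subset_right))
    (fun V hV => isInvertible_dMap_totalCoord hL.frame hV.2) ?_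
  have h1 := contMDiffOn_comp_proj (contMDiffOn_low_section hL.frame inter_subset_right hξ')
  have h2 : ∀ a, ContMDiffOn (IN n) 𝓘(ℝ, ℝ) ∞ (fun V : TM n M =>
      -potHess Ω (flatMap P e V) (0, low P.form e V.proj (e a V.proj))
          (zdiff P e V.proj (cplxI n V.proj (ξ V.proj)), 0)
        + (-(2 * Real.pi)) * (P.form V.proj (cplxI n V.proj (η V.proj)) (e a V.proj)
          - potHess Ω (flatMap P e V) (0, low P.form e V.proj (e a V.proj))
            (0, low P.form e V.proj (η V.proj))))
      ((fun V : TM n M => V.proj) ⁻¹' (W ∩ U)) := by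
    intro a
    have ha := contMDiffOn_comp_proj (contMDiffOn_low_section hL.frame inter_subset_right
      ((hL.frame.smooth a).mono (inter_subset_right (s := W))))
    have hz := contMDiffOn_comp_proj (contMDiffOn_zdiff_section hL.frame hWU inter_subset_right hIξ)
    have hl := contMDiffOn_comp_proj (contMDiffOn_low_section hL.frame inter_subset_right hη')
    have hi := contMDiffOn_comp_proj (smoothVF_low P hL.frame inter_subset_right hIη a)
    have c0 : ContMDiffOn (IN n) 𝓘(ℝ, Fin n ⊕ Fin n → ℂ) ∞ (fun _ : TM n M => (0 : Fin n ⊕ Fin n → ℂ))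
      ((fun V : TM n M => V.proj) ⁻¹' (W ∩ U)) := contMDiffOn_const
    have c1 : ContMDiffOn (IN n) 𝓘(ℝ, Fin n ⊕ Fin n → ℝ) ∞ (fun _ : TM n M => (0 : Fin n ⊕ Fin n → ℝ))
      ((fun V : TM n M => V.proj) ⁻¹' (W ∩ U)) := contMDiffOn_const
    have hHa := hH.clm_apply (c0.prodMk_space ha)
    exact (hHa.clm_apply (hz.prodMk_space c1)).neg.add
      (contMDiffOn_const.mul (hi.sub (hHa.clm_apply (c0.prodMk_space hl))))
  refine (h1.prodMk_space (contMDiffOn_of_pi h2)).congr fun V hV => ?_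
  rw [dMap_totalCoord hL.frame hV.2, dproj_twistMap, hL.dMap_low_twistMap hV.2]
  refine Prod.ext rfl ?_
  funext a
  dsimp only
  rw [low_apply, P.skew, form_fibrePart, hL.form_horHam hV.2, hL.form_vertHam hV.2,
    P.skew _ (e a V.proj) (cplxI n V.proj _)]
  ring

theorem smoothVF_linear_combination {W : Set M} {ξ η : ∀ p : M, T n p}
    (hξ : SmoothVF 𝓘(ℝ, Model n) W ξ) (hη : SmoothVF 𝓘(ℝ, Model n) W η) (r s : ℝ) :
    SmoothVF 𝓘(ℝ, Model n) W (fun p => r • ξ p + s • η p) :=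
  (ContMDiffOn.const_smul_section (a := r) hξ).add_section (ContMDiffOn.const_smul_section (a := s) hη)

theorem SmoothCVF.linear_combination {W : Set M} {ξ η : ∀ p : M, Cx (T n p)}
    (hξ : SmoothCVF 𝓘(ℝ, Model n) W ξ) (hη : SmoothCVF 𝓘(ℝ, Model n) W η) (z w : ℂ) :
    SmoothCVF 𝓘(ℝ, Model n) W (fun p => z • ξ p + w • η p) := by
  constructor
  · have := smoothVF_linear_combination (smoothVF_linear_combination hξ.1 hξ.2 z.re (-z.im))
      (smoothVF_linear_combination hη.1 hη.2 w.re (-w.im)) 1 1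
    simpa [sub_eq_add_neg] using this
  · have := smoothVF_linear_combination (smoothVF_linear_combination hξ.2 hξ.1 z.re z.im)
      (smoothVF_linear_combination hη.2 hη.1 w.re w.im) 1 1
    simpa using this

theorem smoothCVF_cplxI (P : SpecialPeriodStructure n M) {W : Set M} (hW : IsOpen W)
    {ξ : ∀ p : M, Cx (T n p)} (hξ : SmoothCVF 𝓘(ℝ, Model n) W ξ) :
    SmoothCVF 𝓘(ℝ, Model n) W (fun p => cmap (cplxI n p) (ξ p)) := by
  refine ⟨?_, ?_⟩
  · simp only [cre_cmap]
    exact smoothEnd_cplxI P _ _ hW hξ.1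
  · simp only [cim_cmap]
    exact smoothEnd_cplxI P _ _ hW hξ.2

theorem smoothCVF_twistMap {W : Set M} (hW : IsOpen W) {ξ η : ∀ p : M, Cx (T n p)}
    (hξ : SmoothCVF 𝓘(ℝ, Model n) W ξ) (hη : SmoothCVF 𝓘(ℝ, Model n) W η) :
    SmoothCVF (IN n) ((fun V : TM n M => V.proj) ⁻¹' W)
      (fun V => cmk (twistMap B V (cre (ξ V.proj), cre (η V.proj)))
        (twistMap B V (cim (ξ V.proj), cim (η V.proj)))) := by
  refine ⟨?_, ?_⟩
  · simp only [cre_cmk]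
    exact smoothVF_twistMap (ξ := fun p => cre (ξ p)) (η := fun p => cre (η p)) hW hξ.1 hη.1
  · simp only [cim_cmk]
    exact smoothVF_twistMap (ξ := fun p => cim (ξ p)) (η := fun p => cim (η p)) hW hξ.2 hη.2

variable (B)

theorem connFamily_eq_cmk (ζ : ℂ) (V : TM n M) (Y : Cx (T n V.proj)) :
    P.connFamily (joyceFunction P B) ζ V Y
      = cmk (twistMap B V (cre Y, cre (ζ • pi01 n V.proj Y - ζ⁻¹ • pi10 n V.proj Y)))
        (twistMap B V (cim Y, cim (ζ • pi01 n V.proj Y - ζ⁻¹ • pi10 n V.proj Y))) := by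
  rw [connFamily_eq, cmk_twistMap_add]

theorem pi_combination (ζ : ℂ) (p : M) (Y : Cx (T n p)) :
    ζ • pi01 n p Y - ζ⁻¹ • pi10 n p Y
      = ((ζ - ζ⁻¹) / 2) • Y + (Complex.I * (ζ + ζ⁻¹) / 2) • cmap (cplxI n p) Y := by
  rw [pi01, pi10]
  module

theorem smoothCVF_connFamily (ζ : ℂ) {W : Set M} {ξ : ∀ p : M, Cx (T n p)} (hW : IsOpen W)
    (hξ : SmoothCVF 𝓘(ℝ, Model n) W ξ) :
    SmoothCVF (IN n) ((fun V : TM n M => V.proj) ⁻¹' W)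
      (fun V => P.connFamily (joyceFunction P B) ζ V (ξ V.proj)) := by
  have h : SmoothCVF 𝓘(ℝ, Model n) W (fun p => ((ζ - ζ⁻¹) / 2) • ξ p
      + (Complex.I * (ζ + ζ⁻¹) / 2) • cmap (cplxI n p) (ξ p)) :=
    hξ.linear_combination (smoothCVF_cplxI P hW hξ) _ _
  generalize hη : (fun p => ((ζ - ζ⁻¹) / 2) • ξ p
      + (Complex.I * (ζ + ζ⁻¹) / 2) • cmap (cplxI n p) (ξ p)) = η at h
  have e : ∀ V : TM n M, P.connFamily (joyceFunction P B) ζ V (ξ V.proj)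
      = cmk (twistMap B V (cre (ξ V.proj), cre (η V.proj)))
        (twistMap B V (cim (ξ V.proj), cim (η V.proj))) := fun V => by
    rw [connFamily_eq_cmk, pi_combination, ← hη]
  simp only [e]
  exact smoothCVF_twistMap hW hξ h

theorem isLinearMap_connFamily (ζ : ℂ) (V : TM n M) :
    IsLinearMap ℂ (P.connFamily (joyceFunction P B) ζ V) := by
  refine ⟨fun X Y => ?_, fun z X => ?_⟩
  · simp only [connFamily_eq, pi_combination, map_add, map_smul, smul_add]
    abel
  · simp only [connFamily_eq, pi_combination, map_add, map_smul, smul_add]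
    module

theorem cmap_dproj_connFamily (ζ : ℂ) (V : TM n M) (Y : Cx (T n V.proj)) :
    cmap (dproj V) (P.connFamily (joyceFunction P B) ζ V Y) = Y := by
  rw [connFamily_eq_cmk]
  exact cx_ext (by simp [dproj_twistMap]) (by simp [dproj_twistMap])

theorem isComplexEhresmann_connFamily (ζ : ℂ) :
    SKData.IsComplexEhresmann (P.connFamily (joyceFunction P B) ζ) where
  linear := isLinearMap_connFamily B ζ
  section_dproj := cmap_dproj_connFamily B ζ
  smooth _ _ hW hξ := smoothCVF_connFamily B ζ hW hξ

theorem cbil_twistForm_nondeg {V : TM n M} (hnd : P.NonDegAt (joyceFunction P B) V) {X : Cx (T n V.proj)}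
    (h : ∀ b, cbil (twistForm B V) X ((1 : ℂ) ⊗ₜ[ℝ] b) = 0) : X = 0 := by
  refine cx_ext ((twistForm_nondeg B hnd fun b => ?_).trans (map_zero _).symm)
    ((twistForm_nondeg B hnd fun b => ?_).trans (map_zero _).symm)
  · have := congrArg Complex.re (h b)
    simpa [cbil_apply] using this
  · have := congrArg Complex.im (h b)
    simpa [cbil_apply] using this

variable (hnd : ∀ V, P.NonDegAt (joyceFunction P B) V)

theorem sum_forms_eq (σ τ : ℂ) (V : TM n M) (Y W : Cx (T n V.proj)) (y : T n V.proj × T n V.proj) :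
    ∑ j : Fin 3, ![(1 : ℂ), σ, τ] j *
      ((![(joyceHyperData B hnd).form₃ V, (joyceHyperData B hnd).form₁ V, (joyceHyperData B hnd).form₂ V] j
          (twistMap B V (cre Y, cre W)) (twistMap B V y) : ℂ)
        + Complex.I * (![(joyceHyperData B hnd).form₃ V, (joyceHyperData B hnd).form₁ V,
          (joyceHyperData B hnd).form₂ V] j (twistMap B V (cim Y, cim W)) (twistMap B V y) : ℂ))
      = cbil (twistForm B V) (Y + σ • cmap (cplxI n V.proj) W - τ • W) ((1 : ℂ) ⊗ₜ[ℝ] y.1)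
        + cbil (twistForm B V) (-W - σ • cmap (cplxI n V.proj) Y - τ • Y) ((1 : ℂ) ⊗ₜ[ℝ] y.2) := by
  simp only [Fin.sum_univ_three, Matrix.cons_val, joyceHyperData_form₁, joyceHyperData_form₂,
    joyceHyperData_form₃, map_add, map_sub, map_neg, map_smul, LinearMap.add_apply, LinearMap.sub_apply,
    LinearMap.neg_apply, LinearMap.smul_apply, cbil_apply, cre_tmul, cim_tmul, cre_cmap, cim_cmap,
    twistForm_cplxI_left, smul_eq_mul, Complex.one_re, Complex.one_im, one_smul, zero_smul, map_zero]
  push_cast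
  ring

/-- With `σ`, `τ` the two coefficients, vanishing against directions `(0, b)` forces `W = -σ IY - τ
Y`, which is the formula for `𝒜^ζ`. Vanishing against `(b, 0)` is then automatic because `1 + σ² +
τ² = 0`. Flatness of `𝒜^ζ` thus becomes closedness of one combination of the Kähler forms. -/
theorem range_connFamily {ζ : ℂ} (hζ : ζ ≠ 0) (V : TM n M) :
    {a : Cx (TT V) | ∀ b : TT V, ∑ j : Fin 3,
      ![(1 : ℂ), -Complex.I * (ζ + ζ⁻¹) / 2, (ζ⁻¹ - ζ) / 2] j *
      ((![(joyceHyperData B hnd).form₃ V, (joyceHyperData B hnd).form₁ V, (joyceHyperData B hnd).form₂ V] j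
          (cre a) b : ℂ)
        + Complex.I * (![(joyceHyperData B hnd).form₃ V, (joyceHyperData B hnd).form₁ V,
          (joyceHyperData B hnd).form₂ V] j (cim a) b : ℂ)) = 0}
      = range (P.connFamily (joyceFunction P B) ζ V) := by
  ext a
  constructor
  · intro ha
    obtain ⟨x, hx⟩ := exists_twistMap B hnd V (cre a)
    obtain ⟨y, hy⟩ := exists_twistMap B hnd V (cim a)
    have h : ∀ b, cbil (twistForm B V) (-cmk x.2 y.2
        - (-Complex.I * (ζ + ζ⁻¹) / 2) • cmap (cplxI n V.proj) (cmk x.1 y.1)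
        - ((ζ⁻¹ - ζ) / 2) • cmk x.1 y.1) ((1 : ℂ) ⊗ₜ[ℝ] b) = 0 := fun b => by
      have h1 := sum_forms_eq B hnd (-Complex.I * (ζ + ζ⁻¹) / 2) ((ζ⁻¹ - ζ) / 2) V
        (cmk x.1 y.1) (cmk x.2 y.2) (0, b)
      have h2 := ha (twistMap B V (0, b))
      rw [TensorProduct.tmul_zero, map_zero, zero_add] at h1
      rw [← h1, ← h2, ← hx, ← hy]
      simp only [cre_cmk, cim_cmk]
    have h0 := cbil_twistForm_nondeg B (hnd V) h
    refine ⟨cmk x.1 y.1, ?_⟩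
    have hW : ζ • pi01 n V.proj (cmk x.1 y.1) - ζ⁻¹ • pi10 n V.proj (cmk x.1 y.1) = cmk x.2 y.2 := by
      rw [pi_combination, ← sub_eq_zero, ← h0]
      module
    rw [connFamily_eq_cmk, hW, cre_cmk, cre_cmk, cim_cmk, cim_cmk]
    exact cx_ext (by simpa using hx) (by simpa using hy)
  · rintro ⟨Y, rfl⟩ b
    obtain ⟨y, rfl⟩ := exists_twistMap B hnd V b
    rw [connFamily_eq_cmk, cre_cmk, cim_cmk, sum_forms_eq, pi_combination]
    have e1 : cmap (cplxI n V.proj) (cmap (cplxI n V.proj) Y) = -Y :=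
      cx_ext (by simp [cplxI_cplxI]) (by simp [cplxI_cplxI])
    have e2 : Y + (-Complex.I * (ζ + ζ⁻¹) / 2) • cmap (cplxI n V.proj)
        (((ζ - ζ⁻¹) / 2) • Y + (Complex.I * (ζ + ζ⁻¹) / 2) • cmap (cplxI n V.proj) Y)
        - ((ζ⁻¹ - ζ) / 2) • (((ζ - ζ⁻¹) / 2) • Y
          + (Complex.I * (ζ + ζ⁻¹) / 2) • cmap (cplxI n V.proj) Y) = 0 := by
      have h1 : ζ * ζ⁻¹ = 1 := mul_inv_cancel₀ hζ
      have h2 : 1 + (Complex.I * (ζ + ζ⁻¹) / 2) ^ 2 + ((ζ - ζ⁻¹) / 2) ^ 2 = 0 := by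
        linear_combination ((ζ + ζ⁻¹) ^ 2 / 4) * Complex.I_sq - h1
      rw [map_add, map_smul, map_smul, e1]
      calc _ = (1 + (Complex.I * (ζ + ζ⁻¹) / 2) ^ 2 + ((ζ - ζ⁻¹) / 2) ^ 2) • Y := by module
        _ = 0 := by rw [h2, zero_smul]
    have e3 : -(((ζ - ζ⁻¹) / 2) • Y + (Complex.I * (ζ + ζ⁻¹) / 2) • cmap (cplxI n V.proj) Y)
        - (-Complex.I * (ζ + ζ⁻¹) / 2) • cmap (cplxI n V.proj) Y - ((ζ⁻¹ - ζ) / 2) • Y = 0 := by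
      module
    rw [e2, e3]
    simp

include hnd in
theorem involutive_connFamily {ζ : ℂ} (hζ : ζ ≠ 0) :
    Involutive (IN n) (fun V : TM n M => range (P.connFamily (joyceFunction P B) ζ V)) := by
  have h := involutive_kernel (I := IN n) (X := TM n M)
    ![(1 : ℂ), -Complex.I * (ζ + ζ⁻¹) / 2, (ζ⁻¹ - ζ) / 2]
    (β := fun j V => ![(joyceHyperData B hnd).form₃ V, (joyceHyperData B hnd).form₁ V,
      (joyceHyperData B hnd).form₂ V] j)
    (fun j => by
      fin_cases j
      exacts [joyceHyperData_form₃_skew hnd, joyceHyperData_form₁_skew hnd, joyceHyperData_form₂_skew hnd])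
    (fun j => by
      fin_cases j
      exacts [(locallyWedgeSum_form₃ hnd).smoothBil, (locallyWedgeSum_form₁ hnd).smoothBil,
        (locallyWedgeSum_form₂ hnd).smoothBil])
    (fun j => by
      fin_cases j
      exacts [(locallyWedgeSum_form₃ hnd).isClosedForm, (locallyWedgeSum_form₁ hnd).isClosedForm,
        (locallyWedgeSum_form₂ hnd).isClosedForm])
  simp only [range_connFamily B hnd hζ] at h
  exact h

include hnd in
theorem definesSpecialJoyce_joyceFunction : P.toSKData.DefinesSpecialJoyce (joyceFunction P B) where
  ask := isASK P
  smooth := contMDiff_joyceFunction B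
  nondeg := hnd
  nondeg_proj V X hX := by
    rw [h_eq_cmap B hX]
    exact cx_ext (by simp [dproj_horTwist]) (by simp [dproj_horTwist])
  ehresmann ζ _ := isComplexEhresmann_connFamily B ζ
  flat _ hζ := involutive_connFamily B hnd hζ
  type11 V := exists_type11 B hnd V

end Base
end SpecialJoyce

end

/-! ### Comparison with the instanton-corrected forms. -/

section

namespace SpecialJoyce
open Set Filter

section Base
variable {n : ℕ} {M : Type*} [TopologicalSpace M] [ChartedSpace (Model n) M]
  [IsManifold 𝓘(ℂ, Model n) ω M] {P : SpecialPeriodStructure n M} {B : UncoupledBPS P}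
  {e : Fin n ⊕ Fin n → ∀ p : M, T n p}

theorem instV_eq {γ : ∀ p : M, T n p} {V : TM n M} (hz : P.Z V.proj (γ V.proj) ≠ 0) :
    instV P γ V = 1 / (2 * Real.pi) *
      waveSum 0 0 (P.Z V.proj (γ V.proj), P.form V.proj V.2 (γ V.proj)) := by
  rw [instV, waveSum]
  congr 1
  refine tsum_congr fun k => ?_
  have hk : (0 : ℝ) < k := by exact_mod_cast k.pos
  have h := besselK_eq (j := 0) (s := (k : ℝ) * ‖P.Z V.proj (γ V.proj)‖)
    (mul_pos hk (norm_pos_iff.2 hz))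
  rw [pow_zero, one_mul, ← normSq_smul, ← mul_assoc, Nat.cast_zero] at h
  rw [h, waveL, pow_zero, one_mul]
  rfl

/-- One has `|z| K₁(2πk|z|) = k|z|² besselL 1 ((k|z|)²)`, and the factor `|z|² = z z̄` clears the
denominators of `dz/z - dz̄/z̄`. -/
theorem instA_apply {γ : ∀ p : M, T n p} {V : TM n M} (hz : P.Z V.proj (γ V.proj) ≠ 0) (A : TT V) :
    instA P γ V A = -(1 / (4 * Real.pi)) *
      waveSum 1 1 (P.Z V.proj (γ V.proj), P.form V.proj V.2 (γ V.proj))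
      * ((starRingEnd ℂ) (P.Z V.proj (γ V.proj)) * dZ P γ V A
        - P.Z V.proj (γ V.proj) * (starRingEnd ℂ) (dZ P γ V A)) := by
  have e1 : (∑' k : ℕ+, Complex.exp (Complex.I * ((k : ℝ) * theta γ (toCoT P.toSKData V) : ℝ))
        * (‖P.Z V.proj (γ V.proj)‖ : ℂ)
        * (besselK 1 (2 * Real.pi * (k : ℝ) * ‖P.Z V.proj (γ V.proj)‖) : ℂ))
      = (‖P.Z V.proj (γ V.proj)‖ : ℂ) ^ 2
        * waveSum 1 1 (P.Z V.proj (γ V.proj), P.form V.proj V.2 (γ V.proj)) := by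
    rw [waveSum, ← tsum_mul_left]
    refine tsum_congr fun k => ?_
    have hk : (0 : ℝ) < k := by exact_mod_cast k.pos
    have h := besselK_eq (j := 1) (s := (k : ℝ) * ‖P.Z V.proj (γ V.proj)‖)
      (mul_pos hk (norm_pos_iff.2 hz))
    rw [pow_one, ← normSq_smul, ← mul_assoc, Nat.cast_one] at h
    rw [h, waveL, pow_one]
    have h2 : theta γ (toCoT P.toSKData V) = P.form V.proj V.2 (γ V.proj) := rfl
    rw [h2]
    simp only [Prod.smul_mk, smul_eq_mul]
    push_cast
    ring
  have h3 : (‖P.Z V.proj (γ V.proj)‖ : ℂ) ^ 2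
      = P.Z V.proj (γ V.proj) * (starRingEnd ℂ) (P.Z V.proj (γ V.proj)) := (Complex.mul_conj' _).symm
  have h4 : (starRingEnd ℂ) (P.Z V.proj (γ V.proj)) ≠ 0 := (map_ne_zero _).2 hz
  unfold instA
  simp only [e1, LinearMap.smul_apply, LinearMap.sub_apply, smul_eq_mul]
  have h5 : conjForm (dZ P γ V) A = (starRingEnd ℂ) (dZ P γ V A) := rfl
  rw [h5, h3]
  have := Real.pi_ne_zero
  field_simp

section Frame
variable {U : Set M} (hF : IsDarbouxFrame P.Γ P.form U e) {V : TM n M} (hV : V.proj ∈ U) (A : TT V)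
include hF hV

theorem dZ_comb (m : Fin n ⊕ Fin n → ℤ) :
    dZ P (comb e m) V A = (evalComb m (dMap (IN n) (flatMap P e) V A)).1 := by
  have h := dMap_clm_comp_apply (ContinuousLinearMap.fst ℝ ℂ ℝ ∘L evalComb m)
    (mdifferentiableAt_flatMap hF hV) A
  refine Eq.trans ?_ h
  have e1 : (fun W : TM n M => P.Z W.proj (comb e m W.proj))
      = fun W => (ContinuousLinearMap.fst ℝ ℂ ℝ ∘L evalComb m) (flatMap P e W) := by
    funext W
    exact (congrArg Prod.fst (evalComb_flatMap e m W)).symm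
  rw [dZ, e1]
  rfl

theorem dTheta_comb (m : Fin n ⊕ Fin n → ℤ) :
    dTheta P (comb e m) V A = ((evalComb m (dMap (IN n) (flatMap P e) V A)).2 : ℂ) := by
  have h := dMap_clm_comp_apply (Complex.ofRealCLM ∘L ContinuousLinearMap.snd ℝ ℂ ℝ ∘L evalComb m)
    (mdifferentiableAt_flatMap hF hV) A
  refine Eq.trans ?_ h
  have e1 : (fun W : TM n M => (theta (comb e m) (toCoT P.toSKData W) : ℂ)) = fun W =>
      (Complex.ofRealCLM ∘L ContinuousLinearMap.snd ℝ ℂ ℝ ∘L evalComb m) (flatMap P e W) := by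
    funext W
    exact (congrArg (fun x : ℂ × ℝ => (x.2 : ℂ)) (evalComb_flatMap e m W)).symm
  rw [dTheta, e1]
  rfl

theorem dZ_frame (a : Fin n ⊕ Fin n) : dZ P (e a) V A = zdiff P e V.proj (dproj V A) a := by
  have h := dMap_clm_comp_apply (ContinuousLinearMap.proj (R := ℝ) (φ := fun _ : Fin n ⊕ Fin n => ℂ) a
    ∘L ContinuousLinearMap.fst ℝ _ (Fin n ⊕ Fin n → ℝ)) (mdifferentiableAt_flatMap hF hV) A
  rw [dMap_flatMap hF hV] at h
  exact h

theorem dTheta_frame (a : Fin n ⊕ Fin n) : dTheta P (e a) V A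
    = (dMap (IN n) (fun V : TM n M => low P.form e V.proj V.2) V A a : ℂ) := by
  have h := dMap_clm_comp_apply (Complex.ofRealCLM ∘L
    ContinuousLinearMap.proj (R := ℝ) (φ := fun _ : Fin n ⊕ Fin n => ℝ) a
    ∘L ContinuousLinearMap.snd ℝ (Fin n ⊕ Fin n → ℂ) _) (mdifferentiableAt_flatMap hF hV) A
  rw [dMap_flatMap hF hV] at h
  exact h

end Frame

theorem evalComb_zdiff_prodMk (m : Fin n ⊕ Fin n → ℤ) (p : M) (u : T n p) (t : Fin n ⊕ Fin n → ℝ) :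
    evalComb m (zdiff P e p u, t) = ((P.form p u (comb e m p) : ℂ)
      - Complex.I * (P.form p (cplxI n p u) (comb e m p) : ℂ), (evalComb m (0, t)).2) := by
  refine Prod.ext ?_ rfl
  have h := congrArg Prod.fst (evalComb_zdiff (P := P) (e := e) m p u)
  exact h

namespace LocalModel
variable {p₀ : M} {U : Set M} {Ω : {m : Fin n ⊕ Fin n → ℤ // m ≠ 0} → ℝ} {c : ℝ}
  (hL : LocalModel B p₀ U e Ω c) {V : TM n M} (hV : V.proj ∈ U)
include hL hV

theorem index_eq (m : {m : Fin n ⊕ Fin n → ℤ // m ≠ 0}) :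
    (B.index V.proj (comb e m.1 V.proj) : ℂ) = (Ω m : ℂ) := by
  rw [← hL.index _ hV m]; push_cast; rfl

/-- Reduces the comparison to an identity for a single charge. Only charges with `Z_γ ≠ 0` matter,
since those of nonzero index satisfy this. -/
theorem hasSum_index_mul {f : {m : Fin n ⊕ Fin n → ℤ // m ≠ 0} → ℂ} {s : ℂ}
    (a b a' b' : (Fin n ⊕ Fin n → ℂ) × (Fin n ⊕ Fin n → ℝ)) (r : ℂ)
    (hf : ∀ m, P.Z V.proj (comb e m.1 V.proj) ≠ 0 → f m
      = r * (hessSum (evalComb m.1 (flatMap P e V)) (evalComb m.1 a) (evalComb m.1 b)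
        - hessSum (evalComb m.1 (flatMap P e V)) (evalComb m.1 a') (evalComb m.1 b')))
    (hs : s = -(2 * Real.pi) * r *
      ((potHess Ω (flatMap P e V) a b : ℂ) - (potHess Ω (flatMap P e V) a' b' : ℂ))) :
    HasSum (fun m => (B.index V.proj (comb e m.1 V.proj) : ℂ) * f m) s := by
  have h := ((hL.bps.hasSum_fderiv_fderiv_flatPotential (hL.flatMap_mem hV) a b).sub
    (hL.bps.hasSum_fderiv_fderiv_flatPotential (hL.flatMap_mem hV) a' b')).mul_left r
  refine hasSum_of_eq h (fun m => ?_) ?_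
  · rw [hL.index_eq hV]
    by_cases hm : Ω m = 0
    · simp [hm]
    have h2 := hL.bps.evalComb_ne_zero hm (hL.flatMap_mem hV)
    rw [evalComb_flatMap] at h2
    rw [hf m h2]
    ring
  · rw [hs, potHess]
    ring

theorem hasSum_form₃ (hnd : ∀ V, P.NonDegAt (joyceFunction P B) V) (A A' : TT V) :
    HasSum (fun m : {m : Fin n ⊕ Fin n → ℤ // m ≠ 0} =>
        (B.index V.proj (comb e m.1 V.proj) : ℂ) *
          (Complex.I / 2 * instV P (comb e m.1) V
              * wedge (dZ P (comb e m.1) V) (conjForm (dZ P (comb e m.1) V)) A A'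
            + 1 / (2 * Real.pi) * wedge (dTheta P (comb e m.1) V) (instA P (comb e m.1) V) A A'))
      (((joyceHyperData B hnd).form₃ V A A' : ℂ) - ((P.form V.proj (dproj V A) (dproj V A') : ℂ)
        - 1 / (4 * Real.pi ^ 2) *
          ∑ i : Fin n, wedge (dTheta P (e (Sum.inl i)) V) (dTheta P (e (Sum.inr i)) V) A A')) := by
  have hπ : (Real.pi : ℂ) ≠ 0 := by exact_mod_cast Real.pi_ne_zero
  -- The factor `-1/(8π³)` becomes, after multiplication by the `-2π` of the flat potential, the
  -- coefficient `1/(4π²)` of the Hessian in `ω₃`.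
  refine hL.hasSum_index_mul hV (dMap (IN n) (flatMap P e) V A)
    (zdiff P e V.proj (cplxI n V.proj (dproj V A')), 0) (dMap (IN n) (flatMap P e) V A')
    (zdiff P e V.proj (cplxI n V.proj (dproj V A)), 0) (-(1 / (8 * Real.pi ^ 3))) (fun m hz => ?_) ?_
  · have h1 := waveSum_recurrence (x := evalComb m.1 (flatMap P e V)) (by rwa [evalComb_flatMap])
    rw [evalComb_flatMap] at h1
    simp only [wedge]
    rw [instV_eq hz, instA_apply hz, instA_apply hz]
    have h5 : ∀ A, conjForm (dZ P (comb e m.1) V) A = (starRingEnd ℂ) (dZ P (comb e m.1) V A) :=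
      fun _ => rfl
    rw [h5, h5, dZ_comb hL.frame hV, dZ_comb hL.frame hV, dTheta_comb hL.frame hV,
      dTheta_comb hL.frame hV, dMap_flatMap hL.frame hV, dMap_flatMap hL.frame hV, evalComb_zdiff,
      evalComb_zdiff, evalComb_zdiff_prodMk, evalComb_zdiff_prodMk, evalComb_flatMap]
    generalize P.Z V.proj (comb e m.1 V.proj) = z at h1 ⊢
    generalize P.form V.proj V.2 (comb e m.1 V.proj) = φ at h1 ⊢
    simp only [cplxI_cplxI, map_neg, LinearMap.neg_apply, hessSum]
    generalize P.form V.proj (dproj V A) (comb e m.1 V.proj) = α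
    generalize P.form V.proj (cplxI n V.proj (dproj V A)) (comb e m.1 V.proj) = β
    generalize P.form V.proj (dproj V A') (comb e m.1 V.proj) = α'
    generalize P.form V.proj (cplxI n V.proj (dproj V A')) (comb e m.1 V.proj) = β'
    generalize (evalComb m.1 (0, dMap (IN n) (fun V : TM n M => low P.form e V.proj V.2) V A)).2 = θ
    generalize (evalComb m.1 (0, dMap (IN n) (fun V : TM n M => low P.form e V.proj V.2) V A')).2 = θ'
    rw [← Complex.ofReal_pow, ← Complex.normSq_eq_norm_sq, Complex.normSq_apply] at h1
    generalize waveSum 0 0 (z, φ) = w0 at h1 ⊢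
    generalize waveSum 1 0 (z, φ) = w1 at h1 ⊢
    generalize waveSum 2 2 (z, φ) = w2 at h1 ⊢
    generalize waveSum 1 1 (z, φ) = w3
    obtain ⟨x, y⟩ := z
    have hz' : (⟨x, y⟩ : ℂ) = (x : ℂ) + y * Complex.I := Complex.mk_eq_add_mul_I x y
    rw [hz']
    simp only [rdot]
    simp
    push_cast at h1
    -- The recurrence eliminates `waveSum 1 0`; after this only `V_γ` and `A_γ` remain.
    have h2 : w1 = Real.pi * (x * x + y * y) * w2 - Real.pi * w0 := by linear_combination -h1
    have h3 : Complex.I ^ 3 = -Complex.I := Complex.I_pow_three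
    rw [h2]
    field_simp
    ring_nf
    simp only [Complex.I_sq, h3]
    ring
  · rw [hL.joyceHyperData_form₃_eq hnd hV, hL.frame.form_eq_stdForm P.skew hV]
    simp only [wedge, dTheta_frame hL.frame hV]
    rw [stdForm_apply (dMap (IN n) _ V A)]
    push_cast
    have : ∀ i : Fin n, (dMap (IN n) (fun V : TM n M => low P.form e V.proj V.2) V A (Sum.inl i) : ℂ)
        * (dMap (IN n) (fun V : TM n M => low P.form e V.proj V.2) V A' (Sum.inr i) : ℂ)
        - (dMap (IN n) (fun V : TM n M => low P.form e V.proj V.2) V A' (Sum.inl i) : ℂ)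
        * (dMap (IN n) (fun V : TM n M => low P.form e V.proj V.2) V A (Sum.inr i) : ℂ)
        = (dMap (IN n) (fun V : TM n M => low P.form e V.proj V.2) V A (Sum.inl i) : ℂ)
        * (dMap (IN n) (fun V : TM n M => low P.form e V.proj V.2) V A' (Sum.inr i) : ℂ)
        - (dMap (IN n) (fun V : TM n M => low P.form e V.proj V.2) V A (Sum.inr i) : ℂ)
        * (dMap (IN n) (fun V : TM n M => low P.form e V.proj V.2) V A' (Sum.inl i) : ℂ) := fun i => by ring
    simp only [this]
    field_simp
    ring

theorem hasSum_holForm (hnd : ∀ V, P.NonDegAt (joyceFunction P B) V) (A A' : TT V) :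
    HasSum (fun m : {m : Fin n ⊕ Fin n → ℤ // m ≠ 0} =>
        (B.index V.proj (comb e m.1 V.proj) : ℂ) *
          (wedge (dZ P (comb e m.1) V) (instA P (comb e m.1) V) A A'
            + Complex.I / (2 * Real.pi) * instV P (comb e m.1) V
              * wedge (dTheta P (comb e m.1) V) (dZ P (comb e m.1) V) A A'))
      ((joyceHyperData B hnd).holForm V A A' - 1 / (2 * Real.pi) *
          ∑ i : Fin n, (wedge (dZ P (e (Sum.inr i)) V) (dTheta P (e (Sum.inl i)) V) A A'
            - wedge (dZ P (e (Sum.inl i)) V) (dTheta P (e (Sum.inr i)) V) A A')) := by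
  have hπ : (Real.pi : ℂ) ≠ 0 := by exact_mod_cast Real.pi_ne_zero
  -- The Hessian parts of `ω₁` and `iω₂` are summed separately, each with coefficient `1/(2π)` after
  -- multiplication by `-2π`, and then added charge by charge.
  have key := (hL.hasSum_index_mul hV
    (f := fun m => (-(1 / (4 * Real.pi ^ 2)) : ℂ) *
      (hessSum (evalComb m.1 (flatMap P e V)) (evalComb m.1 (dMap (IN n) (flatMap P e) V A))
          (evalComb m.1 (0, low P.form e V.proj (cplxI n V.proj (dproj V A'))))
        - hessSum (evalComb m.1 (flatMap P e V)) (evalComb m.1 (dMap (IN n) (flatMap P e) V A'))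
          (evalComb m.1 (0, low P.form e V.proj (cplxI n V.proj (dproj V A))))))
    _ _ _ _ _ (fun m _ => rfl) rfl).add
    (hL.hasSum_index_mul hV
    (f := fun m => (-(Complex.I / (4 * Real.pi ^ 2)) : ℂ) *
      (hessSum (evalComb m.1 (flatMap P e V)) (evalComb m.1 (dMap (IN n) (flatMap P e) V A))
          (evalComb m.1 (0, low P.form e V.proj (dproj V A')))
        - hessSum (evalComb m.1 (flatMap P e V)) (evalComb m.1 (dMap (IN n) (flatMap P e) V A'))
          (evalComb m.1 (0, low P.form e V.proj (dproj V A)))))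
    _ _ _ _ _ (fun m _ => rfl) rfl)
  refine hasSum_of_eq key (fun m => ?_) ?_
  · by_cases hm : Ω m = 0
    · simp [hL.index_eq hV, hm]
    have hz := hL.bps.evalComb_ne_zero hm (hL.flatMap_mem hV)
    rw [evalComb_flatMap] at hz
    rw [← mul_add]
    congr 1
    simp only [wedge]
    rw [instV_eq hz, instA_apply hz, instA_apply hz]
    rw [dZ_comb hL.frame hV, dZ_comb hL.frame hV, dTheta_comb hL.frame hV,
      dTheta_comb hL.frame hV, dMap_flatMap hL.frame hV, dMap_flatMap hL.frame hV, evalComb_low,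
      evalComb_low, evalComb_low, evalComb_low, evalComb_zdiff_prodMk, evalComb_zdiff_prodMk,
      evalComb_flatMap]
    generalize P.Z V.proj (comb e m.1 V.proj) = z
    generalize P.form V.proj V.2 (comb e m.1 V.proj) = φ
    simp only [hessSum]
    generalize P.form V.proj (dproj V A) (comb e m.1 V.proj) = α
    generalize P.form V.proj (cplxI n V.proj (dproj V A)) (comb e m.1 V.proj) = β
    generalize P.form V.proj (dproj V A') (comb e m.1 V.proj) = α'
    generalize P.form V.proj (cplxI n V.proj (dproj V A')) (comb e m.1 V.proj) = β'
    generalize (evalComb m.1 (0, dMap (IN n) (fun V : TM n M => low P.form e V.proj V.2) V A)).2 = θ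
    generalize (evalComb m.1 (0, dMap (IN n) (fun V : TM n M => low P.form e V.proj V.2) V A')).2 = θ'
    generalize waveSum 0 0 (z, φ) = w0
    generalize waveSum 1 1 (z, φ) = w3
    obtain ⟨x, y⟩ := z
    have hz' : (⟨x, y⟩ : ℂ) = (x : ℂ) + y * Complex.I := Complex.mk_eq_add_mul_I x y
    have h3 : Complex.I ^ 3 = -Complex.I := Complex.I_pow_three
    rw [hz']
    simp only [rdot]
    simp
    field_simp
    ring_nf
    simp only [Complex.I_sq, h3]
    ring
  · rw [HyperData.holForm, hL.joyceHyperData_form₁_eq hnd hV, hL.joyceHyperData_form₂_eq hnd hV]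
    -- The semi-flat part: splitting `dZ = ω(-, e) - iω(I-, e)` separates the `ω₁` and `iω₂`
    -- contributions.
    have hsum : ∀ t t' : Fin n ⊕ Fin n → ℝ,
        ∑ i : Fin n, (zdiff P e V.proj (dproj V A) (Sum.inr i) * t' (Sum.inl i)
            - zdiff P e V.proj (dproj V A') (Sum.inr i) * t (Sum.inl i)
          - (zdiff P e V.proj (dproj V A) (Sum.inl i) * t' (Sum.inr i)
            - zdiff P e V.proj (dproj V A') (Sum.inl i) * t (Sum.inr i)))
        = -(stdForm n (low P.form e V.proj (dproj V A)) t'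
            - stdForm n (low P.form e V.proj (dproj V A')) t : ℝ)
          + Complex.I * (stdForm n (low P.form e V.proj (cplxI n V.proj (dproj V A))) t'
            - stdForm n (low P.form e V.proj (cplxI n V.proj (dproj V A'))) t : ℝ) := fun t t' => by
      simp only [stdForm_apply, ← Finset.sum_sub_distrib]
      push_cast
      rw [Finset.mul_sum, ← Finset.sum_neg_distrib, ← Finset.sum_add_distrib]
      refine Finset.sum_congr rfl fun i _ => ?_
      simp only [zdiff_apply, low_apply]
      ring
    simp only [wedge, dTheta_frame hL.frame hV, dZ_frame hL.frame hV]
    rw [hsum]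
    push_cast
    field_simp
    ring

end LocalModel

theorem matchesInstantonMetric_joyceHyperData (hnd : ∀ V, P.NonDegAt (joyceFunction P B) V) :
    MatchesInstantonMetric P B (joyceHyperData B hnd) := by
  intro U e hF V hV A A'
  obtain ⟨U', -, Ω, c, hL⟩ := exists_localModel B hF hV
  exact ⟨hL.hasSum_form₃ hL.mem hnd A A', hL.hasSum_holForm hL.mem hnd A A'⟩
end Base
end SpecialJoyce

end

end

/-! ### Assembly of the theorem. -/

theorem mainTheorem2 {n : ℕ} {M : Type*} [TopologicalSpace M] [T2Space M]
    [SecondCountableTopology M] [ChartedSpace (SpecialJoyce.Model n) M]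
    [IsManifold 𝓘(ℂ, SpecialJoyce.Model n) ω M]
    (P : SpecialJoyce.SpecialPeriodStructure n M) (B : SpecialJoyce.UncoupledBPS P)
    (hnd : ∀ V : SpecialJoyce.TM n M,
      P.toSKData.NonDegAt (SpecialJoyce.joyceFunction P B) V) :
    (∀ V : SpecialJoyce.TM n M, Summable
      fun x : {γ : SpecialJoyce.T n V.proj // γ ∈ P.Γ V.proj ∧ γ ≠ 0} × ℕ+ =>
        (B.index V.proj x.1.1 : ℂ) * SpecialJoyce.jTerm P V x.1.1 x.2) ∧
    P.toSKData.DefinesSpecialJoyce (SpecialJoyce.joyceFunction P B) ∧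
    ∃ Q : SpecialJoyce.HyperData n M,
      Q.IsAssociated P.toSKData (SpecialJoyce.joyceFunction P B) ∧
      Q.IsHyperkahler ∧
      SpecialJoyce.MatchesInstantonMetric P B Q := by
  refine ⟨fun V => ?_, SpecialJoyce.definesSpecialJoyce_joyceFunction B hnd,
    SpecialJoyce.joyceHyperData B hnd, SpecialJoyce.joyceHyperData_isAssociated B hnd,
    SpecialJoyce.joyceHyperData_isHyperkahler hnd,
    SpecialJoyce.matchesInstantonMetric_joyceHyperData hnd⟩
  obtain ⟨U, e, Ω, c, hL⟩ := SpecialJoyce.exists_localModel_at B V.proj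
  exact hL.summable_jTerm hL.mem
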